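/- **Conventions.** Fractional powers are principal. For $-1<\nu<0$ and $t\in\mathbb C\smallsetminus[1,\infty)$ put $$P_\nu(1-2t)={}_2F_1(-\nu,\nu+1;1;t)=-\frac{\sin\nu\pi}{\pi}\int_0^1\Big[\frac{u(1-tu)}{1-u}\Big]^\nu\frac{du}{1-u}.$$ Let $D=(\mathbb C\smallsetminus\mathbb R)\cup(0,1)$. For $\alpha,\beta\in D$ set $$\Lambda_\nu(\alpha,\beta)=[P_\nu(1-2\alpha)]^2[P_\nu(2\beta-1)]^2\,\mathbb Z+P_\nu(1-2\alpha)P_\nu(2\alpha-1)P_\nu(1-2\beta)P_\nu(2\beta-1)\,\mathbb Z+[P_\nu(2\alpha-1)]^2[P_\nu(1-2\beta)]^2\,\mathbb Z$$ and, for $\alpha\ne\beta$, $$\begin{aligned}S_\nu(\alpha\Vert\beta)={}&[P_\nu(2\beta-1)]^2\int_0^\beta\frac{[P_\nu(1-2t)]^2\,dt}{t-\alpha}-P_\nu(1-2\beta)P_\nu(2\beta-1)\int_0^\beta\frac{P_\nu(1-2t)P_\nu(2t-1)\,dt}{t-\alpha}\\&-P_\nu(2\beta-1)P_\nu(1-2\beta)\int_0^{1-\beta}\frac{P_\nu(1-2t)P_\nu(2t-1)\,dt}{t-1+\alpha}+[P_\nu(1-2\beta)]^2\int_0^{1-\beta}\frac{[P_\nu(1-2t)]^2\,dt}{t-1+\alpha}.\end{aligned}$$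 Each integral is taken along its own continuous, piecewise $C^1$ path on which it converges absolutely and whose interior avoids the pole and the branch cuts of the integrand: the cut is $[1,\infty)$ for the integrands with $[P_\nu(1-2t)]^2$, and the cuts are $(-\infty,0]$ and $[1,\infty)$ for those with $P_\nu(1-2t)P_\nu(2t-1)$. **Interaction entropies.** The ring $\mathscr P_{\rm KZ}$ of Kontsevich–Zagier periods is generated by the absolutely convergent integrals $\int_{A}f(x)\,d^nx$ of algebraic functions (continuous branches, algebraic coefficients) over semialgebraic sets $A\subset\mathbb R^n$ defined over the real algebraic numbers; $\widehat{\mathscr P}_{\rm KZ}=\mathscr P_{\rm KZ}[1/\pi]$. A Gauss–Manin (Picard–Fuchs) operator is a linear differential operator of positive order $r$ with coefficients in $\overline{\mathbb Q}[\alpha]$ that has, on some non-empty connected open set, $r$ linearly independent holomorphic solutions, each a period function $\alpha\mapsto\int_A F(x,\alpha)\,d^nx$ of an algebraic family (absolutely convergent, $A$ as above, $F$ a continuous branch, holomorphic in $\alpha$, of an algebraic function of $(x,\alpha)$ with algebraic coefficients). A formal finite sum $S(\alpha\Vert\beta)=\sum_{m}\int_{L_m(\alpha,\beta)}^{U_m(\alpha,\beta)}f_m(t,\alpha,\beta)\,dt$,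 with each $f_m$ given on a region $W_m\subset\mathbb C^3$ to which the paths of integration are confined, is an *interaction entropy* on a non-empty open parameter set $\Omega\subset\mathbb C^2$ if 1. every $W_m$ is open and non-empty and $f_m$ is holomorphic on it; 2. $L_m,U_m$ are holomorphic algebraic functions on $\Omega$ (with algebraic coefficients), and for all algebraic $(\alpha,\beta)\in\Omega$ each summand, along each path on which it converges absolutely, has its value in $\widehat{\mathscr P}_{\rm KZ}$; 3. there is a Gauss–Manin operator $\widehat O_\alpha$ such that, near every $(\alpha,\beta)\in\Omega$, both $S(\alpha\Vert\beta)$ and $S(\beta\Vert\alpha)$ have holomorphic branches in $\alpha$, and every such branch satisfies $\widehat O_\alpha S(\alpha\Vert\beta)=\widehat O_\alpha S(\beta\Vert\alpha)=\frac1{\alpha-\beta}$. **Proposition.** Let $\nu\in(-1,0)$. (i) For all distinct $\alpha,\beta\in D$, admissible paths exist, and any two values of $S_\nu(\alpha\Vert\beta)$ obtained from admissible paths are congruent modulo $2\pi i\Lambda_\nu(\alpha,\beta)$. (ii) For all distinct $\alpha,\beta\in D$, $$\begin{aligned}S_\nu(\alpha\Vert\beta)-S_\nu(\beta\Vert\alpha)\equiv{}&\frac{\pi}{2\sin\nu\pi}\{[P_\nu(1-2\alpha)]^2+[P_\nu(2\alpha-1)]^2\}P_\nu(2\beta-1)P_\nu(1-2\beta)\\&-\frac{\pi}{2\sin\nu\pi}\{[P_\nu(1-2\beta)]^2+[P_\nu(2\beta-1)]^2\}P_\nu(2\alpha-1)P_\nu(1-2\alpha)\pmod{2\pi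 i\Lambda_\nu(\alpha,\beta)}.\end{aligned}$$ (iii) If moreover $\nu\in\mathbb Q$, then $\frac{\pi^2}{2\sin^2(\nu\pi)}S_\nu(\alpha\Vert\beta)$ is an interaction entropy on $\Omega=\{(\alpha,\beta)\in D\times D:\alpha\ne\beta\}$. -/

import Mathlib

open MeasureTheory Set

/-! ### Legendre functions of fractional degree -/

/-- The Legendre function of the first kind of real degree `ν ∈ (-1, 0)`, through Euler's integral
`P_ν(1 - 2t) = -(sin νπ / π) ∫₀¹ [u (1 - t u) / (1 - u)]^ν du / (1 - u)` for `t ∉ [1, ∞)`, where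
`t = (1 - z) / 2` and the power is the principal one. -/
noncomputable def legendreP (ν : ℝ) (z : ℂ) : ℂ :=
  -((Real.sin (ν * Real.pi) / Real.pi : ℝ) : ℂ) *
    ∫ u in (0 : ℝ)..1,
      ((u : ℂ) * (1 - (1 - z) / 2 * (u : ℂ)) / (1 - (u : ℂ))) ^ (ν : ℂ) / (1 - (u : ℂ))

/-- The slit plane `ℂ ∖ [1, ∞)`. -/
def slitPlaneOne : Set ℂ := {t | ¬ (t.im = 0 ∧ 1 ≤ t.re)}

/-- The double slit plane `(ℂ ∖ ℝ) ∪ (0, 1)`. -/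
def doubleSlit : Set ℂ := {t | t.im ≠ 0 ∨ (0 < t.re ∧ t.re < 1)}

/-! ### Path integrals and formal sums of integrals -/

/-- `γ`, restricted to `[0, 1]`, is a continuous, piecewise continuously differentiable path
from `a` to `b` whose interior points all lie in `W`. -/
def IsPathIn (W : Set ℂ) (a b : ℂ) (γ : ℝ → ℂ) : Prop :=
  γ 0 = a ∧ γ 1 = b ∧ ContinuousOn γ (Icc 0 1) ∧
    (∃ F : Finset ℝ, ∀ s ∈ Ioo (0 : ℝ) 1, s ∉ F → ContDiffAt ℝ 1 γ s) ∧
    ∀ s ∈ Ioo (0 : ℝ) 1, γ s ∈ W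

/-- A formal integral `∫_{L(α,β)}^{U(α,β)} f(t,α,β) dt`, with the region of `(t, α, β)` in which
the integrand is considered (paths of integration have to stay in it). -/
structure FormalIntegral where
  lower : ℂ → ℂ → ℂ
  upper : ℂ → ℂ → ℂ
  integrand : ℂ → ℂ → ℂ → ℂ
  dom : Set (ℂ × ℂ × ℂ)

/-- `w` is the value of the formal integral at `(α, β)` along some path on which it converges
absolutely. -/
def FormalIntegral.IsValue (T : FormalIntegral) (α β w : ℂ) : Prop :=
  ∃ γ : ℝ → ℂ, IsPathIn {t | (t, α, β) ∈ T.dom} (T.lower α β) (T.upper α β) γ ∧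
    IntervalIntegrable (fun s => T.integrand (γ s) α β * deriv γ s) volume 0 1 ∧
    w = ∫ s in (0 : ℝ)..1, T.integrand (γ s) α β * deriv γ s

/-- A formal finite sum of integrals. -/
structure FormalIntegralSum where
  size : ℕ
  term : Fin size → FormalIntegral

/-- `w` is one of the values at `(α, β)` of the (multivalued) function represented by a formal
finite sum of integrals: each summand is integrated along a path of its own. -/
def FormalIntegralSum.IsValue (S : FormalIntegralSum) (α β w : ℂ) : Prop :=
  ∃ v : Fin S.size → ℂ, (∀ m, (S.term m).IsValue α β (v m)) ∧ w = ∑ m, v m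

/-- Multiplication of a formal sum of integrals by a constant. -/
def FormalIntegralSum.scale (c : ℂ) (S : FormalIntegralSum) : FormalIntegralSum where
  size := S.size
  term m :=
    { lower := (S.term m).lower
      upper := (S.term m).upper
      integrand := fun t α β => c * (S.term m).integrand t α β
      dom := (S.term m).dom }

/-- `s` is a holomorphic branch on the open set `N` of the multivalued function whose set of
values at `a` is `{w | V a w}`. -/
def IsBranchOn (V : ℂ → ℂ → Prop) (N : Set ℂ) (s : ℂ → ℂ) : Prop :=
  IsOpen N ∧ DifferentiableOn ℂ s N ∧ ∀ a ∈ N, V a (s a)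

/-! ### Algebraic functions, semialgebraic sets, Kontsevich--Zagier periods -/

/-- The field of algebraic numbers inside `ℂ`. -/
noncomputable abbrev QbarC : IntermediateField ℚ ℂ := algebraicClosure ℚ ℂ

/-- The field of real algebraic numbers. -/
noncomputable abbrev QbarR : IntermediateField ℚ ℝ := algebraicClosure ℚ ℝ

/-- On `s`, the value `f x` satisfies a fixed nontrivial polynomial equation, with algebraic
coefficients, together with the coordinates of `x`. -/
def SatisfiesAlgebraicEquationOn {X σ : Type} (coord : X → σ → ℂ) (f : X → ℂ) (s : Set X) : Prop :=
  ∃ P : MvPolynomial (Option σ) QbarC, P ≠ 0 ∧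
    ∀ x ∈ s, MvPolynomial.aeval (fun o : Option σ => o.elim (f x) (coord x)) P = 0

/-- Semialgebraic subsets of `ℝⁿ` over the real algebraic numbers: finite Boolean combinations
of polynomial inequalities. -/
inductive IsSemialgebraic {n : ℕ} : Set (Fin n → ℝ) → Prop
  | pos (p : MvPolynomial (Fin n) QbarR) : IsSemialgebraic {x | 0 < MvPolynomial.aeval x p}
  | inter (A B : Set (Fin n → ℝ)) :
      IsSemialgebraic A → IsSemialgebraic B → IsSemialgebraic (A ∩ B)
  | compl (A : Set (Fin n → ℝ)) : IsSemialgebraic A → IsSemialgebraic Aᶜ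

/-- `z` is an absolutely convergent integral of an algebraic function (a continuous branch on `D`)
with algebraic coefficients over an algebraic domain `D` in some `ℝⁿ`. -/
def IsKZIntegral (z : ℂ) : Prop :=
  ∃ (n : ℕ) (D : Set (Fin n → ℝ)) (f : (Fin n → ℝ) → ℂ),
    IsSemialgebraic D ∧ ContinuousOn f D ∧
    SatisfiesAlgebraicEquationOn (fun (x : Fin n → ℝ) (i : Fin n) => ((x i : ℝ) : ℂ)) f D ∧
    IntegrableOn f D ∧ z = ∫ x in D, f x

/-- The ring of Kontsevich--Zagier periods. -/
def kzPeriods : Subring ℂ := Subring.closure {z | IsKZIntegral z}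

/-- The extended ring of Kontsevich--Zagier periods: `1 / π` is adjoined. -/
noncomputable def kzPeriodsExt : Subring ℂ :=
  Subring.closure ((kzPeriods : Set ℂ) ∪ {((Real.pi : ℝ) : ℂ)⁻¹})

/-! ### Gauss--Manin differential operators -/

/-- `y` is a period function on `V`: `y a = ∫_D F(x, a) dx` for a family `F(·, a)`, holomorphic
in the parameter `a ∈ V`, of algebraic functions (a continuous branch of an algebraic function
of `(x, a)`, with algebraic coefficients), over an algebraic domain `D`, with absolute
convergence. -/
def IsPeriodFunctionOn (V : Set ℂ) (y : ℂ → ℂ) : Prop :=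
  ∃ (n : ℕ) (D : Set (Fin n → ℝ)) (F : (Fin n → ℝ) × ℂ → ℂ),
    IsSemialgebraic D ∧ ContinuousOn F (D ×ˢ V) ∧
    SatisfiesAlgebraicEquationOn
      (fun (p : (Fin n → ℝ) × ℂ) (o : Option (Fin n)) => o.elim p.2 (fun i => ((p.1 i : ℝ) : ℂ)))
      F (D ×ˢ V) ∧
    (∀ x ∈ D, DifferentiableOn ℂ (fun a => F (x, a)) V) ∧
    ∀ a ∈ V, IntegrableOn (fun x => F (x, a)) D ∧ y a = ∫ x in D, F (x, a)

/-- The value at `a` of `∑ⱼ cⱼ(a) y⁽ʲ⁾(a)`, where the linear differential operator `O` is given by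
its coefficients `cⱼ`, polynomials with algebraic coefficients. -/
noncomputable def applyDiffOp (O : Polynomial (Polynomial QbarC)) (y : ℂ → ℂ) (a : ℂ) : ℂ :=
  O.sum fun j c => Polynomial.aeval a c * iteratedDeriv j y a

/-- A Gauss--Manin (Picard--Fuchs) differential operator: a linear differential operator of
positive order `r`, with coefficients polynomials over the algebraic numbers, that has, on some
nonempty connected open set, a fundamental system of `r` linearly independent solutions all of
which are period functions of algebraic families. -/
def IsGaussManinOperator (O : Polynomial (Polynomial QbarC)) : Prop :=
  0 < O.natDegree ∧
  ∃ (V : Set ℂ) (y : Fin O.natDegree → ℂ → ℂ), IsOpen V ∧ IsConnected V ∧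
    (∀ j, DifferentiableOn ℂ (y j) V ∧ IsPeriodFunctionOn V (y j) ∧
      ∀ a ∈ V, applyDiffOp O (y j) a = 0) ∧
    LinearIndependent ℂ (fun (j : Fin O.natDegree) (a : V) => y j a)

/-! ### Interaction entropies -/

/-- The formal finite sum of integrals `S` represents an interaction entropy, for parameters
`(α, β)` in the nonempty open set `Ω`. -/
structure IsInteractionEntropy (S : FormalIntegralSum) (Ω : Set (ℂ × ℂ)) : Prop where
  isOpen_param : IsOpen Ω
  nonempty_param : Ω.Nonempty
  /-- Analyticity of the integrands. -/
  analyticity : ∀ m, IsOpen (S.term m).dom ∧ (S.term m).dom.Nonempty ∧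
    DifferentiableOn ℂ (fun p : ℂ × ℂ × ℂ => (S.term m).integrand p.1 p.2.1 p.2.2) (S.term m).dom
  /-- The limits of integration are algebraic functions. -/
  algebraic_lower : ∀ m,
    DifferentiableOn ℂ (fun p : ℂ × ℂ => (S.term m).lower p.1 p.2) Ω ∧
    SatisfiesAlgebraicEquationOn (fun (p : ℂ × ℂ) (i : Fin 2) => ![p.1, p.2] i)
      (fun p => (S.term m).lower p.1 p.2) Ω
  algebraic_upper : ∀ m,
    DifferentiableOn ℂ (fun p : ℂ × ℂ => (S.term m).upper p.1 p.2) Ω ∧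
    SatisfiesAlgebraicEquationOn (fun (p : ℂ × ℂ) (i : Fin 2) => ![p.1, p.2] i)
      (fun p => (S.term m).upper p.1 p.2) Ω
  /-- Each summand takes values in the extended ring of periods at algebraic arguments, for every
  path along which it converges absolutely. -/
  periodness : ∀ m, ∀ α β : ℂ, (α, β) ∈ Ω → IsAlgebraic ℚ α → IsAlgebraic ℚ β →
    ∀ w, (S.term m).IsValue α β w → w ∈ kzPeriodsExt
  /-- Both `S(α‖β)` and `S(β‖α)` have local holomorphic branches in `α`, and some Gauss--Manin
  operator in `α` maps every such branch of either of them to `1 / (α - β)`. -/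
  symmetry : ∃ O : Polynomial (Polynomial QbarC), IsGaussManinOperator O ∧
    ∀ α β : ℂ, (α, β) ∈ Ω →
      ((∃ N s, α ∈ N ∧ IsBranchOn (fun a w => S.IsValue a β w) N s) ∧
        ∀ N s, α ∈ N → IsBranchOn (fun a w => S.IsValue a β w) N s →
          applyDiffOp O s α = 1 / (α - β)) ∧
      ((∃ N s, α ∈ N ∧ IsBranchOn (fun a w => S.IsValue β a w) N s) ∧
        ∀ N s, α ∈ N → IsBranchOn (fun a w => S.IsValue β a w) N s →
          applyDiffOp O s α = 1 / (α - β))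

/-! ### The interaction entropy of weight 4 and degree `ν` -/

/-- The four-term formal sum of integrals that defines `S_ν(α‖β)`. -/
noncomputable def entropySum (ν : ℝ) : FormalIntegralSum where
  size := 4
  term :=
    ![{ lower := fun _ _ => 0
        upper := fun _ β => β
        integrand := fun t α β =>
          legendreP ν (2 * β - 1) ^ 2 * (legendreP ν (1 - 2 * t) ^ 2 / (t - α))
        dom := {p | p.1 ∈ slitPlaneOne ∧ p.2.1 ∈ doubleSlit ∧ p.2.2 ∈ doubleSlit ∧ p.1 ≠ p.2.1} },
      { lower := fun _ _ => 0
        upper := fun _ β => β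
        integrand := fun t α β =>
          -(legendreP ν (1 - 2 * β) * legendreP ν (2 * β - 1)) *
            (legendreP ν (1 - 2 * t) * legendreP ν (2 * t - 1) / (t - α))
        dom := {p | p.1 ∈ doubleSlit ∧ p.2.1 ∈ doubleSlit ∧ p.2.2 ∈ doubleSlit ∧ p.1 ≠ p.2.1} },
      { lower := fun _ _ => 0
        upper := fun _ β => 1 - β
        integrand := fun t α β =>
          -(legendreP ν (2 * β - 1) * legendreP ν (1 - 2 * β)) *
            (legendreP ν (1 - 2 * t) * legendreP ν (2 * t - 1) / (t - 1 + α))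
        dom := {p | p.1 ∈ doubleSlit ∧ p.2.1 ∈ doubleSlit ∧ p.2.2 ∈ doubleSlit ∧
          p.1 ≠ 1 - p.2.1} },
      { lower := fun _ _ => 0
        upper := fun _ β => 1 - β
        integrand := fun t α β =>
          legendreP ν (1 - 2 * β) ^ 2 * (legendreP ν (1 - 2 * t) ^ 2 / (t - 1 + α))
        dom := {p | p.1 ∈ slitPlaneOne ∧ p.2.1 ∈ doubleSlit ∧ p.2.2 ∈ doubleSlit ∧
          p.1 ≠ 1 - p.2.1} }]

/-- The group `Λ_ν(α, β)`, generated by three products of Legendre functions. -/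
noncomputable def entropyLattice (ν : ℝ) (α β : ℂ) : AddSubgroup ℂ :=
  AddSubgroup.closure
    {legendreP ν (1 - 2 * α) ^ 2 * legendreP ν (2 * β - 1) ^ 2,
     legendreP ν (1 - 2 * α) * legendreP ν (2 * α - 1) *
       (legendreP ν (1 - 2 * β) * legendreP ν (2 * β - 1)),
     legendreP ν (2 * α - 1) ^ 2 * legendreP ν (1 - 2 * β) ^ 2}

/-- `x ≡ y` modulo `2πi Λ_ν(α, β)`. -/
def EntropyCongr (ν : ℝ) (α β x y : ℂ) : Prop :=
  ∃ l ∈ entropyLattice ν α β, x - y = 2 * (Real.pi : ℂ) * Complex.I * l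

/-- The right-hand side of the reciprocity between `S_ν(α‖β)` and `S_ν(β‖α)`. -/
noncomputable def reciprocityTerm (ν : ℝ) (α β : ℂ) : ℂ :=
  ((Real.pi / (2 * Real.sin (ν * Real.pi)) : ℝ) : ℂ) *
      (legendreP ν (1 - 2 * α) ^ 2 + legendreP ν (2 * α - 1) ^ 2) *
      (legendreP ν (2 * β - 1) * legendreP ν (1 - 2 * β)) -
    ((Real.pi / (2 * Real.sin (ν * Real.pi)) : ℝ) : ℂ) *
      (legendreP ν (1 - 2 * β) ^ 2 + legendreP ν (2 * β - 1) ^ 2) *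
      (legendreP ν (2 * α - 1) * legendreP ν (1 - 2 * α))

/-! ### Slit planes -/

/-! Write F(t) = P_ν(1 - 2t), G(t) = F(1 - t), c = sin(νπ)/π, p = t(1 - t). Both F and G solve
Legendre's equation (p y')' + ν(ν+1) y = 0, and p (F G' - F' G) = c (`legF_wronskian`). Hence F²,
FG, G² span the kernel of the third-order symmetric square O of that equation (`symSq`,
`eq_combination_of_symSq_eq_zero`). Substituting t ↦ 1 - t in the last two integrals turns S(α‖β)
into G(β)² ∫₀^β F²/(t-α) - FG(β) (∫₀^β + ∫₁^β) FG/(t-α) + F(β)² ∫₁^β G²/(t-α).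

Well-definedness. For a kernel h, split h(t)/(t-α) into the divided difference (h(t)-h(α))/(t-α) and
h(α)/(t-α). The first piece has a single-valued primitive, because the domain is star-shaped at 0
and h is at most logarithmic there; the second contributes h(α) times a logarithm of (β-α)/(-α),
ambiguous by 2πiℤ (`exists_pathIntegral_eq`). The four ambiguities add up to 2πi Λ. Parabolic arcs
with three possible shapes supply explicit paths which depend holomorphically on their end point.

Differential equations. In β, S is variation of constants with kernel (G(β)F(t) - F(β)G(t))²/(t-α),
so O_β S = 2c²/(β-α) (`exists_hasJet_right`). In α, the identity O_α 1/(t-α) = -O_t 1/(t-α) and the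
skew-adjointness of O reduce every integral to a boundary value at β, and the boundary values add up
to 2c²/(α-β) (`exists_hasJet_left`). Thus S(α‖β) and S(β‖α) satisfy the same inhomogeneous equation
in α, and multiplication by 1/(2c²) normalises its right-hand side.

Reciprocity. For Im α > 0 > Im β and straight segments, the defect S(α‖β) - S(β‖α) - (reciprocity
term) is x F(α)² + y FG(α) + z G(α)². Letting α = iε → 0 and comparing the powers of log ε kills y
and z; this uses the closed form of ∫₀¹ FG/(t-β) (`unitCauchy_eq`). The antiholomorphic symmetry t ↦
1 - t̄ exchanges F and G up to conjugation and kills x (`entropyDefect_eq_zero`). For other α, β the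
congruence says that one of countably many holomorphic functions vanishes; by uncountability and the
identity theorem this spreads over connected sets (`isReciprocal_of_isOpen`).

Interaction entropy. For ν = -m/q the Euler integrand is algebraic, so the arc integrals become
threefold integrals of algebraic functions over a cube, up to the factor c², which involves 1/π
(`arcIntegral_mem_kzPeriodsExt`). Products of two Euler integrals form a fundamental system of
period functions for O. On a branch the lattice vector is frozen by countability, and it lies in the
kernel of O, so all branches satisfy the same equation (`symSq_iteratedDeriv_of_exists_eq`). -/

theorem isOpen_slitPlaneOne : IsOpen slitPlaneOne := by
  have : IsClosed {t : ℂ | t.im = 0 ∧ 1 ≤ t.re} :=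
    (isClosed_eq Complex.continuous_im continuous_const).inter
      (isClosed_le continuous_const Complex.continuous_re)
  exact this.isOpen_compl

theorem isOpen_doubleSlit : IsOpen doubleSlit := by
  have h1 : IsOpen {t : ℂ | t.im ≠ 0} := isOpen_ne_fun Complex.continuous_im continuous_const
  have h2 : IsOpen {t : ℂ | 0 < t.re ∧ t.re < 1} :=
    (isOpen_lt continuous_const Complex.continuous_re).inter
      (isOpen_lt Complex.continuous_re continuous_const)
  exact h1.union h2

theorem doubleSlit_subset_slitPlaneOne : doubleSlit ⊆ slitPlaneOne := by
  rintro t (h | h) ⟨h1, h2⟩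
  · exact h h1
  · linarith [h.2]

theorem doubleSlit_subset_slitPlane : doubleSlit ⊆ Complex.slitPlane := by
  rintro t (h | h)
  · exact Or.inr h
  · exact Or.inl h.1

theorem one_sub_mem_doubleSlit {t : ℂ} (ht : t ∈ doubleSlit) : 1 - t ∈ doubleSlit := by
  rcases ht with h | h
  · left; simpa using h
  · right; simp; exact ⟨h.2, h.1⟩

/-- The cut [1, ∞) is exactly what keeps 1 - tu off the branch cut of the principal power for every
u in [0, 1], end points included. The closed interval provides compactness later. -/
theorem one_sub_mul_mem_slitPlane {t : ℂ} (ht : t ∈ slitPlaneOne) {u : ℝ} (hu : u ∈ Icc (0 : ℝ) 1) :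
    1 - t * u ∈ Complex.slitPlane := by
  rw [Complex.mem_slitPlane_iff]
  by_contra! h
  obtain ⟨h1, h2⟩ := h
  simp at h1 h2
  rcases h2 with h2 | h2
  · apply ht
    refine ⟨h2, ?_⟩
    by_contra! h3
    have h4 : u = 1 := le_antisymm hu.2 (by nlinarith [hu.1])
    rw [h4] at h1; linarith
  · simp [h2] at h1; linarith

theorem one_sub_mem_slitPlaneOne_iff {t : ℂ} : 1 - t ∈ slitPlaneOne ↔ t ∈ Complex.slitPlane := by
  simp only [slitPlaneOne, Set.mem_ofPred_eq, Complex.mem_slitPlane_iff]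
  simp
  tauto

theorem smul_mem_slitPlaneOne {t : ℂ} (ht : t ∈ slitPlaneOne) {s : ℝ} (hs : s ∈ Icc (0 : ℝ) 1) :
    (s : ℂ) * t ∈ slitPlaneOne := by
  rintro ⟨h1, h2⟩
  simp at h1 h2
  rcases h1 with h1 | h1
  · simp [h1] at h2; linarith
  · refine ht ⟨h1, ?_⟩
    by_contra! h3
    have h4 : s = 1 := le_antisymm hs.2 (by nlinarith [hs.1])
    rw [h4] at h2; linarith

theorem smul_mem_doubleSlit {t : ℂ} (ht : t ∈ doubleSlit) {s : ℝ} (hs : s ∈ Ioc (0 : ℝ) 1) :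
    (s : ℂ) * t ∈ doubleSlit := by
  rcases ht with h | h
  · left; simpa using ⟨hs.1.ne', h⟩
  · right; simp; constructor <;> nlinarith [hs.1, hs.2, h.1, h.2]

/-! ### Euler integrals -/

theorem integrableOn_rpow_mul_rpow {a b : ℝ} (ha : -1 < a) (hb : -1 < b) :
    IntegrableOn (fun u : ℝ => u ^ a * (1 - u) ^ b) (Ioo 0 1) := by
  have h := Complex.betaIntegral_convergent (u := ((a + 1 : ℝ) : ℂ)) (v := ((b + 1 : ℝ) : ℂ))
    (by rw [Complex.ofReal_re]; linarith) (by rw [Complex.ofReal_re]; linarith)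
  rw [intervalIntegrable_iff_integrableOn_Ioo_of_le zero_le_one] at h
  refine IntegrableOn.congr_fun h.norm (fun u hu => ?_) measurableSet_Ioo
  have h1 : (0 : ℝ) < 1 - u := by linarith [hu.2]
  have h2 : (1 : ℂ) - u = ((1 - u : ℝ) : ℂ) := by push_cast; ring
  have e1 : (((a + 1 : ℝ) : ℂ) - 1) = (a : ℂ) := by push_cast; ring
  have e2 : (((b + 1 : ℝ) : ℂ) - 1) = (b : ℂ) := by push_cast; ring
  simp only [e1, e2, h2, norm_mul]
  rw [Complex.norm_cpow_eq_rpow_re_of_pos hu.1, Complex.norm_cpow_eq_rpow_re_of_pos h1]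
  simp

/-- Compactness of a closed ball times [0, 1]. The bound is uniform in u and in t near t₀, so the
weight alone dominates when differentiating under Euler's integral. -/
theorem exists_norm_cpow_one_sub_mul_le (e : ℂ) {t₀ : ℂ} (ht : t₀ ∈ slitPlaneOne) :
    ∃ ε > 0, ∃ C : ℝ, Metric.ball t₀ ε ⊆ slitPlaneOne ∧
      ∀ t ∈ Metric.ball t₀ ε, ∀ u ∈ Icc (0 : ℝ) 1, ‖(1 - t * (u : ℂ)) ^ e‖ ≤ C := by
  obtain ⟨ε, hε, hb⟩ := Metric.nhds_basis_closedBall.mem_iff.1 (isOpen_slitPlaneOne.mem_nhds ht)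
  have hK : IsCompact (Metric.closedBall t₀ ε ×ˢ Icc (0 : ℝ) 1) :=
    (isCompact_closedBall t₀ ε).prod isCompact_Icc
  have hc : ContinuousOn (fun p : ℂ × ℝ => (1 - p.1 * (p.2 : ℂ)) ^ e)
      (Metric.closedBall t₀ ε ×ˢ Icc (0 : ℝ) 1) := by
    refine ContinuousOn.cpow (by fun_prop) continuousOn_const ?_
    rintro ⟨t, u⟩ ⟨h1, h2⟩
    exact one_sub_mul_mem_slitPlane (hb h1) h2
  obtain ⟨C, hC⟩ := hK.exists_bound_of_continuousOn hc
  refine ⟨ε, hε, C, Metric.ball_subset_closedBall.trans hb, fun t h u hu => ?_⟩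
  exact hC (t, u) ⟨Metric.ball_subset_closedBall h, hu⟩

theorem continuousOn_cpow_one_sub_mul (e : ℂ) {t : ℂ} (ht : t ∈ slitPlaneOne) :
    ContinuousOn (fun u : ℝ => (1 - t * (u : ℂ)) ^ e) (Icc 0 1) :=
  ContinuousOn.cpow (by fun_prop) continuousOn_const fun _ hu => one_sub_mul_mem_slitPlane ht hu

theorem integrableOn_mul_cpow_one_sub_mul {W : ℝ → ℝ} (hW : IntegrableOn W (Ioo 0 1)) (e : ℂ)
    {t : ℂ} (ht : t ∈ slitPlaneOne) :
    IntegrableOn (fun u : ℝ => (W u : ℂ) * (1 - t * (u : ℂ)) ^ e) (Ioo 0 1) := by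
  obtain ⟨ε, hε, C, -, hC⟩ := exists_norm_cpow_one_sub_mul_le e ht
  refine Integrable.mul_bdd (c := C) hW.ofReal ?_ ?_
  · exact ((continuousOn_cpow_one_sub_mul e ht).mono Ioo_subset_Icc_self).aestronglyMeasurable
      measurableSet_Ioo
  · refine (ae_restrict_iff' measurableSet_Ioo).2 (Filter.Eventually.of_forall fun u hu => ?_)
    exact hC t (Metric.mem_ball_self hε) u (Ioo_subset_Icc_self hu)

theorem hasDerivAt_integral_mul_cpow_one_sub_mul {W : ℝ → ℝ} (hW : IntegrableOn W (Ioo 0 1)) (e : ℂ)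
    {t : ℂ} (ht : t ∈ slitPlaneOne) :
    HasDerivAt (fun t : ℂ => ∫ u in Ioo (0 : ℝ) 1, (W u : ℂ) * (1 - t * (u : ℂ)) ^ e)
      (-e * ∫ u in Ioo (0 : ℝ) 1, ((u * W u : ℝ) : ℂ) * (1 - t * (u : ℂ)) ^ (e - 1)) t := by
  obtain ⟨ε, hε, C, hsub, hC⟩ := exists_norm_cpow_one_sub_mul_le (e - 1) ht
  have key := (hasDerivAt_integral_of_dominated_loc_of_deriv_le (𝕜 := ℂ)
    (μ := volume.restrict (Ioo (0 : ℝ) 1)) (x₀ := t)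
    (F := fun t u => (W u : ℂ) * (1 - t * (u : ℂ)) ^ e)
    (F' := fun t u => (W u : ℂ) * (-e * (u : ℂ) * (1 - t * (u : ℂ)) ^ (e - 1)))
    (bound := fun u => ‖W u‖ * (‖e‖ * C)) (Metric.ball_mem_nhds t hε) ?_ ?_ ?_ ?_ ?_ ?_).2
  · refine key.congr_deriv ?_
    rw [← integral_const_mul]
    congr 1; ext u; push_cast; ring
  · filter_upwards [isOpen_slitPlaneOne.mem_nhds ht] with s hs
    exact (integrableOn_mul_cpow_one_sub_mul hW e hs).aestronglyMeasurable
  · exact integrableOn_mul_cpow_one_sub_mul hW e ht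
  · have h1 : ContinuousOn (fun u : ℝ => -e * (u : ℂ) * (1 - t * (u : ℂ)) ^ (e - 1)) (Ioo 0 1) :=
      ContinuousOn.mul (by fun_prop)
        ((continuousOn_cpow_one_sub_mul (e - 1) ht).mono Ioo_subset_Icc_self)
    exact hW.ofReal.aestronglyMeasurable.mul (h1.aestronglyMeasurable measurableSet_Ioo)
  · refine (ae_restrict_iff' measurableSet_Ioo).2 (Filter.Eventually.of_forall fun u hu s hs => ?_)
    have h1 := hC s hs u (Ioo_subset_Icc_self hu)
    have h0 : 0 ≤ C := (norm_nonneg _).trans h1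
    have h2 : ‖(u : ℂ)‖ ≤ 1 := by
      rw [Complex.norm_real, Real.norm_of_nonneg hu.1.le]; exact hu.2.le
    rw [norm_mul, norm_mul, norm_mul, norm_neg, Complex.norm_real]
    gcongr
    calc ‖e‖ * ‖(u : ℂ)‖ ≤ ‖e‖ * 1 := by gcongr
      _ = ‖e‖ := mul_one _
  · exact hW.norm.mul_const _
  · refine (ae_restrict_iff' measurableSet_Ioo).2 (Filter.Eventually.of_forall fun u hu s hs => ?_)
    have h1 : HasDerivAt (fun s : ℂ => 1 - s * (u : ℂ)) (-(u : ℂ)) s := by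
      simpa using ((hasDerivAt_id s).mul_const (u : ℂ)).const_sub 1
    have h2 := (h1.cpow_const (c := e)
      (one_sub_mul_mem_slitPlane (hsub hs) (Ioo_subset_Icc_self hu))).const_mul (W u : ℂ)
    exact h2.congr_deriv (by ring)

/-! ### The Legendre function on the slit plane -/

/-- The integrals `∫₀¹ u^(ν+k) (1-u)^(-ν-1) (1-tu)^(ν-k) du`. -/
noncomputable def eulerIntegral (ν : ℝ) (k : ℕ) (t : ℂ) : ℂ :=
  ∫ u in Ioo (0 : ℝ) 1, ((u ^ (ν + k) * (1 - u) ^ (-ν - 1) : ℝ) : ℂ) *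
    (1 - t * (u : ℂ)) ^ ((ν : ℂ) - k)

/-- The constant `sin (νπ) / π`. -/
noncomputable def legC (ν : ℝ) : ℝ := Real.sin (ν * Real.pi) / Real.pi

/-- The function `t ↦ P_ν(1 - 2t)`. -/
noncomputable def legF (ν : ℝ) (t : ℂ) : ℂ := legendreP ν (1 - 2 * t)

/-- The derivative of `legF`. -/
noncomputable def legF₁ (ν : ℝ) (t : ℂ) : ℂ := legC ν * ν * eulerIntegral ν 1 t

/-- The second derivative of `legF`. -/
noncomputable def legF₂ (ν : ℝ) (t : ℂ) : ℂ := -(legC ν * ν * (ν - 1)) * eulerIntegral ν 2 t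

theorem legendreP_one_sub (ν : ℝ) (t : ℂ) : legendreP ν (1 - 2 * t) = legF ν t := rfl

theorem legendreP_sub_one (ν : ℝ) (t : ℂ) : legendreP ν (2 * t - 1) = legF ν (1 - t) := by
  unfold legF; congr 1; ring

theorem legC_neg {ν : ℝ} (hν : -1 < ν ∧ ν < 0) : legC ν < 0 := by
  refine div_neg_of_neg_of_pos (Real.sin_neg_of_neg_of_neg_pi_lt ?_ ?_) Real.pi_pos
  · exact mul_neg_of_neg_of_pos hν.2 Real.pi_pos
  · nlinarith [Real.pi_pos, hν.1]

theorem legC_ne_zero {ν : ℝ} (hν : -1 < ν ∧ ν < 0) : (legC ν : ℂ) ≠ 0 := by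
  exact_mod_cast (legC_neg hν).ne

theorem integrableOn_eulerWeight {ν : ℝ} (hν : -1 < ν ∧ ν < 0) (k : ℕ) :
    IntegrableOn (fun u : ℝ => u ^ (ν + k) * (1 - u) ^ (-ν - 1)) (Ioo 0 1) :=
  integrableOn_rpow_mul_rpow (by have : (0 : ℝ) ≤ k := Nat.cast_nonneg k; linarith [hν.1])
    (by linarith [hν.2])

/-- A positive real factor, here u/(1-u), may be pulled out of a principal power, since it does not
change the argument. -/
theorem legF_integrand_eq {ν u : ℝ} (hu : u ∈ Ioo (0 : ℝ) 1) {t : ℂ} (ht : t ∈ slitPlaneOne) :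
    ((u : ℂ) * (1 - t * (u : ℂ)) / (1 - (u : ℂ))) ^ (ν : ℂ) / (1 - (u : ℂ)) =
      ((u ^ ν * (1 - u) ^ (-ν - 1) : ℝ) : ℂ) * (1 - t * (u : ℂ)) ^ (ν : ℂ) := by
  have h1 : (0 : ℝ) < 1 - u := by linarith [hu.2]
  have h2 : (1 : ℂ) - u = ((1 - u : ℝ) : ℂ) := by push_cast; ring
  have h3 : (1 : ℂ) - t * u ≠ 0 :=
    Complex.slitPlane_ne_zero (one_sub_mul_mem_slitPlane ht (Ioo_subset_Icc_self hu))
  have h4 : 0 < u / (1 - u) := div_pos hu.1 h1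
  have e1 : (u : ℂ) * (1 - t * (u : ℂ)) / (1 - (u : ℂ)) =
      ((u / (1 - u) : ℝ) : ℂ) * (1 - t * (u : ℂ)) := by
    push_cast; ring
  have h5 : (((u / (1 - u) : ℝ) : ℂ)) ≠ 0 := by exact_mod_cast h4.ne'
  rw [e1, Complex.cpow_def_of_ne_zero (mul_ne_zero h5 h3), Complex.log_ofReal_mul h4 h3, add_mul,
    Complex.exp_add, ← Complex.cpow_def_of_ne_zero h3, Complex.ofReal_log h4.le,
    ← Complex.cpow_def_of_ne_zero h5, ← Complex.ofReal_cpow h4.le, h2,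
    Real.div_rpow hu.1.le h1.le, Real.rpow_sub h1, Real.rpow_neg h1.le, Real.rpow_one]
  have h6 : (1 - u) ^ ν ≠ 0 := (Real.rpow_pos_of_pos h1 ν).ne'
  push_cast
  field_simp

theorem legF_eq (ν : ℝ) {t : ℂ} (ht : t ∈ slitPlaneOne) :
    legF ν t = -(legC ν : ℂ) * eulerIntegral ν 0 t := by
  unfold legF legendreP eulerIntegral legC
  congr 1
  rw [intervalIntegral.integral_of_le zero_le_one, integral_Ioc_eq_integral_Ioo]
  refine setIntegral_congr_fun measurableSet_Ioo fun u hu => ?_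
  have e : (1 - (1 - 2 * t)) / 2 = t := by ring
  simp only [e, Nat.cast_zero, add_zero, sub_zero]
  exact legF_integrand_eq hu ht

theorem hasDerivAt_eulerIntegral {ν : ℝ} (hν : -1 < ν ∧ ν < 0) (k : ℕ) {t : ℂ}
    (ht : t ∈ slitPlaneOne) :
    HasDerivAt (eulerIntegral ν k) (-((ν : ℂ) - k) * eulerIntegral ν (k + 1) t) t := by
  refine (hasDerivAt_integral_mul_cpow_one_sub_mul (integrableOn_eulerWeight hν k) _ ht).congr_deriv
    ?_
  congr 1
  refine setIntegral_congr_fun measurableSet_Ioo fun u hu => ?_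
  have e : (ν : ℂ) - k - 1 = (ν : ℂ) - (k + 1 : ℕ) := by push_cast; ring
  have e2 : u ^ (ν + (k + 1 : ℕ)) = u ^ (ν + k) * u := by
    rw [← Real.rpow_add_one hu.1.ne']; congr 1; push_cast; ring
  simp only [e, e2]
  congr 2; ring

theorem hasDerivAt_legF {ν : ℝ} (hν : -1 < ν ∧ ν < 0) {t : ℂ} (ht : t ∈ slitPlaneOne) :
    HasDerivAt (legF ν) (legF₁ ν t) t := by
  have h := (hasDerivAt_eulerIntegral hν 0 ht).const_mul (-(legC ν : ℂ))
  refine (h.congr_of_eventuallyEq ?_).congr_deriv ?_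
  · filter_upwards [isOpen_slitPlaneOne.mem_nhds ht] with s hs using legF_eq ν hs
  · unfold legF₁; push_cast; ring

theorem hasDerivAt_legF₁ {ν : ℝ} (hν : -1 < ν ∧ ν < 0) {t : ℂ} (ht : t ∈ slitPlaneOne) :
    HasDerivAt (legF₁ ν) (legF₂ ν t) t := by
  refine ((hasDerivAt_eulerIntegral hν 1 ht).const_mul (legC ν * ν : ℂ)).congr_deriv ?_
  unfold legF₂; push_cast; ring

theorem differentiableOn_legF {ν : ℝ} (hν : -1 < ν ∧ ν < 0) :
    DifferentiableOn ℂ (legF ν) slitPlaneOne :=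
  fun _ ht => (hasDerivAt_legF hν ht).differentiableAt.differentiableWithinAt

theorem integrableOn_eulerIntegrand {ν : ℝ} (hν : -1 < ν ∧ ν < 0) (k : ℕ) {t : ℂ}
    (ht : t ∈ slitPlaneOne) :
    IntegrableOn (fun u : ℝ => ((u ^ (ν + k) * (1 - u) ^ (-ν - 1) : ℝ) : ℂ) *
      (1 - t * (u : ℂ)) ^ ((ν : ℂ) - k)) (Ioo 0 1) :=
  integrableOn_mul_cpow_one_sub_mul (integrableOn_eulerWeight hν k) _ ht

theorem Complex.cpow_add_one {z : ℂ} (hz : z ≠ 0) (e : ℂ) : z ^ (e + 1) = z ^ e * z := by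
  rw [Complex.cpow_add _ _ hz, Complex.cpow_one]

/-- The combination of the three integrands is the u-derivative of K = u^(ν+1) (1-u)^(-ν)
(1-tu)^(ν-1). Because -1 < ν < 0, both outer exponents are positive and K vanishes at 0 and 1. -/
theorem eulerIntegral_ode {ν : ℝ} (hν : -1 < ν ∧ ν < 0) {t : ℂ} (ht : t ∈ slitPlaneOne) :
    t * (1 - t) * (ν - 1) * eulerIntegral ν 2 t - (1 - 2 * t) * eulerIntegral ν 1 t +
      (ν + 1) * eulerIntegral ν 0 t = 0 := by
  have hI (k) := integrableOn_eulerIntegrand hν k ht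
  set K : ℝ → ℂ := fun u => ((u ^ (ν + 1) * (1 - u) ^ (-ν) : ℝ) : ℂ) *
    (1 - t * (u : ℂ)) ^ ((ν : ℂ) - 1) with hK
  set K' : ℝ → ℂ := fun u => (t * (1 - t) * (ν - 1)) *
      (((u ^ (ν + (2 : ℕ)) * (1 - u) ^ (-ν - 1) : ℝ) : ℂ) *
        (1 - t * (u : ℂ)) ^ ((ν : ℂ) - (2 : ℕ))) -
      (1 - 2 * t) * (((u ^ (ν + (1 : ℕ)) * (1 - u) ^ (-ν - 1) : ℝ) : ℂ) *
        (1 - t * (u : ℂ)) ^ ((ν : ℂ) - (1 : ℕ))) +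
      (ν + 1) * (((u ^ (ν + (0 : ℕ)) * (1 - u) ^ (-ν - 1) : ℝ) : ℂ) *
        (1 - t * (u : ℂ)) ^ ((ν : ℂ) - (0 : ℕ))) with hK'
  have hKint : IntegrableOn K' (Ioo 0 1) :=
    (((hI 2).const_mul _).sub ((hI 1).const_mul _)).add ((hI 0).const_mul _)
  have hKc : ContinuousOn K (Icc 0 1) := by
    refine ContinuousOn.mul ?_ (continuousOn_cpow_one_sub_mul _ ht)
    refine Complex.continuous_ofReal.comp_continuousOn (ContinuousOn.mul ?_ ?_)
    · exact ContinuousOn.rpow_const continuousOn_id fun u _ => Or.inr (by linarith [hν.1])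
    · exact ContinuousOn.rpow_const (by fun_prop) fun u _ => Or.inr (by linarith [hν.2])
  have hKd : ∀ u ∈ Ioo (0 : ℝ) 1, HasDerivAt K (K' u) u := by
    intro u hu
    have h1 : (0 : ℝ) < 1 - u := by linarith [hu.2]
    have hsl := one_sub_mul_mem_slitPlane ht (Ioo_subset_Icc_self hu)
    have hne := Complex.slitPlane_ne_zero hsl
    have d1 : HasDerivAt (fun u : ℝ => u ^ (ν + 1)) ((ν + 1) * u ^ (ν + 1 - 1)) u :=
      Real.hasDerivAt_rpow_const (Or.inl hu.1.ne')
    have d2 : HasDerivAt (fun u : ℝ => (1 - u) ^ (-ν)) (-1 * (-ν) * (1 - u) ^ (-ν - 1)) u :=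
      ((hasDerivAt_id u).const_sub 1).rpow_const (Or.inl h1.ne')
    have d3 : HasDerivAt (fun u : ℝ => 1 - t * (u : ℂ)) (-t) u := by
      simpa using ((Complex.ofRealCLM.hasDerivAt (x := u)).const_mul t).const_sub 1
    have d4 : HasDerivAt (fun u : ℝ => (1 - t * (u : ℂ)) ^ ((ν : ℂ) - 1))
        (((ν : ℂ) - 1) * (1 - t * (u : ℂ)) ^ ((ν : ℂ) - 1 - 1) * (-t)) u :=
      HasDerivAt.comp (h₂ := fun z : ℂ => z ^ ((ν : ℂ) - 1)) u
        (Complex.hasStrictDerivAt_cpow_const hsl).hasDerivAt d3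
    refine ((d1.mul d2).ofReal_comp.mul d4).congr_deriv ?_
    have a1 : u ^ (ν + 1) = u ^ ν * u := Real.rpow_add_one hu.1.ne' _
    have a2 : u ^ (ν + (2 : ℕ)) = u ^ ν * u ^ 2 := by
      rw [Real.rpow_add hu.1, Real.rpow_natCast]
    have a3 : (1 - u) ^ (-ν) = (1 - u) ^ (-ν - 1) * (1 - u) := by
      rw [← Real.rpow_add_one h1.ne']; congr 1; ring
    have b1 : (1 - t * (u : ℂ)) ^ ((ν : ℂ) - 1) =
        (1 - t * (u : ℂ)) ^ ((ν : ℂ) - 2) * (1 - t * (u : ℂ)) := by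
      rw [← Complex.cpow_add_one hne]; congr 1; ring
    have b2 : (1 - t * (u : ℂ)) ^ (ν : ℂ) =
        (1 - t * (u : ℂ)) ^ ((ν : ℂ) - 2) * (1 - t * (u : ℂ)) ^ 2 := by
      rw [pow_two, ← mul_assoc, ← b1, ← Complex.cpow_add_one hne]; congr 1; ring
    have b3 : (ν : ℂ) - 1 - 1 = (ν : ℂ) - 2 := by ring
    simp only [hK', b3, Pi.mul_apply, Nat.cast_zero, Nat.cast_one, Nat.cast_ofNat, add_zero,
      sub_zero, add_sub_cancel_right] at *
    simp only [a1, a2, a3, b1, b2]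
    push_cast
    ring
  have hftc := intervalIntegral.integral_eq_sub_of_hasDerivAt_of_le zero_le_one hKc hKd
    ((intervalIntegrable_iff_integrableOn_Ioo_of_le zero_le_one).2 hKint)
  rw [intervalIntegral.integral_of_le zero_le_one, integral_Ioc_eq_integral_Ioo] at hftc
  have hK0 : K 0 = 0 := by
    simp [hK, Real.zero_rpow (show ν + 1 ≠ 0 by linarith [hν.1])]
  have hK1 : K 1 = 0 := by
    simp [hK, Real.zero_rpow (show -ν ≠ 0 by linarith [hν.2])]
  rw [hK0, hK1, sub_zero] at hftc
  rw [← hftc]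
  unfold eulerIntegral
  rw [hK', integral_add, integral_sub, integral_const_mul, integral_const_mul, integral_const_mul]
  · exact (hI 2).const_mul _
  · exact (hI 1).const_mul _
  · exact ((hI 2).const_mul _).sub ((hI 1).const_mul _)
  · exact (hI 0).const_mul _

/-- Legendre's differential equation. -/
theorem legF_ode {ν : ℝ} (hν : -1 < ν ∧ ν < 0) {t : ℂ} (ht : t ∈ slitPlaneOne) :
    t * (1 - t) * legF₂ ν t + (1 - 2 * t) * legF₁ ν t + ν * (ν + 1) * legF ν t = 0 := by
  rw [legF_eq ν ht]
  unfold legF₂ legF₁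
  linear_combination (-(legC ν : ℂ) * ν) * eulerIntegral_ode hν ht

/-- At t = 0 Euler's integral is B(ν+1, -ν) = Γ(ν+1)Γ(-ν), and the reflection formula matches it
with the prefactor -sin(νπ)/π. -/
theorem legF_zero {ν : ℝ} (hν : -1 < ν ∧ ν < 0) : legF ν 0 = 1 := by
  have h0 : (0 : ℂ) ∈ slitPlaneOne := by rintro ⟨-, h⟩; norm_num at h
  rw [legF_eq ν h0]
  have hB : eulerIntegral ν 0 0 = Complex.betaIntegral ((ν : ℂ) + 1) (-ν) := by
    unfold eulerIntegral Complex.betaIntegral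
    rw [intervalIntegral.integral_of_le zero_le_one, integral_Ioc_eq_integral_Ioo]
    refine setIntegral_congr_fun measurableSet_Ioo fun u hu => ?_
    have h1 : (0 : ℝ) < 1 - u := by linarith [hu.2]
    simp only [zero_mul, sub_zero, Complex.one_cpow, mul_one, Nat.cast_zero, add_zero,
      add_sub_cancel_right]
    rw [Complex.ofReal_mul, Complex.ofReal_cpow hu.1.le, Complex.ofReal_cpow h1.le]
    push_cast; ring
  have hG := Complex.Gamma_mul_Gamma_eq_betaIntegral (s := (ν : ℂ) + 1) (t := -(ν : ℂ))
    (by simp; linarith [hν.1]) (by simp; linarith [hν.2])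
  have hR := Complex.Gamma_mul_Gamma_one_sub (-(ν : ℂ))
  rw [sub_neg_eq_add, add_comm 1 (ν : ℂ), mul_comm, hG] at hR
  have e : (ν : ℂ) + 1 + -ν = 1 := by ring
  rw [e, Complex.Gamma_one, one_mul] at hR
  rw [hB, hR]
  have hs : Real.sin (ν * Real.pi) ≠ 0 := by
    have := (legC_neg hν).ne
    intro h; apply this; simp [legC, h]
  have e2 : Complex.sin (Real.pi * -(ν : ℂ)) = -((Real.sin (ν * Real.pi) : ℝ) : ℂ) := by
    rw [mul_neg, Complex.sin_neg, Complex.ofReal_sin]; push_cast; ring_nf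
  rw [e2, legC]
  have h1 : ((Real.sin (ν * Real.pi) : ℝ) : ℂ) ≠ 0 := by exact_mod_cast hs
  have h2 : (Real.pi : ℂ) ≠ 0 := by exact_mod_cast Real.pi_ne_zero
  push_cast at h1 ⊢
  field_simp

theorem conj_mem_slitPlaneOne {t : ℂ} (ht : t ∈ slitPlaneOne) :
    (starRingEnd ℂ) t ∈ slitPlaneOne := by
  rintro ⟨h1, h2⟩
  simp at h1 h2
  exact ht ⟨h1, h2⟩

/-- Schwarz reflection, valid because ν is real. It later yields a symmetry that determines
constants invisible to logarithmic asymptotics. -/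
theorem legF_conj (ν : ℝ) {t : ℂ} (ht : t ∈ slitPlaneOne) :
    legF ν ((starRingEnd ℂ) t) = (starRingEnd ℂ) (legF ν t) := by
  rw [legF_eq ν ht, legF_eq ν (conj_mem_slitPlaneOne ht), map_mul, map_neg, Complex.conj_ofReal]
  congr 1
  unfold eulerIntegral
  rw [← integral_conj]
  refine setIntegral_congr_fun measurableSet_Ioo fun u hu => ?_
  simp only [map_mul, Complex.conj_ofReal, Nat.cast_zero, sub_zero]
  congr 1
  have hsl := one_sub_mul_mem_slitPlane ht (Ioo_subset_Icc_self hu)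
  have := Complex.cpow_conj (1 - t * (u : ℂ)) (ν : ℂ) (Complex.slitPlane_arg_ne_pi hsl)
  rw [Complex.conj_ofReal] at this
  rw [this, Complex.conj_conj]
  simp

/-! ### The reflected function and the Wronskian -/

/-- The function `t ↦ P_ν(2t - 1)`. -/
noncomputable def legG (ν : ℝ) (t : ℂ) : ℂ := legF ν (1 - t)

/-- The derivative of `legG`. -/
noncomputable def legG₁ (ν : ℝ) (t : ℂ) : ℂ := -legF₁ ν (1 - t)

/-- The second derivative of `legG`. -/
noncomputable def legG₂ (ν : ℝ) (t : ℂ) : ℂ := legF₂ ν (1 - t)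

theorem hasDerivAt_legG {ν : ℝ} (hν : -1 < ν ∧ ν < 0) {t : ℂ} (ht : t ∈ Complex.slitPlane) :
    HasDerivAt (legG ν) (legG₁ ν t) t := by
  have h := (hasDerivAt_legF hν (one_sub_mem_slitPlaneOne_iff.2 ht)).comp t
    ((hasDerivAt_id t).const_sub 1)
  exact h.congr_deriv (by simp [legG₁])

theorem hasDerivAt_legG₁ {ν : ℝ} (hν : -1 < ν ∧ ν < 0) {t : ℂ} (ht : t ∈ Complex.slitPlane) :
    HasDerivAt (legG₁ ν) (legG₂ ν t) t := by
  have h := ((hasDerivAt_legF₁ hν (one_sub_mem_slitPlaneOne_iff.2 ht)).comp t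
    ((hasDerivAt_id t).const_sub 1)).neg
  exact h.congr_deriv (by simp [legG₂])

theorem legG_ode {ν : ℝ} (hν : -1 < ν ∧ ν < 0) {t : ℂ} (ht : t ∈ Complex.slitPlane) :
    t * (1 - t) * legG₂ ν t + (1 - 2 * t) * legG₁ ν t + ν * (ν + 1) * legG ν t = 0 := by
  have := legF_ode hν (one_sub_mem_slitPlaneOne_iff.2 ht)
  unfold legG₂ legG₁ legG
  linear_combination this

theorem starConvex_doubleSlit : StarConvex ℝ (1 / 2 : ℂ) doubleSlit := by
  intro y hy a b ha hb hab
  rcases hb.eq_or_lt with rfl | hb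
  · right; simp at hab ⊢; subst hab; norm_num
  rcases hy with h | h
  · left; simpa using ⟨hb.ne', h⟩
  · right
    simp
    constructor <;> nlinarith [h.1, h.2]

theorem half_mem_doubleSlit : (1 / 2 : ℂ) ∈ doubleSlit := by right; norm_num

theorem isPreconnected_doubleSlit : IsPreconnected doubleSlit :=
  (starConvex_doubleSlit.isPathConnected half_mem_doubleSlit).isConnected.isPreconnected

theorem le_of_le_of_le_rpow {x a b θ : ℝ} (ha : 0 ≤ a) (hb : 0 ≤ b) (hx : 0 < x) (h1 : a ≤ x)
    (h2 : b ≤ x) (hθ : 0 ≤ θ) (hθ' : θ ≤ 1) : a ^ (1 - θ) * b ^ θ ≤ x := by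
  calc a ^ (1 - θ) * b ^ θ ≤ x ^ (1 - θ) * x ^ θ := by gcongr
    _ = x := by rw [← Real.rpow_add hx]; simp

/-- The exponent of a crude bound for the logarithmic singularity of `P_ν` at `-1`. -/
noncomputable def legEta (ν : ℝ) : ℝ := -ν * ((1 + ν) / 2)

theorem legEta_pos {ν : ℝ} (hν : -1 < ν ∧ ν < 0) : 0 < legEta ν := by
  unfold legEta; nlinarith [hν.1, hν.2]

theorem legEta_lt {ν : ℝ} (hν : -1 < ν ∧ ν < 0) : legEta ν < 1 / 2 := by
  unfold legEta; nlinarith [hν.1, hν.2]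

theorem legEta_lt' {ν : ℝ} (hν : -1 < ν ∧ ν < 0) : -1 < ν - legEta ν := by
  unfold legEta; nlinarith [hν.1, hν.2]

/-- With θ = (1+ν)/2, the sum 1 - u + ru dominates the weighted geometric mean (1-u)^(1-θ) (ru)^θ.
Raising to the negative power ν costs r^(-η), η = -νθ, and leaves an integrable weight in u. Since η
< 1/2, even the square of the factor r^(-η) is integrable in r near 0. -/
theorem norm_cpow_le_of_le {ν : ℝ} (hν : -1 < ν ∧ ν < 0) {κ r u : ℝ} (hκ : 0 < κ) (hr : 0 < r)
    (hu : u ∈ Ioo (0 : ℝ) 1) {z : ℂ} (hz : κ * (1 - u + r * u) ≤ ‖z‖) :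
    u ^ ν * (1 - u) ^ (-ν - 1) * ‖z ^ (ν : ℂ)‖ ≤
      κ ^ ν * r ^ (-legEta ν) * (u ^ (ν - legEta ν) * (1 - u) ^ (legEta ν - 1)) := by
  have h1 : (0 : ℝ) < 1 - u := by linarith [hu.2]
  have h0 := hu.1
  have hru : 0 < r * u := by positivity
  set θ := (1 + ν) / 2 with hθ
  have hθ0 : 0 ≤ θ := by rw [hθ]; linarith [hν.1]
  have hθ1 : θ ≤ 1 := by rw [hθ]; linarith [hν.2]
  have hlow := le_of_le_of_le_rpow h1.le hru.le (show 0 < 1 - u + r * u by positivity)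
    (by linarith) (by linarith) hθ0 hθ1
  have hη : legEta ν = -(ν * θ) := by rw [hθ, legEta]; ring
  have hz' : κ * ((1 - u) ^ (1 - θ) * (r * u) ^ θ) ≤ ‖z‖ :=
    le_trans (by gcongr) hz
  have hpos : 0 < κ * ((1 - u) ^ (1 - θ) * (r * u) ^ θ) := by positivity
  have hn : ‖z ^ (ν : ℂ)‖ = ‖z‖ ^ ν := Complex.norm_cpow_real z ν
  rw [hn]
  have h2 : ‖z‖ ^ ν ≤ (κ * ((1 - u) ^ (1 - θ) * (r * u) ^ θ)) ^ ν :=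
    Real.rpow_le_rpow_of_nonpos hpos hz' hν.2.le
  have h3 : (κ * ((1 - u) ^ (1 - θ) * (r * u) ^ θ)) ^ ν =
      κ ^ ν * r ^ (-legEta ν) * (u ^ (-legEta ν) * (1 - u) ^ (ν + legEta ν)) := by
    rw [Real.mul_rpow hκ.le (by positivity), Real.mul_rpow (by positivity) (by positivity),
      ← Real.rpow_mul h1.le, ← Real.rpow_mul hru.le, Real.mul_rpow hr.le h0.le, hη]
    ring_nf
  have h4 : u ^ (ν - legEta ν) = u ^ ν * u ^ (-legEta ν) := by
    rw [← Real.rpow_add h0]; ring_nf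
  have h5 : (1 - u) ^ (legEta ν - 1) = (1 - u) ^ (-ν - 1) * (1 - u) ^ (ν + legEta ν) := by
    rw [← Real.rpow_add h1]; ring_nf
  calc u ^ ν * (1 - u) ^ (-ν - 1) * ‖z‖ ^ ν ≤ u ^ ν * (1 - u) ^ (-ν - 1) *
        (κ ^ ν * r ^ (-legEta ν) * (u ^ (-legEta ν) * (1 - u) ^ (ν + legEta ν))) := by
        rw [← h3]; gcongr
    _ = _ := by rw [h4, h5]; ring

theorem integrableOn_legEta_weight {ν : ℝ} (hν : -1 < ν ∧ ν < 0) :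
    IntegrableOn (fun u : ℝ => u ^ (ν - legEta ν) * (1 - u) ^ (legEta ν - 1)) (Ioo 0 1) :=
  integrableOn_rpow_mul_rpow (legEta_lt' hν) (by linarith [legEta_pos hν])

theorem exists_norm_legF_le {ν : ℝ} (hν : -1 < ν ∧ ν < 0) :
    ∃ M : ℝ, 0 ≤ M ∧ ∀ κ r : ℝ, 0 < κ → 0 < r → ∀ t ∈ slitPlaneOne,
      (∀ u ∈ Ioo (0 : ℝ) 1, κ * (1 - u + r * u) ≤ ‖1 - t * (u : ℂ)‖) →
      ‖legF ν t‖ ≤ M * (κ ^ ν * r ^ (-legEta ν)) := by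
  refine ⟨|legC ν| * ∫ u in Ioo (0 : ℝ) 1, u ^ (ν - legEta ν) * (1 - u) ^ (legEta ν - 1), ?_, ?_⟩
  · refine mul_nonneg (abs_nonneg _) (setIntegral_nonneg measurableSet_Ioo fun u hu => ?_)
    have h1 : (0 : ℝ) < 1 - u := by linarith [hu.2]
    have := hu.1
    positivity
  intro κ r hκ hr t ht hb
  rw [legF_eq ν ht, norm_mul, norm_neg, Complex.norm_real, Real.norm_eq_abs, mul_assoc]
  gcongr
  rw [mul_comm, ← integral_const_mul]
  refine norm_integral_le_of_norm_le ((integrableOn_legEta_weight hν).const_mul _) ?_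
  refine (ae_restrict_iff' measurableSet_Ioo).2 (Filter.Eventually.of_forall fun u hu => ?_)
  have h1 : (0 : ℝ) < 1 - u := by linarith [hu.2]
  have h0 := hu.1
  simp only [Nat.cast_zero, add_zero, sub_zero, norm_mul (α := ℂ)]
  rw [Complex.norm_real, Real.norm_of_nonneg (by positivity)]
  exact norm_cpow_le_of_le hν hκ hr hu (hb u hu)

/-- With u^(ν+1) replaced by 1, the integral of order one at t = 1 - ε is elementary:
((1-u)/(1-u+εu))^(-ν)/ν is a primitive of ε times the integrand, equal to 1/ν at u = 0 and to 0 at u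
= 1. -/
theorem integral_eulerComparison {ν : ℝ} (hν : -1 < ν ∧ ν < 0) {ε : ℝ} (hε : 0 < ε) :
    IntegrableOn (fun u : ℝ => (1 - u) ^ (-ν - 1) * (1 - u + ε * u) ^ (ν - 1)) (Ioo 0 1) ∧
    ε * ∫ u in Ioo (0 : ℝ) 1, (1 - u) ^ (-ν - 1) * (1 - u + ε * u) ^ (ν - 1) = -(1 / ν) := by
  have hApos : ∀ u ∈ Icc (0 : ℝ) 1, 0 < 1 - u + ε * u := by
    intro u hu
    rcases hu.1.eq_or_lt with h | h
    · rw [← h]; norm_num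
    · have := mul_pos hε h; linarith [hu.2]
  have hint : IntegrableOn (fun u : ℝ => (1 - u) ^ (-ν - 1) * (1 - u + ε * u) ^ (ν - 1))
      (Ioo 0 1) := by
    have hw := integrableOn_rpow_mul_rpow (a := 0) (b := -ν - 1) (by norm_num) (by linarith [hν.2])
    simp only [Real.rpow_zero, one_mul] at hw
    have hc : ContinuousOn (fun u : ℝ => (1 - u + ε * u) ^ (ν - 1)) (Icc 0 1) :=
      ContinuousOn.rpow_const (by fun_prop) fun u hu => Or.inl (hApos u hu).ne'
    obtain ⟨C, hC⟩ := isCompact_Icc.exists_bound_of_continuousOn hc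
    refine Integrable.mul_bdd (c := C) hw
      ((hc.mono Ioo_subset_Icc_self).aestronglyMeasurable measurableSet_Ioo) ?_
    exact (ae_restrict_iff' measurableSet_Ioo).2
      (Filter.Eventually.of_forall fun u hu => hC u (Ioo_subset_Icc_self hu))
  refine ⟨hint, ?_⟩
  have hK : ContinuousOn (fun u : ℝ => ((1 - u) / (1 - u + ε * u)) ^ (-ν) / ν) (Icc 0 1) := by
    refine ContinuousOn.div_const (ContinuousOn.rpow_const (ContinuousOn.div (by fun_prop)
      (by fun_prop) fun u hu => (hApos u hu).ne') fun u _ => Or.inr (by linarith [hν.2])) _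
  have hd : ∀ u ∈ Ioo (0 : ℝ) 1, HasDerivAt (fun u : ℝ => ((1 - u) / (1 - u + ε * u)) ^ (-ν) / ν)
      (ε * ((1 - u) ^ (-ν - 1) * (1 - u + ε * u) ^ (ν - 1))) u := by
    intro u hu
    have h1 : (0 : ℝ) < 1 - u := by linarith [hu.2]
    have hA := hApos u (Ioo_subset_Icc_self hu)
    have d1 : HasDerivAt (fun u : ℝ => 1 - u) (-1) u := by
      simpa using (hasDerivAt_id u).const_sub 1
    have d2 : HasDerivAt (fun u : ℝ => 1 - u + ε * u) (-1 + ε) u := by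
      exact (d1.add ((hasDerivAt_id u).const_mul ε)).congr_deriv (by simp)
    refine (((d1.div d2 hA.ne').rpow_const (p := -ν)
      (Or.inl (div_pos h1 hA).ne')).div_const ν).congr_deriv ?_
    simp only [Pi.div_apply]
    rw [Real.div_rpow h1.le hA.le]
    have e1 : (1 - u + ε * u) ^ (ν - 1) = (1 - u + ε * u) ^ (ν + 1) / (1 - u + ε * u) ^ 2 := by
      rw [show ν - 1 = ν + 1 - (2 : ℕ) by push_cast; ring, Real.rpow_sub hA, Real.rpow_natCast]
    have e2 : (1 - u + ε * u) ^ (-ν - 1) = ((1 - u + ε * u) ^ (ν + 1))⁻¹ := by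
      rw [← Real.rpow_neg hA.le]; congr 1; ring
    have hne : (1 - u + ε * u) ^ (ν + 1) ≠ 0 := (Real.rpow_pos_of_pos hA _).ne'
    have hν0 := hν.2.ne
    rw [e1, e2]
    field_simp
    ring
  have hftc := intervalIntegral.integral_eq_sub_of_hasDerivAt_of_le zero_le_one hK hd
    ((intervalIntegrable_iff_integrableOn_Ioo_of_le zero_le_one).2 (hint.const_mul ε))
  rw [intervalIntegral.integral_of_le zero_le_one, integral_Ioc_eq_integral_Ioo,
    integral_const_mul] at hftc
  rw [hftc]
  simp [Real.zero_rpow (show -ν ≠ 0 by linarith [hν.2])]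

/-- Leading behaviour of the derivative at the singular point t = 1. Comparison with
`integral_eulerComparison` leaves the factor 1 - u^(ν+1) ≤ 1 - u, which tames the singularity and
makes the error O(ε^(1/2)). -/
theorem exists_norm_eulerIntegral_one_le {ν : ℝ} (hν : -1 < ν ∧ ν < 0) :
    ∃ M : ℝ, ∀ ε : ℝ, 0 < ε → ε < 1 →
      ‖(ε : ℂ) * eulerIntegral ν 1 (1 - ε) + 1 / ν‖ ≤ ε ^ (1 / 2 : ℝ) * M := by
  refine ⟨∫ u in Ioo (0 : ℝ) 1, u ^ (-(1 / 2) : ℝ) * (1 - u) ^ (-(1 / 2) : ℝ),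
    fun ε hε hε1 => ?_⟩
  obtain ⟨hint, hI⟩ := integral_eulerComparison hν hε
  have hw := integrableOn_rpow_mul_rpow (a := -(1 / 2)) (b := -(1 / 2)) (by norm_num) (by norm_num)
  have hmem : (1 - (ε : ℂ)) ∈ slitPlaneOne := by
    rintro ⟨-, h⟩; simp at h; linarith
  have hE := integrableOn_eulerIntegrand hν 1 hmem
  have hre : ∀ u ∈ Ioo (0 : ℝ) 1, ((u ^ (ν + (1 : ℕ)) * (1 - u) ^ (-ν - 1) : ℝ) : ℂ) *
      (1 - (1 - (ε : ℂ)) * (u : ℂ)) ^ ((ν : ℂ) - (1 : ℕ)) =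
      ((u ^ (ν + 1) * ((1 - u) ^ (-ν - 1) * (1 - u + ε * u) ^ (ν - 1)) : ℝ) : ℂ) := by
    intro u hu
    have hA : 0 ≤ 1 - u + ε * u := by nlinarith [hu.1, hu.2]
    have : (1 - (1 - (ε : ℂ)) * (u : ℂ)) = ((1 - u + ε * u : ℝ) : ℂ) := by push_cast; ring
    rw [this, Nat.cast_one, Nat.cast_one, show (ν : ℂ) - 1 = ((ν - 1 : ℝ) : ℂ) by push_cast; ring,
      ← Complex.ofReal_cpow hA]
    push_cast; ring
  have hE' : IntegrableOn (fun u : ℝ => u ^ (ν + 1) *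
      ((1 - u) ^ (-ν - 1) * (1 - u + ε * u) ^ (ν - 1))) (Ioo 0 1) := by
    have := (hE.congr_fun hre measurableSet_Ioo).re
    simpa [IntegrableOn] using this
  have hval : (ε : ℂ) * eulerIntegral ν 1 (1 - ε) + 1 / ν =
      (((-ε) * ∫ u in Ioo (0 : ℝ) 1, ((1 - u) ^ (-ν - 1) * (1 - u + ε * u) ^ (ν - 1) -
        u ^ (ν + 1) * ((1 - u) ^ (-ν - 1) * (1 - u + ε * u) ^ (ν - 1))) : ℝ) : ℂ) := by
    rw [integral_sub hint hE', mul_sub, neg_mul, hI]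
    unfold eulerIntegral
    rw [setIntegral_congr_fun measurableSet_Ioo hre, integral_complex_ofReal]
    push_cast; ring
  rw [hval, Complex.norm_real, Real.norm_eq_abs, abs_mul, abs_neg, abs_of_pos hε]
  have hbound : |∫ u in Ioo (0 : ℝ) 1, ((1 - u) ^ (-ν - 1) * (1 - u + ε * u) ^ (ν - 1) -
        u ^ (ν + 1) * ((1 - u) ^ (-ν - 1) * (1 - u + ε * u) ^ (ν - 1)))| ≤
      ∫ u in Ioo (0 : ℝ) 1, ε ^ (-(1 / 2) : ℝ) *
        (u ^ (-(1 / 2) : ℝ) * (1 - u) ^ (-(1 / 2) : ℝ)) := by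
    rw [← Real.norm_eq_abs]
    refine norm_integral_le_of_norm_le (hw.const_mul _) ?_
    refine (ae_restrict_iff' measurableSet_Ioo).2 (Filter.Eventually.of_forall fun u hu => ?_)
    have h1 : (0 : ℝ) < 1 - u := by linarith [hu.2]
    have h0 := hu.1
    have hA : 0 < 1 - u + ε * u := by positivity
    have hp : u ≤ u ^ (ν + 1) := by
      calc u = u ^ (1 : ℝ) := (Real.rpow_one u).symm
        _ ≤ u ^ (ν + 1) := Real.rpow_le_rpow_of_exponent_ge h0 hu.2.le (by linarith [hν.2])
    have hp1 : u ^ (ν + 1) ≤ 1 := Real.rpow_le_one h0.le hu.2.le (by linarith [hν.1])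
    have e : (1 - u) ^ (-ν - 1) * (1 - u + ε * u) ^ (ν - 1) -
        u ^ (ν + 1) * ((1 - u) ^ (-ν - 1) * (1 - u + ε * u) ^ (ν - 1)) =
        (1 - u ^ (ν + 1)) * ((1 - u) ^ (-ν - 1) * (1 - u + ε * u) ^ (ν - 1)) := by ring
    rw [e, Real.norm_of_nonneg (mul_nonneg (by linarith) (by positivity))]
    have hAu : 1 - u ≤ 1 - u + ε * u := by nlinarith
    have hAe : ε * u ≤ 1 - u + ε * u := by linarith
    calc (1 - u ^ (ν + 1)) * ((1 - u) ^ (-ν - 1) * (1 - u + ε * u) ^ (ν - 1))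
        ≤ (1 - u) * ((1 - u) ^ (-ν - 1) * (1 - u + ε * u) ^ (ν - 1)) := by gcongr
      _ = (1 - u) ^ (-ν) * (1 - u + ε * u) ^ (ν - 1) := by
          rw [show (-ν) = -ν - 1 + 1 by ring, Real.rpow_add_one h1.ne']; ring_nf
      _ ≤ (1 - u + ε * u) ^ (-ν) * (1 - u + ε * u) ^ (ν - 1) := by
          gcongr; linarith [hν.2]
      _ = (1 - u + ε * u) ^ (-(1 / 2) : ℝ) * (1 - u + ε * u) ^ (-(1 / 2) : ℝ) := by
          rw [← Real.rpow_add hA, ← Real.rpow_add hA]; congr 1; ring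
      -- The power -1 is shared equally between the lower bounds 1 - u and εu of 1 - u + εu, so that
      -- both end-point singularities stay integrable.
      _ ≤ (1 - u) ^ (-(1 / 2) : ℝ) * (ε * u) ^ (-(1 / 2) : ℝ) := by
          gcongr ?_ * ?_
          · exact Real.rpow_le_rpow_of_nonpos h1 hAu (by norm_num)
          · exact Real.rpow_le_rpow_of_nonpos (by positivity) hAe (by norm_num)
      _ = _ := by rw [Real.mul_rpow hε.le h0.le]; ring
  rw [integral_const_mul] at hbound
  calc ε * _ ≤ ε * (ε ^ (-(1 / 2) : ℝ) * ∫ u in Ioo (0 : ℝ) 1,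
        (u ^ (-(1 / 2) : ℝ) * (1 - u) ^ (-(1 / 2) : ℝ))) := by gcongr
    _ = _ := by
        rw [← mul_assoc]; congr 1
        rw [mul_comm, ← Real.rpow_add_one hε.ne']; norm_num

/-- This limit is what fixes the constant value of the Wronskian. -/
theorem tendsto_mul_legG₁ {ν : ℝ} (hν : -1 < ν ∧ ν < 0) :
    Filter.Tendsto (fun ε : ℝ => (ε : ℂ) * legG₁ ν ε) (nhdsWithin 0 (Ioi 0)) (nhds (legC ν)) := by
  obtain ⟨M, hM⟩ := exists_norm_eulerIntegral_one_le hν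
  have h1 : Filter.Tendsto (fun ε : ℝ => (ε : ℂ) * eulerIntegral ν 1 (1 - ε) + 1 / ν)
      (nhdsWithin 0 (Ioi 0)) (nhds 0) := by
    refine squeeze_zero_norm' (a := fun ε : ℝ => ε ^ (1 / 2 : ℝ) * M) ?_ ?_
    · filter_upwards [Ioo_mem_nhdsGT (zero_lt_one' ℝ)] with ε hε using hM ε hε.1 hε.2
    · have : Continuous fun ε : ℝ => ε ^ (1 / 2 : ℝ) * M :=
        (Real.continuous_rpow_const (by norm_num)).mul continuous_const
      have h := this.tendsto 0
      simp only [Real.zero_rpow (show (1 / 2 : ℝ) ≠ 0 by norm_num), zero_mul] at h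
      exact h.mono_left nhdsWithin_le_nhds
  have h2 := (h1.const_mul (-(legC ν * ν : ℂ))).add_const (legC ν : ℂ)
  rw [mul_zero, zero_add] at h2
  refine h2.congr fun ε => ?_
  have : (ν : ℂ) ≠ 0 := by exact_mod_cast hν.2.ne
  unfold legG₁ legF₁
  field_simp
  ring

theorem tendsto_mul_legG {ν : ℝ} (hν : -1 < ν ∧ ν < 0) :
    Filter.Tendsto (fun ε : ℝ => (ε : ℂ) * legG ν ε) (nhdsWithin 0 (Ioi 0)) (nhds 0) := by
  obtain ⟨M, -, hM⟩ := exists_norm_legF_le hν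
  refine squeeze_zero_norm' (a := fun ε : ℝ => ε ^ (1 - legEta ν) * M) ?_ ?_
  · filter_upwards [Ioo_mem_nhdsGT (zero_lt_one' ℝ)] with ε hε
    have hmem : (1 - (ε : ℂ)) ∈ slitPlaneOne := by
      rintro ⟨-, h⟩; simp at h; linarith [hε.1]
    have h := hM 1 ε one_pos hε.1 (1 - ε) hmem fun u hu => by
      have : (1 - (1 - (ε : ℂ)) * (u : ℂ)) = ((1 - u + ε * u : ℝ) : ℂ) := by push_cast; ring
      rw [this, Complex.norm_real, one_mul]
      exact le_abs_self _
    rw [Real.one_rpow, one_mul] at h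
    rw [norm_mul, Complex.norm_real, Real.norm_of_nonneg hε.1.le, sub_eq_add_neg,
      Real.rpow_add hε.1, Real.rpow_one, mul_assoc, mul_comm (ε ^ (-legEta ν))]
    exact mul_le_mul_of_nonneg_left h hε.1.le
  · have he : 0 < 1 - legEta ν := by linarith [legEta_lt hν]
    have : Continuous fun ε : ℝ => ε ^ (1 - legEta ν) * M :=
      (Real.continuous_rpow_const he.le).mul continuous_const
    have h := this.tendsto 0
    simp only [Real.zero_rpow he.ne', zero_mul] at h
    exact h.mono_left nhdsWithin_le_nhds

theorem zero_mem_slitPlaneOne : (0 : ℂ) ∈ slitPlaneOne := by rintro ⟨-, h⟩; norm_num at h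

/-- The Wronskian of `P_ν(1 - 2t)` and `P_ν(2t - 1)`. -/
theorem legF_wronskian {ν : ℝ} (hν : -1 < ν ∧ ν < 0) {t : ℂ} (ht : t ∈ doubleSlit) :
    t * (1 - t) * (legF ν t * legG₁ ν t - legF₁ ν t * legG ν t) = legC ν := by
  set W : ℂ → ℂ := fun t => t * (1 - t) * (legF ν t * legG₁ ν t - legF₁ ν t * legG ν t) with hW
  have hd : ∀ t ∈ doubleSlit, HasDerivAt W 0 t := by
    intro t ht
    have h1 := doubleSlit_subset_slitPlaneOne ht
    have h2 := doubleSlit_subset_slitPlane ht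
    have hp : HasDerivAt (fun t : ℂ => t * (1 - t)) (1 * (1 - t) + t * (-1)) t :=
      (hasDerivAt_id t).mul ((hasDerivAt_id t).const_sub 1)
    refine (hp.mul (((hasDerivAt_legF hν h1).mul (hasDerivAt_legG₁ hν h2)).sub
      ((hasDerivAt_legF₁ hν h1).mul (hasDerivAt_legG hν h2)))).congr_deriv ?_
    simp only [Pi.sub_apply, Pi.mul_apply]
    linear_combination legF ν t * legG_ode hν h2 - legG ν t * legF_ode hν h1
  have hconst : ∀ ε ∈ Ioo (0 : ℝ) 1, W t = W ε := by
    intro ε hε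
    refine isOpen_doubleSlit.is_const_of_deriv_eq_zero isPreconnected_doubleSlit
      (fun x hx => (hd x hx).differentiableAt.differentiableWithinAt)
      (fun x hx => (hd x hx).deriv) ht (Or.inr ?_)
    simpa using hε
  have hcast : Filter.Tendsto (fun ε : ℝ => (ε : ℂ)) (nhdsWithin 0 (Ioi 0)) (nhds 0) := by
    have := Complex.continuous_ofReal.tendsto 0
    rw [Complex.ofReal_zero] at this
    exact this.mono_left nhdsWithin_le_nhds
  have hf := ((hasDerivAt_legF hν zero_mem_slitPlaneOne).continuousAt.tendsto).comp hcast
  have hf₁ := ((hasDerivAt_legF₁ hν zero_mem_slitPlaneOne).continuousAt.tendsto).comp hcast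
  rw [legF_zero hν] at hf
  -- Along ε → 0⁺ the term with ε G(ε) disappears, F(ε) tends to 1, and only ε G'(ε) → c survives.
  have hlim : Filter.Tendsto (fun ε : ℝ => W ε) (nhdsWithin 0 (Ioi 0)) (nhds (legC ν)) := by
    have h := (hcast.const_sub 1).mul ((hf.mul (tendsto_mul_legG₁ hν)).sub
      (hf₁.mul (tendsto_mul_legG hν)))
    simp only [sub_zero, one_mul, mul_zero] at h
    refine h.congr fun ε => ?_
    simp only [hW, Function.comp]
    ring
  have hlim2 : Filter.Tendsto (fun ε : ℝ => W ε) (nhdsWithin 0 (Ioi 0)) (nhds (W t)) := by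
    refine tendsto_const_nhds.congr' ?_
    filter_upwards [Ioo_mem_nhdsGT (zero_lt_one' ℝ)] with ε hε using hconst ε hε
  exact tendsto_nhds_unique hlim2 hlim

/-! ### The logarithmic singularity -/

theorem isPreconnected_ball_inter_slitPlane {ρ : ℝ} (hρ : 0 < ρ) :
    IsPreconnected (Metric.ball (0 : ℂ) ρ ∩ Complex.slitPlane) := by
  have hmem : ((ρ / 2 : ℝ) : ℂ) ∈ Metric.ball (0 : ℂ) ρ ∩ Complex.slitPlane := by
    refine ⟨?_, Or.inl ?_⟩
    · rw [mem_ball_zero_iff, Complex.norm_real, Real.norm_of_nonneg (by positivity)]; linarith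
    · rw [Complex.ofReal_re]; positivity
  have hs : StarConvex ℝ ((ρ / 2 : ℝ) : ℂ) (Metric.ball (0 : ℂ) ρ ∩ Complex.slitPlane) := by
    refine ((convex_ball (0 : ℂ) ρ).starConvex hmem.1).inter ?_
    intro y hy a b ha hb hab
    rcases hb.eq_or_lt with rfl | hb
    · left; simp at hab ⊢; subst hab; norm_num; linarith
    rcases hy with h | h
    · left; simp; nlinarith [mul_pos hb h, mul_nonneg ha hρ.le]
    · right; simpa using ⟨hb.ne', h⟩
  exact (hs.isPathConnected hmem).isConnected.isPreconnected

/-- By the Wronskian, (G/F)' = c/(t(1-t)F²). Its only singularity near 0 is the simple pole c/t,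
because F(0) = 1; what remains after subtracting the pole has a holomorphic primitive on a disc. -/
theorem exists_legG_eq_log {ν : ℝ} (hν : -1 < ν ∧ ν < 0) :
    ∃ ρ : ℝ, 0 < ρ ∧ ρ ≤ 1 ∧ ∃ E : ℂ → ℂ, DifferentiableOn ℂ E (Metric.ball 0 ρ) ∧
      ∀ t ∈ Metric.ball (0 : ℂ) ρ ∩ Complex.slitPlane,
        legG ν t = legF ν t * (legC ν * Complex.log t + E t) := by
  have hne : ∀ᶠ t in nhds (0 : ℂ), legF ν t ≠ 0 :=
    (hasDerivAt_legF hν zero_mem_slitPlaneOne).continuousAt.eventually_ne (by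
      rw [legF_zero hν]; exact one_ne_zero)
  obtain ⟨ρ', hρ', hb'⟩ := Metric.eventually_nhds_iff_ball.1
    (hne.and (isOpen_slitPlaneOne.mem_nhds zero_mem_slitPlaneOne))
  set ρ := min ρ' 1 with hρdef
  have hρ : 0 < ρ := lt_min hρ' one_pos
  have hρ1 : ρ ≤ 1 := min_le_right _ _
  have hb : ∀ t ∈ Metric.ball (0 : ℂ) ρ, legF ν t ≠ 0 ∧ t ∈ slitPlaneOne := fun t ht =>
    hb' t (Metric.ball_subset_ball (min_le_left _ _) ht)
  have hone : ∀ t ∈ Metric.ball (0 : ℂ) ρ, (1 : ℂ) - t ≠ 0 := by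
    intro t ht h
    have : t = 1 := (sub_eq_zero.1 h).symm
    rw [mem_ball_zero_iff, this] at ht
    simp at ht; linarith
  set φ : ℂ → ℂ := fun t => legC ν / ((1 - t) * legF ν t ^ 2) with hφ
  have hφd : DifferentiableOn ℂ φ (Metric.ball 0 ρ) := by
    intro t ht
    refine (DifferentiableAt.div (differentiableAt_const _) ?_ ?_).differentiableWithinAt
    · exact ((differentiableAt_const _).sub differentiableAt_id).mul
        ((hasDerivAt_legF hν (hb t ht).2).differentiableAt.pow 2)
    · exact mul_ne_zero (hone t ht) (pow_ne_zero _ (hb t ht).1)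
  have hφ0 : φ 0 = legC ν := by simp [hφ, legF_zero hν]
  -- Since φ(0) = c, the divided difference of φ = t (G/F)' at 0 is (G/F)' - c/t, with the
  -- singularity at 0 removed.
  have hds : DifferentiableOn ℂ (dslope φ 0) (Metric.ball 0 ρ) :=
    (Complex.differentiableOn_dslope (Metric.ball_mem_nhds _ hρ)).2 hφd
  obtain ⟨E₀, hE₀⟩ := hds.isExactOn_ball
  set S := Metric.ball (0 : ℂ) ρ ∩ Complex.slitPlane with hS
  have hSo : IsOpen S := Metric.isOpen_ball.inter Complex.isOpen_slitPlane
  have hSD : ∀ t ∈ S, t ∈ doubleSlit := by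
    rintro t ⟨h1, h2⟩
    rcases h2 with h2 | h2
    · right
      refine ⟨h2, ?_⟩
      rw [mem_ball_zero_iff] at h1
      linarith [Complex.re_le_norm t]
    · left; exact h2
  have hder : ∀ t ∈ S, HasDerivAt
      (fun t => legG ν t / legF ν t - (legC ν * Complex.log t + E₀ t)) 0 t := by
    intro t ht
    have hF := (hb t ht.1).1
    have ht0 : t ≠ 0 := Complex.slitPlane_ne_zero ht.2
    refine ((((hasDerivAt_legG hν ht.2).div (hasDerivAt_legF hν (hb t ht.1).2) hF)).sub
      (((Complex.hasDerivAt_log ht.2).const_mul _).add (hE₀ t ht.1))).congr_deriv ?_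
    rw [dslope_of_ne _ ht0, slope_def_field, hφ0]
    have h1 := hone t ht.1
    have hw := legF_wronskian hν (hSD t ht)
    simp only [hφ]
    field_simp
    linear_combination t * hw
  obtain ⟨a, ha⟩ := hSo.exists_is_const_of_deriv_eq_zero (isPreconnected_ball_inter_slitPlane hρ)
    (fun t ht => (hder t ht).differentiableAt.differentiableWithinAt)
    (fun t ht => (hder t ht).deriv)
  refine ⟨ρ, hρ, hρ1, fun t => E₀ t + a, ?_, fun t ht => ?_⟩
  · exact fun t ht => ((hE₀ t ht).add_const a).differentiableAt.differentiableWithinAt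
  · have h := ha t ht
    have hF := (hb t ht.1).1
    rw [sub_eq_iff_eq_add, div_eq_iff hF] at h
    rw [h]; ring

theorem norm_log_le {t : ℂ} (ht : t ≠ 0) (h1 : ‖t‖ ≤ 1) :
    ‖Complex.log t‖ ≤ (2 + Real.pi) * ‖t‖ ^ (-(1 / 2) : ℝ) := by
  have h0 : 0 < ‖t‖ := norm_pos_iff.2 ht
  have h2 := Real.abs_log_mul_self_rpow_lt ‖t‖ (1 / 2) h0 h1 (by norm_num)
  rw [abs_mul, abs_of_pos (Real.rpow_pos_of_pos h0 _)] at h2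
  have h3 : |Real.log ‖t‖| ≤ 2 * ‖t‖ ^ (-(1 / 2) : ℝ) := by
    rw [Real.rpow_neg h0.le, ← div_eq_mul_inv, le_div_iff₀ (Real.rpow_pos_of_pos h0 _)]
    linarith
  have h4 : 1 ≤ ‖t‖ ^ (-(1 / 2) : ℝ) :=
    Real.one_le_rpow_of_pos_of_le_one_of_nonpos h0 h1 (by norm_num)
  calc ‖Complex.log t‖ ≤ |(Complex.log t).re| + |(Complex.log t).im| :=
        Complex.norm_le_abs_re_add_abs_im _
    _ ≤ 2 * ‖t‖ ^ (-(1 / 2) : ℝ) + Real.pi * ‖t‖ ^ (-(1 / 2) : ℝ) := by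
        rw [Complex.log_re, Complex.log_im]
        refine add_le_add h3 ?_
        calc |Complex.arg t| ≤ Real.pi * 1 := by rw [mul_one]; exact Complex.abs_arg_le_pi t
          _ ≤ _ := by gcongr
    _ = _ := by ring

/-- Since φ - 1 = O(t) and log t = O(|t|^(-1/2)), freezing φ and ψ at 0 costs O(|t|^(1/2)). Applied
with φ = F and φ = F², this treats G and FG at once. -/
theorem exists_norm_mul_log_add_sub_le {φ ψ : ℂ → ℂ} (c : ℂ) (hφ : DifferentiableAt ℂ φ 0)
    (hψ : DifferentiableAt ℂ ψ 0) (hφ0 : φ 0 = 1) :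
    ∃ ρ > 0, ∃ C : ℝ, 0 ≤ C ∧ ∀ t : ℂ, t ≠ 0 → ‖t‖ < ρ →
      ‖φ t * (c * Complex.log t) + ψ t - (c * Complex.log t + ψ 0)‖ ≤ C * ‖t‖ ^ (1 / 2 : ℝ) := by
  obtain ⟨A, hA0, hA⟩ := hφ.hasDerivAt.isBigO_sub.exists_pos
  obtain ⟨B, hB0, hB⟩ := hψ.hasDerivAt.isBigO_sub.exists_pos
  obtain ⟨ρ, hρ, hb⟩ := Metric.eventually_nhds_iff_ball.1 (hA.bound.and hB.bound)
  refine ⟨min ρ 1, lt_min hρ one_pos, A * ‖c‖ * (2 + Real.pi) + B, by positivity,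
    fun t ht0 ht => ?_⟩
  have ht1 : ‖t‖ ≤ 1 := (ht.trans_le (min_le_right _ _)).le
  have h0 : 0 < ‖t‖ := norm_pos_iff.2 ht0
  obtain ⟨h1, h2⟩ := hb t (mem_ball_zero_iff.2 (ht.trans_le (min_le_left _ _)))
  rw [hφ0, sub_zero] at h1
  rw [sub_zero] at h2
  have h3 : ‖t‖ ≤ ‖t‖ ^ (1 / 2 : ℝ) := by
    calc ‖t‖ = ‖t‖ ^ (1 : ℝ) := (Real.rpow_one _).symm
      _ ≤ _ := Real.rpow_le_rpow_of_exponent_ge h0 ht1 (by norm_num)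
  have h4 : ‖t‖ * ‖t‖ ^ (-(1 / 2) : ℝ) = ‖t‖ ^ (1 / 2 : ℝ) := by
    rw [mul_comm, ← Real.rpow_add_one h0.ne']; norm_num
  calc _ = ‖(φ t - 1) * (c * Complex.log t) + (ψ t - ψ 0)‖ := by congr 1; ring
    _ ≤ (A * ‖t‖) * (‖c‖ * ((2 + Real.pi) * ‖t‖ ^ (-(1 / 2) : ℝ))) + B * ‖t‖ := by
        refine (norm_add_le _ _).trans (add_le_add ?_ h2)
        rw [norm_mul, norm_mul]
        gcongr
        exact norm_log_le ht0 ht1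
    _ = A * ‖c‖ * (2 + Real.pi) * (‖t‖ * ‖t‖ ^ (-(1 / 2) : ℝ)) + B * ‖t‖ := by ring
    _ ≤ A * ‖c‖ * (2 + Real.pi) * ‖t‖ ^ (1 / 2 : ℝ) + B * ‖t‖ ^ (1 / 2 : ℝ) := by
        rw [h4]; gcongr
    _ = _ := by ring

/-- The behaviour of `P_ν(1 - 2t)` and `P_ν(2t - 1)` near `t = 0`. -/
theorem exists_log_approx {ν : ℝ} (hν : -1 < ν ∧ ν < 0) :
    ∃ (d : ℂ) (ρ C : ℝ), 0 < ρ ∧ ρ ≤ 1 ∧ 0 ≤ C ∧ ∀ t ∈ Complex.slitPlane, ‖t‖ < ρ →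
      t ∈ doubleSlit ∧
      ‖legG ν t - (legC ν * Complex.log t + d)‖ ≤ C * ‖t‖ ^ (1 / 2 : ℝ) ∧
      ‖legF ν t * legG ν t - (legC ν * Complex.log t + d)‖ ≤ C * ‖t‖ ^ (1 / 2 : ℝ) ∧
      ‖legF ν t‖ ≤ C ∧ ‖legF ν t - 1‖ ≤ C * ‖t‖ ∧ ‖legG ν t‖ ≤ C * ‖t‖ ^ (-(1 / 2) : ℝ) := by
  obtain ⟨ρ₀, hρ₀, hρ₀1, E, hE, hG⟩ := exists_legG_eq_log hν
  have hE0 : DifferentiableAt ℂ E 0 :=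
    hE.differentiableAt (Metric.ball_mem_nhds _ hρ₀)
  have hF0 := (hasDerivAt_legF hν zero_mem_slitPlaneOne).differentiableAt
  have hF1 := legF_zero hν
  obtain ⟨ρ₁, hρ₁, C₁, hC₁, h₁⟩ := exists_norm_mul_log_add_sub_le (φ := legF ν)
    (ψ := fun t => legF ν t * E t) (legC ν) hF0 (hF0.mul hE0) hF1
  obtain ⟨ρ₂, hρ₂, C₂, hC₂, h₂⟩ := exists_norm_mul_log_add_sub_le (φ := fun t => legF ν t ^ 2)
    (ψ := fun t => legF ν t ^ 2 * E t) (legC ν) (hF0.pow 2) ((hF0.pow 2).mul hE0) (by simp [hF1])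
  obtain ⟨A, hA0, hA⟩ := hF0.hasDerivAt.isBigO_sub.exists_pos
  obtain ⟨ρ₃, hρ₃, h₃⟩ := Metric.eventually_nhds_iff_ball.1 hA.bound
  simp only [hF1, one_mul, one_pow, sub_zero] at h₁ h₂ h₃
  set ρ := min (min ρ₀ ρ₁) (min ρ₂ ρ₃) with hρ
  have hlt (t : ℂ) (ht : ‖t‖ < ρ) : ‖t‖ < ρ₀ ∧ ‖t‖ < ρ₁ ∧ ‖t‖ < ρ₂ ∧ ‖t‖ < ρ₃ := by
    simp only [hρ, lt_min_iff] at ht; tauto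
  refine ⟨E 0, ρ, C₁ + C₂ + (A + 1) + (C₁ + |legC ν| * (2 + Real.pi) + ‖E 0‖), by positivity,
    (min_le_left _ _).trans ((min_le_left _ _).trans hρ₀1), by positivity, fun t ht htρ => ?_⟩
  obtain ⟨hl0, hl1, hl2, hl3⟩ := hlt t htρ
  have ht0 := Complex.slitPlane_ne_zero ht
  have h0 : 0 < ‖t‖ := norm_pos_iff.2 ht0
  have ht1 : ‖t‖ ≤ 1 := (hl0.trans_le hρ₀1).le
  have hpos : 0 < ‖t‖ ^ (1 / 2 : ℝ) := Real.rpow_pos_of_pos h0 _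
  have hpos2 : 1 ≤ ‖t‖ ^ (-(1 / 2) : ℝ) :=
    Real.one_le_rpow_of_pos_of_le_one_of_nonpos h0 ht1 (by norm_num)
  have hle1 : ‖t‖ ^ (1 / 2 : ℝ) ≤ 1 := Real.rpow_le_one h0.le ht1 (by norm_num)
  have hg := hG t ⟨mem_ball_zero_iff.2 hl0, ht⟩
  have hc0 : 0 ≤ |legC ν| * (2 + Real.pi) := by positivity
  have hnE := norm_nonneg (E 0)
  have k1 : ‖legG ν t - (legC ν * Complex.log t + E 0)‖ ≤ C₁ * ‖t‖ ^ (1 / 2 : ℝ) := by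
    convert h₁ t ht0 hl1 using 2
    rw [hg]; ring
  have k2 : ‖legF ν t * legG ν t - (legC ν * Complex.log t + E 0)‖ ≤ C₂ * ‖t‖ ^ (1 / 2 : ℝ) := by
    convert h₂ t ht0 hl2 using 2
    rw [hg]; ring
  have k3 := h₃ t (mem_ball_zero_iff.2 hl3)
  refine ⟨?_, ?_, ?_, ?_, ?_, ?_⟩
  · rcases ht with h | h
    · right; exact ⟨h, by linarith [Complex.re_le_norm t]⟩
    · left; exact h
  · refine k1.trans ?_; gcongr; linarith
  · refine k2.trans ?_; gcongr; linarith
  · have : ‖legF ν t‖ ≤ A * 1 + 1 := by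
      calc ‖legF ν t‖ = ‖(legF ν t - 1) + 1‖ := by congr 1; ring
        _ ≤ A * ‖t‖ + 1 := (norm_add_le _ _).trans (add_le_add k3 (by simp))
        _ ≤ A * 1 + 1 := by gcongr
    linarith
  · refine k3.trans ?_; gcongr; linarith
  · calc ‖legG ν t‖ = ‖(legG ν t - (legC ν * Complex.log t + E 0)) +
          (legC ν * Complex.log t + E 0)‖ := by congr 1; ring
      _ ≤ C₁ * 1 + (|legC ν| * ((2 + Real.pi) * ‖t‖ ^ (-(1 / 2) : ℝ)) + ‖E 0‖) := by
          refine (norm_add_le _ _).trans (add_le_add (k1.trans (by gcongr)) ?_)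
          refine (norm_add_le _ _).trans (add_le_add ?_ le_rfl)
          rw [norm_mul, Complex.norm_real, Real.norm_eq_abs]
          gcongr
          exact norm_log_le ht0 ht1
      _ ≤ C₁ * ‖t‖ ^ (-(1 / 2) : ℝ) + (|legC ν| * ((2 + Real.pi) * ‖t‖ ^ (-(1 / 2) : ℝ)) +
          ‖E 0‖ * ‖t‖ ^ (-(1 / 2) : ℝ)) := by
          gcongr
          exact le_mul_of_one_le_right hnE hpos2
      _ = (C₁ + |legC ν| * (2 + Real.pi) + ‖E 0‖) * ‖t‖ ^ (-(1 / 2) : ℝ) := by ring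
      _ ≤ _ := mul_le_mul_of_nonneg_right (by linarith) (by positivity)

/-! ### Holomorphic dependence of integrals on a parameter -/

/-- For holomorphic integrands Cauchy's estimate converts domination of F into domination of its
derivative, so no separate bound on the derivative is required. -/
theorem hasDerivAt_integral_of_differentiableOn_of_bound {X : Type*} [MeasurableSpace X]
    {μ : Measure X} {F : ℂ → X → ℂ} {bound : X → ℝ} {z₀ : ℂ} {r : ℝ} (hr : 0 < r)
    (hmeas : ∀ z ∈ Metric.ball z₀ r, AEStronglyMeasurable (F z) μ)
    (hd : ∀ᵐ x ∂μ, DifferentiableOn ℂ (fun z => F z x) (Metric.ball z₀ r))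
    (hb : ∀ᵐ x ∂μ, ∀ z ∈ Metric.ball z₀ r, ‖F z x‖ ≤ bound x) (hint : Integrable bound μ) :
    HasDerivAt (fun z => ∫ x, F z x ∂μ) (∫ x, deriv (fun z => F z x) z₀ ∂μ) z₀ := by
  have hz₀ : z₀ ∈ Metric.ball z₀ r := Metric.mem_ball_self hr
  have hsub : ∀ z ∈ Metric.ball z₀ (r / 2), Metric.closedBall z (r / 4) ⊆ Metric.ball z₀ r := by
    intro z hz w hw
    rw [Metric.mem_ball] at hz ⊢
    rw [Metric.mem_closedBall] at hw
    linarith [dist_triangle w z z₀]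
  have hda : ∀ᵐ x ∂μ, ∀ z ∈ Metric.ball z₀ r, DifferentiableAt ℂ (fun z => F z x) z := by
    filter_upwards [hd] with x hx z hz
    exact hx.differentiableAt (Metric.isOpen_ball.mem_nhds hz)
  refine (hasDerivAt_integral_of_dominated_loc_of_deriv_le (𝕜 := ℂ)
    (F' := fun z x => deriv (fun z => F z x) z) (bound := fun x => bound x / (r / 4))
    (Metric.ball_mem_nhds z₀ (half_pos hr)) ?_ ?_ ?_ ?_ ?_ ?_).2
  · filter_upwards [Metric.ball_mem_nhds z₀ hr] with z hz using hmeas z hz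
  · exact hint.mono' (hmeas z₀ hz₀) (hb.mono fun x hx => hx z₀ hz₀)
  -- Measurability of the derivative in x: it is a limit of difference quotients along z₀ + r/(n+2).
  -- The shift by 2 keeps every point, n = 0 included, inside the open ball.
  · have hmem : ∀ n : ℕ, z₀ + ((r / (n + 2) : ℝ) : ℂ) ∈ Metric.ball z₀ r := by
      intro n
      rw [Metric.mem_ball, dist_eq_norm, add_sub_cancel_left, Complex.norm_real,
        Real.norm_of_nonneg (by positivity)]
      rw [div_lt_iff₀ (by positivity)]
      nlinarith [(Nat.cast_nonneg n : (0 : ℝ) ≤ n)]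
    refine aestronglyMeasurable_of_tendsto_ae Filter.atTop
      (f := fun (n : ℕ) x => slope (fun z => F z x) z₀ (z₀ + ((r / (n + 2) : ℝ) : ℂ))) ?_ ?_
    · intro n
      simp only [slope_def_field]
      simp only [div_eq_mul_inv]
      exact AEStronglyMeasurable.mul_const ((hmeas _ (hmem n)).sub (hmeas _ hz₀)) _
    · filter_upwards [hda] with x hx
      have h1 := (hasDerivAt_iff_tendsto_slope.1 (hx z₀ hz₀).hasDerivAt)
      refine h1.comp ?_
      rw [tendsto_nhdsWithin_iff]
      constructor
      · have h2 : Filter.Tendsto (fun n : ℕ => r / ((n : ℝ) + 2)) Filter.atTop (nhds 0) := by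
          refine Filter.Tendsto.const_div_atTop ?_ r
          exact Filter.tendsto_atTop_add_const_right _ _ tendsto_natCast_atTop_atTop
        have h3 := (Complex.continuous_ofReal.tendsto 0).comp h2
        simpa using h3.const_add z₀
      · refine Filter.Eventually.of_forall fun n h => ?_
        have h4 : ((r / (n + 2) : ℝ) : ℂ) = 0 := by simpa using h
        have : r / ((n : ℝ) + 2) ≠ 0 := by positivity
        exact this (by exact_mod_cast h4)
  · filter_upwards [hd, hb] with x hx hx' z hz
    refine Complex.norm_deriv_le_of_forall_mem_sphere_norm_le (by positivity)
      (hx.diffContOnCl_ball (hsub z hz)) fun w hw => ?_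
    exact hx' w (hsub z hz (Metric.sphere_subset_closedBall hw))
  · exact hint.div_const _
  · filter_upwards [hda] with x hx z hz
    exact (hx z (Metric.ball_subset_ball (by linarith) hz)).hasDerivAt

/-! ### Primitives on domains that are star-shaped at the origin -/

/-- `h` is a holomorphic function on an open set `U`, star-shaped with respect to `0`, with at most
a mild singularity at `0`. -/
structure IsMildAtZero (U : Set ℂ) (h : ℂ → ℂ) : Prop where
  isOpen : IsOpen U
  smul_mem : ∀ z ∈ U, ∀ s ∈ Ioc (0 : ℝ) 1, (s : ℂ) * z ∈ U
  differentiableOn : DifferentiableOn ℂ h U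
  bound : ∃ ρ > 0, ∃ C : ℝ, ∀ z ∈ U, z ≠ 0 → ‖z‖ < ρ → ‖h z‖ ≤ C * ‖z‖ ^ (-(1 / 2) : ℝ)

/-- The integral of `h` along the segment from `0` to `z`. -/
noncomputable def radialPrimitive (h : ℂ → ℂ) (z : ℂ) : ℂ :=
  ∫ s in Ioo (0 : ℝ) 1, z * h (s * z)

theorem integrableOn_rpow_neg_half :
    IntegrableOn (fun s : ℝ => s ^ (-(1 / 2) : ℝ)) (Ioo 0 1) := by
  simpa using integrableOn_rpow_mul_rpow (a := -(1 / 2)) (b := 0) (by norm_num) (by norm_num)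

theorem norm_mul_le_of_bound {h : ℂ → ℂ} {C s : ℝ} {z : ℂ} (hs : 0 < s) (hz : z ≠ 0)
    (hb : ‖h (s * z)‖ ≤ C * ‖(s : ℂ) * z‖ ^ (-(1 / 2) : ℝ)) :
    ‖z * h (s * z)‖ ≤ C * ‖z‖ ^ (1 / 2 : ℝ) * s ^ (-(1 / 2) : ℝ) := by
  have hz' : 0 < ‖z‖ := norm_pos_iff.2 hz
  rw [norm_mul]
  calc ‖z‖ * ‖h (s * z)‖ ≤ ‖z‖ * (C * ‖(s : ℂ) * z‖ ^ (-(1 / 2) : ℝ)) := by gcongr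
    _ = C * (‖z‖ ^ (-(1 / 2) : ℝ) * ‖z‖) * s ^ (-(1 / 2) : ℝ) := by
        rw [norm_mul, Complex.norm_real, Real.norm_of_nonneg hs.le,
          Real.mul_rpow hs.le hz'.le]
        ring
    _ = _ := by rw [← Real.rpow_add_one hz'.ne']; norm_num

namespace IsMildAtZero

variable {U : Set ℂ} {h : ℂ → ℂ}

theorem continuousOn_radial (hU : IsMildAtZero U h) {z : ℂ} (hz : z ∈ U) :
    ContinuousOn (fun s : ℝ => h (s * z)) (Ioc 0 1) :=
  hU.differentiableOn.continuousOn.comp (by fun_prop) fun s hs => hU.smul_mem z hz s hs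

theorem exists_radial_bound (hU : IsMildAtZero U h) {z₀ : ℂ} (hz₀ : z₀ ∈ U) :
    ∃ r > 0, ∃ M : ℝ, Metric.ball z₀ r ⊆ U ∧ ∀ z ∈ Metric.ball z₀ r, ∀ s ∈ Ioo (0 : ℝ) 1,
      ‖z * h (s * z)‖ ≤ M * s ^ (-(1 / 2) : ℝ) := by
  obtain ⟨ρ, hρ, C, hC⟩ := hU.bound
  obtain ⟨r, hr, hrU⟩ := Metric.nhds_basis_closedBall.mem_iff.1 (hU.isOpen.mem_nhds hz₀)
  set R := ‖z₀‖ + r with hR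
  have hRpos : 0 < R := by positivity
  have hzR : ∀ z ∈ Metric.closedBall z₀ r, ‖z‖ ≤ R := by
    intro z hz
    rw [mem_closedBall_iff_norm] at hz
    calc ‖z‖ = ‖z₀ + (z - z₀)‖ := by congr 1; ring
      _ ≤ R := (norm_add_le _ _).trans (by rw [hR]; gcongr)
  set s₁ := min (ρ / (R + 1)) 1 with hs₁
  have hs₁pos : 0 < s₁ := by positivity
  have hK : IsCompact (Icc s₁ 1 ×ˢ Metric.closedBall z₀ r) :=
    isCompact_Icc.prod (isCompact_closedBall _ _)
  have hc : ContinuousOn (fun p : ℝ × ℂ => p.2 * h (p.1 * p.2))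
      (Icc s₁ 1 ×ˢ Metric.closedBall z₀ r) := by
    refine ContinuousOn.mul (by fun_prop) (hU.differentiableOn.continuousOn.comp (by fun_prop) ?_)
    rintro ⟨s, z⟩ ⟨h1, h2⟩
    exact hU.smul_mem z (hrU h2) s ⟨hs₁pos.trans_le h1.1, h1.2⟩
  obtain ⟨M, hM⟩ := hK.exists_bound_of_continuousOn hc
  refine ⟨r, hr, max M (max C 0 * R ^ (1 / 2 : ℝ)), Metric.ball_subset_closedBall.trans hrU,
    fun z hz s hs => ?_⟩
  have hzc := Metric.ball_subset_closedBall hz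
  have hspos : 0 < s ^ (-(1 / 2) : ℝ) := Real.rpow_pos_of_pos hs.1 _
  have hs1 : 1 ≤ s ^ (-(1 / 2) : ℝ) :=
    Real.one_le_rpow_of_pos_of_le_one_of_nonpos hs.1 hs.2.le (by norm_num)
  rcases le_or_gt s₁ s with hle | hlt
  · have h1 := hM (s, z) ⟨⟨hle, hs.2.le⟩, hzc⟩
    have hM0 : 0 ≤ M := (norm_nonneg _).trans h1
    calc _ ≤ M * 1 := by simpa using h1
      _ ≤ max M (max C 0 * R ^ (1 / 2 : ℝ)) * s ^ (-(1 / 2) : ℝ) := by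
        gcongr; exact le_max_left _ _
  · rcases eq_or_ne z 0 with rfl | hz0
    · simp only [zero_mul, norm_zero]; positivity
    have hlt' : ‖(s : ℂ) * z‖ < ρ := by
      rw [norm_mul, Complex.norm_real, Real.norm_of_nonneg hs.1.le]
      have h2 : s < ρ / (R + 1) := hlt.trans_le (min_le_left _ _)
      rw [lt_div_iff₀ (by positivity)] at h2
      nlinarith [hzR z hzc, hs.1]
    have h1 := norm_mul_le_of_bound hs.1 hz0
      (hC _ (hU.smul_mem z (hrU hzc) s ⟨hs.1, hs.2.le⟩)
        (mul_ne_zero (by exact_mod_cast hs.1.ne') hz0) hlt')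
    refine h1.trans ?_
    gcongr
    refine le_trans ?_ (le_max_right _ _)
    gcongr
    · exact le_max_left _ _
    · exact hzR z hzc

/-- Differentiating under the integral gives ∂_z (z h(sz)) = h(sz) + sz h'(sz) = ∂_s (s h(sz)). The
fundamental theorem in s then returns h(z₀), because s h(s z₀) → 0 as s → 0. -/
theorem hasDerivAt_radialPrimitive (hU : IsMildAtZero U h) {z₀ : ℂ} (hz₀ : z₀ ∈ U) :
    HasDerivAt (radialPrimitive h) (h z₀) z₀ := by
  obtain ⟨r, hr, M, hrU, hM⟩ := hU.exists_radial_bound hz₀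
  have hdz : ∀ s ∈ Ioc (0 : ℝ) 1, ∀ z ∈ U, HasDerivAt (fun z : ℂ => z * h (s * z))
      (h (s * z) + z * (deriv h (s * z) * s)) z := by
    intro s hs z hz
    have h1 := (hU.differentiableOn.differentiableAt (hU.isOpen.mem_nhds
      (hU.smul_mem z hz s hs))).hasDerivAt
    have h2 : HasDerivAt (fun z : ℂ => (s : ℂ) * z) s z := by
      simpa using (hasDerivAt_id z).const_mul (s : ℂ)
    exact ((hasDerivAt_id z).mul (HasDerivAt.comp z h1 h2)).congr_deriv (by simp)
  have key := hasDerivAt_integral_of_differentiableOn_of_bound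
    (μ := volume.restrict (Ioo (0 : ℝ) 1)) (F := fun z s => z * h (s * z)) (z₀ := z₀)
    (bound := fun s => M * s ^ (-(1 / 2) : ℝ)) hr ?_ ?_ ?_ ?_
  · refine key.congr_deriv ?_
    set Φ : ℝ → ℂ := fun s => s * h (s * z₀) with hΦ
    set Φ' : ℝ → ℂ := fun s => h (s * z₀) + z₀ * (deriv h (s * z₀) * s) with hΦ'
    have hcongr : ∫ s in Ioo (0 : ℝ) 1, deriv (fun z => z * h (s * z)) z₀ =
        ∫ s in Ioo (0 : ℝ) 1, Φ' s :=
      setIntegral_congr_fun measurableSet_Ioo fun s hs => (hdz s (Ioo_subset_Ioc_self hs) z₀ hz₀).deriv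
    rw [hcongr]
    have hd : ∀ s ∈ Ioo (0 : ℝ) 1, HasDerivAt Φ (Φ' s) s := by
      intro s hs
      have h1 := (hU.differentiableOn.differentiableAt (hU.isOpen.mem_nhds
        (hU.smul_mem z₀ hz₀ s (Ioo_subset_Ioc_self hs)))).hasDerivAt
      have h2 : HasDerivAt (fun s : ℝ => (s : ℂ) * z₀) z₀ s := by
        simpa using (Complex.ofRealCLM.hasDerivAt (x := s)).mul_const z₀
      have h3 : HasDerivAt (fun s : ℝ => (s : ℂ)) 1 s := Complex.ofRealCLM.hasDerivAt
      exact (h3.mul (HasDerivAt.comp (h₂ := h) s h1 h2)).congr_deriv (by simp [hΦ']; ring)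
    obtain ⟨ρ, hρ, C, hC⟩ := hU.bound
    have hcont : ContinuousOn Φ (Icc 0 1) := by
      intro s hs
      rcases hs.1.eq_or_lt with h0 | h0
      · subst h0
        have hΦ0 : Φ 0 = 0 := by simp [hΦ]
        rcases eq_or_ne z₀ 0 with rfl | hz0
        · simp only [hΦ, mul_zero]; fun_prop
        have hz0' : 0 < ‖z₀‖ := norm_pos_iff.2 hz0
        have hlim : Filter.Tendsto (fun s : ℝ => C * ‖z₀‖ ^ (-(1 / 2) : ℝ) * s ^ (1 / 2 : ℝ))
            (nhdsWithin 0 (Icc 0 1)) (nhds 0) := by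
          have hcc : Continuous fun s : ℝ => C * ‖z₀‖ ^ (-(1 / 2) : ℝ) * s ^ (1 / 2 : ℝ) :=
            continuous_const.mul (Real.continuous_rpow_const (by norm_num))
          have := hcc.tendsto 0
          simp only [Real.zero_rpow (show (1 / 2 : ℝ) ≠ 0 by norm_num), mul_zero] at this
          exact this.mono_left nhdsWithin_le_nhds
        rw [ContinuousWithinAt, hΦ0]
        refine squeeze_zero_norm' ?_ hlim
        have hsm : ∀ᶠ s : ℝ in nhdsWithin 0 (Icc 0 1), ‖(s : ℂ) * z₀‖ < ρ := by
          refine nhdsWithin_le_nhds ?_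
          have hc0 : Continuous fun s : ℝ => ‖(s : ℂ) * z₀‖ := by fun_prop
          exact hc0.tendsto' 0 0 (by simp) |>.eventually_lt_const hρ
        filter_upwards [hsm, self_mem_nhdsWithin] with s hs1 hs2
        rcases hs2.1.eq_or_lt with h0 | h0
        · simp [hΦ, ← h0]
        · have h1 := hC _ (hU.smul_mem z₀ hz₀ s ⟨h0, hs2.2⟩)
            (mul_ne_zero (by exact_mod_cast h0.ne') hz0) hs1
          rw [hΦ, norm_mul, Complex.norm_real, Real.norm_of_nonneg h0.le]
          calc s * ‖h (s * z₀)‖ ≤ s * (C * ‖(s : ℂ) * z₀‖ ^ (-(1 / 2) : ℝ)) := by gcongr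
            _ = C * ‖z₀‖ ^ (-(1 / 2) : ℝ) * (s ^ (-(1 / 2) : ℝ) * s) := by
                rw [norm_mul, Complex.norm_real, Real.norm_of_nonneg h0.le,
                  Real.mul_rpow h0.le hz0'.le]
                ring
            _ = _ := by rw [← Real.rpow_add_one h0.ne']; norm_num
      · have h1 : ContinuousAt (fun s : ℝ => h (s * z₀)) s := by
          have := (hU.differentiableOn.differentiableAt (hU.isOpen.mem_nhds
            (hU.smul_mem z₀ hz₀ s ⟨h0, hs.2⟩))).continuousAt
          exact ContinuousAt.comp (f := fun s : ℝ => (s : ℂ) * z₀) this (by fun_prop)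
        exact (ContinuousAt.mul (by fun_prop) h1).continuousWithinAt
    have hint : IntervalIntegrable Φ' volume 0 1 := by
      rw [intervalIntegrable_iff_integrableOn_Ioo_of_le zero_le_one]
      -- Integrability of the derivative again comes from Cauchy's estimate, on a circle of radius
      -- r/2.
      have hdb : ∀ s ∈ Ioo (0 : ℝ) 1, ‖Φ' s‖ ≤ M * s ^ (-(1 / 2) : ℝ) / (r / 2) := by
        intro s hs
        change ‖h (s * z₀) + z₀ * (deriv h (s * z₀) * s)‖ ≤ _
        rw [← (hdz s (Ioo_subset_Ioc_self hs) z₀ hz₀).deriv]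
        have hsub : Metric.closedBall z₀ (r / 2) ⊆ Metric.ball z₀ r :=
          Metric.closedBall_subset_ball (by linarith)
        refine Complex.norm_deriv_le_of_forall_mem_sphere_norm_le (by positivity)
          (DifferentiableOn.diffContOnCl_ball (U := Metric.ball z₀ r) (fun z hz =>
            (hdz s (Ioo_subset_Ioc_self hs) z (hrU hz)).differentiableAt.differentiableWithinAt) hsub)
          fun w hw => hM w (hsub (Metric.sphere_subset_closedBall hw)) s hs
      refine Integrable.mono' ((integrableOn_rpow_neg_half.const_mul M).div_const (r / 2)) ?_
        ((ae_restrict_iff' measurableSet_Ioo).2 (Filter.Eventually.of_forall hdb))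
      refine ContinuousOn.aestronglyMeasurable ?_ measurableSet_Ioo
      have hd' : ContinuousOn (deriv h) U :=
        (hU.differentiableOn.deriv hU.isOpen).continuousOn
      refine ((hU.continuousOn_radial hz₀).mono Ioo_subset_Ioc_self).add
        (continuousOn_const.mul (ContinuousOn.mul ?_ (by fun_prop)))
      exact hd'.comp (by fun_prop) fun s hs => hU.smul_mem z₀ hz₀ s (Ioo_subset_Ioc_self hs)
    have hftc := intervalIntegral.integral_eq_sub_of_hasDerivAt_of_le zero_le_one hcont hd hint
    rw [intervalIntegral.integral_of_le zero_le_one, integral_Ioc_eq_integral_Ioo] at hftc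
    rw [hftc]
    simp [hΦ]
  · intro z hz
    exact (continuousOn_const.mul ((hU.continuousOn_radial (hrU hz)).mono
      Ioo_subset_Ioc_self)).aestronglyMeasurable measurableSet_Ioo
  · refine (ae_restrict_iff' measurableSet_Ioo).2 (Filter.Eventually.of_forall fun s hs z hz => ?_)
    exact (hdz s (Ioo_subset_Ioc_self hs) z (hrU hz)).differentiableAt.differentiableWithinAt
  · exact (ae_restrict_iff' measurableSet_Ioo).2
      (Filter.Eventually.of_forall fun s hs z hz => hM z hz s hs)
  · exact integrableOn_rpow_neg_half.const_mul M

/-- Paths start at 0, which need not belong to U; continuity there lets the fundamental theorem run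
along the whole path. -/
theorem continuousWithinAt_radialPrimitive (hU : IsMildAtZero U h) :
    ContinuousWithinAt (radialPrimitive h) (insert 0 U) 0 := by
  obtain ⟨ρ, hρ, C, hC⟩ := hU.bound
  have h0 : radialPrimitive h 0 = 0 := by simp [radialPrimitive]
  rw [ContinuousWithinAt, h0]
  set I := ∫ s in Ioo (0 : ℝ) 1, s ^ (-(1 / 2) : ℝ)
  have hlim : Filter.Tendsto (fun z : ℂ => C * ‖z‖ ^ (1 / 2 : ℝ) * I)
      (nhdsWithin 0 (insert 0 U)) (nhds 0) := by
    have hcc : Continuous fun z : ℂ => C * ‖z‖ ^ (1 / 2 : ℝ) * I :=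
      (continuous_const.mul (continuous_norm.rpow_const fun _ => Or.inr (by norm_num))).mul
        continuous_const
    exact (hcc.tendsto' 0 0 (by simp)).mono_left nhdsWithin_le_nhds
  refine squeeze_zero_norm' ?_ hlim
  filter_upwards [self_mem_nhdsWithin, nhdsWithin_le_nhds (Metric.ball_mem_nhds (0 : ℂ) hρ)]
    with z hz hzρ
  rcases eq_or_ne z 0 with rfl | hz0
  · simp [h0]
  have hzU : z ∈ U := hz.resolve_left hz0
  rw [mem_ball_zero_iff] at hzρ
  rw [radialPrimitive, ← integral_const_mul]
  refine norm_integral_le_of_norm_le (integrableOn_rpow_neg_half.const_mul _)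
    ((ae_restrict_iff' measurableSet_Ioo).2 (Filter.Eventually.of_forall fun s hs => ?_))
  refine norm_mul_le_of_bound hs.1 hz0 (hC _ (hU.smul_mem z hzU s (Ioo_subset_Ioc_self hs))
    (mul_ne_zero (by exact_mod_cast hs.1.ne') hz0) ?_)
  rw [norm_mul, Complex.norm_real, Real.norm_of_nonneg hs.1.le]
  nlinarith [hs.1, hs.2, norm_nonneg z]

/-- Removing the pole at a keeps the function in the class: the division is harmless away from a,
and a is away from 0. This makes the regular part of h(t)/(t-a) path independent. -/
theorem dslope_mild (hU : IsMildAtZero U h) {a : ℂ} (ha : a ∈ U) (ha0 : a ≠ 0) :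
    IsMildAtZero U (dslope h a) := by
  refine ⟨hU.isOpen, hU.smul_mem,
    (Complex.differentiableOn_dslope (hU.isOpen.mem_nhds ha)).2 hU.differentiableOn, ?_⟩
  obtain ⟨ρ, hρ, C, hC⟩ := hU.bound
  have han : 0 < ‖a‖ := norm_pos_iff.2 ha0
  refine ⟨min ρ (min (‖a‖ / 2) 1), by positivity, (C + ‖h a‖) * (2 / ‖a‖), fun z hz hz0 hzρ => ?_⟩
  simp only [lt_min_iff] at hzρ
  obtain ⟨h1, h2, h3⟩ := hzρ
  have hza : z ≠ a := by rintro rfl; linarith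
  have hzn : 0 < ‖z‖ := norm_pos_iff.2 hz0
  have hza' : ‖a‖ / 2 ≤ ‖z - a‖ := by
    have := norm_sub_norm_le a z
    rw [norm_sub_rev] at this
    linarith
  have hone : 1 ≤ ‖z‖ ^ (-(1 / 2) : ℝ) :=
    Real.one_le_rpow_of_pos_of_le_one_of_nonpos hzn h3.le (by norm_num)
  have hnum : ‖h z - h a‖ ≤ (C + ‖h a‖) * ‖z‖ ^ (-(1 / 2) : ℝ) := by
    rw [add_mul]
    refine (norm_sub_le _ _).trans (add_le_add (hC z hz hz0 h1) ?_)
    exact le_mul_of_one_le_right (norm_nonneg _) hone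
  have hnum0 := (norm_nonneg _).trans hnum
  rw [dslope_of_ne _ hza, slope_def_field, norm_div]
  calc ‖h z - h a‖ / ‖z - a‖ ≤ (C + ‖h a‖) * ‖z‖ ^ (-(1 / 2) : ℝ) / (‖a‖ / 2) := by gcongr
    _ = _ := by field_simp

end IsMildAtZero

/-! ### Logarithms along a path and values of path integrals -/

/-- A continuous logarithm of a differentiable function is differentiable: by continuity L(y) - L(x)
stays within the strip where the principal logarithm inverts exp. The general field 𝕜 covers both a
path parameter and a complex end point. -/
theorem hasDerivAt_of_exp_eq {𝕜 : Type*} [NontriviallyNormedField 𝕜] [NormedAlgebra 𝕜 ℂ]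
    {L g : 𝕜 → ℂ} {g' : ℂ} {x : 𝕜} (hc : ContinuousAt L x)
    (he : ∀ᶠ y in nhds x, Complex.exp (L y) = g y) (hg : HasDerivAt g g' x) :
    HasDerivAt L (g' / g x) x := by
  have hgx : Complex.exp (L x) = g x := he.self_of_nhds
  have hne : g x ≠ 0 := hgx ▸ Complex.exp_ne_zero _
  have h1 : HasDerivAt (fun y => g y / g x) (g' / g x) x := hg.div_const _
  have h2 : HasDerivAt Complex.log (g x / g x)⁻¹ (g x / g x) :=
    Complex.hasDerivAt_log (by rw [div_self hne]; exact Complex.one_mem_slitPlane)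
  have h3 : HasDerivAt (fun y => L x + Complex.log (g y / g x)) (g' / g x) x :=
    ((HasDerivAt.comp (h₂ := Complex.log) x h2 h1).const_add (L x)).congr_deriv
      (by rw [div_self hne]; simp)
  refine h3.congr_of_eventuallyEq ?_
  have him : ∀ᶠ y in nhds x, ‖L y - L x‖ < Real.pi := by
    have : ContinuousAt (fun y => ‖L y - L x‖) x := by fun_prop
    exact this.eventually_lt_const (by simpa using Real.pi_pos)
  filter_upwards [he, him] with y h1 h2
  have h3 := (Complex.abs_im_le_norm (L y - L x)).trans_lt h2
  rw [← h1, ← hgx, ← Complex.exp_sub, Complex.log_exp (abs_lt.1 h3).1 (abs_lt.1 h3).2.le]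
  ring

/-- Lifting of a path through the exponential, obtained from simple connectivity of ℝ after
extending γ by constants beyond [0, 1]. -/
theorem exists_continuousOn_exp_eq {γ : ℝ → ℂ} (hγ : ContinuousOn γ (Icc 0 1))
    (hne : ∀ s ∈ Icc (0 : ℝ) 1, γ s ≠ 0) :
    ∃ L : ℝ → ℂ, ContinuousOn L (Icc 0 1) ∧ ∀ s ∈ Icc (0 : ℝ) 1, Complex.exp (L s) = γ s := by
  have hsc : IsSimplyConnected (univ : Set ℝ) := by
    have := (convex_univ (𝕜 := ℝ) (E := ℝ)).contractibleSpace ⟨0, mem_univ _⟩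
    exact (inferInstance : SimplyConnectedSpace (univ : Set ℝ))
  obtain ⟨L, hL, he⟩ := Complex.exists_continuousOn_eqOn_exp_comp hsc isOpen_univ
    (g := IccExtend zero_le_one ((Icc (0 : ℝ) 1).domRestrict γ))
    (Continuous.continuousOn (Continuous.Icc_extend'
      (continuousOn_iff_continuous_domRestrict.1 hγ))) (by
      rintro ⟨x, -, hx⟩
      exact hne _ (projIcc (0 : ℝ) 1 zero_le_one x).2 hx)
  refine ⟨L, hL.mono (subset_univ _), fun s hs => ?_⟩
  have := he (mem_univ s)
  rw [Function.comp_apply, IccExtend_of_mem _ _ hs] at this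
  exact this

theorem IsPathIn.mono {W W' : Set ℂ} {a b : ℂ} {γ : ℝ → ℂ} (h : IsPathIn W a b γ) (hW : W ⊆ W') :
    IsPathIn W' a b γ :=
  ⟨h.1, h.2.1, h.2.2.1, h.2.2.2.1, fun s hs => hW (h.2.2.2.2 s hs)⟩

/-- The values of path integrals `∫ κ h(t) / (t - α) dt` from `0` to `β` along `γ`. -/
theorem exists_pathIntegral_eq {α β : ℂ} (hα0 : α ≠ 0) (hαβ : α ≠ β) {γ : ℝ → ℂ}
    (hγ : IsPathIn {t | t ≠ α} 0 β γ) :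
    ∃ ℓ : ℂ, Complex.exp ℓ = (β - α) / (-α) ∧
      ∀ (U : Set ℂ) (h : ℂ → ℂ) (κ : ℂ), IsMildAtZero U h → α ∈ U → β ∈ U →
      (∀ s ∈ Ioo (0 : ℝ) 1, γ s ∈ U) →
      IntervalIntegrable (fun s => κ * (h (γ s) / (γ s - α)) * deriv γ s) volume 0 1 →
      ∫ s in (0 : ℝ)..1, κ * (h (γ s) / (γ s - α)) * deriv γ s =
        κ * (radialPrimitive (dslope h α) β + h α * ℓ) := by
  obtain ⟨h0, h1, hc, ⟨F, hF⟩, hmem⟩ := hγ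
  have hne : ∀ s ∈ Icc (0 : ℝ) 1, γ s - α ≠ 0 := by
    intro s hs
    rw [sub_ne_zero]
    rcases hs.1.eq_or_lt with h | h
    · rw [← h, h0]; exact hα0.symm
    rcases hs.2.eq_or_lt with h' | h'
    · rw [h', h1]; exact hαβ.symm
    · exact hmem s ⟨h, h'⟩
  obtain ⟨L, hL, he⟩ := exists_continuousOn_exp_eq (hc.sub continuousOn_const) hne
  -- The increment of a continuous logarithm of γ - α depends on the path and on α only, so it is
  -- chosen before the kernel h.
  refine ⟨L 1 - L 0, ?_, ?_⟩
  · rw [Complex.exp_sub, he 1 (by simp), he 0 (by simp)]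
    simp [h0, h1]
  intro U h κ hU hα hβ hmemU hint
  have hq := hU.dslope_mild hα hα0
  set H := radialPrimitive (dslope h α) with hH
  have hH0 : H 0 = 0 := by simp [hH, radialPrimitive]
  have hγU : ∀ s ∈ Icc (0 : ℝ) 1, γ s ∈ insert 0 U := by
    intro s hs
    rcases hs.1.eq_or_lt with h | h
    · left; rw [← h, h0]
    rcases hs.2.eq_or_lt with h' | h'
    · right; rw [h', h1]; exact hβ
    · right; exact hmemU s ⟨h, h'⟩
  have hHc : ContinuousOn H (insert 0 U) := by
    intro z hz
    rcases eq_or_ne z 0 with rfl | hz0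
    · exact hq.continuousWithinAt_radialPrimitive
    · exact (hq.hasDerivAt_radialPrimitive (hz.resolve_left hz0)).continuousAt.continuousWithinAt
  have hHγ : ContinuousOn (fun s => H (γ s)) (Icc 0 1) := hHc.comp hc hγU
  -- The primitive along γ is κ (H∘γ + h(α) L). It is continuous on [0, 1] and differentiable off
  -- the finite set where γ may fail to be C¹.
  have hftc := integral_eq_of_hasDerivAt_off_countable_of_le
    (fun s => κ * (H (γ s) + h α * L s)) (fun s => κ * (h (γ s) / (γ s - α)) * deriv γ s)
    zero_le_one F.countable_toSet
    (continuousOn_const.mul (hHγ.add (continuousOn_const.mul hL))) ?_ hint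
  · rw [hftc, h0, h1, hH0]; ring
  · rintro s ⟨hs, hsF⟩
    have hds := ((hF s hs hsF).differentiableAt one_ne_zero).hasDerivAt
    have hdH : HasDerivAt (fun s => H (γ s)) (dslope h α (γ s) * deriv γ s) s :=
      HasDerivAt.comp (h₂ := H) s (hq.hasDerivAt_radialPrimitive (hmemU s hs)) hds
    have hIcc : Icc (0 : ℝ) 1 ∈ nhds s := Icc_mem_nhds hs.1 hs.2
    have hdL : HasDerivAt L (deriv γ s / (γ s - α)) s :=
      hasDerivAt_of_exp_eq (𝕜 := ℝ) (g := fun y => γ y - α) (hL.continuousAt hIcc)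
        (by filter_upwards [hIcc] with y hy using he y hy) (hds.sub_const α)
    refine ((hdH.add (hdL.const_mul (h α))).const_mul κ).congr_deriv ?_
    have hsa : γ s ≠ α := hmem s hs
    rw [dslope_of_ne _ hsa, slope_def_field]
    have := sub_ne_zero.2 hsa
    field_simp
    ring

theorem exists_int_of_exp_eq {x y : ℂ} (h : Complex.exp x = Complex.exp y) :
    ∃ n : ℤ, x - y = 2 * (Real.pi : ℂ) * Complex.I * n := by
  obtain ⟨n, hn⟩ := Complex.exp_eq_exp_iff_exists_int.1 h
  exact ⟨n, by rw [hn]; ring⟩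

/-! ### The two kernels -/

theorem legG_one_sub (ν : ℝ) (t : ℂ) : legG ν (1 - t) = legF ν t := by simp [legG]

theorem le_mul_rpow_neg_half {C x : ℝ} (hC : 0 ≤ C) (hx : 0 < x) (hx1 : x ≤ 1) :
    C ≤ C * x ^ (-(1 / 2) : ℝ) :=
  le_mul_of_one_le_right hC (Real.one_le_rpow_of_pos_of_le_one_of_nonpos hx hx1 (by norm_num))

theorem isMildAtZero_legF_sq {ν : ℝ} (hν : -1 < ν ∧ ν < 0) :
    IsMildAtZero slitPlaneOne (fun t => legF ν t ^ 2) := by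
  refine ⟨isOpen_slitPlaneOne, fun z hz s hs => smul_mem_slitPlaneOne hz (Ioc_subset_Icc_self hs),
    (differentiableOn_legF hν).pow 2, ?_⟩
  have hc : ContinuousAt (fun t => ‖legF ν t ^ 2‖) 0 :=
    ((hasDerivAt_legF hν zero_mem_slitPlaneOne).continuousAt.pow 2).norm
  have h2 : ∀ᶠ t in nhds (0 : ℂ), ‖legF ν t ^ 2‖ < 2 :=
    hc.eventually_lt_const (by simp [legF_zero hν])
  obtain ⟨ρ, hρ, hb⟩ := Metric.eventually_nhds_iff_ball.1 h2
  refine ⟨min ρ 1, by positivity, 2, fun z _ hz0 hzρ => ?_⟩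
  rw [lt_min_iff] at hzρ
  exact (hb z (mem_ball_zero_iff.2 hzρ.1)).le.trans
    (le_mul_rpow_neg_half (by norm_num) (norm_pos_iff.2 hz0) hzρ.2.le)

theorem differentiableOn_legG {ν : ℝ} (hν : -1 < ν ∧ ν < 0) :
    DifferentiableOn ℂ (legG ν) Complex.slitPlane :=
  fun _ ht => (hasDerivAt_legG hν ht).differentiableAt.differentiableWithinAt

theorem isMildAtZero_legF_mul_legG {ν : ℝ} (hν : -1 < ν ∧ ν < 0) :
    IsMildAtZero doubleSlit (fun t => legF ν t * legG ν t) := by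
  refine ⟨isOpen_doubleSlit, fun z hz s hs => smul_mem_doubleSlit hz hs,
    ((differentiableOn_legF hν).mono doubleSlit_subset_slitPlaneOne).mul
      ((differentiableOn_legG hν).mono doubleSlit_subset_slitPlane), ?_⟩
  obtain ⟨d, ρ, C, hρ, hρ1, hC, h⟩ := exists_log_approx hν
  refine ⟨ρ, hρ, C * C, fun z hz hz0 hzρ => ?_⟩
  obtain ⟨-, -, -, h1, -, h2⟩ := h z (doubleSlit_subset_slitPlane hz) hzρ
  rw [norm_mul, mul_assoc]
  gcongr

/-- The constant kernel serves to recognise the logarithm of an arc as an integral: its divided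
differences vanish. -/
theorem isMildAtZero_one : IsMildAtZero univ (fun _ => 1) := by
  refine ⟨isOpen_univ, fun _ _ _ _ => mem_univ _, differentiableOn_const 1, 1, one_pos, 1,
    fun z _ hz0 hz => ?_⟩
  rw [norm_one]
  exact le_mul_rpow_neg_half (by norm_num) (norm_pos_iff.2 hz0) hz.le

/-! ### Parabolic arcs -/

/-- A family of parabolic arcs from `0` to `β`. -/
noncomputable def arc (c β : ℂ) (s : ℝ) : ℂ := s * β + s * (1 - s) * c

/-- The arcs that are used as explicit paths of integration. -/
def IsGoodArc (c β : ℂ) : Prop :=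
  β ∈ doubleSlit ∧ (c = 0 ∨ c = 1 ∨ (c = Complex.I ∧ 0 < β.re ∧ β.re < 1))

@[simp] theorem arc_zero_right (c β : ℂ) : arc c β 0 = 0 := by simp [arc]

@[simp] theorem arc_one_right (c β : ℂ) : arc c β 1 = β := by simp [arc]

theorem hasDerivAt_arc (c β : ℂ) (s : ℝ) : HasDerivAt (arc c β) (β + (1 - 2 * s) * c) s := by
  have h1 : HasDerivAt (fun s : ℝ => (s : ℂ)) 1 s := Complex.ofRealCLM.hasDerivAt
  have h2 := (h1.mul_const β).add ((h1.mul (h1.const_sub 1)).mul_const c)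
  exact h2.congr_deriv (by ring)

theorem contDiff_arc (c β : ℂ) : ContDiff ℝ 1 (arc c β) := by
  have h1 : ContDiff ℝ 1 (fun s : ℝ => (s : ℂ)) := Complex.ofRealCLM.contDiff
  exact (h1.mul contDiff_const).add ((h1.mul (contDiff_const.sub h1)).mul contDiff_const)

theorem continuous_arc (c β : ℂ) : Continuous (arc c β) := (contDiff_arc c β).continuous

theorem arc_eq_mul (c β : ℂ) (s : ℝ) : arc c β s = s * (β + (1 - s) * c) := by
  simp [arc]; ring

theorem IsGoodArc.slope_mem {c β : ℂ} (h : IsGoodArc c β) {s : ℝ} (hs : s ∈ Icc (0 : ℝ) 1) :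
    β + (1 - s) * c ∈ Complex.slitPlane := by
  obtain ⟨hβ, rfl | rfl | ⟨rfl, h1, h2⟩⟩ := h
  · simpa using doubleSlit_subset_slitPlane hβ
  · rcases hβ with hβ | hβ
    · right; simpa using hβ
    · left; simp; linarith [hs.2, hβ.1]
  · left; simpa using h1

theorem IsGoodArc.arc_mem {c β : ℂ} (h : IsGoodArc c β) {s : ℝ} (hs : s ∈ Ioc (0 : ℝ) 1) :
    arc c β s ∈ doubleSlit := by
  rw [arc_eq_mul]
  obtain ⟨hβ, rfl | rfl | ⟨rfl, h1, h2⟩⟩ := h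
  · simpa using smul_mem_doubleSlit hβ hs
  · rcases hβ with hβ | hβ
    · left; simpa using ⟨hs.1.ne', hβ⟩
    · right; simp
      constructor
      · have := hs.1; have := hs.2; have := hβ.1
        apply mul_pos hs.1; linarith
      · nlinarith [hs.1, hs.2, hβ.1, hβ.2, mul_pos hs.1 (sub_pos.2 hβ.2), sq_nonneg (1 - s)]
  · right; simp
    constructor <;> nlinarith [hs.1, hs.2]

theorem IsGoodArc.eventually {c β : ℂ} (h : IsGoodArc c β) : ∀ᶠ b in nhds β, IsGoodArc c b := by
  obtain ⟨hβ, rfl | rfl | ⟨rfl, h1, h2⟩⟩ := h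
  · filter_upwards [isOpen_doubleSlit.mem_nhds hβ] with b hb using ⟨hb, Or.inl rfl⟩
  · filter_upwards [isOpen_doubleSlit.mem_nhds hβ] with b hb using ⟨hb, Or.inr (Or.inl rfl)⟩
  · filter_upwards [isOpen_doubleSlit.mem_nhds hβ,
      (Complex.continuous_re.tendsto β).eventually_lt_const h2,
      (Complex.continuous_re.tendsto β).eventually_const_lt h1] with b hb h2 h1
    exact ⟨hb, Or.inr (Or.inr ⟨rfl, h1, h2⟩)⟩

/-- The segment works unless it meets α. If it does and β is real, bending by I moves the interior
of the arc off the real line. If β is not real, bending by 1 leaves the imaginary part s·Im β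
unchanged, so α could only be met at its old parameter, where the arc has moved by s(1-s) ≠ 0. All
three values of c are algebraic, which matters for periods. -/
theorem exists_isGoodArc {α β : ℂ} (hα : α ∈ doubleSlit) (hβ : β ∈ doubleSlit) (hαβ : α ≠ β) :
    ∃ c : ℂ, (c = 0 ∨ c = 1 ∨ c = Complex.I) ∧ IsGoodArc c β ∧
      ∀ s ∈ Icc (0 : ℝ) 1, arc c β s ≠ α := by
  have hα0 : α ≠ 0 := Complex.slitPlane_ne_zero (doubleSlit_subset_slitPlane hα)
  by_cases h0 : ∀ s ∈ Icc (0 : ℝ) 1, arc 0 β s ≠ α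
  · exact ⟨0, Or.inl rfl, ⟨hβ, Or.inl rfl⟩, h0⟩
  push Not at h0
  obtain ⟨s₀, hs₀, he⟩ := h0
  have he' : (s₀ : ℂ) * β = α := by simpa [arc] using he
  by_cases him : β.im = 0
  · have hre : 0 < β.re ∧ β.re < 1 := hβ.resolve_left (fun h => h him)
    refine ⟨Complex.I, Or.inr (Or.inr rfl), ⟨hβ, Or.inr (Or.inr ⟨rfl, hre⟩)⟩, fun s hs h => ?_⟩
    have h1 := congrArg Complex.im h
    rw [← he', arc_eq_mul] at h1
    simp [him] at h1
    rcases h1 with h1 | h1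
    · apply hα0; rw [← h, h1]; simp
    · apply hαβ
      have : s = 1 := by linarith
      rw [← h, this]; simp
  · refine ⟨1, Or.inr (Or.inl rfl), ⟨hβ, Or.inr (Or.inl rfl)⟩, fun s hs h => ?_⟩
    have h1 := congrArg Complex.im h
    rw [← he', arc_eq_mul] at h1
    simp at h1
    have hs1 : s = s₀ := h1.resolve_right him
    rw [← he', arc_eq_mul, ← hs1] at h
    have h2 : (s : ℂ) * (1 - s) = 0 := by linear_combination h
    rcases mul_eq_zero.1 h2 with h3 | h3
    · apply hα0; rw [← he', ← hs1, h3]; simp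
    · apply hαβ
      rw [← he', ← hs1, ← sub_eq_zero.1 h3]; simp

theorem eventually_arc_ne {c : ℂ} {α β : ℂ} (h : ∀ s ∈ Icc (0 : ℝ) 1, arc c β s ≠ α) :
    ∃ δ > 0, ∀ᶠ p : ℂ × ℂ in nhds (α, β), ∀ s ∈ Icc (0 : ℝ) 1, δ ≤ ‖arc c p.2 s - p.1‖ := by
  have hcont : Continuous fun q : (ℂ × ℂ) × ℝ => ‖arc c q.1.2 q.2 - q.1.1‖ := by
    unfold arc; fun_prop
  have hc1 : Continuous fun s : ℝ => ‖arc c β s - α‖ := by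
    unfold arc; fun_prop
  obtain ⟨s₁, hs₁, hmin⟩ := isCompact_Icc.exists_isMinOn (nonempty_Icc.2 zero_le_one)
    hc1.continuousOn
  have hpos : 0 < ‖arc c β s₁ - α‖ := norm_pos_iff.2 (sub_ne_zero.2 (h s₁ hs₁))
  refine ⟨‖arc c β s₁ - α‖ / 2, half_pos hpos, ?_⟩
  have := isCompact_Icc.eventually_forall_of_forall_eventually (x₀ := (α, β)) (K := Icc (0 : ℝ) 1)
    (P := fun (p : ℂ × ℂ) (s : ℝ) => ‖arc c β s₁ - α‖ / 2 ≤ ‖arc c p.2 s - p.1‖) (by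
      intro s hs
      have h1 : ‖arc c β s₁ - α‖ / 2 < ‖arc c β s - α‖ := by
        have : ‖arc c β s₁ - α‖ ≤ ‖arc c β s - α‖ := hmin hs
        linarith
      exact ((hcont.tendsto ((α, β), s)).eventually_const_lt h1).mono fun _ hx => hx.le)
  exact this

theorem IsGoodArc.exists_norm_le {c β : ℂ} (h : IsGoodArc c β) :
    ∃ κ > 0, ∀ s ∈ Icc (0 : ℝ) 1, κ * s ≤ ‖arc c β s‖ := by
  have hc1 : Continuous fun s : ℝ => ‖β + (1 - s) * c‖ := by fun_prop
  obtain ⟨s₁, hs₁, hmin⟩ := isCompact_Icc.exists_isMinOn (nonempty_Icc.2 zero_le_one)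
    hc1.continuousOn
  refine ⟨_, norm_pos_iff.2 (Complex.slitPlane_ne_zero (h.slope_mem hs₁)), fun s hs => ?_⟩
  rw [arc_eq_mul, norm_mul, Complex.norm_real, Real.norm_of_nonneg hs.1, mul_comm]
  exact mul_le_mul_of_nonneg_left (hmin hs) hs.1

theorem integrableOn_of_bound_near_zero {φ : ℝ → ℂ} (hc : ContinuousOn φ (Ioc 0 1)) {δ C : ℝ}
    (hδ : 0 < δ) (hb : ∀ s ∈ Ioc (0 : ℝ) 1, s < δ → ‖φ s‖ ≤ C * s ^ (-(1 / 2) : ℝ)) :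
    IntegrableOn φ (Ioo 0 1) := by
  have hK : ContinuousOn φ (Icc (min δ 1) 1) := hc.mono fun s hs =>
    ⟨(lt_min hδ one_pos).trans_le hs.1, hs.2⟩
  obtain ⟨M, hM⟩ := isCompact_Icc.exists_bound_of_continuousOn hK
  refine Integrable.mono' (integrableOn_rpow_neg_half.const_mul (max C M))
    ((hc.mono Ioo_subset_Ioc_self).aestronglyMeasurable measurableSet_Ioo)
    ((ae_restrict_iff' measurableSet_Ioo).2 (Filter.Eventually.of_forall fun s hs => ?_))
  have hspos : 0 < s ^ (-(1 / 2) : ℝ) := Real.rpow_pos_of_pos hs.1 _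
  rcases lt_or_ge s δ with h | h
  · refine (hb s (Ioo_subset_Ioc_self hs) h).trans ?_
    gcongr; exact le_max_left _ _
  · have h1 := hM s ⟨(min_le_left _ _).trans h, hs.2.le⟩
    refine (h1.trans (le_mul_rpow_neg_half ((norm_nonneg _).trans h1) hs.1 hs.2.le)).trans ?_
    gcongr; exact le_max_right _ _

theorem IsMildAtZero.integrableOn_arc {U : Set ℂ} {h : ℂ → ℂ} (hU : IsMildAtZero U h)
    (hD : doubleSlit ⊆ U) {c β : ℂ} (hg : IsGoodArc c β) :
    IntegrableOn (fun s => h (arc c β s) * (β + (1 - 2 * s) * c)) (Ioo 0 1) := by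
  obtain ⟨ρ, hρ, C, hC⟩ := hU.bound
  obtain ⟨κ, hκ, hκs⟩ := hg.exists_norm_le
  have hlin : Continuous fun s : ℝ => ‖β + (1 - 2 * s) * c‖ := by fun_prop
  obtain ⟨M, hM⟩ :=
    (isCompact_Icc (a := (0 : ℝ)) (b := 1)).exists_bound_of_continuousOn hlin.continuousOn
  have hM0 : 0 ≤ M := (norm_nonneg _).trans (hM 0 (by simp))
  have hsm : ∀ᶠ s : ℝ in nhds 0, ‖arc c β s‖ < ρ :=
    (continuous_arc c β).norm.tendsto' 0 0 (by simp) |>.eventually_lt_const hρ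
  obtain ⟨δ, hδ, hb⟩ := Metric.eventually_nhds_iff_ball.1 hsm
  refine integrableOn_of_bound_near_zero (δ := δ) (C := max C 0 * κ ^ (-(1 / 2) : ℝ) * M) ?_ hδ ?_
  · refine ContinuousOn.mul (hU.differentiableOn.continuousOn.comp
      (continuous_arc c β).continuousOn fun s hs => hD (hg.arc_mem hs)) (by fun_prop)
  · intro s hs hsδ
    have hmem := hg.arc_mem hs
    have h1 := hC _ (hD hmem) (Complex.slitPlane_ne_zero (doubleSlit_subset_slitPlane hmem))
      (hb s (by rw [mem_ball_zero_iff, Real.norm_of_nonneg hs.1.le]; exact hsδ))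
    have h2 : ‖arc c β s‖ ^ (-(1 / 2) : ℝ) ≤ κ ^ (-(1 / 2) : ℝ) * s ^ (-(1 / 2) : ℝ) := by
      rw [← Real.mul_rpow hκ.le hs.1.le]
      exact Real.rpow_le_rpow_of_nonpos (mul_pos hκ hs.1) (hκs s (Ioc_subset_Icc_self hs))
        (by norm_num)
    have h3 : ‖β + (1 - 2 * s) * c‖ ≤ M := by simpa using hM s (Ioc_subset_Icc_self hs)
    have hs0 := hs.1
    have h4 : ‖h (arc c β s)‖ ≤ max C 0 * (κ ^ (-(1 / 2) : ℝ) * s ^ (-(1 / 2) : ℝ)) :=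
      h1.trans (mul_le_mul (le_max_left _ _) h2 (by positivity) (le_max_right _ _))
    rw [norm_mul]
    exact (mul_le_mul h4 h3 (norm_nonneg _) (by positivity)).trans_eq (by ring)

/-! ### Cauchy transforms -/

/-- The integrals `∫₀¹ φ(s) / (γ(s) - α)^k ds`. -/
noncomputable def cauchyTransform (φ γ : ℝ → ℂ) (k : ℕ) (α : ℂ) : ℂ :=
  ∫ s in Ioo (0 : ℝ) 1, φ s / (γ s - α) ^ k

theorem integrableOn_cauchyTransform {φ γ : ℝ → ℂ} (hφ : IntegrableOn φ (Ioo 0 1))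
    (hγ : ContinuousOn γ (Icc 0 1)) (k : ℕ) {α : ℂ} (hne : ∀ s ∈ Icc (0 : ℝ) 1, γ s ≠ α) :
    IntegrableOn (fun s => φ s / (γ s - α) ^ k) (Ioo 0 1) := by
  have hc : ContinuousOn (fun s => ((γ s - α) ^ k)⁻¹) (Icc 0 1) :=
    ((hγ.sub continuousOn_const).pow k).inv₀ fun s hs => pow_ne_zero _ (sub_ne_zero.2 (hne s hs))
  obtain ⟨M, hM⟩ := isCompact_Icc.exists_bound_of_continuousOn hc
  simp only [div_eq_mul_inv]
  exact Integrable.mul_bdd (c := M) hφ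
    ((hc.mono Ioo_subset_Icc_self).aestronglyMeasurable measurableSet_Ioo)
    ((ae_restrict_iff' measurableSet_Ioo).2
      (Filter.Eventually.of_forall fun s hs => hM s (Ioo_subset_Icc_self hs)))

theorem hasDerivAt_cauchyTransform {φ γ : ℝ → ℂ} (hφ : IntegrableOn φ (Ioo 0 1))
    (hγ : ContinuousOn γ (Icc 0 1)) (k : ℕ) {α : ℂ} (hne : ∀ s ∈ Icc (0 : ℝ) 1, γ s ≠ α) :
    HasDerivAt (cauchyTransform φ γ k) (k * cauchyTransform φ γ (k + 1) α) α := by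
  obtain ⟨s₁, hs₁, hmin⟩ := isCompact_Icc.exists_isMinOn (nonempty_Icc.2 zero_le_one)
    (f := fun s => ‖γ s - α‖) (hγ.sub continuousOn_const).norm
  set δ := ‖γ s₁ - α‖ with hδ
  have hδ0 : 0 < δ := norm_pos_iff.2 (sub_ne_zero.2 (hne s₁ hs₁))
  have hlow : ∀ a ∈ Metric.ball α (δ / 2), ∀ s ∈ Icc (0 : ℝ) 1, δ / 2 ≤ ‖γ s - a‖ := by
    intro a ha s hs
    have h1 : δ ≤ ‖γ s - α‖ := hmin hs
    rw [mem_ball_iff_norm] at ha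
    have h2 : ‖γ s - α‖ ≤ ‖γ s - a‖ + ‖a - α‖ := by
      calc _ = ‖(γ s - a) + (a - α)‖ := by congr 1; ring
        _ ≤ _ := norm_add_le _ _
    linarith
  have hne' : ∀ a ∈ Metric.ball α (δ / 2), ∀ s ∈ Icc (0 : ℝ) 1, γ s ≠ a := by
    intro a ha s hs h
    have := hlow a ha s hs
    rw [h, sub_self, norm_zero] at this
    linarith
  have hd : ∀ s ∈ Icc (0 : ℝ) 1, ∀ a ∈ Metric.ball α (δ / 2),
      HasDerivAt (fun a => φ s / (γ s - a) ^ k) (k * (φ s / (γ s - a) ^ (k + 1))) a := by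
    intro s hs a ha
    have h0 := sub_ne_zero.2 (hne' a ha s hs)
    have h1 := (((hasDerivAt_id a).const_sub (γ s)).pow k).inv (pow_ne_zero _ h0)
    refine ((h1.const_mul (φ s)).congr_of_eventuallyEq
      (Filter.Eventually.of_forall fun a => ?_)).congr_deriv ?_
    · simp [div_eq_mul_inv]
    · rcases k with _ | k
      · simp
      · simp only [id, Nat.add_sub_cancel, Pi.pow_apply]
        field_simp
        ring
  have key := hasDerivAt_integral_of_differentiableOn_of_bound
    (μ := volume.restrict (Ioo (0 : ℝ) 1)) (F := fun a s => φ s / (γ s - a) ^ k) (z₀ := α)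
    (bound := fun s => ‖φ s‖ / (δ / 2) ^ k) (half_pos hδ0) ?_ ?_ ?_ ?_
  · refine key.congr_deriv ?_
    unfold cauchyTransform
    rw [← integral_const_mul]
    exact setIntegral_congr_fun measurableSet_Ioo fun s hs =>
      (hd s (Ioo_subset_Icc_self hs) α (Metric.mem_ball_self (half_pos hδ0))).deriv
  · exact fun a ha => (integrableOn_cauchyTransform hφ hγ k (hne' a ha)).aestronglyMeasurable
  · exact (ae_restrict_iff' measurableSet_Ioo).2 (Filter.Eventually.of_forall fun s hs a ha =>
      (hd s (Ioo_subset_Icc_self hs) a ha).differentiableAt.differentiableWithinAt)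
  · refine (ae_restrict_iff' measurableSet_Ioo).2 (Filter.Eventually.of_forall fun s hs a ha => ?_)
    rw [norm_div, norm_pow]
    gcongr
    exact hlow a ha s (Ioo_subset_Icc_self hs)
  · exact hφ.norm.div_const _

/-! ### Integrals along parabolic arcs -/

/-- The integral of `h(t) / (t - α)` along a parabolic arc from `0` to `β`. -/
noncomputable def arcIntegral (h : ℂ → ℂ) (c α β : ℂ) : ℂ :=
  ∫ s in Ioo (0 : ℝ) 1, h (arc c β s) * (β + (1 - 2 * s) * c) / (arc c β s - α)

theorem arcIntegral_eq_cauchyTransform (h : ℂ → ℂ) (c α β : ℂ) :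
    arcIntegral h c α β =
      cauchyTransform (fun s => h (arc c β s) * (β + (1 - 2 * s) * c)) (arc c β) 1 α := by
  simp [arcIntegral, cauchyTransform]

theorem IsGoodArc.isPathIn {U : Set ℂ} {c α β : ℂ} (hg : IsGoodArc c β)
    (hD : doubleSlit ⊆ U) (hne : ∀ s ∈ Icc (0 : ℝ) 1, arc c β s ≠ α) :
    IsPathIn {t | t ∈ U ∧ t ≠ α} 0 β (arc c β) :=
  ⟨by simp, by simp, (continuous_arc c β).continuousOn,
    ⟨∅, fun s _ _ => (contDiff_arc c β).contDiffAt⟩,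
    fun s hs => ⟨hD (hg.arc_mem (Ioo_subset_Ioc_self hs)), hne s (Ioo_subset_Icc_self hs)⟩⟩

theorem arc_integrand_eq (h : ℂ → ℂ) (κ c α β : ℂ) (s : ℝ) :
    κ * (h (arc c β s) / (arc c β s - α)) * deriv (arc c β) s =
      κ * (h (arc c β s) * (β + (1 - 2 * s) * c) / (arc c β s - α)) := by
  rw [(hasDerivAt_arc c β s).deriv]; ring

section

variable {U : Set ℂ} {h : ℂ → ℂ} {c α β : ℂ}

theorem IsMildAtZero.integrableOn_arcIntegral (hU : IsMildAtZero U h) (hD : doubleSlit ⊆ U)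
    (hg : IsGoodArc c β) (hne : ∀ s ∈ Icc (0 : ℝ) 1, arc c β s ≠ α) :
    IntegrableOn (fun s => h (arc c β s) * (β + (1 - 2 * s) * c) / (arc c β s - α)) (Ioo 0 1) := by
  simpa using integrableOn_cauchyTransform (hU.integrableOn_arc hD hg)
    (continuous_arc c β).continuousOn 1 hne

theorem IsMildAtZero.intervalIntegrable_arc (hU : IsMildAtZero U h) (hD : doubleSlit ⊆ U)
    (hg : IsGoodArc c β) (hne : ∀ s ∈ Icc (0 : ℝ) 1, arc c β s ≠ α) (κ : ℂ) :
    IntervalIntegrable (fun s => κ * (h (arc c β s) / (arc c β s - α)) * deriv (arc c β) s)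
      volume 0 1 := by
  simp only [arc_integrand_eq]
  rw [intervalIntegrable_iff_integrableOn_Ioo_of_le zero_le_one]
  exact (hU.integrableOn_arcIntegral hD hg hne).const_mul κ

theorem integral_arc_eq (h : ℂ → ℂ) (κ c α β : ℂ) :
    ∫ s in (0 : ℝ)..1, κ * (h (arc c β s) / (arc c β s - α)) * deriv (arc c β) s =
      κ * arcIntegral h c α β := by
  simp only [arc_integrand_eq]
  rw [intervalIntegral.integral_of_le zero_le_one, integral_Ioc_eq_integral_Ioo,
    integral_const_mul, arcIntegral]

/-- Testing the path formula on the kernel 1 identifies the logarithm as the arc integral of 1, a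
concrete function of α and β. -/
theorem IsGoodArc.exists_eq (hg : IsGoodArc c β) (hα : α ∈ doubleSlit)
    (hne : ∀ s ∈ Icc (0 : ℝ) 1, arc c β s ≠ α) :
    Complex.exp (arcIntegral (fun _ => 1) c α β) = (β - α) / (-α) ∧
      ∀ (U : Set ℂ) (h : ℂ → ℂ), IsMildAtZero U h → doubleSlit ⊆ U →
        arcIntegral h c α β =
          radialPrimitive (dslope h α) β + h α * arcIntegral (fun _ => 1) c α β := by
  have hα0 : α ≠ 0 := Complex.slitPlane_ne_zero (doubleSlit_subset_slitPlane hα)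
  have hαβ : α ≠ β := by simpa using (hne 1 (by simp)).symm
  obtain ⟨ℓ, he, hℓ⟩ := exists_pathIntegral_eq hα0 hαβ
    ((hg.isPathIn subset_rfl hne).mono fun t ht => ht.2)
  have hval : ∀ (U : Set ℂ) (h : ℂ → ℂ), IsMildAtZero U h → doubleSlit ⊆ U →
      arcIntegral h c α β = radialPrimitive (dslope h α) β + h α * ℓ := by
    intro U h hU hD
    have := hℓ U h 1 hU (hD hα) (hD hg.1)
      (fun s hs => hD (hg.arc_mem (Ioo_subset_Ioc_self hs))) (hU.intervalIntegrable_arc hD hg hne 1)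
    rwa [integral_arc_eq, one_mul, one_mul] at this
  have h1 : arcIntegral (fun _ => 1) c α β = ℓ := by
    rw [hval univ _ isMildAtZero_one (subset_univ _)]
    have : dslope (fun _ : ℂ => (1 : ℂ)) α = fun _ => 0 := by
      ext z
      rcases eq_or_ne z α with rfl | hz
      · simp
      · simp [dslope_of_ne _ hz, slope_def_field]
    simp [this, radialPrimitive]
  rw [h1]
  exact ⟨he, hval⟩

/-- Any value of a path integral differs from the value along a parabolic arc by periods. -/
theorem IsMildAtZero.exists_int_pathIntegral_eq (hU : IsMildAtZero U h) (hD : doubleSlit ⊆ U)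
    (hg : IsGoodArc c β) (hα : α ∈ doubleSlit) (hne : ∀ s ∈ Icc (0 : ℝ) 1, arc c β s ≠ α)
    {κ : ℂ} {γ : ℝ → ℂ} (hγ : IsPathIn {t | t ∈ U ∧ t ≠ α} 0 β γ)
    (hint : IntervalIntegrable (fun s => κ * (h (γ s) / (γ s - α)) * deriv γ s) volume 0 1) :
    ∃ n : ℤ, ∫ s in (0 : ℝ)..1, κ * (h (γ s) / (γ s - α)) * deriv γ s =
      κ * arcIntegral h c α β + 2 * (Real.pi : ℂ) * Complex.I * (n * (κ * h α)) := by
  have hα0 : α ≠ 0 := Complex.slitPlane_ne_zero (doubleSlit_subset_slitPlane hα)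
  have hαβ : α ≠ β := by simpa using (hne 1 (by simp)).symm
  obtain ⟨ℓ, he, hℓ⟩ := exists_pathIntegral_eq hα0 hαβ (hγ.mono fun t ht => ht.2)
  obtain ⟨he', hval⟩ := hg.exists_eq hα hne
  obtain ⟨n, hn⟩ := exists_int_of_exp_eq (he.trans he'.symm)
  refine ⟨n, ?_⟩
  rw [hℓ U h κ hU (hD hα) (hD hg.1) (fun s hs => (hγ.2.2.2.2 s hs).1) hint, hval U h hU hD]
  linear_combination κ * h α * hn

/-- For the kernel 1 the integrand is rational in the end point, so differentiation under the
integral is immediate. Only continuity is used afterwards; the derivative follows from the known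
exponential. -/
theorem IsGoodArc.differentiableAt_arcIntegral_one (hne : ∀ s ∈ Icc (0 : ℝ) 1, arc c β s ≠ α) :
    DifferentiableAt ℂ (fun b => arcIntegral (fun _ => 1) c α b) β := by
  obtain ⟨δ, hδ, hev⟩ := eventually_arc_ne hne
  have hev' : ∀ᶠ b in nhds β, (∀ s ∈ Icc (0 : ℝ) 1, δ ≤ ‖arc c b s - α‖) ∧ ‖b‖ < ‖β‖ + 1 := by
    refine Filter.Eventually.and ?_ (continuous_norm.continuousAt.eventually_lt_const (by simp))
    have : Filter.Tendsto (fun b : ℂ => (α, b)) (nhds β) (nhds (α, β)) :=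
      (Continuous.tendsto (by fun_prop) β)
    exact this.eventually hev
  obtain ⟨r, hr, hb⟩ := Metric.eventually_nhds_iff_ball.1 hev'
  have hne' : ∀ b ∈ Metric.ball β r, ∀ s ∈ Icc (0 : ℝ) 1, arc c b s - α ≠ 0 := by
    intro b hbm s hs h0
    have := (hb b hbm).1 s hs
    rw [h0, norm_zero] at this
    linarith
  refine (hasDerivAt_integral_of_differentiableOn_of_bound
    (μ := volume.restrict (Ioo (0 : ℝ) 1)) (z₀ := β)
    (F := fun b s => 1 * (b + (1 - 2 * s) * c) / (arc c b s - α))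
    (bound := fun _ => (‖β‖ + 1 + 3 * ‖c‖) / δ) hr ?_ ?_ ?_ ?_).differentiableAt
  · intro b hbm
    refine ContinuousOn.aestronglyMeasurable (ContinuousOn.div (by fun_prop)
      ((continuous_arc c b).continuousOn.sub continuousOn_const) fun s hs => ?_) measurableSet_Ioo
    exact hne' b hbm s (Ioo_subset_Icc_self hs)
  · refine (ae_restrict_iff' measurableSet_Ioo).2 (Filter.Eventually.of_forall fun s hs b hbm => ?_)
    have hd1 : DifferentiableAt ℂ (fun z : ℂ => arc c z s - α) b := by unfold arc; fun_prop
    have hd2 : DifferentiableAt ℂ (fun z : ℂ => 1 * (z + (1 - 2 * (s : ℂ)) * c)) b := by fun_prop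
    exact (hd2.div hd1 (hne' b hbm s (Ioo_subset_Icc_self hs))).differentiableWithinAt
  · refine (ae_restrict_iff' measurableSet_Ioo).2 (Filter.Eventually.of_forall fun s hs b hbm => ?_)
    obtain ⟨h1, h2⟩ := hb b hbm
    rw [norm_div, one_mul]
    gcongr
    · refine (norm_add_le _ _).trans (add_le_add h2.le ?_)
      rw [norm_mul]
      gcongr
      calc ‖(1 : ℂ) - 2 * s‖ = |1 - 2 * s| := by
            rw [← Real.norm_eq_abs, ← Complex.norm_real]; simp
        _ ≤ 3 := by rw [abs_le]; constructor <;> linarith [hs.1, hs.2]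
    · exact h1 s (Ioo_subset_Icc_self hs)
  · exact integrable_const _

/-- The whole arc moves with β, so the splitting is differentiated instead: the regular part
contributes (h(β)-h(α))/(β-α) and the logarithm h(α)/(β-α). -/
theorem IsMildAtZero.hasDerivAt_arcIntegral_right (hU : IsMildAtZero U h) (hD : doubleSlit ⊆ U)
    (hg : IsGoodArc c β) (hα : α ∈ doubleSlit) (hne : ∀ s ∈ Icc (0 : ℝ) 1, arc c β s ≠ α) :
    HasDerivAt (arcIntegral h c α) (h β / (β - α)) β := by
  have hα0 : α ≠ 0 := Complex.slitPlane_ne_zero (doubleSlit_subset_slitPlane hα)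
  have hβα : β ≠ α := by simpa using hne 1 (by simp)
  obtain ⟨δ, hδ, hev⟩ := eventually_arc_ne hne
  have hev' : ∀ᶠ b in nhds β, IsGoodArc c b ∧ ∀ s ∈ Icc (0 : ℝ) 1, arc c b s ≠ α := by
    refine hg.eventually.and ?_
    have : Filter.Tendsto (fun b : ℂ => (α, b)) (nhds β) (nhds (α, β)) :=
      (Continuous.tendsto (by fun_prop) β)
    filter_upwards [this.eventually hev] with b hb s hs h0
    have := hb s hs
    rw [h0, sub_self, norm_zero] at this
    linarith
  have hq := hU.dslope_mild (hD hα) hα0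
  have hℓ : HasDerivAt (arcIntegral (fun _ => 1) c α) (1 / (β - α)) β := by
    have hd : HasDerivAt (fun b => (b - α) / (-α)) (1 / (-α)) β :=
      ((hasDerivAt_id β).sub_const α).div_const (-α)
    refine (hasDerivAt_of_exp_eq (IsGoodArc.differentiableAt_arcIntegral_one hne).continuousAt
      ?_ hd).congr_deriv ?_
    · filter_upwards [hev'] with b hb using (hb.1.exists_eq hα hb.2).1
    · have := sub_ne_zero.2 hβα
      field_simp
  refine (((hq.hasDerivAt_radialPrimitive (hD hg.1)).add (hℓ.const_mul (h α))).congr_of_eventuallyEq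
    ?_).congr_deriv ?_
  · filter_upwards [hev'] with b hb using (hb.1.exists_eq hα hb.2).2 U h hU hD
  · rw [dslope_of_ne _ hβα, slope_def_field]
    have := sub_ne_zero.2 hβα
    field_simp
    ring

theorem IsMildAtZero.differentiableAt_arcIntegral_left (hU : IsMildAtZero U h)
    (hD : doubleSlit ⊆ U) (hg : IsGoodArc c β) (hne : ∀ s ∈ Icc (0 : ℝ) 1, arc c β s ≠ α) :
    DifferentiableAt ℂ (fun a => arcIntegral h c a β) α := by
  simp only [arcIntegral_eq_cauchyTransform]
  exact (hasDerivAt_cauchyTransform (hU.integrableOn_arc hD hg) (continuous_arc c β).continuousOn 1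
    hne).differentiableAt

end

/-! ### Values of the entropy -/

/-- The kernel `P_ν(1 - 2t)²`. -/
noncomputable def kerFF (ν : ℝ) (t : ℂ) : ℂ := legF ν t ^ 2

/-- The kernel `P_ν(1 - 2t) P_ν(2t - 1)`. -/
noncomputable def kerFG (ν : ℝ) (t : ℂ) : ℂ := legF ν t * legG ν t

theorem isMildAtZero_kerFF {ν : ℝ} (hν : -1 < ν ∧ ν < 0) : IsMildAtZero slitPlaneOne (kerFF ν) :=
  isMildAtZero_legF_sq hν

theorem isMildAtZero_kerFG {ν : ℝ} (hν : -1 < ν ∧ ν < 0) : IsMildAtZero doubleSlit (kerFG ν) :=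
  isMildAtZero_legF_mul_legG hν

theorem kerFG_one_sub (ν : ℝ) (t : ℂ) : kerFG ν (1 - t) = kerFG ν t := by
  simp [kerFG, legG, mul_comm]

theorem kerFF_one_sub (ν : ℝ) (t : ℂ) : kerFF ν (1 - t) = legG ν t ^ 2 := rfl

/-- `w` is a value of `∫ κ h(t) / (t - α) dt` along some path from `0` to `β` in `U`. -/
def IsKernelValue (U : Set ℂ) (h : ℂ → ℂ) (κ α β w : ℂ) : Prop :=
  ∃ γ : ℝ → ℂ, IsPathIn {t | t ∈ U ∧ t ≠ α} 0 β γ ∧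
    IntervalIntegrable (fun s => κ * (h (γ s) / (γ s - α)) * deriv γ s) volume 0 1 ∧
    w = ∫ s in (0 : ℝ)..1, κ * (h (γ s) / (γ s - α)) * deriv γ s

theorem FormalIntegral.isValue_iff {T : FormalIntegral} {U : Set ℂ} {h : ℂ → ℂ}
    {κ α β a b : ℂ} (hl : T.lower α β = 0) (hu : T.upper α β = b)
    (hi : ∀ t, T.integrand t α β = κ * (h t / (t - a)))
    (hd : ∀ t, (t, α, β) ∈ T.dom ↔ t ∈ U ∧ t ≠ a) (w : ℂ) :
    T.IsValue α β w ↔ IsKernelValue U h κ a b w := by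
  unfold FormalIntegral.IsValue IsKernelValue
  simp only [hl, hu, hi, hd]

/-- The last two summands are the first two kernels at the reflected pair (1-α, 1-β), so one theory
of ∫ κ h(t)/(t-α) dt covers all four. -/
theorem IsKernelValue.scale_iff (ν : ℝ) (C : ℂ) {α β : ℂ} (hα : α ∈ doubleSlit)
    (hβ : β ∈ doubleSlit) (w : ℂ) :
    ((((entropySum ν).scale C).term (0 : Fin 4)).IsValue α β w ↔
      IsKernelValue slitPlaneOne (kerFF ν) (C * legG ν β ^ 2) α β w) ∧
    ((((entropySum ν).scale C).term (1 : Fin 4)).IsValue α β w ↔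
      IsKernelValue doubleSlit (kerFG ν) (C * -kerFG ν β) α β w) ∧
    ((((entropySum ν).scale C).term (2 : Fin 4)).IsValue α β w ↔
      IsKernelValue doubleSlit (kerFG ν) (C * -kerFG ν β) (1 - α) (1 - β) w) ∧
    ((((entropySum ν).scale C).term (3 : Fin 4)).IsValue α β w ↔
      IsKernelValue slitPlaneOne (kerFF ν) (C * legF ν β ^ 2) (1 - α) (1 - β) w) := by
  refine ⟨FormalIntegral.isValue_iff rfl rfl (fun t => ?_) (fun t => ?_) w,
    FormalIntegral.isValue_iff rfl rfl (fun t => ?_) (fun t => ?_) w,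
    FormalIntegral.isValue_iff rfl rfl (fun t => ?_) (fun t => ?_) w,
    FormalIntegral.isValue_iff rfl rfl (fun t => ?_) (fun t => ?_) w⟩
  · change C * (legendreP ν (2 * β - 1) ^ 2 * (legendreP ν (1 - 2 * t) ^ 2 / (t - α))) = _
    rw [legendreP_sub_one, legendreP_one_sub, kerFF, legG]; ring
  · change (t ∈ slitPlaneOne ∧ α ∈ doubleSlit ∧ β ∈ doubleSlit ∧ t ≠ α) ↔ _
    tauto
  · change C * (-(legendreP ν (1 - 2 * β) * legendreP ν (2 * β - 1)) *
      (legendreP ν (1 - 2 * t) * legendreP ν (2 * t - 1) / (t - α))) = _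
    simp only [legendreP_sub_one, legendreP_one_sub, kerFG, legG]; ring
  · change (t ∈ doubleSlit ∧ α ∈ doubleSlit ∧ β ∈ doubleSlit ∧ t ≠ α) ↔ _
    tauto
  · change C * (-(legendreP ν (2 * β - 1) * legendreP ν (1 - 2 * β)) *
      (legendreP ν (1 - 2 * t) * legendreP ν (2 * t - 1) / (t - 1 + α))) = _
    simp only [legendreP_sub_one, legendreP_one_sub, kerFG, legG]
    rw [show t - 1 + α = t - (1 - α) by ring]; ring
  · change (t ∈ doubleSlit ∧ α ∈ doubleSlit ∧ β ∈ doubleSlit ∧ t ≠ 1 - α) ↔ _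
    tauto
  · change C * (legendreP ν (1 - 2 * β) ^ 2 * (legendreP ν (1 - 2 * t) ^ 2 / (t - 1 + α))) = _
    simp only [legendreP_one_sub, kerFF]
    rw [show t - 1 + α = t - (1 - α) by ring]; ring
  · change (t ∈ slitPlaneOne ∧ α ∈ doubleSlit ∧ β ∈ doubleSlit ∧ t ≠ 1 - α) ↔ _
    tauto

theorem entropySum_scale_isValue_iff (ν : ℝ) (C : ℂ) {α β : ℂ} (hα : α ∈ doubleSlit)
    (hβ : β ∈ doubleSlit) (w : ℂ) :
    ((entropySum ν).scale C).IsValue α β w ↔ ∃ w₀ w₁ w₂ w₃ : ℂ,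
      IsKernelValue slitPlaneOne (kerFF ν) (C * legG ν β ^ 2) α β w₀ ∧
      IsKernelValue doubleSlit (kerFG ν) (C * -kerFG ν β) α β w₁ ∧
      IsKernelValue doubleSlit (kerFG ν) (C * -kerFG ν β) (1 - α) (1 - β) w₂ ∧
      IsKernelValue slitPlaneOne (kerFF ν) (C * legF ν β ^ 2) (1 - α) (1 - β) w₃ ∧
      w = w₀ + w₁ + w₂ + w₃ := by
  have key (w : ℂ) := IsKernelValue.scale_iff ν C hα hβ w
  constructor
  · rintro ⟨v, hv, rfl⟩
    exact ⟨v (0 : Fin 4), v (1 : Fin 4), v (2 : Fin 4), v (3 : Fin 4),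
      (key _).1.1 (hv (0 : Fin 4)), (key _).2.1.1 (hv (1 : Fin 4)),
      (key _).2.2.1.1 (hv (2 : Fin 4)), (key _).2.2.2.1 (hv (3 : Fin 4)), Fin.sum_univ_four v⟩
  · rintro ⟨w₀, w₁, w₂, w₃, h0, h1, h2, h3, rfl⟩
    refine ⟨(![w₀, w₁, w₂, w₃] : Fin 4 → ℂ), fun m => ?_, ?_⟩
    · change Fin 4 at m
      fin_cases m
      · exact (key _).1.2 h0
      · exact (key _).2.1.2 h1
      · exact (key _).2.2.1.2 h2
      · exact (key _).2.2.2.2 h3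
    · exact (Fin.sum_univ_four (![w₀, w₁, w₂, w₃] : Fin 4 → ℂ)).symm

theorem FormalIntegralSum.scale_one (S : FormalIntegralSum) : S.scale 1 = S := by
  simp [FormalIntegralSum.scale]

/-! ### The lattice -/

/-- Integral combinations of the three generators of the lattice. -/
noncomputable def latticeVector (ν : ℝ) (n : ℤ × ℤ × ℤ) (α β : ℂ) : ℂ :=
  n.1 * (legF ν α ^ 2 * legG ν β ^ 2) + n.2.1 * (kerFG ν α * kerFG ν β) +
    n.2.2 * (legG ν α ^ 2 * legF ν β ^ 2)

theorem mem_entropyLattice_iff {ν : ℝ} {α β l : ℂ} :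
    l ∈ entropyLattice ν α β ↔ ∃ n, l = latticeVector ν n α β := by
  unfold entropyLattice
  simp only [legendreP_sub_one, legendreP_one_sub]
  constructor
  · intro h
    induction h using AddSubgroup.closure_induction with
    | mem x hx =>
      rcases hx with rfl | rfl | rfl
      · exact ⟨(1, 0, 0), by simp [latticeVector, legG]⟩
      · exact ⟨(0, 1, 0), by simp [latticeVector, legG, kerFG]⟩
      · exact ⟨(0, 0, 1), by simp [latticeVector, legG]⟩
    | zero => exact ⟨(0, 0, 0), by simp [latticeVector]⟩
    | add x y _ _ hx hy =>
      obtain ⟨n, rfl⟩ := hx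
      obtain ⟨m, rfl⟩ := hy
      exact ⟨(n.1 + m.1, n.2.1 + m.2.1, n.2.2 + m.2.2), by simp [latticeVector]; ring⟩
    | neg x _ hx =>
      obtain ⟨n, rfl⟩ := hx
      exact ⟨(-n.1, -n.2.1, -n.2.2), by simp [latticeVector]; ring⟩
  · rintro ⟨n, rfl⟩
    have e : latticeVector ν n α β = n.1 • (legF ν α ^ 2 * legF ν (1 - β) ^ 2) +
        n.2.1 • (legF ν α * legF ν (1 - α) * (legF ν β * legF ν (1 - β))) +
        n.2.2 • (legF ν (1 - α) ^ 2 * legF ν β ^ 2) := by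
      simp [latticeVector, kerFG, legG]
    rw [e]
    refine add_mem (add_mem (zsmul_mem (AddSubgroup.subset_closure ?_) _)
      (zsmul_mem (AddSubgroup.subset_closure ?_) _))
      (zsmul_mem (AddSubgroup.subset_closure ?_) _)
    · exact Or.inl rfl
    · exact Or.inr (Or.inl rfl)
    · exact Or.inr (Or.inr rfl)

theorem entropyLattice_comm (ν : ℝ) (α β : ℂ) : entropyLattice ν α β = entropyLattice ν β α := by
  ext l
  rw [mem_entropyLattice_iff, mem_entropyLattice_iff]
  constructor
  · rintro ⟨n, rfl⟩; exact ⟨(n.2.2, n.2.1, n.1), by simp [latticeVector]; ring⟩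
  · rintro ⟨n, rfl⟩; exact ⟨(n.2.2, n.2.1, n.1), by simp [latticeVector]; ring⟩

theorem EntropyCongr.trans {ν : ℝ} {α β x y z : ℂ} (h : EntropyCongr ν α β x y)
    (h' : EntropyCongr ν α β y z) : EntropyCongr ν α β x z := by
  obtain ⟨l, hl, e⟩ := h
  obtain ⟨l', hl', e'⟩ := h'
  exact ⟨l + l', add_mem hl hl', by linear_combination e + e'⟩

theorem EntropyCongr.sub {ν : ℝ} {α β x y x' y' : ℂ} (h : EntropyCongr ν α β x y)
    (h' : EntropyCongr ν α β x' y') : EntropyCongr ν α β (x - x') (y - y') := by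
  obtain ⟨l, hl, e⟩ := h
  obtain ⟨l', hl', e'⟩ := h'
  exact ⟨l - l', sub_mem hl hl', by linear_combination e - e'⟩

theorem EntropyCongr.swap {ν : ℝ} {α β x y : ℂ} (h : EntropyCongr ν α β x y) :
    EntropyCongr ν β α x y := by
  obtain ⟨l, hl, e⟩ := h
  exact ⟨l, entropyLattice_comm ν α β ▸ hl, e⟩

/-! ### Standard values -/

/-- The arcs with parameters `c` and `c'` are admissible for `S_ν(α‖β)`. -/
structure IsGoodPair (c c' α β : ℂ) : Prop where
  left_mem : α ∈ doubleSlit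
  good : IsGoodArc c β
  ne : ∀ s ∈ Icc (0 : ℝ) 1, arc c β s ≠ α
  good' : IsGoodArc c' (1 - β)
  ne' : ∀ s ∈ Icc (0 : ℝ) 1, arc c' (1 - β) s ≠ 1 - α

/-- The value of `S_ν(α‖β)` along parabolic arcs. -/
noncomputable def entropyValue (ν : ℝ) (c c' α β : ℂ) : ℂ :=
  legG ν β ^ 2 * arcIntegral (kerFF ν) c α β - kerFG ν β * arcIntegral (kerFG ν) c α β -
    kerFG ν β * arcIntegral (kerFG ν) c' (1 - α) (1 - β) +
    legF ν β ^ 2 * arcIntegral (kerFF ν) c' (1 - α) (1 - β)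

theorem exists_isGoodPair {α β : ℂ} (hα : α ∈ doubleSlit) (hβ : β ∈ doubleSlit) (hαβ : α ≠ β) :
    ∃ c c' : ℂ, IsGoodPair c c' α β := by
  obtain ⟨c, -, h1, h2⟩ := exists_isGoodArc hα hβ hαβ
  obtain ⟨c', -, h1', h2'⟩ := exists_isGoodArc (one_sub_mem_doubleSlit hα)
    (one_sub_mem_doubleSlit hβ) (fun h => hαβ (sub_right_injective h))
  exact ⟨c, c', hα, h1, h2, h1', h2'⟩

theorem eventually_arc_ne' {c : ℂ} {α β : ℂ} (h : ∀ s ∈ Icc (0 : ℝ) 1, arc c β s ≠ α) :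
    ∀ᶠ p : ℂ × ℂ in nhds (α, β), ∀ s ∈ Icc (0 : ℝ) 1, arc c p.2 s ≠ p.1 := by
  obtain ⟨δ, hδ, hev⟩ := eventually_arc_ne h
  filter_upwards [hev] with p hp s hs h0
  have := hp s hs
  rw [h0, sub_self, norm_zero] at this
  linarith

/-- Keeping the shapes c, c' fixed while the parameters vary is what produces local holomorphic
branches. -/
theorem IsGoodPair.eventually {c c' α β : ℂ} (h : IsGoodPair c c' α β) :
    ∀ᶠ p : ℂ × ℂ in nhds (α, β), IsGoodPair c c' p.1 p.2 := by
  have h2 : Filter.Tendsto (fun p : ℂ × ℂ => (1 - p.1, 1 - p.2)) (nhds (α, β))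
      (nhds (1 - α, 1 - β)) := Continuous.tendsto (by fun_prop) (α, β)
  filter_upwards [continuous_fst.continuousAt.eventually_mem (isOpen_doubleSlit.mem_nhds h.left_mem),
    continuous_snd.continuousAt.eventually h.good.eventually, eventually_arc_ne' h.ne,
    ((Continuous.tendsto (by fun_prop : Continuous fun p : ℂ × ℂ => 1 - p.2) (α, β))).eventually
      h.good'.eventually, h2.eventually (eventually_arc_ne' h.ne')] with p k1 k2 k3 k4 k5
  exact ⟨k1, k2, k3, k4, k5⟩

theorem IsGoodPair.ne_self {c c' α β : ℂ} (h : IsGoodPair c c' α β) : α ≠ β := by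
  simpa using (h.ne 1 (by simp)).symm

theorem IsGoodArc.isKernelValue {U : Set ℂ} {h : ℂ → ℂ} {c α β : ℂ} (hU : IsMildAtZero U h)
    (hD : doubleSlit ⊆ U) (hg : IsGoodArc c β) (hne : ∀ s ∈ Icc (0 : ℝ) 1, arc c β s ≠ α) (κ : ℂ) :
    IsKernelValue U h κ α β (κ * arcIntegral h c α β) :=
  ⟨arc c β, hg.isPathIn hD hne, hU.intervalIntegrable_arc hD hg hne κ,
    (integral_arc_eq h κ c α β).symm⟩

theorem IsGoodPair.isValue {ν : ℝ} (hν : -1 < ν ∧ ν < 0) (C : ℂ) {c c' α β : ℂ}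
    (h : IsGoodPair c c' α β) :
    ((entropySum ν).scale C).IsValue α β (C * entropyValue ν c c' α β) := by
  rw [entropySum_scale_isValue_iff ν C h.left_mem h.good.1]
  refine ⟨_, _, _, _,
    IsGoodArc.isKernelValue (isMildAtZero_kerFF hν) doubleSlit_subset_slitPlaneOne h.good h.ne _,
    IsGoodArc.isKernelValue (isMildAtZero_kerFG hν) subset_rfl h.good h.ne _,
    IsGoodArc.isKernelValue (isMildAtZero_kerFG hν) subset_rfl h.good' h.ne' _,
    IsGoodArc.isKernelValue (isMildAtZero_kerFF hν) doubleSlit_subset_slitPlaneOne h.good' h.ne' _,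
    ?_⟩
  unfold entropyValue
  ring

/-- Each summand is ambiguous by 2πi times an integer times its prefactor and its kernel at the
pole. These products are precisely the generators of the lattice. -/
theorem IsGoodPair.exists_eq_of_isValue {ν : ℝ} (hν : -1 < ν ∧ ν < 0) (C : ℂ) {c c' α β : ℂ}
    (h : IsGoodPair c c' α β) {w : ℂ} (hw : ((entropySum ν).scale C).IsValue α β w) :
    ∃ n, w = C * (entropyValue ν c c' α β +
      2 * (Real.pi : ℂ) * Complex.I * latticeVector ν n α β) := by
  rw [entropySum_scale_isValue_iff ν C h.left_mem h.good.1] at hw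
  obtain ⟨w₀, w₁, w₂, w₃, ⟨γ₀, p₀, i₀, rfl⟩, ⟨γ₁, p₁, i₁, rfl⟩, ⟨γ₂, p₂, i₂, rfl⟩,
    ⟨γ₃, p₃, i₃, rfl⟩, rfl⟩ := hw
  have hα' := one_sub_mem_doubleSlit h.left_mem
  obtain ⟨n₀, e₀⟩ := (isMildAtZero_kerFF hν).exists_int_pathIntegral_eq
    doubleSlit_subset_slitPlaneOne h.good h.left_mem h.ne p₀ i₀
  obtain ⟨n₁, e₁⟩ := (isMildAtZero_kerFG hν).exists_int_pathIntegral_eq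
    subset_rfl h.good h.left_mem h.ne p₁ i₁
  obtain ⟨n₂, e₂⟩ := (isMildAtZero_kerFG hν).exists_int_pathIntegral_eq
    subset_rfl h.good' hα' h.ne' p₂ i₂
  obtain ⟨n₃, e₃⟩ := (isMildAtZero_kerFF hν).exists_int_pathIntegral_eq
    doubleSlit_subset_slitPlaneOne h.good' hα' h.ne' p₃ i₃
  -- The two mixed integrals carry the prefactor -FG(β) and the same residue, since FG is invariant
  -- under t ↦ 1 - t; both therefore contribute to the middle generator.
  refine ⟨(n₀, -n₁ - n₂, n₃), ?_⟩
  rw [e₀, e₁, e₂, e₃, kerFG_one_sub, kerFF_one_sub]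
  unfold entropyValue latticeVector
  simp only [kerFF]
  push_cast
  ring

theorem entropySum_isValue_congr {ν : ℝ} (hν : -1 < ν ∧ ν < 0) {α β : ℂ} (hα : α ∈ doubleSlit)
    (hβ : β ∈ doubleSlit) (hαβ : α ≠ β) :
    (∃ s, (entropySum ν).IsValue α β s) ∧
      ∀ s s', (entropySum ν).IsValue α β s → (entropySum ν).IsValue α β s' →
        EntropyCongr ν α β s s' := by
  obtain ⟨c, c', h⟩ := exists_isGoodPair hα hβ hαβ
  rw [← FormalIntegralSum.scale_one (entropySum ν)]
  refine ⟨⟨_, h.isValue hν 1⟩, fun s s' hs hs' => ?_⟩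
  obtain ⟨n, rfl⟩ := h.exists_eq_of_isValue hν 1 hs
  obtain ⟨n', rfl⟩ := h.exists_eq_of_isValue hν 1 hs'
  refine ⟨_, sub_mem (mem_entropyLattice_iff.2 ⟨n, rfl⟩) (mem_entropyLattice_iff.2 ⟨n', rfl⟩), ?_⟩
  ring

/-! ### Analytic dependence of the standard values -/

theorem IsGoodPair.differentiableAt_left {ν : ℝ} (hν : -1 < ν ∧ ν < 0) {c c' α β : ℂ}
    (h : IsGoodPair c c' α β) : DifferentiableAt ℂ (fun a => entropyValue ν c c' a β) α := by
  have hFF := isMildAtZero_kerFF hν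
  have hFG := isMildAtZero_kerFG hν
  have hs : DifferentiableAt ℂ (fun a : ℂ => 1 - a) α := by fun_prop
  have d0 := hFF.differentiableAt_arcIntegral_left doubleSlit_subset_slitPlaneOne h.good h.ne
  have d1 := hFG.differentiableAt_arcIntegral_left subset_rfl h.good h.ne
  have d2 := (hFG.differentiableAt_arcIntegral_left subset_rfl h.good' h.ne').comp α hs
  have d3 := (hFF.differentiableAt_arcIntegral_left doubleSlit_subset_slitPlaneOne h.good'
    h.ne').comp α hs
  exact (((d0.const_mul _).sub (d1.const_mul _)).sub (d2.const_mul _)).add (d3.const_mul _)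

theorem IsGoodPair.hasDerivAt_right {ν : ℝ} (hν : -1 < ν ∧ ν < 0) {c c' α β : ℂ}
    (h : IsGoodPair c c' α β) :
    HasDerivAt (fun b => arcIntegral (kerFF ν) c α b) (legF ν β ^ 2 / (β - α)) β ∧
    HasDerivAt (fun b => arcIntegral (kerFG ν) c α b) (kerFG ν β / (β - α)) β ∧
    HasDerivAt (fun b => arcIntegral (kerFG ν) c' (1 - α) (1 - b)) (kerFG ν β / (β - α)) β ∧
    HasDerivAt (fun b => arcIntegral (kerFF ν) c' (1 - α) (1 - b)) (legG ν β ^ 2 / (β - α)) β := by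
  have hFF := isMildAtZero_kerFF hν
  have hFG := isMildAtZero_kerFG hν
  have hα' := one_sub_mem_doubleSlit h.left_mem
  have hs : HasDerivAt (fun b : ℂ => 1 - b) (-1) β := by
    simpa using (hasDerivAt_id β).const_sub 1
  have hne := sub_ne_zero.2 h.ne_self.symm
  have hne' : (1 - β) - (1 - α) ≠ 0 := by
    intro h0; apply hne; linear_combination -h0
  refine ⟨hFF.hasDerivAt_arcIntegral_right doubleSlit_subset_slitPlaneOne h.good h.left_mem h.ne,
    hFG.hasDerivAt_arcIntegral_right subset_rfl h.good h.left_mem h.ne, ?_, ?_⟩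
  · refine (HasDerivAt.comp (h₂ := arcIntegral (kerFG ν) c' (1 - α)) β
      (hFG.hasDerivAt_arcIntegral_right subset_rfl h.good' hα' h.ne') hs).congr_deriv ?_
    rw [kerFG_one_sub]
    field_simp
    ring
  · refine (HasDerivAt.comp (h₂ := arcIntegral (kerFF ν) c' (1 - α)) β
      (hFF.hasDerivAt_arcIntegral_right doubleSlit_subset_slitPlaneOne h.good' hα' h.ne')
      hs).congr_deriv ?_
    rw [kerFF_one_sub]
    field_simp
    ring

theorem differentiableAt_legF {ν : ℝ} (hν : -1 < ν ∧ ν < 0) {t : ℂ} (ht : t ∈ doubleSlit) :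
    DifferentiableAt ℂ (legF ν) t :=
  (hasDerivAt_legF hν (doubleSlit_subset_slitPlaneOne ht)).differentiableAt

theorem differentiableAt_legG {ν : ℝ} (hν : -1 < ν ∧ ν < 0) {t : ℂ} (ht : t ∈ doubleSlit) :
    DifferentiableAt ℂ (legG ν) t :=
  (hasDerivAt_legG hν (doubleSlit_subset_slitPlane ht)).differentiableAt

theorem IsGoodPair.differentiableAt_right {ν : ℝ} (hν : -1 < ν ∧ ν < 0) {c c' α β : ℂ}
    (h : IsGoodPair c c' α β) : DifferentiableAt ℂ (fun b => entropyValue ν c c' α b) β := by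
  obtain ⟨d0, d1, d2, d3⟩ := h.hasDerivAt_right hν
  have hF := differentiableAt_legF hν h.good.1
  have hG := differentiableAt_legG hν h.good.1
  have hFG : DifferentiableAt ℂ (kerFG ν) β := hF.mul hG
  exact ((((hG.pow 2).mul d0.differentiableAt).sub (hFG.mul d1.differentiableAt)).sub
    (hFG.mul d2.differentiableAt)).add ((hF.pow 2).mul d3.differentiableAt)

/-! ### Analytic functions with values in a lattice -/

/-- Countably many zero sets cover a disc, which is uncountable, so one of them is uncountable
inside a compact disc and has an accumulation point there. The identity theorem applies to that
function. This lets an integer vector chosen point by point be taken constant. -/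
theorem exists_forall_eq_of_forall_exists_eq {ι : Type*} [Countable ι] {N V : Set ℂ}
    {F : ι → ℂ → ℂ} (hN : IsOpen N) (hNc : IsPreconnected N)
    (hF : ∀ i, DifferentiableOn ℂ (F i) N) (hV : IsOpen V) (hVne : V.Nonempty) (hVN : V ⊆ N)
    (h : ∀ a ∈ V, ∃ i, F i a = 0) : ∃ i, ∀ a ∈ N, F i a = 0 := by
  obtain ⟨a, ha⟩ := hVne
  obtain ⟨r, hr, hb⟩ := Metric.nhds_basis_closedBall.mem_iff.1 (hV.mem_nhds ha)
  set K := Metric.closedBall a r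
  obtain ⟨i, hi⟩ : ∃ i, ¬ (K ∩ {z | F i z = 0}).Countable := by
    by_contra! hcon
    have hK : (⋃ i, K ∩ {z | F i z = 0}).Countable := countable_iUnion hcon
    obtain ⟨z, hz, hz'⟩ := (hK.dense_compl ℝ).inter_open_nonempty (Metric.ball a r)
      Metric.isOpen_ball ⟨a, Metric.mem_ball_self hr⟩
    obtain ⟨i, hi⟩ := h z (hb (Metric.ball_subset_closedBall hz))
    exact hz' (mem_iUnion.2 ⟨i, Metric.ball_subset_closedBall hz, hi⟩)
  obtain ⟨x, hxK, hx⟩ := (Set.Infinite.mono subset_rfl fun hf => hi (Set.Finite.countable hf) :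
    (K ∩ {z | F i z = 0}).Infinite).exists_accPt_of_subset_isCompact
      (isCompact_closedBall a r) inter_subset_left
  refine ⟨i, fun z hz => ((hF i).analyticOnNhd hN).eqOn_zero_of_preconnected_of_frequently_eq_zero
    hNc (hVN (hb hxK)) ?_ hz⟩
  exact (accPt_iff_frequently_nhdsNE.1 hx).mono fun z hz => hz.2

theorem isPreconnected_ball_diff_singleton (b : ℂ) (r : ℝ) :
    IsPreconnected (Metric.ball b r \ {b}) := by
  have h1 : IsPreconnected (Ioo (0 : ℝ) r ×ˢ (univ : Set ℝ)) :=
    isPreconnected_Ioo.prod isPreconnected_univ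
  have h2 : Metric.ball b r \ {b} =
      (fun p : ℝ × ℝ => b + p.1 * Complex.exp (p.2 * Complex.I)) '' (Ioo (0 : ℝ) r ×ˢ univ) := by
    ext z
    constructor
    · rintro ⟨h, h'⟩
      refine ⟨(‖z - b‖, (z - b).arg), ⟨⟨norm_pos_iff.2 (sub_ne_zero.2 h'), ?_⟩, mem_univ _⟩, ?_⟩
      · rwa [← mem_ball_iff_norm]
      · simp [Complex.norm_mul_exp_arg_mul_I]
    · rintro ⟨⟨ρ, θ⟩, ⟨⟨h, h'⟩, -⟩, rfl⟩
      dsimp only at h h' ⊢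
      have hn : ‖(ρ : ℂ) * Complex.exp (θ * Complex.I)‖ = ρ := by
        rw [norm_mul, Complex.norm_exp_ofReal_mul_I, Complex.norm_real, Real.norm_of_nonneg h.le,
          mul_one]
      refine ⟨?_, ?_⟩
      · rw [mem_ball_iff_norm, add_sub_cancel_left, hn]; exact h'
      · intro h0
        rw [mem_singleton_iff, add_eq_left] at h0
        rw [h0, norm_zero] at hn
        exact h.ne hn
  rw [h2]
  exact h1.image _ (by fun_prop)

/-- A punctured disc around b is connected, so in a separation it lies in one of the two pieces;
putting b back into that piece would separate U itself. -/
theorem isPreconnected_diff_singleton {U : Set ℂ} (hU : IsOpen U) (hc : IsPreconnected U) (b : ℂ) :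
    IsPreconnected (U \ {b}) := by
  by_cases hb : b ∈ U
  swap
  · rwa [sdiff_singleton_eq_self hb]
  obtain ⟨r, hr, hB⟩ := Metric.isOpen_iff.1 hU b hb
  have key : ∀ u v : Set ℂ, IsOpen u → IsOpen v → U \ {b} ⊆ u ∪ v →
      (U \ {b} ∩ v).Nonempty → Metric.ball b r \ {b} ⊆ u → (U \ {b} ∩ (u ∩ v)).Nonempty := by
    intro u v hu hv huv ⟨x, hx, hxv⟩ hBu
    have hsub : U ⊆ (u ∪ Metric.ball b r) ∪ v \ {b} := by
      intro z hz
      by_cases hzb : z = b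
      · exact Or.inl (Or.inr (hzb ▸ Metric.mem_ball_self hr))
      · rcases huv ⟨hz, hzb⟩ with h | h
        · exact Or.inl (Or.inl h)
        · exact Or.inr ⟨h, hzb⟩
    obtain ⟨y, hyU, hy⟩ := hc (u ∪ Metric.ball b r) (v \ {b}) (hu.union Metric.isOpen_ball)
      (hv.sdiff isClosed_singleton) hsub ⟨b, hb, Or.inr (Metric.mem_ball_self hr)⟩
      ⟨x, hx.1, hxv, hx.2⟩
    refine ⟨y, ⟨hyU, hy.2.2⟩, ?_, hy.2.1⟩
    rcases hy.1 with h | h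
    · exact h
    · exact hBu ⟨h, hy.2.2⟩
  intro u v hu hv huv hxu hxv
  have hBB : Metric.ball b r \ {b} ⊆ U \ {b} := sdiff_subset_sdiff_left hB
  by_cases h1 : (Metric.ball b r \ {b} ∩ u).Nonempty
  · by_cases h2 : (Metric.ball b r \ {b} ∩ v).Nonempty
    · exact (isPreconnected_ball_diff_singleton b r u v hu hv (hBB.trans huv) h1 h2).mono
        (inter_subset_inter_left _ hBB)
    · refine key u v hu hv huv hxv fun z hz => (huv (hBB hz)).resolve_right fun h => h2 ⟨z, hz, h⟩
  · rw [inter_comm u v]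
    refine key v u hv hu (by rwa [union_comm]) hxu fun z hz =>
      (huv (hBB hz)).resolve_left fun h => h1 ⟨z, hz, h⟩

/-- The continuation principle: the interior of the set where P holds is open by construction and
relatively closed by the local hypothesis. -/
theorem IsPreconnected.forall_of_local_propagation {U W : Set ℂ} (hc : IsPreconnected U)
    {P : ℂ → Prop} (hloc : ∀ a ∈ U, ∃ r > 0, Metric.ball a r ⊆ U ∧ ∀ V ⊆ Metric.ball a r,
      IsOpen V → V.Nonempty → (∀ v ∈ V, P v) → ∀ x ∈ Metric.ball a r, P x)
    (hW : IsOpen W) (hWne : W.Nonempty) (hWU : W ⊆ U) (hWP : ∀ w ∈ W, P w) : ∀ a ∈ U, P a := by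
  have h1 : W ⊆ interior {a | P a} := hW.subset_interior_iff.2 hWP
  obtain ⟨w, hw⟩ := hWne
  have h2 := hc.subset_of_closure_inter_subset isOpen_interior ⟨w, hWU hw, h1 hw⟩ ?_
  · exact fun a ha => interior_subset (h2 ha)
  · rintro a ⟨ha, haU⟩
    obtain ⟨r, hr, -, hprop⟩ := hloc a haU
    obtain ⟨x, hx, hx'⟩ := mem_closure_iff.1 ha _ Metric.isOpen_ball (Metric.mem_ball_self hr)
    have h3 := hprop (Metric.ball a r ∩ interior {a | P a}) inter_subset_left
      (Metric.isOpen_ball.inter isOpen_interior) ⟨x, hx, hx'⟩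
      (fun v hv => interior_subset hv.2)
    exact mem_interior.2 ⟨_, h3, Metric.isOpen_ball, Metric.mem_ball_self hr⟩

/-! ### Propagation of the reciprocity -/

/-- The reciprocity relation at `(α, β)`. -/
def IsReciprocal (ν : ℝ) (α β : ℂ) : Prop :=
  ∀ s s', (entropySum ν).IsValue α β s → (entropySum ν).IsValue β α s' →
    EntropyCongr ν α β (s - s') (reciprocityTerm ν α β)

theorem reciprocityTerm_eq {ν : ℝ} (α β : ℂ) :
    reciprocityTerm ν α β = ((legF ν α ^ 2 + legG ν α ^ 2) * kerFG ν β -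
      (legF ν β ^ 2 + legG ν β ^ 2) * kerFG ν α) / (2 * (legC ν : ℂ)) := by
  have h : ((Real.pi / (2 * Real.sin (ν * Real.pi)) : ℝ) : ℂ) = 1 / (2 * (legC ν : ℂ)) := by
    rw [legC]; push_cast; rw [← mul_div_assoc, one_div_div]
  simp only [reciprocityTerm, legendreP_sub_one, legendreP_one_sub, kerFG, legG, h]
  ring

theorem IsReciprocal.symm {ν : ℝ} {α β : ℂ} (h : IsReciprocal ν α β) : IsReciprocal ν β α := by
  intro s s' hs hs'
  obtain ⟨l, hl, e⟩ := h s' s hs' hs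
  refine ⟨-l, neg_mem (entropyLattice_comm ν α β ▸ hl), ?_⟩
  have : reciprocityTerm ν β α = -reciprocityTerm ν α β := by
    rw [reciprocityTerm_eq, reciprocityTerm_eq]; ring
  rw [this]
  linear_combination -e

/-- The defect of the reciprocity for the values along given arcs. -/
noncomputable def entropyDefect (ν : ℝ) (c c' d d' α β : ℂ) : ℂ :=
  entropyValue ν c c' α β - entropyValue ν d d' β α - reciprocityTerm ν α β

/-- By the congruence of values a single choice of arcs decides the matter, and reciprocity becomes
the vanishing of one member of a countable family of holomorphic functions. -/
theorem isReciprocal_iff {ν : ℝ} (hν : -1 < ν ∧ ν < 0) {c c' d d' α β : ℂ}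
    (h : IsGoodPair c c' α β) (h' : IsGoodPair d d' β α) :
    IsReciprocal ν α β ↔ ∃ n, entropyDefect ν c c' d d' α β -
      2 * (Real.pi : ℂ) * Complex.I * latticeVector ν n α β = 0 := by
  have hv := h.isValue hν 1
  have hv' := h'.isValue hν 1
  rw [FormalIntegralSum.scale_one, one_mul] at hv hv'
  constructor
  · intro hr
    obtain ⟨l, hl, e⟩ := hr _ _ hv hv'
    obtain ⟨n, rfl⟩ := mem_entropyLattice_iff.1 hl
    exact ⟨n, by rw [entropyDefect]; linear_combination e⟩
  · rintro ⟨n, e⟩ s s' hs hs'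
    have e1 := (entropySum_isValue_congr hν h.left_mem h.good.1 h.ne_self).2 _ _ hs hv
    have e2 := ((entropySum_isValue_congr hν h'.left_mem h'.good.1 h'.ne_self).2 _ _ hs' hv').swap
    refine (e1.sub e2).trans ⟨latticeVector ν n α β, mem_entropyLattice_iff.2 ⟨n, rfl⟩, ?_⟩
    rw [entropyDefect] at e
    linear_combination e

theorem differentiableAt_latticeVector {ν : ℝ} (hν : -1 < ν ∧ ν < 0) (n : ℤ × ℤ × ℤ) {α : ℂ}
    (hα : α ∈ doubleSlit) (β : ℂ) : DifferentiableAt ℂ (fun a => latticeVector ν n a β) α := by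
  have hF := differentiableAt_legF hν hα
  have hG := differentiableAt_legG hν hα
  unfold latticeVector kerFG
  fun_prop

theorem differentiableAt_reciprocityTerm {ν : ℝ} (hν : -1 < ν ∧ ν < 0) {α : ℂ}
    (hα : α ∈ doubleSlit) (β : ℂ) : DifferentiableAt ℂ (fun a => reciprocityTerm ν a β) α := by
  have hF := differentiableAt_legF hν hα
  have hG := differentiableAt_legG hν hα
  simp only [reciprocityTerm_eq, kerFG]
  fun_prop

theorem IsGoodPair.eventually_left {c c' α β : ℂ} (h : IsGoodPair c c' α β) :
    ∀ᶠ a in nhds α, IsGoodPair c c' a β :=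
  (Continuous.tendsto (by fun_prop : Continuous fun a : ℂ => (a, β)) α).eventually h.eventually

theorem IsGoodPair.eventually_right {c c' α β : ℂ} (h : IsGoodPair c c' α β) :
    ∀ᶠ b in nhds β, IsGoodPair c c' α b :=
  (Continuous.tendsto (by fun_prop : Continuous fun b : ℂ => (α, b)) β).eventually h.eventually

/-- On a small ball the arcs can be kept fixed, so the integer vector is constant there and
vanishing spreads from an open subset to the ball; connectedness of the punctured double slit plane
then spreads it everywhere. -/
theorem isReciprocal_of_isOpen {ν : ℝ} (hν : -1 < ν ∧ ν < 0) {β : ℂ} (hβ : β ∈ doubleSlit)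
    {W : Set ℂ} (hW : IsOpen W) (hWne : W.Nonempty) (hWD : W ⊆ doubleSlit \ {β})
    (hWr : ∀ a ∈ W, IsReciprocal ν a β) : ∀ a ∈ doubleSlit \ {β}, IsReciprocal ν a β := by
  refine (isPreconnected_diff_singleton isOpen_doubleSlit isPreconnected_doubleSlit
    β).forall_of_local_propagation (fun a ha => ?_) hW hWne hWD hWr
  obtain ⟨c, c', h⟩ := exists_isGoodPair ha.1 hβ ha.2
  obtain ⟨d, d', h'⟩ := exists_isGoodPair hβ ha.1 (Ne.symm ha.2)
  obtain ⟨r, hr, hb⟩ := Metric.eventually_nhds_iff_ball.1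
    (h.eventually_left.and h'.eventually_right)
  refine ⟨r, hr, fun x hx => ⟨(hb x hx).1.left_mem, (hb x hx).1.ne_self⟩,
    fun V hVb hV hVne hP => ?_⟩
  set F : ℤ × ℤ × ℤ → ℂ → ℂ := fun n x => entropyDefect ν c c' d d' x β -
    2 * (Real.pi : ℂ) * Complex.I * latticeVector ν n x β
  have hF : ∀ n, DifferentiableOn ℂ (F n) (Metric.ball a r) := by
    intro n x hx
    obtain ⟨k, k'⟩ := hb x hx
    exact ((((k.differentiableAt_left hν).sub (k'.differentiableAt_right hν)).sub
      (differentiableAt_reciprocityTerm hν k.left_mem β)).sub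
      ((differentiableAt_latticeVector hν n k.left_mem β).const_mul _)).differentiableWithinAt
  obtain ⟨n, hn⟩ := exists_forall_eq_of_forall_exists_eq Metric.isOpen_ball
    (convex_ball a r).isPreconnected hF hV hVne hVb
    (fun x hx => (isReciprocal_iff hν (hb x (hVb hx)).1 (hb x (hVb hx)).2).1 (hP x hx))
  exact fun x hx => (isReciprocal_iff hν (hb x hx).1 (hb x hx).2).2 ⟨n, hn x hx⟩

/-- The reciprocity everywhere follows from the reciprocity for `α` in the upper and `β` in the
lower half plane. -/
theorem isReciprocal_of_half_planes {ν : ℝ} (hν : -1 < ν ∧ ν < 0)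
    (h : ∀ α β : ℂ, 0 < α.im → β.im < 0 → IsReciprocal ν α β) {α β : ℂ} (hα : α ∈ doubleSlit)
    (hβ : β ∈ doubleSlit) (hαβ : α ≠ β) : IsReciprocal ν α β := by
  have hI : IsOpen {z : ℂ | 0 < z.im} := isOpen_lt continuous_const Complex.continuous_im
  have hI' : IsOpen {z : ℂ | z.im < 0} := isOpen_lt Complex.continuous_im continuous_const
  -- First α is freed with β kept in the lower half plane. The antisymmetry of the relation then
  -- exchanges the roles and frees the other variable.
  have step : ∀ α β : ℂ, β.im < 0 → α ∈ doubleSlit \ {β} → IsReciprocal ν α β := by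
    intro α β hβ hα
    refine isReciprocal_of_isOpen hν (Or.inl hβ.ne) hI ⟨Complex.I, by simp⟩ (fun z hz => ?_)
      (fun z hz => h z β hz hβ) α hα
    have hz' : 0 < z.im := hz
    refine ⟨Or.inl hz'.ne', ?_⟩
    rintro rfl
    exact lt_asymm hz' hβ
  refine isReciprocal_of_isOpen hν hβ (W := {z : ℂ | z.im < 0} \ {β})
    (hI'.sdiff isClosed_singleton) ?_ (fun z hz => ⟨Or.inl (ne_of_lt hz.1), hz.2⟩)
    (fun z hz => (step β z hz.1 ⟨hβ, fun h => hz.2 h.symm⟩).symm) α ⟨hα, hαβ⟩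
  by_cases hb : β = -Complex.I
  · exact ⟨-2 * Complex.I, by simp, by rw [hb]; intro h; have := congrArg Complex.im h; norm_num at this⟩
  · exact ⟨-Complex.I, by simp, fun h => hb h.symm⟩

/-! ### The symmetric square of Legendre's equation -/

/-- The value at `t` of the symmetric square of Legendre's operator, applied to a function with
the given value and derivatives at `t`. -/
noncomputable def symSq (ν : ℝ) (t y y₁ y₂ y₃ : ℂ) : ℂ :=
  (t * (1 - t)) ^ 2 * y₃ + 3 * (t * (1 - t)) * (1 - 2 * t) * y₂ +
    (1 + (4 * (ν * (ν + 1)) - 6) * (t * (1 - t))) * y₁ + 2 * (ν * (ν + 1)) * (1 - 2 * t) * y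

/-- `y₁, y₂, y₃` are the first three derivatives of `y` on `U`. -/
structure HasJet (U : Set ℂ) (y y₁ y₂ y₃ : ℂ → ℂ) : Prop where
  h₀ : ∀ t ∈ U, HasDerivAt y (y₁ t) t
  h₁ : ∀ t ∈ U, HasDerivAt y₁ (y₂ t) t
  h₂ : ∀ t ∈ U, HasDerivAt y₂ (y₃ t) t

theorem HasJet.mono {U V : Set ℂ} {y y₁ y₂ y₃ : ℂ → ℂ} (h : HasJet U y y₁ y₂ y₃) (hVU : V ⊆ U) :
    HasJet V y y₁ y₂ y₃ :=
  ⟨fun t ht => h.h₀ t (hVU ht), fun t ht => h.h₁ t (hVU ht), fun t ht => h.h₂ t (hVU ht)⟩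

theorem HasJet.add {U : Set ℂ} {y y₁ y₂ y₃ z z₁ z₂ z₃ : ℂ → ℂ} (h : HasJet U y y₁ y₂ y₃)
    (k : HasJet U z z₁ z₂ z₃) :
    HasJet U (fun t => y t + z t) (fun t => y₁ t + z₁ t) (fun t => y₂ t + z₂ t)
      (fun t => y₃ t + z₃ t) :=
  ⟨fun t ht => (h.h₀ t ht).add (k.h₀ t ht), fun t ht => (h.h₁ t ht).add (k.h₁ t ht),
    fun t ht => (h.h₂ t ht).add (k.h₂ t ht)⟩

theorem HasJet.const_mul {U : Set ℂ} {y y₁ y₂ y₃ : ℂ → ℂ} (h : HasJet U y y₁ y₂ y₃) (c : ℂ) :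
    HasJet U (fun t => c * y t) (fun t => c * y₁ t) (fun t => c * y₂ t) (fun t => c * y₃ t) :=
  ⟨fun t ht => (h.h₀ t ht).const_mul c, fun t ht => (h.h₁ t ht).const_mul c,
    fun t ht => (h.h₂ t ht).const_mul c⟩

theorem HasJet.sub {U : Set ℂ} {y y₁ y₂ y₃ z z₁ z₂ z₃ : ℂ → ℂ} (h : HasJet U y y₁ y₂ y₃)
    (k : HasJet U z z₁ z₂ z₃) :
    HasJet U (fun t => y t - z t) (fun t => y₁ t - z₁ t) (fun t => y₂ t - z₂ t)
      (fun t => y₃ t - z₃ t) :=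
  ⟨fun t ht => (h.h₀ t ht).sub (k.h₀ t ht), fun t ht => (h.h₁ t ht).sub (k.h₁ t ht),
    fun t ht => (h.h₂ t ht).sub (k.h₂ t ht)⟩

theorem HasJet.one_sub {U : Set ℂ} {y y₁ y₂ y₃ : ℂ → ℂ} (h : HasJet U y y₁ y₂ y₃) :
    HasJet {t | 1 - t ∈ U} (fun t => y (1 - t)) (fun t => -y₁ (1 - t)) (fun t => y₂ (1 - t))
      (fun t => -y₃ (1 - t)) := by
  have hs (t : ℂ) : HasDerivAt (fun b : ℂ => 1 - b) (-1) t := by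
    simpa using (hasDerivAt_id t).const_sub 1
  refine ⟨fun t ht => ?_, fun t ht => ?_, fun t ht => ?_⟩
  · exact (HasDerivAt.comp (h₂ := y) t (h.h₀ _ ht) (hs t)).congr_deriv (by ring)
  · exact (HasDerivAt.comp (h₂ := y₁) t (h.h₁ _ ht) (hs t)).neg.congr_deriv (by ring)
  · exact (HasDerivAt.comp (h₂ := y₂) t (h.h₂ _ ht) (hs t)).congr_deriv (by ring)

theorem HasJet.iteratedDeriv_eq {U : Set ℂ} {y y₁ y₂ y₃ : ℂ → ℂ} (hU : IsOpen U)
    (h : HasJet U y y₁ y₂ y₃) {t : ℂ} (ht : t ∈ U) :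
    iteratedDeriv 1 y t = y₁ t ∧ iteratedDeriv 2 y t = y₂ t ∧ iteratedDeriv 3 y t = y₃ t := by
  have e1 : ∀ s ∈ U, deriv y s = y₁ s := fun s hs => (h.h₀ s hs).deriv
  have e2 : ∀ s ∈ U, deriv (deriv y) s = y₂ s := fun s hs => by
    rw [Filter.EventuallyEq.deriv_eq (Filter.eventually_of_mem (hU.mem_nhds hs) e1)]
    exact (h.h₁ s hs).deriv
  have e3 : ∀ s ∈ U, deriv (deriv (deriv y)) s = y₃ s := fun s hs => by
    rw [Filter.EventuallyEq.deriv_eq (Filter.eventually_of_mem (hU.mem_nhds hs) e2)]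
    exact (h.h₂ s hs).deriv
  simp only [iteratedDeriv_succ, iteratedDeriv_zero]
  exact ⟨e1 t ht, e2 t ht, e3 t ht⟩

/-- A solution `u` of Legendre's equation on `U`, with its derivative `u₁`. -/
structure IsLegendreSol (ν : ℝ) (U : Set ℂ) (u u₁ : ℂ → ℂ) : Prop where
  h₀ : ∀ t ∈ U, HasDerivAt u (u₁ t) t
  h₁ : ∀ t ∈ U, HasDerivAt u₁ (-((1 - 2 * t) * u₁ t + ν * (ν + 1) * u t) / (t * (1 - t))) t

theorem mul_one_sub_ne_zero {t : ℂ} (ht : t ∈ doubleSlit) : t * (1 - t) ≠ 0 :=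
  mul_ne_zero (Complex.slitPlane_ne_zero (doubleSlit_subset_slitPlane ht))
    (Complex.slitPlane_ne_zero (doubleSlit_subset_slitPlane (one_sub_mem_doubleSlit ht)))

theorem isLegendreSol_legF {ν : ℝ} (hν : -1 < ν ∧ ν < 0) :
    IsLegendreSol ν doubleSlit (legF ν) (legF₁ ν) := by
  refine ⟨fun t ht => hasDerivAt_legF hν (doubleSlit_subset_slitPlaneOne ht), fun t ht =>
    (hasDerivAt_legF₁ hν (doubleSlit_subset_slitPlaneOne ht)).congr_deriv ?_⟩
  rw [eq_div_iff (mul_one_sub_ne_zero ht)]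
  linear_combination legF_ode hν (doubleSlit_subset_slitPlaneOne ht)

theorem isLegendreSol_legG {ν : ℝ} (hν : -1 < ν ∧ ν < 0) :
    IsLegendreSol ν doubleSlit (legG ν) (legG₁ ν) := by
  refine ⟨fun t ht => hasDerivAt_legG hν (doubleSlit_subset_slitPlane ht), fun t ht =>
    (hasDerivAt_legG₁ hν (doubleSlit_subset_slitPlane ht)).congr_deriv ?_⟩
  rw [eq_div_iff (mul_one_sub_ne_zero ht)]
  linear_combination legG_ode hν (doubleSlit_subset_slitPlane ht)

/-- The derivative of a product of solutions. -/
noncomputable def prodJet₁ (u u₁ v v₁ : ℂ → ℂ) (t : ℂ) : ℂ := u₁ t * v t + u t * v₁ t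

/-- The second derivative of a product of solutions. -/
noncomputable def prodJet₂ (ν : ℝ) (u u₁ v v₁ : ℂ → ℂ) (t : ℂ) : ℂ :=
  2 * (u₁ t * v₁ t) -
    ((1 - 2 * t) * (u₁ t * v t + u t * v₁ t) + 2 * (ν * (ν + 1)) * (u t * v t)) / (t * (1 - t))

/-- The third derivative of a product of solutions. -/
noncomputable def prodJet₃ (ν : ℝ) (u u₁ v v₁ : ℂ → ℂ) (t : ℂ) : ℂ :=
  -(3 * (t * (1 - t)) * (1 - 2 * t) * prodJet₂ ν u u₁ v v₁ t +
    (1 + (4 * (ν * (ν + 1)) - 6) * (t * (1 - t))) * prodJet₁ u u₁ v v₁ t +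
    2 * (ν * (ν + 1)) * (1 - 2 * t) * (u t * v t)) / (t * (1 - t)) ^ 2

/-- Immediate, because `prodJet₃` is obtained by solving the equation for the third derivative; the
content is that it really is that derivative, which is `IsLegendreSol.hasJet_mul`. -/
theorem symSq_prodJet (ν : ℝ) (u u₁ v v₁ : ℂ → ℂ) {t : ℂ} (ht : t ∈ doubleSlit) :
    symSq ν t (u t * v t) (prodJet₁ u u₁ v v₁ t) (prodJet₂ ν u u₁ v v₁ t)
      (prodJet₃ ν u u₁ v v₁ t) = 0 := by
  have := pow_ne_zero 2 (mul_one_sub_ne_zero ht)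
  unfold symSq prodJet₃
  rw [mul_div_cancel₀ _ this]
  ring

theorem IsLegendreSol.hasJet_mul {ν : ℝ} {U : Set ℂ} {u u₁ v v₁ : ℂ → ℂ} (hUD : U ⊆ doubleSlit)
    (hu : IsLegendreSol ν U u u₁) (hv : IsLegendreSol ν U v v₁) :
    HasJet U (fun t => u t * v t) (prodJet₁ u u₁ v v₁) (prodJet₂ ν u u₁ v v₁)
      (prodJet₃ ν u u₁ v v₁) := by
  refine ⟨fun t ht => ?_, fun t ht => ?_, fun t ht => ?_⟩
  · exact (hu.h₀ t ht).mul (hv.h₀ t ht)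
  · have hp := mul_one_sub_ne_zero (hUD ht)
    refine (((hu.h₁ t ht).mul (hv.h₀ t ht)).add ((hu.h₀ t ht).mul (hv.h₁ t ht))).congr_deriv ?_
    unfold prodJet₂
    field_simp
    ring
  · have hp := mul_one_sub_ne_zero (hUD ht)
    have hq : HasDerivAt (fun t : ℂ => 1 - 2 * t) (-2) t := by
      simpa using ((hasDerivAt_id t).const_mul 2).const_sub 1
    have hpd : HasDerivAt (fun t : ℂ => t * (1 - t)) (1 * (1 - t) + t * (-1)) t :=
      (hasDerivAt_id t).mul ((hasDerivAt_id t).const_sub 1)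
    have h0 := (hu.h₀ t ht).mul (hv.h₀ t ht)
    have h1 := ((hu.h₁ t ht).mul (hv.h₀ t ht)).add ((hu.h₀ t ht).mul (hv.h₁ t ht))
    have h2 := (hu.h₁ t ht).mul (hv.h₁ t ht)
    refine ((h2.const_mul 2).sub (((hq.mul h1).add (h0.const_mul (2 * (ν * (ν + 1) : ℂ)))).div hpd
      hp)).congr_deriv ?_
    unfold prodJet₃ prodJet₂ prodJet₁
    have hp1 : t ≠ 0 := left_ne_zero_of_mul hp
    have hp2 : 1 - t ≠ 0 := right_ne_zero_of_mul hp
    simp only [Pi.add_apply, Pi.mul_apply]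
    field_simp
    ring

/-- The bilinear concomitant of a function and a product of solutions. -/
noncomputable def legConc (ν : ℝ) (E E₁ E₂ u u₁ v v₁ : ℂ → ℂ) (t : ℂ) : ℂ :=
  (t * (1 - t)) ^ 2 * (E₂ t * (u t * v t) - E₁ t * (u₁ t * v t + u t * v₁ t) +
    2 * (E t * (u₁ t * v₁ t))) + t * (1 - t) * ((1 - 2 * t) * (E₁ t * (u t * v t)) +
    2 * (ν * (ν + 1)) * (E t * (u t * v t)))

/-- Lagrange's identity for the skew-adjoint operator O: w·O[E] + E·O[w] is an exact derivative, and
O[w] = 0 for a product w = uv of solutions. -/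
theorem hasDerivAt_legConc {ν : ℝ} {U V : Set ℂ} {E E₁ E₂ E₃ u u₁ v v₁ : ℂ → ℂ}
    (hE : HasJet V E E₁ E₂ E₃) (hu : IsLegendreSol ν U u u₁) (hv : IsLegendreSol ν U v v₁) {t : ℂ}
    (ht : t ∈ U) (ht' : t ∈ V) (hUD : U ⊆ doubleSlit) :
    HasDerivAt (legConc ν E E₁ E₂ u u₁ v v₁)
      (u t * v t * symSq ν t (E t) (E₁ t) (E₂ t) (E₃ t)) t := by
  have hp := mul_one_sub_ne_zero (hUD ht)
  have hq : HasDerivAt (fun t : ℂ => 1 - 2 * t) (-2) t := by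
    simpa using ((hasDerivAt_id t).const_mul 2).const_sub 1
  have hpd : HasDerivAt (fun t : ℂ => t * (1 - t)) (1 * (1 - t) + t * (-1)) t :=
    (hasDerivAt_id t).mul ((hasDerivAt_id t).const_sub 1)
  have h0 := (hu.h₀ t ht).mul (hv.h₀ t ht)
  have h1 := ((hu.h₁ t ht).mul (hv.h₀ t ht)).add ((hu.h₀ t ht).mul (hv.h₁ t ht))
  have h2 := (hu.h₁ t ht).mul (hv.h₁ t ht)
  have e0 := hE.h₀ t ht'
  have e1 := hE.h₁ t ht'
  have e2 := hE.h₂ t ht'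
  refine (((hpd.pow 2).mul (((e2.mul h0).sub (e1.mul h1)).add ((e0.mul h2).const_mul 2))).add
    (hpd.mul ((hq.mul (e1.mul h0)).add
      ((e0.mul h0).const_mul (2 * (ν * (ν + 1) : ℂ)))))).congr_deriv ?_
  have hp1 : t ≠ 0 := left_ne_zero_of_mul hp
  have hp2 : 1 - t ≠ 0 := right_ne_zero_of_mul hp
  unfold symSq
  simp only [Pi.add_apply, Pi.mul_apply, Pi.sub_apply, Pi.pow_apply]
  field_simp
  ring

/-- The concomitants of E with G², FG, F² are first integrals. Weighted by F², -2FG, G² their sum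
loses all derivatives of E and equals 2E times the squared Wronskian constant, that is 2c²E;
dividing by 2c² gives the coefficients. -/
theorem eq_combination_of_symSq_eq_zero {ν : ℝ} (hν : -1 < ν ∧ ν < 0) {U : Set ℂ} (hU : IsOpen U)
    (hc : IsPreconnected U) (hUD : U ⊆ doubleSlit) {E E₁ E₂ E₃ : ℂ → ℂ}
    (hE : HasJet U E E₁ E₂ E₃) (h0 : ∀ t ∈ U, symSq ν t (E t) (E₁ t) (E₂ t) (E₃ t) = 0) :
    ∃ x y z : ℂ, ∀ t ∈ U, E t = x * legF ν t ^ 2 + y * kerFG ν t + z * legG ν t ^ 2 := by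
  rcases U.eq_empty_or_nonempty with rfl | ⟨t₀, ht₀⟩
  · exact ⟨0, 0, 0, by simp⟩
  have key : ∀ u u₁ v v₁ : ℂ → ℂ, IsLegendreSol ν doubleSlit u u₁ →
      IsLegendreSol ν doubleSlit v v₁ → ∀ t ∈ U,
        legConc ν E E₁ E₂ u u₁ v v₁ t = legConc ν E E₁ E₂ u u₁ v v₁ t₀ := by
    intro u u₁ v v₁ hu hv t ht
    have hd : ∀ t ∈ U, HasDerivAt (legConc ν E E₁ E₂ u u₁ v v₁) 0 t := fun t ht =>
      (hasDerivAt_legConc hE hu hv (hUD ht) ht subset_rfl).congr_deriv (by rw [h0 t ht, mul_zero])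
    exact hU.is_const_of_deriv_eq_zero hc
      (fun x hx => (hd x hx).differentiableAt.differentiableWithinAt)
      (fun x hx => (hd x hx).deriv) ht ht₀
  have hF := isLegendreSol_legF hν
  have hG := isLegendreSol_legG hν
  have hc0 : (legC ν : ℂ) ≠ 0 := legC_ne_zero hν
  refine ⟨legConc ν E E₁ E₂ (legG ν) (legG₁ ν) (legG ν) (legG₁ ν) t₀ / (2 * legC ν ^ 2),
    -2 * legConc ν E E₁ E₂ (legF ν) (legF₁ ν) (legG ν) (legG₁ ν) t₀ / (2 * legC ν ^ 2),
    legConc ν E E₁ E₂ (legF ν) (legF₁ ν) (legF ν) (legF₁ ν) t₀ / (2 * legC ν ^ 2), fun t ht => ?_⟩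
  rw [← key _ _ _ _ hG hG t ht, ← key _ _ _ _ hF hG t ht, ← key _ _ _ _ hF hF t ht]
  have hw := legF_wronskian hν (hUD ht)
  field_simp
  rw [← hw]
  unfold legConc kerFG
  ring

/-! ### The inhomogeneous equation in the second argument -/

/-- Variation of constants. The end-point contributions (G²)⁽ᵏ⁾F² - 2(FG)⁽ᵏ⁾FG + (F²)⁽ᵏ⁾G², divided
by b - α, vanish for k = 0, 1, and for k = 2 the numerator is twice the squared Wronskian FG' - F'G.
So only the third derivative produces an inhomogeneity, and multiplied by (b(1-b))² it is 2c²/(b-α).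
-/
theorem exists_hasJet_right {ν : ℝ} (hν : -1 < ν ∧ ν < 0) {c c' α : ℂ} {N : Set ℂ}
    (h : ∀ b ∈ N, IsGoodPair c c' α b) :
    ∃ y₁ y₂ y₃, HasJet N (fun b => entropyValue ν c c' α b) y₁ y₂ y₃ ∧
      ∀ b ∈ N, symSq ν b (entropyValue ν c c' α b) (y₁ b) (y₂ b) (y₃ b) =
        2 * (legC ν : ℂ) ^ 2 / (b - α) := by
  have hND : N ⊆ doubleSlit := fun b hb => (h b hb).good.1
  have hF := isLegendreSol_legF hν
  have hG := isLegendreSol_legG hν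
  have jFF := hF.hasJet_mul subset_rfl hF
  have jFG := hF.hasJet_mul subset_rfl hG
  have jGG := hG.hasJet_mul subset_rfl hG
  set w₀ := fun b => arcIntegral (kerFF ν) c α b
  set w₁ := fun b => arcIntegral (kerFG ν) c α b
  set w₂ := fun b => arcIntegral (kerFG ν) c' (1 - α) (1 - b)
  set w₃ := fun b => arcIntegral (kerFF ν) c' (1 - α) (1 - b)
  have hval : (fun b => entropyValue ν c c' α b) = fun b => legG ν b * legG ν b * w₀ b -
      legF ν b * legG ν b * (w₁ b + w₂ b) + legF ν b * legF ν b * w₃ b := by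
    funext b
    simp only [entropyValue, kerFG, w₀, w₁, w₂, w₃]
    ring
  have hder : ∀ A B C A₁ B₁ C₁ : ℂ → ℂ, ∀ b ∈ N, HasDerivAt A (A₁ b) b → HasDerivAt B (B₁ b) b →
      HasDerivAt C (C₁ b) b →
      HasDerivAt (fun b => A b * w₀ b - B b * (w₁ b + w₂ b) + C b * w₃ b)
        (A₁ b * w₀ b - B₁ b * (w₁ b + w₂ b) + C₁ b * w₃ b +
          (A b * legF ν b ^ 2 - 2 * (B b * kerFG ν b) + C b * legG ν b ^ 2) / (b - α)) b := by
    intro A B C A₁ B₁ C₁ b hb hA hB hC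
    obtain ⟨d0, d1, d2, d3⟩ := (h b hb).hasDerivAt_right hν
    refine (((hA.mul d0).sub (hB.mul (d1.add d2))).add (hC.mul d3)).congr_deriv ?_
    simp only [Pi.add_apply]
    ring
  refine ⟨fun b => prodJet₁ (legG ν) (legG₁ ν) (legG ν) (legG₁ ν) b * w₀ b -
      prodJet₁ (legF ν) (legF₁ ν) (legG ν) (legG₁ ν) b * (w₁ b + w₂ b) +
      prodJet₁ (legF ν) (legF₁ ν) (legF ν) (legF₁ ν) b * w₃ b,
    fun b => prodJet₂ ν (legG ν) (legG₁ ν) (legG ν) (legG₁ ν) b * w₀ b -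
      prodJet₂ ν (legF ν) (legF₁ ν) (legG ν) (legG₁ ν) b * (w₁ b + w₂ b) +
      prodJet₂ ν (legF ν) (legF₁ ν) (legF ν) (legF₁ ν) b * w₃ b,
    fun b => prodJet₃ ν (legG ν) (legG₁ ν) (legG ν) (legG₁ ν) b * w₀ b -
      prodJet₃ ν (legF ν) (legF₁ ν) (legG ν) (legG₁ ν) b * (w₁ b + w₂ b) +
      prodJet₃ ν (legF ν) (legF₁ ν) (legF ν) (legF₁ ν) b * w₃ b +
      (prodJet₂ ν (legG ν) (legG₁ ν) (legG ν) (legG₁ ν) b * legF ν b ^ 2 -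
        2 * (prodJet₂ ν (legF ν) (legF₁ ν) (legG ν) (legG₁ ν) b * kerFG ν b) +
        prodJet₂ ν (legF ν) (legF₁ ν) (legF ν) (legF₁ ν) b * legG ν b ^ 2) / (b - α),
    ⟨fun b hb => ?_, fun b hb => ?_, fun b hb => ?_⟩, fun b hb => ?_⟩
  · rw [hval]
    refine (hder _ _ _ _ _ _ b hb (jGG.h₀ b (hND hb)) (jFG.h₀ b (hND hb))
      (jFF.h₀ b (hND hb))).congr_deriv ?_
    unfold kerFG
    ring
  · refine (hder _ _ _ _ _ _ b hb (jGG.h₁ b (hND hb)) (jFG.h₁ b (hND hb))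
      (jFF.h₁ b (hND hb))).congr_deriv ?_
    unfold kerFG prodJet₁
    ring
  · exact hder _ _ _ _ _ _ b hb (jGG.h₂ b (hND hb)) (jFG.h₂ b (hND hb)) (jFF.h₂ b (hND hb))
  · have e1 := symSq_prodJet ν (legG ν) (legG₁ ν) (legG ν) (legG₁ ν) (hND hb)
    have e2 := symSq_prodJet ν (legF ν) (legF₁ ν) (legG ν) (legG₁ ν) (hND hb)
    have e3 := symSq_prodJet ν (legF ν) (legF₁ ν) (legF ν) (legF₁ ν) (hND hb)
    have e4 : (b * (1 - b)) ^ 2 * (prodJet₂ ν (legG ν) (legG₁ ν) (legG ν) (legG₁ ν) b *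
        legF ν b ^ 2 - 2 * (prodJet₂ ν (legF ν) (legF₁ ν) (legG ν) (legG₁ ν) b * kerFG ν b) +
        prodJet₂ ν (legF ν) (legF₁ ν) (legF ν) (legF₁ ν) b * legG ν b ^ 2) =
        2 * (legC ν : ℂ) ^ 2 := by
      rw [← legF_wronskian hν (hND hb)]
      unfold prodJet₂ kerFG
      ring
    rw [congrFun hval b, ← e4]
    unfold symSq at e1 e2 e3 ⊢
    linear_combination w₀ b * e1 - (w₁ b + w₂ b) * e2 + w₃ b * e3

/-! ### The inhomogeneous equation in the first argument -/

/-- A rational identity which trades the operator in the parameter α for the operator in the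
integration variable, where integration by parts is available. -/
theorem symSq_cauchy_kernel (ν : ℝ) {t α : ℂ} (h : t - α ≠ 0) :
    symSq ν α (1 / (t - α)) (1 / (t - α) ^ 2) (2 / (t - α) ^ 3) (6 / (t - α) ^ 4) =
      -symSq ν t (1 / (t - α)) (-1 / (t - α) ^ 2) (2 / (t - α) ^ 3) (-6 / (t - α) ^ 4) := by
  unfold symSq
  field_simp
  ring

theorem hasJet_cauchy_kernel (α : ℂ) :
    HasJet {α}ᶜ (fun t => 1 / (t - α)) (fun t => -1 / (t - α) ^ 2) (fun t => 2 / (t - α) ^ 3)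
      (fun t => -6 / (t - α) ^ 4) := by
  have hs (t : ℂ) : HasDerivAt (fun t : ℂ => t - α) 1 t := (hasDerivAt_id t).sub_const α
  refine ⟨fun t ht => ?_, fun t ht => ?_, fun t ht => ?_⟩
  · have h0 : t - α ≠ 0 := sub_ne_zero.2 ht
    exact ((hasDerivAt_const t (1 : ℂ)).div (hs t) h0).congr_deriv (by simp)
  · have h0 : t - α ≠ 0 := sub_ne_zero.2 ht
    refine ((hasDerivAt_const t (-1 : ℂ)).div ((hs t).pow 2) (pow_ne_zero 2 h0)).congr_deriv ?_
    simp only [Pi.pow_apply]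
    field_simp
    ring
  · have h0 : t - α ≠ 0 := sub_ne_zero.2 ht
    refine ((hasDerivAt_const t (2 : ℂ)).div ((hs t).pow 3) (pow_ne_zero 3 h0)).congr_deriv ?_
    simp only [Pi.pow_apply]
    field_simp
    ring

/-- The boundary terms at `0` vanish for the product `u v`. -/
structure IsNegligibleAtZero (u u₁ v v₁ : ℂ → ℂ) : Prop where
  h₀ : Filter.Tendsto (fun t => t * (1 - t) * (u t * v t)) (nhdsWithin 0 doubleSlit) (nhds 0)
  h₁ : Filter.Tendsto (fun t => (t * (1 - t)) ^ 2 * (u₁ t * v t + u t * v₁ t))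
    (nhdsWithin 0 doubleSlit) (nhds 0)
  h₂ : Filter.Tendsto (fun t => (t * (1 - t)) ^ 2 * (u₁ t * v₁ t))
    (nhdsWithin 0 doubleSlit) (nhds 0)

theorem tendsto_mul_one_sub_zero {l : Filter ℂ} (hl : l ≤ nhds 0) :
    Filter.Tendsto (fun t : ℂ => t * (1 - t)) l (nhds 0) := by
  have : Filter.Tendsto (fun t : ℂ => t * (1 - t)) (nhds 0) (nhds (0 * (1 - 0))) :=
    Continuous.tendsto (by fun_prop) 0
  rw [zero_mul] at this
  exact this.mono_left hl

theorem tendsto_legF_zero {ν : ℝ} (hν : -1 < ν ∧ ν < 0) {l : Filter ℂ} (hl : l ≤ nhds 0) :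
    Filter.Tendsto (legF ν) l (nhds 1) ∧ Filter.Tendsto (legF₁ ν) l (nhds (legF₁ ν 0)) := by
  have h0 := (hasDerivAt_legF hν zero_mem_slitPlaneOne).continuousAt.tendsto
  rw [legF_zero hν] at h0
  exact ⟨h0.mono_left hl,
    (hasDerivAt_legF₁ hν zero_mem_slitPlaneOne).continuousAt.tendsto.mono_left hl⟩

theorem isNegligibleAtZero_legF_legF {ν : ℝ} (hν : -1 < ν ∧ ν < 0) :
    IsNegligibleAtZero (legF ν) (legF₁ ν) (legF ν) (legF₁ ν) := by
  have hp := tendsto_mul_one_sub_zero (nhdsWithin_le_nhds (s := doubleSlit))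
  obtain ⟨hF, hF1⟩ := tendsto_legF_zero hν (nhdsWithin_le_nhds (s := doubleSlit))
  refine ⟨?_, ?_, ?_⟩
  · simpa using hp.mul (hF.mul hF)
  · simpa using (hp.pow 2).mul ((hF1.mul hF).add (hF.mul hF1))
  · simpa using (hp.pow 2).mul (hF1.mul hF1)

theorem tendsto_mul_legG_zero {ν : ℝ} (hν : -1 < ν ∧ ν < 0) :
    Filter.Tendsto (fun t => t * legG ν t) (nhdsWithin 0 doubleSlit) (nhds 0) := by
  obtain ⟨d, ρ, C, hρ, hρ1, hC, h⟩ := exists_log_approx hν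
  have hlim : Filter.Tendsto (fun t : ℂ => C * ‖t‖ ^ (1 / 2 : ℝ)) (nhdsWithin 0 doubleSlit)
      (nhds 0) := by
    have hc : Continuous fun t : ℂ => C * ‖t‖ ^ (1 / 2 : ℝ) :=
      continuous_const.mul (continuous_norm.rpow_const fun _ => Or.inr (by norm_num))
    have := hc.tendsto 0
    simp only [norm_zero] at this
    rw [Real.zero_rpow (by norm_num), mul_zero] at this
    exact this.mono_left nhdsWithin_le_nhds
  refine squeeze_zero_norm' ?_ hlim
  filter_upwards [self_mem_nhdsWithin, nhdsWithin_le_nhds (Metric.ball_mem_nhds 0 hρ)] with t ht hb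
  have ht' := doubleSlit_subset_slitPlane ht
  have hpos : 0 < ‖t‖ := norm_pos_iff.2 (Complex.slitPlane_ne_zero ht')
  obtain ⟨-, -, -, -, -, hg⟩ := h t ht' (by simpa using hb)
  calc ‖t * legG ν t‖ ≤ ‖t‖ * (C * ‖t‖ ^ (-(1 / 2) : ℝ)) := by rw [norm_mul]; gcongr
    _ = C * (‖t‖ ^ (1 : ℝ) * ‖t‖ ^ (-(1 / 2) : ℝ)) := by rw [Real.rpow_one]; ring
    _ = C * ‖t‖ ^ (1 / 2 : ℝ) := by rw [← Real.rpow_add hpos]; norm_num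

/-- The growth of G is beaten by the factor t. For G' the Wronskian gives t(1-t)G' = (c +
F'·t(1-t)G)/F, which converges along every approach within the double slit plane and not merely
along the reals. -/
theorem isNegligibleAtZero_legF_legG {ν : ℝ} (hν : -1 < ν ∧ ν < 0) :
    IsNegligibleAtZero (legF ν) (legF₁ ν) (legG ν) (legG₁ ν) := by
  have hp := tendsto_mul_one_sub_zero (nhdsWithin_le_nhds (s := doubleSlit))
  obtain ⟨hF, hF1⟩ := tendsto_legF_zero hν (nhdsWithin_le_nhds (s := doubleSlit))
  have h1 : Filter.Tendsto (fun t : ℂ => 1 - t) (nhdsWithin 0 doubleSlit) (nhds 1) := by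
    have : Filter.Tendsto (fun t : ℂ => 1 - t) (nhds 0) (nhds (1 - 0)) :=
      Continuous.tendsto (by fun_prop) 0
    rw [sub_zero] at this
    exact this.mono_left nhdsWithin_le_nhds
  have hpG : Filter.Tendsto (fun t : ℂ => t * (1 - t) * legG ν t) (nhdsWithin 0 doubleSlit)
      (nhds 0) := by
    have := (tendsto_mul_legG_zero hν).mul h1
    rw [zero_mul] at this
    exact this.congr fun t => by ring
  have hpG1 : Filter.Tendsto (fun t : ℂ => t * (1 - t) * legG₁ ν t) (nhdsWithin 0 doubleSlit)
      (nhds (legC ν)) := by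
    have h2 : Filter.Tendsto (fun t : ℂ => (legC ν + legF₁ ν t * (t * (1 - t) * legG ν t)) /
        legF ν t) (nhdsWithin 0 doubleSlit) (nhds ((legC ν + legF₁ ν 0 * 0) / 1)) :=
      (tendsto_const_nhds.add (hF1.mul hpG)).div hF one_ne_zero
    rw [mul_zero, add_zero, div_one] at h2
    refine h2.congr' ?_
    filter_upwards [self_mem_nhdsWithin, hF.eventually_ne one_ne_zero] with t ht hne
    rw [← legF_wronskian hν ht]
    field_simp
    ring
  refine ⟨?_, ?_, ?_⟩
  · have := hF.mul hpG
    rw [mul_zero] at this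
    exact this.congr fun t => by ring
  · have := (hF1.mul (hp.mul hpG)).add (hF.mul (hp.mul hpG1))
    simp only [mul_zero, zero_mul, add_zero] at this
    exact this.congr fun t => by ring
  · have := hF1.mul (hp.mul hpG1)
    simp only [mul_zero, zero_mul] at this
    exact this.congr fun t => by ring

theorem IsGoodArc.tendsto_arc {c β : ℂ} (h : IsGoodArc c β) :
    Filter.Tendsto (arc c β) (nhdsWithin 0 (Ioi 0)) (nhdsWithin 0 doubleSlit) := by
  refine tendsto_nhdsWithin_iff.2 ⟨?_, ?_⟩
  · have := (continuous_arc c β).tendsto 0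
    rw [arc_zero_right] at this
    exact this.mono_left nhdsWithin_le_nhds
  · filter_upwards [Ioc_mem_nhdsGT one_pos] with s hs using h.arc_mem hs

theorem integral_four_mul {X : Type*} [MeasurableSpace X] {μ : Measure X} {F₁ F₂ F₃ F₄ : X → ℂ}
    (h₁ : Integrable F₁ μ) (h₂ : Integrable F₂ μ) (h₃ : Integrable F₃ μ) (h₄ : Integrable F₄ μ)
    (a b c d : ℂ) : ∫ x, a * F₁ x + (b * F₂ x + (c * F₃ x + d * F₄ x)) ∂μ =
      a * ∫ x, F₁ x ∂μ + (b * ∫ x, F₂ x ∂μ + (c * ∫ x, F₃ x ∂μ + d * ∫ x, F₄ x ∂μ)) := by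
  have i₃ : Integrable (fun x => c * F₃ x + d * F₄ x) μ := (h₃.const_mul c).add (h₄.const_mul d)
  have i₂ : Integrable (fun x => b * F₂ x + (c * F₃ x + d * F₄ x)) μ := (h₂.const_mul b).add i₃
  simp only [← integral_const_mul]
  rw [← integral_add (h₃.const_mul c) (h₄.const_mul d), ← integral_add (h₂.const_mul b) i₃,
    ← integral_add (h₁.const_mul a) i₂]

/-- Applying the operator under the integral sign makes the integrand an exact derivative of the
concomitant along the arc. The boundary term at 0 is negligible, so only the end point β
contributes. -/
theorem symSq_cauchyTransform {ν : ℝ} {U : Set ℂ} {u u₁ v v₁ h : ℂ → ℂ} {c α β : ℂ}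
    (hu : IsLegendreSol ν doubleSlit u u₁) (hv : IsLegendreSol ν doubleSlit v v₁)
    (hn : IsNegligibleAtZero u u₁ v v₁) (hh : ∀ t, h t = u t * v t) (hU : IsMildAtZero U h)
    (hD : doubleSlit ⊆ U) (hg : IsGoodArc c β) (hα : α ∈ doubleSlit)
    (hne : ∀ s ∈ Icc (0 : ℝ) 1, arc c β s ≠ α) :
    let φ : ℝ → ℂ := fun s => h (arc c β s) * (β + (1 - 2 * s) * c)
    symSq ν α (cauchyTransform φ (arc c β) 1 α) (cauchyTransform φ (arc c β) 2 α)
      (2 * cauchyTransform φ (arc c β) 3 α) (6 * cauchyTransform φ (arc c β) 4 α) =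
      -legConc ν (fun t => 1 / (t - α)) (fun t => -1 / (t - α) ^ 2) (fun t => 2 / (t - α) ^ 3)
        u u₁ v v₁ β := by
  intro φ
  have hα0 : α ≠ 0 := Complex.slitPlane_ne_zero (doubleSlit_subset_slitPlane hα)
  have hφ := hU.integrableOn_arc hD hg
  have hI (k : ℕ) := integrableOn_cauchyTransform hφ (continuous_arc c β).continuousOn k hne
  set K := legConc ν (fun t => 1 / (t - α)) (fun t => -1 / (t - α) ^ 2) (fun t => 2 / (t - α) ^ 3)
        u u₁ v v₁
  set p := α * (1 - α)
  set Φ : ℝ → ℂ := fun s => 2 * (ν * (ν + 1)) * (1 - 2 * α) * (φ s / (arc c β s - α) ^ 1) +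
    ((1 + (4 * (ν * (ν + 1)) - 6) * p) * (φ s / (arc c β s - α) ^ 2) +
    (3 * p * (1 - 2 * α) * 2 * (φ s / (arc c β s - α) ^ 3) +
    p ^ 2 * 6 * (φ s / (arc c β s - α) ^ 4)))
  have hΦ : IntegrableOn Φ (Ioo 0 1) := ((hI 1).const_mul _).add (((hI 2).const_mul _).add
    (((hI 3).const_mul _).add ((hI 4).const_mul _)))
  have hder : ∀ s ∈ Ioo (0 : ℝ) 1, HasDerivAt (fun s => -K (arc c β s)) (Φ s) s := by
    intro s hs
    have hm := hg.arc_mem (Ioo_subset_Ioc_self hs)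
    have hna := hne s (Ioo_subset_Icc_self hs)
    have hk := hasDerivAt_legConc (hasJet_cauchy_kernel α) hu hv hm hna subset_rfl
    refine (HasDerivAt.comp (𝕜 := ℝ) (𝕜' := ℂ) (h₂ := K) s hk
      (hasDerivAt_arc c β s)).neg.congr_deriv ?_
    have e := symSq_cauchy_kernel ν (sub_ne_zero.2 hna)
    have e' : symSq ν (arc c β s) (1 / (arc c β s - α)) (-1 / (arc c β s - α) ^ 2)
      (2 / (arc c β s - α) ^ 3) (-6 / (arc c β s - α) ^ 4) = -symSq ν α (1 / (arc c β s - α))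
      (1 / (arc c β s - α) ^ 2) (2 / (arc c β s - α) ^ 3) (6 / (arc c β s - α) ^ 4) := by
      rw [e, neg_neg]
    rw [e', ← hh]
    simp only [Φ, φ, symSq, p]
    ring
  have hl0 : Filter.Tendsto (fun s => -K (arc c β s)) (nhdsWithin 0 (Ioi 0)) (nhds 0) := by
    have hK : Filter.Tendsto K (nhdsWithin 0 doubleSlit) (nhds 0) := by
      have hp := tendsto_mul_one_sub_zero (nhdsWithin_le_nhds (s := doubleSlit))
      have ck (k : ℕ) (r : ℂ) : ∃ l, Filter.Tendsto (fun t : ℂ => r / (t - α) ^ k)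
          (nhdsWithin 0 doubleSlit) (nhds l) := by
        refine ⟨_, Filter.Tendsto.mono_left (ContinuousAt.tendsto (x := (0 : ℂ)) ?_)
          nhdsWithin_le_nhds⟩
        exact continuousAt_const.div (by fun_prop) (pow_ne_zero _ (by simpa using hα0))
      have hq : Filter.Tendsto (fun t : ℂ => 1 - 2 * t) (nhdsWithin 0 doubleSlit)
        (nhds (1 - 2 * 0)) := (Continuous.tendsto (by fun_prop) 0).mono_left nhdsWithin_le_nhds
      obtain ⟨l₀, k₀⟩ := ck 1 1
      obtain ⟨l₁, k₁⟩ := ck 2 (-1)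
      obtain ⟨l₂, k₂⟩ := ck 3 2
      have t := ((((k₂.mul hp).mul hn.h₀).sub (k₁.mul hn.h₁)).add ((k₀.mul hn.h₂).const_mul
        2)).add (((hq.mul k₁).mul hn.h₀).add ((k₀.mul hn.h₀).const_mul
        (2 * (ν * (ν + 1)) : ℂ)))
      simp only [mul_zero, sub_zero, add_zero] at t
      refine t.congr fun t => ?_
      simp only [K, legConc, pow_one]
      ring
    simpa using (hK.comp hg.tendsto_arc).neg
  have hl1 : Filter.Tendsto (fun s => -K (arc c β s)) (nhdsWithin 1 (Iio 1)) (nhds (-K β)) := by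
    have hβα : β ∈ ({α}ᶜ : Set ℂ) := by simpa using hne 1 (by simp)
    have hk := (hasDerivAt_legConc (hasJet_cauchy_kernel α) hu hv hg.1 hβα
      subset_rfl).continuousAt
    have ha := (continuous_arc c β).tendsto 1
    rw [arc_one_right] at ha
    exact ((hk.tendsto.comp ha).neg).mono_left nhdsWithin_le_nhds
  have hFTC := intervalIntegral.integral_eq_sub_of_hasDerivAt_of_tendsto one_pos hder
    ((intervalIntegrable_iff_integrableOn_Ioo_of_le zero_le_one).2 hΦ) hl0 hl1
  rw [intervalIntegral.integral_of_le zero_le_one, integral_Ioc_eq_integral_Ioo, sub_zero] at hFTC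
  rw [← hFTC]
  simp only [Φ]
  rw [integral_four_mul (hI 1) (hI 2) (hI 3) (hI 4)]
  simp only [symSq, cauchyTransform, p, φ]
  ring

theorem hasJet_arcIntegral {U : Set ℂ} {h : ℂ → ℂ} (hU : IsMildAtZero U h) (hD : doubleSlit ⊆ U)
    {c β : ℂ} (hg : IsGoodArc c β) {M : Set ℂ}
    (hM : ∀ a ∈ M, ∀ s ∈ Icc (0 : ℝ) 1, arc c β s ≠ a) :
    let φ : ℝ → ℂ := fun s => h (arc c β s) * (β + (1 - 2 * s) * c)
    HasJet M (fun a => arcIntegral h c a β) (cauchyTransform φ (arc c β) 2)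
      (fun a => 2 * cauchyTransform φ (arc c β) 3 a)
      (fun a => 6 * cauchyTransform φ (arc c β) 4 a) := by
  intro φ
  have key (k : ℕ) (a : ℂ) (ha : a ∈ M) := hasDerivAt_cauchyTransform (hU.integrableOn_arc hD hg)
    (continuous_arc c β).continuousOn k (hM a ha)
  refine ⟨fun a ha => ?_, fun a ha => ?_, fun a ha => ?_⟩
  · simp only [arcIntegral_eq_cauchyTransform]
    exact (key 1 a ha).congr_deriv (by simp [φ])
  · exact (key 2 a ha).congr_deriv (by simp [φ])
  · exact ((key 3 a ha).const_mul 2).congr_deriv (by push_cast; ring)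

/-- The integrals reduce to concomitants of E(t) = 1/(t-a) at β, or at the reflected point. The
prefactors of S weight them as in `eq_combination_of_symSq_eq_zero`, so derivatives of E cancel and
-2c²E(β) = 2c²/(a-β) is left. -/
theorem exists_hasJet_left {ν : ℝ} (hν : -1 < ν ∧ ν < 0) {c c' β : ℂ} {N : Set ℂ}
    (h : ∀ a ∈ N, IsGoodPair c c' a β) :
    ∃ y₁ y₂ y₃, HasJet N (fun a => entropyValue ν c c' a β) y₁ y₂ y₃ ∧
      ∀ a ∈ N, symSq ν a (entropyValue ν c c' a β) (y₁ a) (y₂ a) (y₃ a) =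
        2 * (legC ν : ℂ) ^ 2 / (a - β) := by
  rcases N.eq_empty_or_nonempty with rfl | ⟨a₀, ha₀⟩
  · exact ⟨0, 0, 0, ⟨by simp, by simp, by simp⟩, by simp⟩
  have hg := (h a₀ ha₀).good
  have hg' := (h a₀ ha₀).good'
  have hFF := isMildAtZero_kerFF hν
  have hFG := isMildAtZero_kerFG hν
  have hF := isLegendreSol_legF hν
  have hG := isLegendreSol_legG hν
  have nFF := isNegligibleAtZero_legF_legF hν
  have nFG := isNegligibleAtZero_legF_legG hν
  have eFF : ∀ t, kerFF ν t = legF ν t * legF ν t := fun t => by rw [kerFF, sq]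
  have eFG : ∀ t, kerFG ν t = legF ν t * legG ν t := fun t => rfl
  set N' : Set ℂ := {a | 1 - a ∈ N}
  have hM' : ∀ a ∈ N', ∀ s ∈ Icc (0 : ℝ) 1, arc c' (1 - β) s ≠ a := fun a ha => by
    simpa using (h _ ha).ne'
  have j0 := (hasJet_arcIntegral hFF doubleSlit_subset_slitPlaneOne hg (M := N)
    fun a ha => (h a ha).ne)
  have j1 := (hasJet_arcIntegral hFG subset_rfl hg (M := N) fun a ha => (h a ha).ne)
  have hN' : N ⊆ {t | 1 - t ∈ N'} := fun a ha => by simpa [N'] using ha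
  have j2 := ((hasJet_arcIntegral hFG subset_rfl hg' hM').one_sub).mono hN'
  have j3 := ((hasJet_arcIntegral hFF doubleSlit_subset_slitPlaneOne hg' hM').one_sub).mono hN'
  refine ⟨_, _, _, (((j0.const_mul (legG ν β ^ 2)).sub (j1.const_mul (kerFG ν β))).sub
    (j2.const_mul (kerFG ν β))).add (j3.const_mul (legF ν β ^ 2)), fun a ha => ?_⟩
  have hp := h a ha
  have hα' := one_sub_mem_doubleSlit hp.left_mem
  have l0 := symSq_cauchyTransform hF hF nFF eFF hFF doubleSlit_subset_slitPlaneOne hg hp.left_mem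
    hp.ne
  have l1 := symSq_cauchyTransform hF hG nFG eFG hFG subset_rfl hg hp.left_mem hp.ne
  have l2 := symSq_cauchyTransform hF hG nFG eFG hFG subset_rfl hg' hα' hp.ne'
  have l3 := symSq_cauchyTransform hF hF nFF eFF hFF doubleSlit_subset_slitPlaneOne hg' hα' hp.ne'
  have hw := legF_wronskian hν hg.1
  have hne : β - a ≠ 0 := sub_ne_zero.2 hp.ne_self.symm
  have hne2 : a - β ≠ 0 := sub_ne_zero.2 hp.ne_self
  have e1 : 1 - β - (1 - a) = a - β := by ring
  simp only [entropyValue, arcIntegral_eq_cauchyTransform]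
  have hfin : 2 * (legC ν : ℂ) ^ 2 / (a - β) =
      -legG ν β ^ 2 * legConc ν (fun t => 1 / (t - a)) (fun t => -1 / (t - a) ^ 2)
        (fun t => 2 / (t - a) ^ 3) (legF ν) (legF₁ ν) (legF ν) (legF₁ ν) β +
      kerFG ν β * legConc ν (fun t => 1 / (t - a)) (fun t => -1 / (t - a) ^ 2)
        (fun t => 2 / (t - a) ^ 3) (legF ν) (legF₁ ν) (legG ν) (legG₁ ν) β -
      kerFG ν β * legConc ν (fun t => 1 / (t - (1 - a))) (fun t => -1 / (t - (1 - a)) ^ 2)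
        (fun t => 2 / (t - (1 - a)) ^ 3) (legF ν) (legF₁ ν) (legG ν) (legG₁ ν) (1 - β) +
      legF ν β ^ 2 * legConc ν (fun t => 1 / (t - (1 - a))) (fun t => -1 / (t - (1 - a)) ^ 2)
        (fun t => 2 / (t - (1 - a)) ^ 3) (legF ν) (legF₁ ν) (legF ν) (legF₁ ν) (1 - β) := by
    rw [← hw]
    simp only [legConc, legG, legG₁, kerFG, e1, sub_sub_cancel,
      show β - a = -(a - β) by ring]
    field_simp
    ring
  rw [hfin]
  unfold symSq at l0 l1 l2 l3 ⊢
  -- The operator changes sign under t ↦ 1 - t, hence the reversed signs of the two reflected terms.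
  linear_combination legG ν β ^ 2 * l0 - kerFG ν β * l1 + kerFG ν β * l2 - legF ν β ^ 2 * l3

/-! ### Logarithmic asymptotics -/

/-- Boundedness near `0` of a function of `ε > 0`. -/
def IsBoundedNearZero (F : ℝ → ℂ) : Prop := ∃ C : ℝ, ∀ᶠ ε in nhdsWithin 0 (Ioi 0), ‖F ε‖ ≤ C

namespace IsBoundedNearZero

variable {F G : ℝ → ℂ}

theorem add (hF : IsBoundedNearZero F) (hG : IsBoundedNearZero G) :
    IsBoundedNearZero fun ε => F ε + G ε := by
  obtain ⟨C, hC⟩ := hF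
  obtain ⟨D, hD⟩ := hG
  exact ⟨C + D, by filter_upwards [hC, hD] with ε h h' using (norm_add_le _ _).trans (add_le_add h h')⟩

theorem mul (hF : IsBoundedNearZero F) (hG : IsBoundedNearZero G) :
    IsBoundedNearZero fun ε => F ε * G ε := by
  obtain ⟨C, hC⟩ := hF
  obtain ⟨D, hD⟩ := hG
  refine ⟨C * D, ?_⟩
  filter_upwards [hC, hD] with ε h h'
  rw [norm_mul]
  exact mul_le_mul h h' (norm_nonneg _) ((norm_nonneg _).trans h)

theorem const (c : ℂ) : IsBoundedNearZero fun _ => c := ⟨‖c‖, by simp⟩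

theorem const_mul (c : ℂ) (hF : IsBoundedNearZero F) : IsBoundedNearZero fun ε => c * F ε :=
  (const c).mul hF

theorem neg (hF : IsBoundedNearZero F) : IsBoundedNearZero fun ε => -F ε := by
  simpa [IsBoundedNearZero] using hF

theorem sub (hF : IsBoundedNearZero F) (hG : IsBoundedNearZero G) :
    IsBoundedNearZero fun ε => F ε - G ε := by
  simpa only [sub_eq_add_neg] using hF.add hG.neg

theorem congr (hF : IsBoundedNearZero F) (h : ∀ᶠ ε in nhdsWithin 0 (Ioi 0), F ε = G ε) :
    IsBoundedNearZero G := by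
  obtain ⟨C, hC⟩ := hF
  exact ⟨C, by filter_upwards [hC, h] with ε h h' using h' ▸ h⟩

theorem of_tendsto {l : ℂ} (h : Filter.Tendsto F (nhdsWithin 0 (Ioi 0)) (nhds l)) :
    IsBoundedNearZero F :=
  ⟨‖l‖ + 1, (h.norm.eventually_le_const (by linarith))⟩

end IsBoundedNearZero

/-- Comparison of coefficients with x = log ε → -∞: dividing by x², then by x, isolates A and then
B. -/
theorem eq_zero_of_isBoundedNearZero_log {A B : ℂ}
    (h : IsBoundedNearZero fun ε => A * (Real.log ε : ℂ) ^ 2 + B * (Real.log ε : ℂ)) :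
    A = 0 ∧ B = 0 := by
  obtain ⟨C, hC⟩ := h
  have hC' : ∀ᶠ x : ℝ in Filter.atBot, ‖A * (x : ℂ) ^ 2 + B * (x : ℂ)‖ ≤ C := by
    filter_upwards [Real.tendsto_exp_atBot_nhdsGT.eventually hC] with x hx
    simpa using hx
  have hinv : Filter.Tendsto (fun x : ℝ => ((x : ℂ))⁻¹) Filter.atBot (nhds 0) := by
    have := Complex.continuous_ofReal.tendsto 0 |>.comp tendsto_inv_atBot_zero
    simpa [Function.comp_def] using this
  have key : Filter.Tendsto (fun x : ℝ => (A * (x : ℂ) ^ 2 + B * (x : ℂ)) * (x : ℂ)⁻¹)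
      Filter.atBot (nhds 0) := by
    refine squeeze_zero_norm' (a := fun x : ℝ => C * ‖(x : ℂ)⁻¹‖) ?_ (by
      simpa using hinv.norm.const_mul C)
    filter_upwards [hC'] with x hx
    rw [norm_mul]
    gcongr
  have hne : ∀ᶠ x : ℝ in Filter.atBot, (x : ℂ) ≠ 0 := by
    filter_upwards [Filter.eventually_lt_atBot 0] with x hx
    exact_mod_cast hx.ne
  have hA : A = 0 := by
    have h1 := (key.mul hinv).sub (hinv.const_mul B)
    simp only [mul_zero, sub_zero] at h1
    refine tendsto_nhds_unique (tendsto_const_nhds.congr' ?_) h1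
    filter_upwards [hne] with x hx
    field_simp
    ring
  subst hA
  refine ⟨rfl, tendsto_nhds_unique (tendsto_const_nhds.congr' ?_) key⟩
  filter_upwards [hne] with x hx
  field_simp
  ring

theorem mem_slitPlane_of_re_nonneg {ω : ℂ} (h : 0 ≤ ω.re) (h0 : ω ≠ 0) : ω ∈ Complex.slitPlane := by
  rw [Complex.mem_slitPlane_iff]
  rcases h.eq_or_lt with h | h
  · right; intro h1; exact h0 (Complex.ext h.symm h1)
  · left; exact h

theorem le_norm_add_mul {ω : ℂ} (h : 0 ≤ ω.re) {s ε : ℝ} (hε : 0 < ε) :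
    s ≤ ‖(s : ℂ) + ε * ω‖ := by
  refine le_trans ?_ (Complex.re_le_norm _)
  simp
  positivity

theorem add_mul_ne_zero {ω : ℂ} (h : 0 ≤ ω.re) (h0 : ω ≠ 0) {s ε : ℝ} (hs : 0 ≤ s) (hε : 0 < ε) :
    (s : ℂ) + ε * ω ∈ Complex.slitPlane := by
  refine mem_slitPlane_of_re_nonneg (by simp; positivity) fun h1 => ?_
  have h2 := congrArg Complex.re h1
  simp at h2
  have h3 : ε * ω.re = 0 := by have : 0 ≤ ε * ω.re := by positivity
                               linarith
  have h4 : s = 0 := by linarith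
  rw [h4] at h1
  have : (ε : ℂ) ≠ 0 := by exact_mod_cast hε.ne'
  simp [this, h0] at h1

theorem integral_inv_add {z : ℂ} (hz : ∀ s ∈ Icc (0 : ℝ) 1, (s : ℂ) + z ∈ Complex.slitPlane) :
    ∫ s in Ioo (0 : ℝ) 1, 1 / ((s : ℂ) + z) = Complex.log (1 + z) - Complex.log z := by
  have hd : ∀ s ∈ uIcc (0 : ℝ) 1, HasDerivAt (fun s : ℝ => Complex.log ((s : ℂ) + z))
      (1 / ((s : ℂ) + z)) s := by
    intro s hs
    rw [uIcc_of_le zero_le_one] at hs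
    have h1 : HasDerivAt (fun s : ℝ => (s : ℂ) + z) 1 s := Complex.ofRealCLM.hasDerivAt.add_const z
    exact h1.clog_real (hz s hs)
  have hi : IntervalIntegrable (fun s : ℝ => 1 / ((s : ℂ) + z)) volume 0 1 := by
    refine ContinuousOn.intervalIntegrable ?_
    rw [uIcc_of_le zero_le_one]
    exact continuousOn_const.div (by fun_prop) fun s hs => Complex.slitPlane_ne_zero (hz s hs)
  have := intervalIntegral.integral_eq_sub_of_hasDerivAt hd hi
  rw [intervalIntegral.integral_of_le zero_le_one, integral_Ioc_eq_integral_Ioo] at this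
  rw [this]
  simp

theorem integrableOn_ofReal_log : IntegrableOn (fun s : ℝ => (Real.log s : ℂ)) (Ioo 0 1) := by
  have := (intervalIntegral.intervalIntegrable_log' (a := 0) (b := 1))
  rw [intervalIntegrable_iff_integrableOn_Ioo_of_le zero_le_one] at this
  exact this.ofReal

/-- A primitive is s log s/(z(s+z)) - log(s+z)/z, and s log s vanishes at both end points. This is
the derivative needed for the logarithmic Cauchy integral. -/
theorem integral_log_div_sq {z : ℂ} (hz0 : z ∈ Complex.slitPlane)
    (hz : ∀ s ∈ Icc (0 : ℝ) 1, (s : ℂ) + z ∈ Complex.slitPlane) :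
    ∫ s in Ioo (0 : ℝ) 1, (Real.log s : ℂ) / ((s : ℂ) + z) ^ 2 =
      -(Complex.log (1 + z) - Complex.log z) / z := by
  have hzn := Complex.slitPlane_ne_zero hz0
  set Φ : ℝ → ℂ := fun s => ((s * Real.log s : ℝ) : ℂ) / (z * (s + z)) - Complex.log (s + z) / z
  have hcl : ∀ s ∈ Icc (0 : ℝ) 1, ContinuousAt Φ s := by
    intro s hs
    have h0 := Complex.slitPlane_ne_zero (hz s hs)
    have h1 : ContinuousAt (fun s : ℝ => ((s * Real.log s : ℝ) : ℂ)) s :=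
      (Complex.continuous_ofReal.comp Real.continuous_mul_log).continuousAt
    have h2 : ContinuousAt (fun s : ℝ => (s : ℂ) + z) s := by fun_prop
    exact (h1.div (continuousAt_const.mul h2) (mul_ne_zero hzn h0)).sub
      ((h2.clog (hz s hs)).div_const z)
  have hd : ∀ s ∈ Ioo (0 : ℝ) 1, HasDerivAt Φ ((Real.log s : ℂ) / ((s : ℂ) + z) ^ 2) s := by
    intro s hs
    have hm := hz s (Ioo_subset_Icc_self hs)
    have h0 := Complex.slitPlane_ne_zero hm
    have h1 : HasDerivAt (fun s : ℝ => (s : ℂ) + z) 1 s := Complex.ofRealCLM.hasDerivAt.add_const z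
    have h2 : HasDerivAt (fun s : ℝ => ((s * Real.log s : ℝ) : ℂ)) ((Real.log s + 1 : ℝ) : ℂ) s :=
      (Real.hasDerivAt_mul_log hs.1.ne').ofReal_comp
    refine ((h2.div (h1.const_mul z) (mul_ne_zero hzn h0)).sub
      ((h1.clog_real hm).div_const z)).congr_deriv ?_
    push_cast
    field_simp
    ring
  have hi : IntegrableOn (fun s : ℝ => (Real.log s : ℂ) / ((s : ℂ) + z) ^ 2) (Ioo 0 1) := by
    have := integrableOn_cauchyTransform integrableOn_ofReal_log
      (γ := fun s : ℝ => (s : ℂ)) (by fun_prop) 2 (α := -z)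
      (fun s hs h => Complex.slitPlane_ne_zero (hz s hs) (by rw [h]; ring))
    simpa using this
  have hFTC := intervalIntegral.integral_eq_sub_of_hasDerivAt_of_tendsto one_pos hd
    ((intervalIntegrable_iff_integrableOn_Ioo_of_le zero_le_one).2 hi)
    ((hcl 0 (by simp)).tendsto.mono_left nhdsWithin_le_nhds)
    ((hcl 1 (by simp)).tendsto.mono_left nhdsWithin_le_nhds)
  rw [intervalIntegral.integral_of_le zero_le_one, integral_Ioc_eq_integral_Ioo] at hFTC
  rw [hFTC]
  simp [Φ]
  ring

theorem isBoundedNearZero_log_one_add (ω : ℂ) :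
    IsBoundedNearZero fun ε => Complex.log (1 + ε * ω) := by
  have : ContinuousAt (fun ε : ℝ => Complex.log (1 + ε * ω)) 0 :=
    ContinuousAt.clog (by fun_prop) (by simp)
  exact IsBoundedNearZero.of_tendsto (this.tendsto.mono_left nhdsWithin_le_nhds)

theorem clog_ofReal_mul {ε : ℝ} (hε : 0 < ε) {ω : ℂ} (h0 : ω ≠ 0) :
    Complex.log (ε * ω) = Real.log ε + Complex.log ω := Complex.log_ofReal_mul hε h0

theorem isBoundedNearZero_integral_inv {ω : ℂ} (h : 0 ≤ ω.re) (h0 : ω ≠ 0) :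
    IsBoundedNearZero fun ε =>
      (∫ s in Ioo (0 : ℝ) 1, 1 / ((s : ℂ) + ε * ω)) + (Real.log ε : ℂ) := by
  refine ((isBoundedNearZero_log_one_add ω).sub
    (IsBoundedNearZero.const (Complex.log ω))).congr ?_
  filter_upwards [self_mem_nhdsWithin] with ε hε
  rw [integral_inv_add fun s hs => add_mul_ne_zero h h0 hs.1 hε, clog_ofReal_mul hε h0]
  ring

/-- The dilogarithm is avoided by differentiating in ε: the whole expression has derivative
log(1+εω)/ε, which is bounded near 0, so the expression is Lipschitz there. -/
theorem isBoundedNearZero_integral_log {ω : ℂ} (h : 0 ≤ ω.re) (h0 : ω ≠ 0) :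
    IsBoundedNearZero fun ε =>
      (∫ s in Ioo (0 : ℝ) 1, (Real.log s : ℂ) / ((s : ℂ) + ε * ω)) +
        ((Real.log ε : ℂ) + Complex.log ω) ^ 2 / 2 := by
  set H : ℝ → ℂ := fun ε => (∫ s in Ioo (0 : ℝ) 1, (Real.log s : ℂ) / ((s : ℂ) + ε * ω)) +
    ((Real.log ε : ℂ) + Complex.log ω) ^ 2 / 2
  have hd : ∀ ε : ℝ, 0 < ε → HasDerivAt H (Complex.log (1 + ε * ω) / ε) ε := by
    intro ε hε
    have hne : ∀ s ∈ Icc (0 : ℝ) 1, (s : ℂ) ≠ -(ε * ω) := fun s hs e =>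
      Complex.slitPlane_ne_zero (add_mul_ne_zero h h0 hs.1 hε) (by rw [e]; ring)
    have h1 := hasDerivAt_cauchyTransform integrableOn_ofReal_log
      (γ := fun s : ℝ => (s : ℂ)) (by fun_prop) 1 (α := -(ε * ω)) hne
    have h2 : HasDerivAt (fun ε : ℝ => -((ε : ℂ) * ω)) (-ω) ε := by
      have : HasDerivAt (fun ε : ℝ => (ε : ℂ)) 1 ε := Complex.ofRealCLM.hasDerivAt
      exact (this.mul_const ω).neg.congr_deriv (by simp)
    have h3 := HasDerivAt.comp (𝕜 := ℝ) (𝕜' := ℂ) (h₂ := cauchyTransform (fun s : ℝ =>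
      (Real.log s : ℂ)) (fun s : ℝ => (s : ℂ)) 1) ε h1 h2
    have h4 : HasDerivAt (fun ε : ℝ => (Real.log ε : ℂ)) ((ε⁻¹ : ℝ) : ℂ) ε :=
      (Real.hasDerivAt_log hε.ne').ofReal_comp
    have h5 := h3.add (((h4.add_const (Complex.log ω)).pow 2).div_const 2)
    have hfun : H = (cauchyTransform (fun s : ℝ => (Real.log s : ℂ)) (fun s : ℝ => (s : ℂ)) 1 ∘
        fun ε : ℝ => -((ε : ℂ) * ω)) +
        fun ε : ℝ => ((fun ε : ℝ => (Real.log ε : ℂ) + Complex.log ω) ^ 2) ε / 2 := by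
      funext ε
      simp [H, cauchyTransform]
    rw [hfun]
    refine h5.congr_deriv ?_
    have hε' : (ε : ℂ) ≠ 0 := by exact_mod_cast hε.ne'
    have e := integral_log_div_sq (z := ε * ω)
      (by simpa using add_mul_ne_zero h h0 (le_refl (0 : ℝ)) hε)
      (fun s hs => add_mul_ne_zero h h0 hs.1 hε)
    rw [clog_ofReal_mul hε h0] at e
    have e2 : cauchyTransform (fun s : ℝ => (Real.log s : ℂ)) (fun s : ℝ => (s : ℂ)) (1 + 1)
        (-(ε * ω)) = -(Complex.log (1 + ε * ω) - (Real.log ε + Complex.log ω)) / (ε * ω) := by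
      rw [← e]
      simp [cauchyTransform]
    rw [e2]
    push_cast
    field_simp
    ring
  -- For |εω| ≤ 1/2 one has |log(1+εω)| ≤ (3/2)|εω|; the constant 2 is a convenient rounding.
  have hlip : ∀ᶠ ε : ℝ in nhds 0, ‖Complex.log (1 + ε * ω)‖ ≤ 2 * ‖ω‖ * |ε| := by
    have hc : ContinuousAt (fun ε : ℝ => ‖(ε : ℂ) * ω‖) 0 := by fun_prop
    have := hc.eventually_le_const (u := 1 / 2) (by simp)
    filter_upwards [this] with ε hε
    refine (Complex.norm_log_one_add_half_le_self hε).trans ?_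
    rw [norm_mul, Complex.norm_real, Real.norm_eq_abs]
    nlinarith [norm_nonneg ω, abs_nonneg ε, mul_nonneg (norm_nonneg ω) (abs_nonneg ε)]
  obtain ⟨r, hr, hb⟩ := Metric.eventually_nhds_iff_ball.1 hlip
  have hsub : Ioo (0 : ℝ) r ⊆ Metric.ball 0 r := fun ε hε => by
    rw [Real.ball_eq_Ioo]; exact ⟨by linarith [hε.1], by linarith [hε.2]⟩
  refine ⟨‖H (r / 2)‖ + 2 * ‖ω‖ * r, ?_⟩
  filter_upwards [Ioo_mem_nhdsGT hr] with ε hε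
  have := (convex_Ioo (0 : ℝ) r).norm_image_sub_le_of_norm_hasDerivWithin_le (f := H)
    (f' := fun ε => Complex.log (1 + ε * ω) / ε) (C := 2 * ‖ω‖)
    (fun x hx => (hd x hx.1).hasDerivWithinAt) (fun x hx => ?_)
    (⟨by linarith, by linarith⟩ : r / 2 ∈ Ioo 0 r) hε
  · have h2 : ‖ε - r / 2‖ ≤ r := by
      rw [Real.norm_eq_abs, abs_le]; constructor <;> linarith [hε.1, hε.2]
    calc ‖H ε‖ = ‖H (r / 2) + (H ε - H (r / 2))‖ := by congr 1; ring
      _ ≤ ‖H (r / 2)‖ + ‖H ε - H (r / 2)‖ := norm_add_le _ _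
      _ ≤ ‖H (r / 2)‖ + 2 * ‖ω‖ * r := by
        have : 2 * ‖ω‖ * ‖ε - r / 2‖ ≤ 2 * ‖ω‖ * r := by gcongr
        linarith
  · rw [norm_div, Complex.norm_real, Real.norm_eq_abs, div_le_iff₀ (abs_pos.2 hx.1.ne')]
    exact hb x (hsub hx)

theorem exists_global_bound {ψ : ℝ → ℂ} (hc : ContinuousOn ψ (Ioc 0 1)) {δ C : ℝ} (hδ : 0 < δ)
    (hb : ∀ s ∈ Ioc (0 : ℝ) 1, s < δ → ‖ψ s‖ ≤ C * s ^ (1 / 2 : ℝ)) :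
    ∃ K : ℝ, ∀ s ∈ Ioc (0 : ℝ) 1, ‖ψ s‖ ≤ K * s ^ (1 / 2 : ℝ) := by
  have hm : 0 < min δ 1 := lt_min hδ one_pos
  have hK : ContinuousOn ψ (Icc (min δ 1) 1) := hc.mono fun s hs => ⟨hm.trans_le hs.1, hs.2⟩
  obtain ⟨M, hM⟩ := isCompact_Icc.exists_bound_of_continuousOn hK
  have hM0 : 0 ≤ M := (norm_nonneg _).trans (hM 1 ⟨min_le_right _ _, le_rfl⟩)
  have hq : 0 < (min δ 1) ^ (1 / 2 : ℝ) := Real.rpow_pos_of_pos hm _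
  refine ⟨max C (M / (min δ 1) ^ (1 / 2 : ℝ)), fun s hs => ?_⟩
  have hspos : 0 < s ^ (1 / 2 : ℝ) := Real.rpow_pos_of_pos hs.1 _
  by_cases h : s < δ
  · exact (hb s hs h).trans (by gcongr; exact le_max_left _ _)
  · have hms : min δ 1 ≤ s := (min_le_left _ _).trans (not_lt.1 h)
    calc ‖ψ s‖ ≤ M := hM s ⟨hms, hs.2⟩
      _ = M / (min δ 1) ^ (1 / 2 : ℝ) * (min δ 1) ^ (1 / 2 : ℝ) := by field_simp
      _ ≤ M / (min δ 1) ^ (1 / 2 : ℝ) * s ^ (1 / 2 : ℝ) := by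
        gcongr
      _ ≤ _ := by gcongr; exact le_max_right _ _

/-- Split φ into p log s + q and a remainder O(s^(1/2)). As Re ω ≥ 0, |s + εω| ≥ s, so the remainder
is dominated by a multiple of s^(-1/2) uniformly in ε; the other two pieces are explicit. -/
theorem isBoundedNearZero_integral {ω : ℂ} (h : 0 ≤ ω.re) (h0 : ω ≠ 0) {φ : ℝ → ℂ}
    (hc : ContinuousOn φ (Ioc 0 1)) {p q : ℂ} {δ C : ℝ} (hδ : 0 < δ)
    (hb : ∀ s ∈ Ioc (0 : ℝ) 1, s < δ → ‖φ s - (p * Real.log s + q)‖ ≤ C * s ^ (1 / 2 : ℝ)) :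
    IsBoundedNearZero fun ε => (∫ s in Ioo (0 : ℝ) 1, φ s / ((s : ℂ) + ε * ω)) +
      (p * (((Real.log ε : ℂ) + Complex.log ω) ^ 2 / 2) + q * Real.log ε) := by
  set ψ : ℝ → ℂ := fun s => φ s - (p * Real.log s + q)
  have hlogc : ContinuousOn (fun s : ℝ => (Real.log s : ℂ)) (Ioc 0 1) :=
    Complex.continuous_ofReal.comp_continuousOn
      (Real.continuousOn_log.mono fun s hs => hs.1.ne')
  have hψc : ContinuousOn ψ (Ioc 0 1) :=
    hc.sub ((continuousOn_const.mul hlogc).add continuousOn_const)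
  obtain ⟨K, hK⟩ := exists_global_bound hψc hδ hb
  have hK0 : 0 ≤ K := by simpa using (norm_nonneg _).trans (hK 1 (by simp))
  have hψi : IntegrableOn ψ (Ioo 0 1) := by
    refine integrableOn_of_bound_near_zero hψc (C := K) one_pos fun s hs _ => (hK s hs).trans ?_
    gcongr 1
    exact Real.rpow_le_rpow_of_exponent_ge hs.1 hs.2 (by norm_num)
  have hbd : IsBoundedNearZero fun ε => ∫ s in Ioo (0 : ℝ) 1, ψ s / ((s : ℂ) + ε * ω) := by
    refine ⟨∫ s in Ioo (0 : ℝ) 1, K * s ^ (-(1 / 2) : ℝ), ?_⟩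
    filter_upwards [self_mem_nhdsWithin] with ε hε
    refine norm_integral_le_of_norm_le (integrableOn_rpow_neg_half.const_mul K)
      ((ae_restrict_iff' measurableSet_Ioo).2 (Filter.Eventually.of_forall fun s hs => ?_))
    have h1 := le_norm_add_mul h hε (s := s)
    rw [norm_div, div_le_iff₀ (hs.1.trans_le h1)]
    calc ‖ψ s‖ ≤ K * s ^ (1 / 2 : ℝ) := hK s (Ioo_subset_Ioc_self hs)
      _ = K * s ^ (-(1 / 2) : ℝ) * s := by
        have : s ^ (1 / 2 : ℝ) = s ^ (-(1 / 2) : ℝ) * s := by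
          nth_rw 3 [← Real.rpow_one s]
          rw [← Real.rpow_add hs.1]; norm_num
        rw [this]; ring
      _ ≤ _ := by
        have := hs.1
        gcongr
  refine ((hbd.add ((isBoundedNearZero_integral_log h h0).const_mul p)).add
    ((isBoundedNearZero_integral_inv h h0).const_mul q)).congr ?_
  filter_upwards [self_mem_nhdsWithin] with ε hε
  have hne : ∀ s ∈ Icc (0 : ℝ) 1, (s : ℂ) ≠ -(ε * ω) := fun s hs e =>
    Complex.slitPlane_ne_zero (add_mul_ne_zero h h0 hs.1 hε) (by rw [e]; ring)
  have hI : ∀ χ : ℝ → ℂ, IntegrableOn χ (Ioo 0 1) →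
      IntegrableOn (fun s : ℝ => χ s / ((s : ℂ) + ε * ω)) (Ioo 0 1) := by
    intro χ hχ
    have := integrableOn_cauchyTransform hχ (γ := fun s : ℝ => (s : ℂ)) (by fun_prop) 1
      (α := -(ε * ω)) hne
    simpa using this
  have i1 := hI _ hψi
  have i2 := hI _ integrableOn_ofReal_log
  have i3 := hI (fun _ => 1) (integrableOn_const (by simp))
  have e := integral_four_mul i1 i2 i3 i3 1 p q 0
  have e2 : (∫ s in Ioo (0 : ℝ) 1, φ s / ((s : ℂ) + ε * ω)) =
      ∫ s in Ioo (0 : ℝ) 1, 1 * (ψ s / ((s : ℂ) + ε * ω)) +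
        (p * ((Real.log s : ℂ) / ((s : ℂ) + ε * ω)) + (q * (1 / ((s : ℂ) + ε * ω)) +
          0 * (1 / ((s : ℂ) + ε * ω)))) := by
    refine setIntegral_congr_fun measurableSet_Ioo fun s hs => ?_
    simp only [ψ]
    ring
  rw [e2, e]
  ring

/-! ### Asymptotics of Legendre functions and their Cauchy integrals at the origin -/

theorem tendsto_ofReal_mul_zero (a : ℂ) :
    Filter.Tendsto (fun ε : ℝ => (ε : ℂ) * a) (nhdsWithin 0 (Ioi 0)) (nhds 0) := by
  have : Filter.Tendsto (fun ε : ℝ => (ε : ℂ) * a) (nhds 0) (nhds (((0 : ℝ) : ℂ) * a)) :=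
    Continuous.tendsto (by fun_prop) 0
  simp only [Complex.ofReal_zero, zero_mul] at this
  exact this.mono_left nhdsWithin_le_nhds

theorem ofReal_mul_mem_slitPlane {ε : ℝ} (hε : 0 < ε) {a : ℂ} (ha : a ∈ Complex.slitPlane) :
    (ε : ℂ) * a ∈ Complex.slitPlane := by
  rw [Complex.mem_slitPlane_iff] at ha ⊢
  simp only [Complex.mul_re, Complex.mul_im, Complex.ofReal_re, Complex.ofReal_im, zero_mul,
    sub_zero, add_zero]
  rcases ha with h | h
  · left; positivity
  · right; exact mul_ne_zero hε.ne' h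

/-- The logarithmic behaviour at the origin of the Legendre functions, with constant term `d`. -/
structure HasLogAsymptotics (ν : ℝ) (d : ℂ) : Prop where
  legF_sq : ∀ a ∈ Complex.slitPlane, IsBoundedNearZero fun ε => legF ν (ε * a) ^ 2
  kerFG : ∀ a ∈ Complex.slitPlane,
    IsBoundedNearZero fun ε => kerFG ν (ε * a) - legC ν * (Real.log ε : ℂ)
  legG_sq : ∀ a ∈ Complex.slitPlane, IsBoundedNearZero fun ε =>
    legG ν (ε * a) ^ 2 - (legC ν * (Real.log ε : ℂ) + (legC ν * Complex.log a + d)) ^ 2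
  norm_legG : ∀ a ∈ Complex.slitPlane, ∃ C : ℝ, ∀ᶠ ε : ℝ in nhdsWithin 0 (Ioi 0),
    ‖legG ν (ε * a)‖ ≤ C * ε ^ (-(1 / 2) : ℝ)
  arcFF : ∀ a b : ℂ, a ≠ 0 → b ∈ doubleSlit → 0 ≤ (-a / b).re →
    IsBoundedNearZero fun ε => arcIntegral (_root_.kerFF ν) 0 (ε * a) b + (Real.log ε : ℂ)
  arcFG : ∀ a b : ℂ, a ≠ 0 → b ∈ doubleSlit → 0 ≤ (-a / b).re →
    IsBoundedNearZero fun ε => arcIntegral (_root_.kerFG ν) 0 (ε * a) b +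
      (legC ν * (((Real.log ε : ℂ) + Complex.log (-a / b)) ^ 2 / 2) +
        (legC ν * Complex.log b + d) * (Real.log ε : ℂ))

theorem arcIntegral_zero_eq (h : ℂ → ℂ) (ε : ℝ) (a : ℂ) {b : ℂ} (hb : b ≠ 0) :
    arcIntegral h 0 (ε * a) b =
      ∫ s in Ioo (0 : ℝ) 1, h (s * b) / ((s : ℂ) + ε * (-a / b)) := by
  refine setIntegral_congr_fun measurableSet_Ioo fun s _ => ?_
  have e : (s : ℂ) * b - ε * a = b * (s + ε * (-a / b)) := by field_simp; ring
  simp only [arc, mul_zero, add_zero, e]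
  rw [mul_comm (h _) b, mul_div_mul_left _ _ hb]

theorem exists_hasLogAsymptotics {ν : ℝ} (hν : -1 < ν ∧ ν < 0) : ∃ d, HasLogAsymptotics ν d := by
  obtain ⟨d, ρ, C, hρ, hρ1, hC, h⟩ := exists_log_approx hν
  have hev : ∀ a ∈ Complex.slitPlane, ∀ᶠ ε : ℝ in nhdsWithin 0 (Ioi 0),
      0 < ε ∧ ε < 1 ∧ (ε : ℂ) * a ∈ Complex.slitPlane ∧ ‖(ε : ℂ) * a‖ < ρ := by
    intro a ha
    filter_upwards [Ioo_mem_nhdsGT one_pos,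
      (tendsto_ofReal_mul_zero a).norm.eventually_lt_const (by simpa using hρ)] with ε hε hε'
    exact ⟨hε.1, hε.2, ofReal_mul_mem_slitPlane hε.1 ha, hε'⟩
  have hnorm : ∀ a : ℂ, ∀ ε : ℝ, 0 < ε → ∀ x : ℝ,
      ‖(ε : ℂ) * a‖ ^ x = ‖a‖ ^ x * ε ^ x := by
    intro a ε hε x
    rw [norm_mul, Complex.norm_real, Real.norm_of_nonneg hε.le,
      Real.mul_rpow hε.le (norm_nonneg _), mul_comm]
  refine ⟨d, fun a ha => ?_, fun a ha => ?_, fun a ha => ?_, fun a ha => ?_,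
    fun a b ha hb hre => ?_, fun a b ha hb hre => ?_⟩
  · refine ⟨C * C, ?_⟩
    filter_upwards [hev a ha] with ε ⟨hε, _, hm, hn⟩
    obtain ⟨-, -, -, h1, -, -⟩ := h _ hm hn
    rw [norm_pow, sq]
    exact mul_le_mul h1 h1 (norm_nonneg _) hC
  · have : IsBoundedNearZero fun ε => kerFG ν (ε * a) -
        (legC ν * Complex.log (ε * a) + d) := by
      refine ⟨C * 1, ?_⟩
      filter_upwards [hev a ha] with ε ⟨hε, _, hm, hn⟩
      obtain ⟨-, -, h1, -, -, -⟩ := h _ hm hn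
      refine h1.trans ?_
      gcongr
      exact Real.rpow_le_one (norm_nonneg _) (hn.le.trans hρ1) (by norm_num)
    refine (this.add (IsBoundedNearZero.const (legC ν * Complex.log a + d))).congr ?_
    filter_upwards [self_mem_nhdsWithin] with ε hε
    rw [clog_ofReal_mul hε (Complex.slitPlane_ne_zero ha)]
    ring
  · refine ⟨C * (C + (C + C)), ?_⟩
    filter_upwards [hev a ha] with ε ⟨hε, _, hm, hn⟩
    obtain ⟨-, h1, -, -, -, h2⟩ := h _ hm hn
    have hpos : 0 < ‖(ε : ℂ) * a‖ := norm_pos_iff.2 (Complex.slitPlane_ne_zero hm)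
    have e : (legC ν : ℂ) * (Real.log ε : ℂ) + (legC ν * Complex.log a + d) =
        legC ν * Complex.log (ε * a) + d := by
      rw [clog_ofReal_mul hε (Complex.slitPlane_ne_zero ha)]; ring
    rw [e]
    set g := legG ν (ε * a)
    set l := legC ν * Complex.log (ε * a) + d
    set n := ‖(ε : ℂ) * a‖
    have hle : n ^ (1 / 2 : ℝ) ≤ n ^ (-(1 / 2) : ℝ) :=
      Real.rpow_le_rpow_of_exponent_ge hpos (hn.le.trans hρ1) (by norm_num)
    have hone : n ^ (1 / 2 : ℝ) * n ^ (-(1 / 2) : ℝ) = 1 := by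
      rw [← Real.rpow_add hpos]; norm_num
    have hl : ‖g + l‖ ≤ (C + (C + C)) * n ^ (-(1 / 2) : ℝ) := by
      have e2 : g + l = g + (g - (g - l)) := by ring
      rw [e2]
      refine (norm_add_le _ _).trans ?_
      have := norm_sub_le g (g - l)
      have h3 : C * n ^ (1 / 2 : ℝ) ≤ C * n ^ (-(1 / 2) : ℝ) := by gcongr
      linarith
    -- The approximation error n^(1/2) compensates the crude growth n^(-1/2) of the sum.
    calc ‖g ^ 2 - l ^ 2‖ = ‖g - l‖ * ‖g + l‖ := by rw [← norm_mul]; congr 1; ring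
      _ ≤ (C * n ^ (1 / 2 : ℝ)) * ((C + (C + C)) * n ^ (-(1 / 2) : ℝ)) := by gcongr
      _ = C * (C + (C + C)) * (n ^ (1 / 2 : ℝ) * n ^ (-(1 / 2) : ℝ)) := by ring
      _ = _ := by rw [hone, mul_one]
  · refine ⟨C * ‖a‖ ^ (-(1 / 2) : ℝ), ?_⟩
    filter_upwards [hev a ha] with ε ⟨hε, _, hm, hn⟩
    obtain ⟨-, -, -, -, -, h2⟩ := h _ hm hn
    rw [hnorm a ε hε] at h2
    linarith
  · have hb0 := Complex.slitPlane_ne_zero (doubleSlit_subset_slitPlane hb)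
    have hω : -a / b ≠ 0 := div_ne_zero (neg_ne_zero.2 ha) hb0
    have hbp : 0 < ‖b‖ := norm_pos_iff.2 hb0
    simp only [arcIntegral_zero_eq _ _ a hb0]
    have := isBoundedNearZero_integral (φ := fun s : ℝ => _root_.kerFF ν (s * b)) hre hω (p := 0)
      (q := 1) (δ := ρ / ‖b‖) (C := C * (C + 1) * ‖b‖) ?_ (by positivity) ?_
    · simpa using this
    · exact (isMildAtZero_kerFF hν).continuousOn_radial (doubleSlit_subset_slitPlaneOne hb)
    · intro s hs hsδ
      have hm : (s : ℂ) * b ∈ Complex.slitPlane :=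
        ofReal_mul_mem_slitPlane hs.1 (doubleSlit_subset_slitPlane hb)
      have hns : ‖(s : ℂ) * b‖ = s * ‖b‖ := by
        rw [norm_mul, Complex.norm_real, Real.norm_of_nonneg hs.1.le]
      obtain ⟨-, -, -, h1, h2, -⟩ := h _ hm (by rw [hns]; exact (lt_div_iff₀ hbp).1 hsδ)
      have e : _root_.kerFF ν (s * b) - (0 * (Real.log s : ℂ) + 1) =
          (legF ν (s * b) - 1) * (legF ν (s * b) + 1) := by unfold kerFF; ring
      have hs2 : s ≤ s ^ (1 / 2 : ℝ) := by
        conv_lhs => rw [← Real.rpow_one s]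
        exact Real.rpow_le_rpow_of_exponent_ge hs.1 hs.2 (by norm_num)
      rw [e, norm_mul]
      calc _ ≤ (C * (s * ‖b‖)) * (C + 1) := by
            rw [hns] at h2
            refine mul_le_mul h2 ((norm_add_le _ _).trans ?_) (norm_nonneg _) (by
              have := hs.1; positivity)
            rw [norm_one]; linarith
        _ = C * (C + 1) * ‖b‖ * s := by ring
        _ ≤ _ := by gcongr
  · have hb0 := Complex.slitPlane_ne_zero (doubleSlit_subset_slitPlane hb)
    have hω : -a / b ≠ 0 := div_ne_zero (neg_ne_zero.2 ha) hb0
    have hbp : 0 < ‖b‖ := norm_pos_iff.2 hb0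
    simp only [arcIntegral_zero_eq _ _ a hb0]
    refine isBoundedNearZero_integral (φ := fun s : ℝ => _root_.kerFG ν (s * b)) hre hω
      (δ := ρ / ‖b‖) (C := C * ‖b‖ ^ (1 / 2 : ℝ)) ?_ (by positivity) ?_
    · exact (isMildAtZero_kerFG hν).continuousOn_radial hb
    · intro s hs hsδ
      have hm : (s : ℂ) * b ∈ Complex.slitPlane :=
        ofReal_mul_mem_slitPlane hs.1 (doubleSlit_subset_slitPlane hb)
      have hns : ‖(s : ℂ) * b‖ = s * ‖b‖ := by
        rw [norm_mul, Complex.norm_real, Real.norm_of_nonneg hs.1.le]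
      obtain ⟨-, -, h1, -, -, -⟩ := h _ hm (by rw [hns]; exact (lt_div_iff₀ hbp).1 hsδ)
      rw [hnorm b s hs.1, clog_ofReal_mul hs.1 hb0] at h1
      have e : (legC ν : ℂ) * (Real.log s : ℂ) + (legC ν * Complex.log b + d) =
        legC ν * (Real.log s + Complex.log b) + d := by ring
      rw [e, mul_assoc]
      exact h1

/-- On the ray through a, F² is bounded, FG grows like c log ε, and G² like (c log ε + c log a +
d)². The coefficients z and y are therefore readable from the powers of log ε, whereas x stays
invisible. -/
theorem HasLogAsymptotics.coeff_eq {ν : ℝ} {d : ℂ} (h : HasLogAsymptotics ν d) {a x y z A B : ℂ}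
    (ha : a ∈ Complex.slitPlane)
    (hb : IsBoundedNearZero fun ε => x * legF ν (ε * a) ^ 2 + y * _root_.kerFG ν (ε * a) +
      z * legG ν (ε * a) ^ 2 - (A * (Real.log ε : ℂ) ^ 2 + B * (Real.log ε : ℂ))) :
    z * (legC ν : ℂ) ^ 2 = A ∧
      y * legC ν + 2 * z * legC ν * (legC ν * Complex.log a + d) = B := by
  have h1 := (h.legF_sq a ha).const_mul x
  have h2 := (h.kerFG a ha).const_mul y
  have h3 := (h.legG_sq a ha).const_mul z
  have h4 := IsBoundedNearZero.const (z * (legC ν * Complex.log a + d) ^ 2)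
  have := eq_zero_of_isBoundedNearZero_log (A := z * (legC ν : ℂ) ^ 2 - A)
    (B := y * legC ν + 2 * z * legC ν * (legC ν * Complex.log a + d) - B)
    ((((((hb.sub h1).sub h2).sub h3).sub h4)).congr
      (Filter.Eventually.of_forall fun ε => by ring))
  exact ⟨sub_eq_zero.1 this.1, sub_eq_zero.1 this.2⟩

/-! ### The Cauchy integral of the mixed kernel over the unit interval -/

/-- The Cauchy integral `∫₀¹ P_ν(1 - 2t) P_ν(2t - 1) / (t - β) dt`. -/
noncomputable def unitCauchy (ν : ℝ) (β : ℂ) : ℂ :=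
  arcIntegral (kerFG ν) 0 β (1 / 2) - arcIntegral (kerFG ν) 0 (1 - β) (1 / 2)

theorem isGoodArc_half : IsGoodArc 0 (1 / 2) := ⟨half_mem_doubleSlit, Or.inl rfl⟩

theorem arc_zero_eq (b : ℂ) (s : ℝ) : arc 0 b s = s * b := by simp [arc]

theorem arc_half_ne {β : ℂ} (hβ : β.im ≠ 0) (s : ℝ) : arc 0 (1 / 2) s ≠ β := by
  rintro rfl
  rw [arc_zero_eq] at hβ
  simp at hβ

theorem arcIntegral_conj {h : ℂ → ℂ} (hh : ∀ t ∈ doubleSlit,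
    h ((starRingEnd ℂ) t) = (starRingEnd ℂ) (h t)) {b : ℂ} (hb : b ∈ doubleSlit) (a : ℂ) :
    arcIntegral h 0 ((starRingEnd ℂ) a) ((starRingEnd ℂ) b) =
      (starRingEnd ℂ) (arcIntegral h 0 a b) := by
  unfold arcIntegral
  rw [← integral_conj]
  refine setIntegral_congr_fun measurableSet_Ioo fun s hs => ?_
  have := hh _ (smul_mem_doubleSlit hb (Ioo_subset_Ioc_self hs))
  simp only [arc_zero_eq, mul_zero, add_zero, map_div₀, map_mul, map_sub, Complex.conj_ofReal,
    ← this]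

theorem legG_conj (ν : ℝ) {t : ℂ} (ht : t ∈ doubleSlit) :
    legG ν ((starRingEnd ℂ) t) = (starRingEnd ℂ) (legG ν t) := by
  unfold legG
  rw [← legF_conj ν (doubleSlit_subset_slitPlaneOne (one_sub_mem_doubleSlit ht))]
  simp

theorem kerFF_conj (ν : ℝ) {t : ℂ} (ht : t ∈ doubleSlit) :
    kerFF ν ((starRingEnd ℂ) t) = (starRingEnd ℂ) (kerFF ν t) := by
  simp [kerFF, legF_conj ν (doubleSlit_subset_slitPlaneOne ht)]

theorem kerFG_conj (ν : ℝ) {t : ℂ} (ht : t ∈ doubleSlit) :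
    kerFG ν ((starRingEnd ℂ) t) = (starRingEnd ℂ) (kerFG ν t) := by
  simp [kerFG, legF_conj ν (doubleSlit_subset_slitPlaneOne ht), legG_conj ν ht]

/-- The map β ↦ 1 - β̄ preserves the lower half plane and exchanges F and G up to conjugation; this
determines the coefficient that asymptotics at 0 cannot see. -/
theorem unitCauchy_reflect (ν : ℝ) (β : ℂ) :
    unitCauchy ν (1 - (starRingEnd ℂ) β) = -(starRingEnd ℂ) (unitCauchy ν β) := by
  have h (a : ℂ) := arcIntegral_conj (fun t ht => kerFG_conj ν ht) half_mem_doubleSlit a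
  have e : (starRingEnd ℂ) (1 / 2) = 1 / 2 := by rw [map_div₀, map_one, map_ofNat]
  rw [e] at h
  have h1 := h (1 - β)
  rw [map_sub, map_one] at h1
  unfold unitCauchy
  rw [sub_sub_cancel, h, h1, map_sub]
  ring

theorem isPreconnected_lowerHalfPlane : IsPreconnected {z : ℂ | z.im < 0} :=
  (convex_halfSpace_im_lt 0).isPreconnected

theorem isPreconnected_upperHalfPlane : IsPreconnected {z : ℂ | 0 < z.im} :=
  (convex_halfSpace_im_gt 0).isPreconnected

theorem isOpen_lowerHalfPlane : IsOpen {z : ℂ | z.im < 0} :=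
  isOpen_lt Complex.continuous_im continuous_const

theorem isOpen_upperHalfPlane : IsOpen {z : ℂ | 0 < z.im} :=
  isOpen_lt continuous_const Complex.continuous_im

/-- The Cauchy integral over (0, 1) solves the homogeneous equation: boundary terms at the outer end
points are negligible, and those of the two halves at 1/2 cancel. -/
theorem exists_unitCauchy_eq {ν : ℝ} (hν : -1 < ν ∧ ν < 0) : ∃ x y z : ℂ, ∀ β : ℂ, β.im < 0 →
    unitCauchy ν β = x * legF ν β ^ 2 + y * kerFG ν β + z * legG ν β ^ 2 := by
  have hFG := isMildAtZero_kerFG hν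
  have hF := isLegendreSol_legF hν
  have hG := isLegendreSol_legG hν
  have nFG := isNegligibleAtZero_legF_legG hν
  have eFG : ∀ t, kerFG ν t = legF ν t * legG ν t := fun t => rfl
  have j1 := hasJet_arcIntegral hFG subset_rfl isGoodArc_half (M := {z : ℂ | z.im < 0})
    fun a ha s _ => arc_half_ne (ne_of_lt ha) s
  have j2 := ((hasJet_arcIntegral hFG subset_rfl isGoodArc_half (M := {z : ℂ | 0 < z.im})
    fun a ha s _ => arc_half_ne (ne_of_gt ha) s).one_sub).mono
      (fun a (ha : a.im < 0) => by simpa using ha : {z : ℂ | z.im < 0} ⊆ _)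
  refine eq_combination_of_symSq_eq_zero hν isOpen_lowerHalfPlane isPreconnected_lowerHalfPlane
    (fun z hz => Or.inl (ne_of_lt hz)) (j1.sub j2) fun a ha => ?_
  have ha0 : a.im ≠ 0 := ne_of_lt ha
  have ha1 : (1 - a).im ≠ 0 := by simpa using ha0
  have haD : a ∈ doubleSlit := Or.inl ha0
  have l1 := symSq_cauchyTransform hF hG nFG eFG hFG subset_rfl isGoodArc_half haD
    fun s _ => arc_half_ne ha0 s
  have l2 := symSq_cauchyTransform hF hG nFG eFG hFG subset_rfl isGoodArc_half
    (one_sub_mem_doubleSlit haD) fun s _ => arc_half_ne ha1 s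
  simp only [unitCauchy, arcIntegral_eq_cauchyTransform]
  have hne : (1 : ℂ) / 2 - a ≠ 0 := fun h => ha0 (by
    have := congrArg Complex.im (sub_eq_zero.1 h); simpa using this.symm)
  have hfin : legConc ν (fun t => 1 / (t - a)) (fun t => -1 / (t - a) ^ 2)
        (fun t => 2 / (t - a) ^ 3) (legF ν) (legF₁ ν) (legG ν) (legG₁ ν) (1 / 2) +
      legConc ν (fun t => 1 / (t - (1 - a))) (fun t => -1 / (t - (1 - a)) ^ 2)
        (fun t => 2 / (t - (1 - a)) ^ 3) (legF ν) (legF₁ ν) (legG ν) (legG₁ ν) (1 / 2) = 0 := by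
    have e : (1 : ℂ) / 2 - (1 - a) = -(1 / 2 - a) := by ring
    have e2 : (1 : ℂ) - 1 / 2 = 1 / 2 := by norm_num
    simp only [legConc, legG, legG₁, e, e2]
    field_simp
    ring
  unfold symSq at l1 l2 ⊢
  linear_combination l1 + l2 - hfin

/-- With β = -iε, the coefficients of log² ε and log ε give z = -1/(2c) and y = -πi, independently
of the unknown constant d. The reflection symmetry then forces x̄ = -z. -/
theorem unitCauchy_eq {ν : ℝ} (hν : -1 < ν ∧ ν < 0) {β : ℂ} (hβ : β.im < 0) :
    unitCauchy ν β = (legF ν β ^ 2 - legG ν β ^ 2) / (2 * legC ν) -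
      Real.pi * Complex.I * kerFG ν β := by
  obtain ⟨d, hd⟩ := exists_hasLogAsymptotics hν
  obtain ⟨x, y, z, h⟩ := exists_unitCauchy_eq hν
  have hc0 := legC_ne_zero hν
  have hI : -Complex.I ∈ Complex.slitPlane := by rw [Complex.mem_slitPlane_iff]; right; simp
  have hlogI : Complex.log (-Complex.I) = -(Real.pi / 2) * Complex.I := by
    simp [Complex.log_neg_I]
  have him : ∀ ε : ℝ, 0 < ε → ((ε : ℂ) * -Complex.I).im < 0 := fun ε hε => by simpa using hε
  have hω : -(-Complex.I) / (1 / 2 : ℂ) = ((2 : ℝ) : ℂ) * Complex.I := by push_cast; ring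
  have hlogω : Complex.log (-(-Complex.I) / (1 / 2 : ℂ)) + Complex.log (1 / 2) =
      Real.pi / 2 * Complex.I := by
    rw [hω, Complex.log_ofReal_mul two_pos Complex.I_ne_zero, Complex.log_I,
      show (1 / 2 : ℂ) = ((1 / 2 : ℝ) : ℂ) by push_cast; ring,
      ← Complex.ofReal_log (by norm_num), one_div, Real.log_inv]
    push_cast
    ring
  have hT := hd.arcFG (-Complex.I) (1 / 2) (neg_ne_zero.2 Complex.I_ne_zero) half_mem_doubleSlit
    (by rw [hω]; simp)
  -- The pole 1 - β of the other half tends to 1, at positive distance from [0, 1/2], so this half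
  -- is bounded.
  have hT2 : IsBoundedNearZero fun ε =>
      arcIntegral (kerFG ν) 0 (1 - ε * -Complex.I) (1 / 2) := by
    have hcont := ((isMildAtZero_kerFG hν).differentiableAt_arcIntegral_left subset_rfl
      isGoodArc_half (α := 1) (fun s hs h => by
        rw [arc_zero_eq] at h
        have := congrArg Complex.re h
        simp at this
        linarith [hs.2])).continuousAt.tendsto
    have h1 := (tendsto_ofReal_mul_zero (-Complex.I)).const_sub 1
    rw [sub_zero] at h1
    exact IsBoundedNearZero.of_tendsto (hcont.comp h1)
  set lω := Complex.log (-(-Complex.I) / (1 / 2 : ℂ))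
  have hcomb := hd.coeff_eq (a := -Complex.I) (x := x) (y := y) (z := z) (A := -(legC ν : ℂ) / 2)
    (B := -(legC ν * (Real.pi / 2 * Complex.I) + d)) hI (by
      refine ((hT.sub hT2).sub (IsBoundedNearZero.const (legC ν * lω ^ 2 / 2))).congr ?_
      filter_upwards [self_mem_nhdsWithin] with ε hε
      rw [← h _ (him ε hε), unitCauchy, ← hlogω]
      ring)
  obtain ⟨hz, hy⟩ := hcomb
  have hz' : z = -1 / (2 * legC ν) := by
    field_simp
    have := mul_left_cancel₀ hc0 (show (legC ν : ℂ) * (z * legC ν * 2) = legC ν * -1 by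
      linear_combination 2 * hz)
    linear_combination this
  have hy' : y = -(Real.pi * Complex.I) := by
    rw [hlogI, hz'] at hy
    field_simp at hy
    have := mul_left_cancel₀ hc0 (show (legC ν : ℂ) * y = legC ν * -(Real.pi * Complex.I) by
      linear_combination hy / 2)
    exact this
  have hx' : x = 1 / (2 * legC ν) := by
    have hrel : ∀ β : ℂ, β.im < 0 → (x - 1 / (2 * legC ν)) * legF ν β ^ 2 + 0 * kerFG ν β +
        (z + (starRingEnd ℂ) x) * legG ν β ^ 2 = 0 := by
      intro β hβ
      have hD : β ∈ doubleSlit := Or.inl hβ.ne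
      have h1 := h (1 - (starRingEnd ℂ) β) (by simpa using hβ)
      have h2 := congrArg (starRingEnd ℂ) h1
      have hf : legF ν (1 - (starRingEnd ℂ) β) = (starRingEnd ℂ) (legG ν β) := legG_conj ν hD
      have hg : legG ν (1 - (starRingEnd ℂ) β) = (starRingEnd ℂ) (legF ν β) := by
        rw [legG_one_sub, legF_conj ν (doubleSlit_subset_slitPlaneOne hD)]
      rw [unitCauchy_reflect, kerFG_one_sub, kerFG_conj ν hD, hf, hg, h β hβ] at h2
      simp only [map_neg, map_add, map_mul, map_pow, Complex.conj_conj] at h2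
      have hzc : (starRingEnd ℂ) z = -1 / (2 * legC ν) := by
        rw [hz', map_div₀, map_neg, map_one, map_mul, map_ofNat, Complex.conj_ofReal]
      have hyc : (starRingEnd ℂ) y = Real.pi * Complex.I := by rw [hy']; simp
      rw [hzc, hyc, hy'] at h2
      linear_combination -h2
    have := hd.coeff_eq (a := -Complex.I) (A := 0) (B := 0) hI ((IsBoundedNearZero.const 0).congr (by
      filter_upwards [self_mem_nhdsWithin] with ε hε
      rw [hrel _ (him ε hε)]; ring))
    have h3 : z + (starRingEnd ℂ) x = 0 := by
      have := this.1
      simpa [hc0] using this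
    have h4 := congrArg (starRingEnd ℂ) h3
    simp only [map_add, Complex.conj_conj, map_zero] at h4
    rw [hz', map_div₀, map_neg, map_one, map_mul, map_ofNat, Complex.conj_ofReal] at h4
    linear_combination h4
  rw [h β hβ, hx', hy', hz']
  ring

/-! ### The reciprocity for straight paths -/

theorem arc_zero_ne {a b : ℂ} (h : 0 < a.im ∧ b.im ≤ 0 ∨ a.im < 0 ∧ 0 ≤ b.im) {s : ℝ}
    (hs : s ∈ Icc (0 : ℝ) 1) : arc 0 b s ≠ a := by
  rintro rfl
  rw [arc_zero_eq] at h
  simp only [Complex.mul_im, Complex.ofReal_re, Complex.ofReal_im, zero_mul, add_zero] at h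
  rcases h with ⟨h1, h2⟩ | ⟨h1, h2⟩
  · exact absurd h1 (not_lt.2 (mul_nonpos_of_nonneg_of_nonpos hs.1 h2))
  · exact absurd h1 (not_lt.2 (mul_nonneg hs.1 h2))

theorem isGoodPair_zero {α β : ℂ} (hβ : β ∈ doubleSlit)
    (h : 0 < α.im ∧ β.im ≤ 0 ∨ α.im < 0 ∧ 0 ≤ β.im) : IsGoodPair 0 0 α β := by
  refine ⟨Or.inl ?_, ⟨hβ, Or.inl rfl⟩, fun s hs => arc_zero_ne h hs,
    ⟨one_sub_mem_doubleSlit hβ, Or.inl rfl⟩, fun s hs => arc_zero_ne ?_ hs⟩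
  · rcases h with h | h
    · exact h.1.ne'
    · exact h.1.ne
  · simp only [Complex.sub_im, Complex.one_im]
    rcases h with h | h
    · right; constructor <;> linarith [h.1, h.2]
    · left; constructor <;> linarith [h.1, h.2]

/-- Reflected, the left side integrates FG/(t-β) from 1 to α and the right one from 0 to α. Both
have the same derivative in the end point; moving it from 1/2 to α along a segment, which apart from
1/2 lies in the upper half plane, keeps all paths away from β. At 1/2 the difference is
-`unitCauchy`. -/
theorem arcIntegral_one_sub_eq {ν : ℝ} (hν : -1 < ν ∧ ν < 0) {α β : ℂ} (hα : 0 < α.im)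
    (hβ : β.im < 0) : arcIntegral (kerFG ν) 0 (1 - β) (1 - α) =
      arcIntegral (kerFG ν) 0 β α - unitCauchy ν β := by
  set Φ : ℂ → ℂ := fun b => arcIntegral (kerFG ν) 0 (1 - β) (1 - b) - arcIntegral (kerFG ν) 0 β b
  set l : ℝ → ℂ := fun s => 1 / 2 + s * (α - 1 / 2)
  have hl : ∀ s, HasDerivAt l (α - 1 / 2) s := by
    intro s
    have : HasDerivAt (fun s : ℝ => (s : ℂ)) 1 s := Complex.ofRealCLM.hasDerivAt
    exact ((this.mul_const (α - 1 / 2)).const_add (1 / 2)).congr_deriv (by simp)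
  have hd : ∀ s ∈ Icc (0 : ℝ) 1, HasDerivAt (fun s => Φ (l s)) 0 s := by
    intro s hs
    have him : (l s).im = s * α.im := by simp [l]
    have hD : l s ∈ doubleSlit := by
      rcases hs.1.eq_or_lt with rfl | h
      · right; simp [l]; norm_num
      · left; rw [him]; positivity
    have hg := isGoodPair_zero (α := β) hD (Or.inr ⟨hβ, by
      rw [him]; exact mul_nonneg hs.1 hα.le⟩)
    obtain ⟨-, d1, d2, -⟩ := hg.hasDerivAt_right hν
    have h1 : HasDerivAt Φ 0 (l s) := (d2.sub d1).congr_deriv (sub_self _)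
    exact (HasDerivAt.comp (𝕜 := ℝ) (𝕜' := ℂ) (h₂ := Φ) s h1 (hl s)).congr_deriv (zero_mul _)
  have hconst := constant_of_has_deriv_right_zero
    (fun s hs => (hd s hs).continuousAt.continuousWithinAt)
    (fun s hs => (hd s (Ico_subset_Icc_self hs)).hasDerivWithinAt) 1 (by simp)
  simp only [l, Φ] at hconst
  norm_num at hconst
  unfold unitCauchy
  linear_combination hconst

/-- S(α‖β) and S(β‖α) have the same image 2c²/(α-β) under O_α, and the reciprocity term, as a
function of α, lies in the kernel of O_α. -/
theorem exists_entropyDefect_eq {ν : ℝ} (hν : -1 < ν ∧ ν < 0) {β : ℂ} (hβ : β.im < 0) :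
    ∃ x y z : ℂ, ∀ α : ℂ, 0 < α.im → entropyDefect ν 0 0 0 0 α β =
      x * legF ν α ^ 2 + y * kerFG ν α + z * legG ν α ^ 2 := by
  have hβD : β ∈ doubleSlit := Or.inl hβ.ne
  set N := {z : ℂ | 0 < z.im}
  have hND : N ⊆ doubleSlit := fun z hz => Or.inl (ne_of_gt hz)
  obtain ⟨y₁, y₂, y₃, hy, hy'⟩ := exists_hasJet_left hν (c := 0) (c' := 0) (β := β) (N := N)
    fun a ha => isGoodPair_zero hβD (Or.inl ⟨ha, hβ.le⟩)
  obtain ⟨z₁, z₂, z₃, hz, hz'⟩ := exists_hasJet_right hν (c := 0) (c' := 0) (α := β) (N := N)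
    fun a ha => isGoodPair_zero (hND ha) (Or.inr ⟨hβ, le_of_lt ha⟩)
  have hF := isLegendreSol_legF hν
  have hG := isLegendreSol_legG hν
  have jFF := (hF.hasJet_mul subset_rfl hF).mono hND
  have jFG := (hF.hasJet_mul subset_rfl hG).mono hND
  have jGG := (hG.hasJet_mul subset_rfl hG).mono hND
  have hr : (fun a => entropyDefect ν 0 0 0 0 a β) = fun a =>
      (entropyValue ν 0 0 a β - entropyValue ν 0 0 β a) -
        (kerFG ν β / (2 * legC ν) * (legF ν a * legF ν a + legG ν a * legG ν a) -
        (legF ν β ^ 2 + legG ν β ^ 2) / (2 * legC ν) * (legF ν a * legG ν a)) := by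
    funext a
    rw [entropyDefect, reciprocityTerm_eq]
    unfold kerFG
    ring
  have hj := (hy.sub hz).sub (((jFF.add jGG).const_mul (kerFG ν β / (2 * legC ν))).sub
    (jFG.const_mul ((legF ν β ^ 2 + legG ν β ^ 2) / (2 * legC ν))))
  rw [← hr] at hj
  refine eq_combination_of_symSq_eq_zero hν isOpen_upperHalfPlane isPreconnected_upperHalfPlane
    hND hj fun a ha => ?_
  have e0 := hy' a ha
  have e1 := hz' a ha
  have e2 := symSq_prodJet ν (legF ν) (legF₁ ν) (legF ν) (legF₁ ν) (hND ha)
  have e3 := symSq_prodJet ν (legF ν) (legF₁ ν) (legG ν) (legG₁ ν) (hND ha)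
  have e4 := symSq_prodJet ν (legG ν) (legG₁ ν) (legG ν) (legG₁ ν) (hND ha)
  have hra := congrFun hr a
  rw [hra]
  unfold symSq at e0 e1 e2 e3 e4 ⊢
  linear_combination e0 - e1 - kerFG ν β / (2 * legC ν) * (e2 + e4) +
    (legF ν β ^ 2 + legG ν β ^ 2) / (2 * legC ν) * e3

theorem abs_im_le_norm_sub {β t : ℂ} (hβ : β.im < 0) (ht : 0 ≤ t.im) : |β.im| ≤ ‖t - β‖ := by
  refine le_trans ?_ (Complex.abs_im_le_norm _)
  rw [Complex.sub_im, abs_of_neg hβ, abs_of_pos (by linarith)]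
  linarith

theorem exists_norm_legF_le_of_re_le {ν : ℝ} (hν : -1 < ν ∧ ν < 0) :
    ∃ M : ℝ, 0 ≤ M ∧ ∀ r : ℝ, 0 < r → ∀ t : ℂ, t.re ≤ 1 - r →
      ‖legF ν t‖ ≤ M * r ^ (-legEta ν) := by
  obtain ⟨M, hM, h⟩ := exists_norm_legF_le hν
  refine ⟨M, hM, fun r hr t ht => ?_⟩
  have h1 := h 1 r one_pos hr t (fun h => by linarith [h.2]) fun u hu => by
    refine le_trans ?_ (Complex.re_le_norm _)
    simp
    nlinarith [hu.1, hu.2]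
  simpa using h1

theorem isBoundedNearZero_arcFF_origin {ν : ℝ} (hν : -1 < ν ∧ ν < 0) {β : ℂ} (hβ : β.im < 0) :
    ∃ C : ℝ, ∀ᶠ ε : ℝ in nhdsWithin 0 (Ioi 0),
      ‖arcIntegral (kerFF ν) 0 β (ε * Complex.I)‖ ≤ C * ε := by
  obtain ⟨M, hM, h⟩ := exists_norm_legF_le_of_re_le hν
  have hb : 0 < |β.im| := abs_pos.2 hβ.ne
  refine ⟨M ^ 2 / |β.im|, ?_⟩
  filter_upwards [self_mem_nhdsWithin] with ε hε
  have hε' : 0 < ε := hε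
  have key : ∀ s ∈ Ioo (0 : ℝ) 1, ‖kerFF ν (arc 0 (ε * Complex.I) s) *
      (ε * Complex.I + (1 - 2 * s) * 0) / (arc 0 (ε * Complex.I) s - β)‖ ≤ M ^ 2 / |β.im| * ε := by
    intro s hs
    have h1 := h 1 one_pos (arc 0 (ε * Complex.I) s) (by simp [arc_zero_eq])
    rw [Real.one_rpow, mul_one] at h1
    have h2 : |β.im| ≤ ‖arc 0 (ε * Complex.I) s - β‖ := abs_im_le_norm_sub hβ (by
      simp [arc_zero_eq]; exact mul_nonneg hs.1.le hε'.le)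
    rw [norm_div, norm_mul, kerFF, norm_pow, mul_zero, add_zero, norm_mul, Complex.norm_I, mul_one,
      Complex.norm_real, Real.norm_of_nonneg hε'.le, div_mul_eq_mul_div]
    gcongr
  have := norm_setIntegral_le_of_norm_le_const (μ := volume) (s := Ioo (0 : ℝ) 1) (by simp) key
  simpa [arcIntegral] using this

theorem isBoundedNearZero_arcFG_origin {ν : ℝ} (hν : -1 < ν ∧ ν < 0) {β : ℂ} (hβ : β.im < 0) :
    ∃ C : ℝ, ∀ᶠ ε : ℝ in nhdsWithin 0 (Ioi 0),
      ‖arcIntegral (kerFG ν) 0 β (ε * Complex.I)‖ ≤ C * ε ^ (1 / 2 : ℝ) := by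
  obtain ⟨ρ, hρ, C, hC⟩ := (isMildAtZero_kerFG hν).bound
  have hb : 0 < |β.im| := abs_pos.2 hβ.ne
  set J := ∫ s in Ioo (0 : ℝ) 1, s ^ (-(1 / 2) : ℝ)
  refine ⟨C / |β.im| * J, ?_⟩
  filter_upwards [Ioo_mem_nhdsGT hρ] with ε hε
  have hI : (ε : ℂ) * Complex.I ∈ doubleSlit := Or.inl (by simpa using hε.1.ne')
  have key : ∀ s ∈ Ioo (0 : ℝ) 1, ‖kerFG ν (arc 0 (ε * Complex.I) s) *
      (ε * Complex.I + (1 - 2 * s) * 0) / (arc 0 (ε * Complex.I) s - β)‖ ≤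
        C / |β.im| * ε ^ (1 / 2 : ℝ) * s ^ (-(1 / 2) : ℝ) := by
    intro s hs
    have hn : ‖arc 0 (ε * Complex.I) s‖ = s * ε := by
      rw [arc_zero_eq, norm_mul, norm_mul, Complex.norm_I, mul_one, Complex.norm_real,
        Complex.norm_real, Real.norm_of_nonneg hs.1.le, Real.norm_of_nonneg hε.1.le]
    have hsε : 0 < s * ε := mul_pos hs.1 hε.1
    have h1 := hC (arc 0 (ε * Complex.I) s)
      (by rw [arc_zero_eq]; exact smul_mem_doubleSlit hI (Ioo_subset_Ioc_self hs))
      (norm_pos_iff.1 (by rw [hn]; exact hsε)) (by rw [hn]; nlinarith [hs.2, hε.2, hε.1])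
    have h2 : |β.im| ≤ ‖arc 0 (ε * Complex.I) s - β‖ := abs_im_le_norm_sub hβ (by
      simp [arc_zero_eq]; exact mul_nonneg hs.1.le hε.1.le)
    rw [hn, Real.mul_rpow hs.1.le hε.1.le] at h1
    have h3 : ε ^ (-(1 / 2) : ℝ) * ε = ε ^ (1 / 2 : ℝ) := by
      nth_rw 2 [← Real.rpow_one ε]
      rw [← Real.rpow_add hε.1]; norm_num
    rw [norm_div, norm_mul, mul_zero, add_zero, norm_mul, Complex.norm_I, mul_one,
      Complex.norm_real, Real.norm_of_nonneg hε.1.le]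
    calc _ ≤ C * (s ^ (-(1 / 2) : ℝ) * ε ^ (-(1 / 2) : ℝ)) * ε / |β.im| := by
          have h4 := mul_le_mul_of_nonneg_right h1 hε.1.le
          exact div_le_div₀ ((mul_nonneg (norm_nonneg _) hε.1.le).trans h4) h4 hb h2
      _ = C / |β.im| * (ε ^ (-(1 / 2) : ℝ) * ε) * s ^ (-(1 / 2) : ℝ) := by ring
      _ = _ := by rw [h3]
  have := norm_integral_le_of_norm_le (integrableOn_rpow_neg_half.const_mul _)
    ((ae_restrict_iff' measurableSet_Ioo).2 (Filter.Eventually.of_forall key))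
  rw [integral_const_mul] at this
  calc _ ≤ _ := this
    _ = _ := by ring

/-- Here the path approaches the singular point 1 of F. The bound |F(t)| ≤ M (1-s)^(-η) with 2η < 1
keeps the square integrable uniformly in ε. -/
theorem isBoundedNearZero_arcFF_one {ν : ℝ} (hν : -1 < ν ∧ ν < 0) {β : ℂ} (hβ : β.im < 0) :
    IsBoundedNearZero fun ε => arcIntegral (kerFF ν) 0 (1 - β) (1 - ε * Complex.I) := by
  obtain ⟨M, hM, h⟩ := exists_norm_legF_le_of_re_le hν
  have hb : 0 < |β.im| := abs_pos.2 hβ.ne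
  have hint : IntegrableOn (fun s : ℝ => s ^ (0 : ℝ) * (1 - s) ^ (-(2 * legEta ν))) (Ioo 0 1) :=
    integrableOn_rpow_mul_rpow (by norm_num) (by linarith [legEta_lt hν])
  refine ⟨∫ s in Ioo (0 : ℝ) 1, M ^ 2 * 2 / |β.im| * (s ^ (0 : ℝ) * (1 - s) ^ (-(2 * legEta ν))), ?_⟩
  filter_upwards [Ioo_mem_nhdsGT one_pos] with ε hε
  refine norm_integral_le_of_norm_le (hint.const_mul _)
    ((ae_restrict_iff' measurableSet_Ioo).2 (Filter.Eventually.of_forall fun s hs => ?_))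
  have h1s : (0 : ℝ) < 1 - s := by linarith [hs.2]
  have h1 := h (1 - s) h1s (arc 0 (1 - ε * Complex.I) s) (by simp [arc_zero_eq])
  have h2 : |β.im| ≤ ‖arc 0 (1 - ε * Complex.I) s - (1 - β)‖ := by
    refine le_trans ?_ (Complex.abs_im_le_norm _)
    have : (arc 0 (1 - ε * Complex.I) s - (1 - β)).im = -(s * ε) + β.im := by
      simp [arc_zero_eq]
    have h3 : 0 < s * ε := mul_pos hs.1 hε.1
    rw [this, abs_of_neg hβ, abs_of_neg (by linarith)]
    linarith
  have h3 : ‖(1 : ℂ) - ε * Complex.I‖ ≤ 2 := by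
    refine (norm_sub_le _ _).trans ?_
    rw [norm_one, norm_mul, Complex.norm_I, mul_one, Complex.norm_real,
      Real.norm_of_nonneg hε.1.le]
    linarith [hε.2]
  have h4 : ((1 - s) ^ (-legEta ν)) ^ 2 = (1 - s) ^ (-(2 * legEta ν)) := by
    rw [← Real.rpow_natCast, ← Real.rpow_mul h1s.le]; congr 1; push_cast; ring
  rw [norm_div, norm_mul, kerFF, norm_pow, mul_zero, add_zero, Real.rpow_zero, one_mul]
  calc _ ≤ (M * (1 - s) ^ (-legEta ν)) ^ 2 * 2 / |β.im| := by gcongr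
    _ = M ^ 2 * 2 / |β.im| * ((1 - s) ^ (-legEta ν)) ^ 2 := by ring
    _ = _ := by rw [h4]

/-- Along α = iε every contribution of order log² ε and log ε cancels, so the defect is bounded and
the coefficients of FG and G² vanish. -/
theorem entropyDefect_eq_mul_legF_sq {ν : ℝ} (hν : -1 < ν ∧ ν < 0) {β : ℂ} (hβ : β.im < 0) :
    ∃ x : ℂ, ∀ α : ℂ, 0 < α.im → entropyDefect ν 0 0 0 0 α β = x * legF ν α ^ 2 := by
  obtain ⟨x, y, z, h⟩ := exists_entropyDefect_eq hν hβ
  obtain ⟨d, hd⟩ := exists_hasLogAsymptotics hν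
  have hc0 := legC_ne_zero hν
  have hβD : β ∈ doubleSlit := Or.inl hβ.ne
  have hβ0 := Complex.slitPlane_ne_zero (doubleSlit_subset_slitPlane hβD)
  have hI : Complex.I ∈ Complex.slitPlane := by rw [Complex.mem_slitPlane_iff]; right; simp
  have him : ∀ ε : ℝ, 0 < ε → 0 < ((ε : ℂ) * Complex.I).im := fun ε hε => by simpa using hε
  have hre : 0 < (-Complex.I / β).re := by
    have : (-Complex.I / β).re = -β.im / Complex.normSq β := by
      rw [Complex.div_re]; simp
    rw [this]
    exact div_pos (by linarith) (Complex.normSq_pos.2 hβ0)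
  have hlog : Complex.log (-Complex.I / β) = -(Real.pi / 2) * Complex.I - Complex.log β := by
    have hexp : Complex.exp (-(Real.pi / 2) * Complex.I - Complex.log β) = -Complex.I / β := by
      rw [Complex.exp_sub, Complex.exp_log hβ0]
      congr 1
      rw [show -((Real.pi : ℂ) / 2) * Complex.I = -(Real.pi / 2 * Complex.I) by ring,
        Complex.exp_neg, Complex.exp_pi_div_two_mul_I]
      simp
    rw [← hexp]
    have harg := Complex.arg_neg_iff.2 hβ
    have harg' := Complex.neg_pi_lt_arg β
    apply Complex.log_exp
    · simp [Complex.log_im]; linarith [Real.pi_pos]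
    · simp [Complex.log_im]; linarith [Real.pi_pos]
  have b0 := hd.arcFF Complex.I β Complex.I_ne_zero hβD hre.le
  have b1 := hd.arcFG Complex.I β Complex.I_ne_zero hβD hre.le
  have bk : ∀ (U : Set ℂ) (k : ℂ → ℂ), IsMildAtZero U k → doubleSlit ⊆ U →
      IsBoundedNearZero fun ε => arcIntegral k 0 (1 - ε * Complex.I) (1 - β) := by
    intro U k hk hU
    have hg : IsGoodArc 0 (1 - β) := ⟨one_sub_mem_doubleSlit hβD, Or.inl rfl⟩
    have hcont := (hk.differentiableAt_arcIntegral_left hU hg (α := 1) (fun s hs h => by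
      rw [arc_zero_eq] at h
      have h1 := congrArg Complex.im h
      simp only [Complex.mul_im, Complex.ofReal_re, Complex.ofReal_im, zero_mul, add_zero,
        Complex.sub_im, Complex.one_im, zero_sub, mul_neg, neg_eq_zero, mul_eq_zero, hβ.ne,
        or_false] at h1
      simp [h1] at h)).continuousAt.tendsto
    have h1 := (tendsto_ofReal_mul_zero Complex.I).const_sub 1
    rw [sub_zero] at h1
    exact IsBoundedNearZero.of_tendsto (hcont.comp h1)
  have b2 := bk _ _ (isMildAtZero_kerFG hν) subset_rfl
  have b3 := bk _ _ (isMildAtZero_kerFF hν) doubleSlit_subset_slitPlaneOne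
  have b4 : IsBoundedNearZero fun ε =>
      legG ν (ε * Complex.I) ^ 2 * arcIntegral (kerFF ν) 0 β (ε * Complex.I) := by
    obtain ⟨C, hC⟩ := hd.norm_legG _ hI
    obtain ⟨D, hD⟩ := isBoundedNearZero_arcFF_origin hν hβ
    refine ⟨C ^ 2 * D, ?_⟩
    filter_upwards [hC, hD, self_mem_nhdsWithin] with ε h1 h2 hε
    have hε' : 0 < ε := hε
    have h3 : (ε ^ (-(1 / 2) : ℝ)) ^ 2 * ε = 1 := by
      rw [← Real.rpow_natCast, ← Real.rpow_mul hε'.le]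
      nth_rw 2 [← Real.rpow_one ε]
      rw [← Real.rpow_add hε']; norm_num
    rw [norm_mul, norm_pow]
    calc _ ≤ (C * ε ^ (-(1 / 2) : ℝ)) ^ 2 * (D * ε) :=
          mul_le_mul (pow_le_pow_left₀ (norm_nonneg _) h1 2) h2 (norm_nonneg _) (by positivity)
      _ = C ^ 2 * D * ((ε ^ (-(1 / 2) : ℝ)) ^ 2 * ε) := by ring
      _ = _ := by rw [h3, mul_one]
  have b5 : IsBoundedNearZero fun ε =>
      kerFG ν (ε * Complex.I) * arcIntegral (kerFG ν) 0 β (ε * Complex.I) := by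
    obtain ⟨C, hC⟩ := hd.norm_legG _ hI
    obtain ⟨D, hD⟩ := isBoundedNearZero_arcFG_origin hν hβ
    have : IsBoundedNearZero fun ε =>
        legG ν (ε * Complex.I) * arcIntegral (kerFG ν) 0 β (ε * Complex.I) := by
      refine ⟨C * D, ?_⟩
      filter_upwards [hC, hD, self_mem_nhdsWithin] with ε h1 h2 hε
      have hε' : 0 < ε := hε
      have h3 : ε ^ (-(1 / 2) : ℝ) * ε ^ (1 / 2 : ℝ) = 1 := by
        rw [← Real.rpow_add hε']; norm_num
      rw [norm_mul]
      calc _ ≤ (C * ε ^ (-(1 / 2) : ℝ)) * (D * ε ^ (1 / 2 : ℝ)) :=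
            mul_le_mul h1 h2 (norm_nonneg _) ((norm_nonneg _).trans h1)
        _ = C * D * (ε ^ (-(1 / 2) : ℝ) * ε ^ (1 / 2 : ℝ)) := by ring
        _ = _ := by rw [h3, mul_one]
    refine ((IsBoundedNearZero.of_tendsto ((hasDerivAt_legF hν
      zero_mem_slitPlaneOne).continuousAt.tendsto.comp (tendsto_ofReal_mul_zero Complex.I))).mul
      this).congr (Filter.Eventually.of_forall fun ε => ?_)
    simp only [Function.comp_apply, kerFG]
    ring
  have b6 := (hd.legF_sq _ hI).mul (isBoundedNearZero_arcFF_one hν hβ)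
  have b7 := hd.kerFG _ hI
  have b8 := hd.legG_sq _ hI
  have b9 := hd.legF_sq _ hI
  set lβ := Complex.log β
  have hcoeff := hd.coeff_eq (a := Complex.I) (x := x) (y := y) (z := z) (A := 0) (B := 0) hI (by
    -- In S(β‖α) the integral starting at 1 is rewritten through the one starting at 0 and
    -- `unitCauchy`, which doubles the mixed term b5. The coefficient of FG(α) collected from
    -- `unitCauchy` and the reciprocity term is G(β)²/c + πi FG(β). Its logarithm cancels those of
    -- the integrals with pole at α; `comb2` adds the remaining constants.
    have comb := (((((((b0.const_mul (legG ν β ^ 2)).sub (b1.const_mul (kerFG ν β))).sub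
      (b2.const_mul (kerFG ν β))).add (b3.const_mul (legF ν β ^ 2))).sub b4).add
      (b5.const_mul 2)).sub b6).add ((b7.const_mul (legG ν β ^ 2 / legC ν +
        Real.pi * Complex.I * kerFG ν β)).sub ((b8.const_mul (kerFG ν β / (2 * legC ν))).add
        (b9.const_mul (kerFG ν β / (2 * legC ν)))))
    have comb2 := comb.add (IsBoundedNearZero.const (kerFG ν β * (legC ν *
      (-(Real.pi / 2) * Complex.I - lβ) ^ 2 / 2 -
        (legC ν * (Real.pi / 2 * Complex.I) + d) ^ 2 / (2 * legC ν))))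
    refine comb2.congr ?_
    filter_upwards [self_mem_nhdsWithin] with ε hε
    rw [← h _ (him ε hε), entropyDefect, reciprocityTerm_eq, entropyValue, entropyValue,
      arcIntegral_one_sub_eq hν (him ε hε) hβ, unitCauchy_eq hν hβ, hlog, Complex.log_I]
    field_simp
    ring)
  obtain ⟨hz, hy⟩ := hcoeff
  have hz0 : z = 0 := by simpa [hc0] using hz
  have hy0 : y = 0 := by simpa [hc0, hz0] using hy
  exact ⟨x, fun α hα => by rw [h α hα, hz0, hy0]; ring⟩

/-- Because F and G are real on (0, 1), the map t ↦ 1 - t̄ conjugates the kernels, exchanges F with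
G, and permutes the four integrals of S. -/
theorem entropyDefect_reflect (ν : ℝ) {α β : ℂ} (hα : α ∈ doubleSlit) (hβ : β ∈ doubleSlit) :
    entropyDefect ν 0 0 0 0 (1 - (starRingEnd ℂ) α) (1 - (starRingEnd ℂ) β) =
      (starRingEnd ℂ) (entropyDefect ν 0 0 0 0 α β) := by
  have hf : ∀ t ∈ doubleSlit, legF ν (1 - (starRingEnd ℂ) t) = (starRingEnd ℂ) (legG ν t) :=
    fun t ht => legG_conj ν ht
  have hg : ∀ t ∈ doubleSlit, legG ν (1 - (starRingEnd ℂ) t) = (starRingEnd ℂ) (legF ν t) := by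
    intro t ht
    rw [legG_one_sub, legF_conj ν (doubleSlit_subset_slitPlaneOne ht)]
  have hh : ∀ t ∈ doubleSlit, kerFG ν (1 - (starRingEnd ℂ) t) = (starRingEnd ℂ) (kerFG ν t) := by
    intro t ht
    rw [kerFG_one_sub, kerFG_conj ν ht]
  have e1 (a b : ℂ) (hb : b ∈ doubleSlit) := arcIntegral_conj (fun t ht => kerFF_conj ν ht) hb a
  have e2 (a b : ℂ) (hb : b ∈ doubleSlit) := arcIntegral_conj (fun t ht => kerFG_conj ν ht) hb a
  have hs (t : ℂ) : 1 - (starRingEnd ℂ) t = (starRingEnd ℂ) (1 - t) := by simp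
  have hv : ∀ a b : ℂ, a ∈ doubleSlit → b ∈ doubleSlit →
      entropyValue ν 0 0 (1 - (starRingEnd ℂ) a) (1 - (starRingEnd ℂ) b) =
        (starRingEnd ℂ) (entropyValue ν 0 0 a b) := by
    intro a b ha hb
    unfold entropyValue
    rw [sub_sub_cancel, sub_sub_cancel, hf b hb, hg b hb, hh b hb, hs, hs,
      e1 _ _ (one_sub_mem_doubleSlit hb), e2 _ _ (one_sub_mem_doubleSlit hb), e1 _ _ hb, e2 _ _ hb]
    simp only [map_sub, map_add, map_mul, map_pow]
    ring
  unfold entropyDefect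
  rw [hv α β hα hβ, hv β α hβ hα, reciprocityTerm_eq, reciprocityTerm_eq, hf α hα, hf β hβ,
    hg α hα, hg β hβ, hh α hα, hh β hβ]
  simp only [map_sub, map_add, map_mul, map_pow, map_div₀, map_ofNat, Complex.conj_ofReal]
  ring

/-- Reflection preserves the two half planes and turns x F² into a multiple of G². Thus x F² = x̄'
G² on the upper half plane, where x' belongs to 1 - β̄; the log² growth of G² at 0 forces x' = 0,
and reflecting back annihilates the defect at (α, β). -/
theorem entropyDefect_eq_zero {ν : ℝ} (hν : -1 < ν ∧ ν < 0) {α β : ℂ} (hα : 0 < α.im)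
    (hβ : β.im < 0) : entropyDefect ν 0 0 0 0 α β = 0 := by
  obtain ⟨x, hx⟩ := entropyDefect_eq_mul_legF_sq hν hβ
  obtain ⟨x', hx'⟩ := entropyDefect_eq_mul_legF_sq hν (β := 1 - (starRingEnd ℂ) β) (by simpa using hβ)
  obtain ⟨d, hd⟩ := exists_hasLogAsymptotics hν
  have hI : Complex.I ∈ Complex.slitPlane := by rw [Complex.mem_slitPlane_iff]; right; simp
  have key : ∀ a : ℂ, 0 < a.im → x * legF ν a ^ 2 = (starRingEnd ℂ) x' * legG ν a ^ 2 := by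
    intro a ha
    have haD : a ∈ doubleSlit := Or.inl ha.ne'
    have h1 := hx' (1 - (starRingEnd ℂ) a) (by simpa using ha)
    have h2 : legF ν (1 - (starRingEnd ℂ) a) = (starRingEnd ℂ) (legG ν a) := legG_conj ν haD
    rw [entropyDefect_reflect ν haD (Or.inl hβ.ne), hx a ha, h2] at h1
    have h3 := congrArg (starRingEnd ℂ) h1
    simpa using h3
  have h0 := (hd.coeff_eq (a := Complex.I) (x := x) (y := 0) (z := -(starRingEnd ℂ) x') (A := 0)
    (B := 0) hI ((IsBoundedNearZero.const 0).congr (by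
      filter_upwards [self_mem_nhdsWithin] with ε hε
      have hε' : 0 < ε := hε
      rw [key _ (by simpa using hε')]; ring))).1
  have h1 : x' = 0 := by
    have := legC_ne_zero hν
    simpa [this] using h0
  have h2 := hx' (1 - (starRingEnd ℂ) α) (by simpa using hα)
  rw [entropyDefect_reflect ν (Or.inl hα.ne') (Or.inl hβ.ne), h1, zero_mul] at h2
  simpa using h2

/-- The reciprocity of the entropy. -/
theorem isReciprocal {ν : ℝ} (hν : -1 < ν ∧ ν < 0) {α β : ℂ} (hα : α ∈ doubleSlit)
    (hβ : β ∈ doubleSlit) (hαβ : α ≠ β) : IsReciprocal ν α β := by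
  refine isReciprocal_of_half_planes hν (fun a b ha hb => ?_) hα hβ hαβ
  refine (isReciprocal_iff hν (isGoodPair_zero (Or.inl hb.ne) (Or.inl ⟨ha, hb.le⟩))
    (isGoodPair_zero (Or.inl ha.ne') (Or.inr ⟨hb, ha.le⟩))).2 ⟨0, ?_⟩
  rw [entropyDefect_eq_zero hν ha hb]
  simp [latticeVector]

/-! ### The differential equation of all branches -/

theorem HasJet.congr {U : Set ℂ} (hU : IsOpen U) {y y₁ y₂ y₃ s : ℂ → ℂ} (h : HasJet U y y₁ y₂ y₃)
    (hs : EqOn s y U) : HasJet U s y₁ y₂ y₃ :=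
  ⟨fun t ht => (h.h₀ t ht).congr_of_eventuallyEq (hs.eventuallyEq_of_mem (hU.mem_nhds ht)),
    h.h₁, h.h₂⟩

theorem exists_hasJet_combination {ν : ℝ} (hν : -1 < ν ∧ ν < 0) (x y z : ℂ) :
    ∃ w₁ w₂ w₃, HasJet doubleSlit
      (fun t => x * legF ν t ^ 2 + y * kerFG ν t + z * legG ν t ^ 2) w₁ w₂ w₃ ∧
      ∀ t ∈ doubleSlit, symSq ν t (x * legF ν t ^ 2 + y * kerFG ν t + z * legG ν t ^ 2)
        (w₁ t) (w₂ t) (w₃ t) = 0 := by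
  have hF := isLegendreSol_legF hν
  have hG := isLegendreSol_legG hν
  have hj := (((hF.hasJet_mul subset_rfl hF).const_mul x).add
    ((hF.hasJet_mul subset_rfl hG).const_mul y)).add ((hG.hasJet_mul subset_rfl hG).const_mul z)
  refine ⟨_, _, _, hj.congr isOpen_doubleSlit fun t _ => by simp only [kerFG]; ring,
    fun t ht => ?_⟩
  have e2 := symSq_prodJet ν (legF ν) (legF₁ ν) (legF ν) (legF₁ ν) ht
  have e3 := symSq_prodJet ν (legF ν) (legF₁ ν) (legG ν) (legG₁ ν) ht
  have e4 := symSq_prodJet ν (legG ν) (legG₁ ν) (legG ν) (legG₁ ν) ht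
  unfold symSq kerFG at *
  linear_combination x * e2 + y * e3 + z * e4

/-- A branch may a priori use a different integer vector at each point. Holomorphy and countability
make it constant on the ball, and the resulting combination of F², FG, G² is annihilated by the
operator. -/
theorem symSq_iteratedDeriv_of_exists_eq {ν : ℝ} (hν : -1 < ν ∧ ν < 0) {C α R : ℂ} {r : ℝ}
    (hr : 0 < r) {s v v₁ v₂ v₃ : ℂ → ℂ} {x y z : ℤ × ℤ × ℤ → ℂ}
    (hBD : Metric.ball α r ⊆ doubleSlit) (hs : DifferentiableOn ℂ s (Metric.ball α r))
    (hv : HasJet (Metric.ball α r) v v₁ v₂ v₃)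
    (hR : symSq ν α (v α) (v₁ α) (v₂ α) (v₃ α) = R)
    (hsv : ∀ b ∈ Metric.ball α r, ∃ n, s b =
      C * (v b + (x n * legF ν b ^ 2 + y n * kerFG ν b + z n * legG ν b ^ 2))) :
    symSq ν α (s α) (iteratedDeriv 1 s α) (iteratedDeriv 2 s α) (iteratedDeriv 3 s α) = C * R := by
  have hα : α ∈ Metric.ball α r := Metric.mem_ball_self hr
  choose w₁ w₂ w₃ hw hw0 using fun n => exists_hasJet_combination hν (x n) (y n) (z n)
  have hj n := (hv.add ((hw n).mono hBD)).const_mul C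
  obtain ⟨n, hn⟩ := exists_forall_eq_of_forall_exists_eq
    (F := fun n b => s b -
      C * (v b + (x n * legF ν b ^ 2 + y n * kerFG ν b + z n * legG ν b ^ 2)))
    Metric.isOpen_ball (convex_ball α r).isPreconnected
    (fun n => hs.sub fun b hb => ((hj n).h₀ b hb).differentiableAt.differentiableWithinAt)
    Metric.isOpen_ball ⟨α, hα⟩ subset_rfl
    (fun b hb => (hsv b hb).imp fun n h => sub_eq_zero.2 h)
  have hjs := (hj n).congr Metric.isOpen_ball (s := s) fun b hb => sub_eq_zero.1 (hn b hb)
  obtain ⟨i1, i2, i3⟩ := hjs.iteratedDeriv_eq Metric.isOpen_ball hα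
  rw [i1, i2, i3, sub_eq_zero.1 (hn α hα), ← hR]
  have h0 := hw0 n α (hBD hα)
  unfold symSq at h0 ⊢
  linear_combination C * h0

theorem isBranchOn_left {ν : ℝ} (hν : -1 < ν ∧ ν < 0) (C : ℂ) {α β : ℂ} (hα : α ∈ doubleSlit)
    (hβ : β ∈ doubleSlit) (hαβ : α ≠ β) :
    (∃ N s, α ∈ N ∧ IsBranchOn (fun a w => ((entropySum ν).scale C).IsValue a β w) N s) ∧
      ∀ N s, α ∈ N → IsBranchOn (fun a w => ((entropySum ν).scale C).IsValue a β w) N s →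
        symSq ν α (s α) (iteratedDeriv 1 s α) (iteratedDeriv 2 s α) (iteratedDeriv 3 s α) =
          C * (2 * (legC ν : ℂ) ^ 2 / (α - β)) := by
  obtain ⟨c, c', h⟩ := exists_isGoodPair hα hβ hαβ
  constructor
  · obtain ⟨r, hr, hb⟩ := Metric.eventually_nhds_iff_ball.1 h.eventually_left
    exact ⟨Metric.ball α r, fun a => C * entropyValue ν c c' a β, Metric.mem_ball_self hr,
      Metric.isOpen_ball, fun a ha =>
        (((hb a ha).differentiableAt_left hν).const_mul C).differentiableWithinAt,
      fun a ha => (hb a ha).isValue hν C⟩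
  · rintro N s hαN ⟨hN, hs, hval⟩
    obtain ⟨r, hr, hb⟩ := Metric.eventually_nhds_iff_ball.1
      (h.eventually_left.and (hN.eventually_mem hαN))
    obtain ⟨y₁, y₂, y₃, hy, hy'⟩ := exists_hasJet_left hν fun a ha => (hb a ha).1
    refine symSq_iteratedDeriv_of_exists_eq hν hr
      (x := fun n => 2 * (Real.pi : ℂ) * Complex.I * (n.1 * legG ν β ^ 2))
      (y := fun n => 2 * (Real.pi : ℂ) * Complex.I * (n.2.1 * kerFG ν β))
      (z := fun n => 2 * (Real.pi : ℂ) * Complex.I * (n.2.2 * legF ν β ^ 2))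
      (fun a ha => (hb a ha).1.left_mem) (hs.mono fun a ha => (hb a ha).2) hy
      (hy' α (Metric.mem_ball_self hr)) fun a ha => ?_
    obtain ⟨n, hn⟩ := (hb a ha).1.exists_eq_of_isValue hν C (hval a (hb a ha).2)
    exact ⟨n, by rw [hn, latticeVector]; ring⟩

theorem isBranchOn_right {ν : ℝ} (hν : -1 < ν ∧ ν < 0) (C : ℂ) {α β : ℂ} (hα : α ∈ doubleSlit)
    (hβ : β ∈ doubleSlit) (hαβ : α ≠ β) :
    (∃ N s, α ∈ N ∧ IsBranchOn (fun a w => ((entropySum ν).scale C).IsValue β a w) N s) ∧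
      ∀ N s, α ∈ N → IsBranchOn (fun a w => ((entropySum ν).scale C).IsValue β a w) N s →
        symSq ν α (s α) (iteratedDeriv 1 s α) (iteratedDeriv 2 s α) (iteratedDeriv 3 s α) =
          C * (2 * (legC ν : ℂ) ^ 2 / (α - β)) := by
  obtain ⟨c, c', h⟩ := exists_isGoodPair hβ hα hαβ.symm
  constructor
  · obtain ⟨r, hr, hb⟩ := Metric.eventually_nhds_iff_ball.1 h.eventually_right
    exact ⟨Metric.ball α r, fun a => C * entropyValue ν c c' β a, Metric.mem_ball_self hr,
      Metric.isOpen_ball, fun a ha =>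
        (((hb a ha).differentiableAt_right hν).const_mul C).differentiableWithinAt,
      fun a ha => (hb a ha).isValue hν C⟩
  · rintro N s hαN ⟨hN, hs, hval⟩
    obtain ⟨r, hr, hb⟩ := Metric.eventually_nhds_iff_ball.1
      (h.eventually_right.and (hN.eventually_mem hαN))
    obtain ⟨y₁, y₂, y₃, hy, hy'⟩ := exists_hasJet_right hν fun a ha => (hb a ha).1
    refine symSq_iteratedDeriv_of_exists_eq hν hr
      (x := fun n => 2 * (Real.pi : ℂ) * Complex.I * (n.2.2 * legG ν β ^ 2))
      (y := fun n => 2 * (Real.pi : ℂ) * Complex.I * (n.2.1 * kerFG ν β))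
      (z := fun n => 2 * (Real.pi : ℂ) * Complex.I * (n.1 * legF ν β ^ 2))
      (fun a ha => (hb a ha).1.good.1) (hs.mono fun a ha => (hb a ha).2) hy
      (hy' α (Metric.mem_ball_self hr)) fun a ha => ?_
    obtain ⟨n, hn⟩ := (hb a ha).1.exists_eq_of_isValue hν C (hval a (hb a ha).2)
    exact ⟨n, by rw [hn, latticeVector]; ring⟩

/-! ### Algebraic equations and the unit cube -/

/-- The polynomial Y^q A - B is nontrivial because, at a point where A ≠ 0, its values at Y = 0 and
Y = 1 differ; the set has to be nonempty for this. -/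
theorem satisfiesAlgebraicEquationOn_of_pow_mul_eq {X σ : Type} {coord : X → σ → ℂ} {f : X → ℂ}
    {s : Set X} (hs : s.Nonempty) {q : ℕ} (hq : 0 < q) {A B : MvPolynomial σ QbarC}
    (hA : ∀ x ∈ s, MvPolynomial.aeval (coord x) A ≠ 0)
    (h : ∀ x ∈ s, f x ^ q * MvPolynomial.aeval (coord x) A = MvPolynomial.aeval (coord x) B) :
    SatisfiesAlgebraicEquationOn coord f s := by
  have hev : ∀ (x : X) (w : ℂ) (p : MvPolynomial σ QbarC),
      MvPolynomial.aeval (fun o : Option σ => o.elim w (coord x)) (MvPolynomial.rename some p) =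
        MvPolynomial.aeval (coord x) p := by
    intro x w p
    rw [MvPolynomial.aeval_rename]
    rfl
  refine ⟨MvPolynomial.X none ^ q * MvPolynomial.rename some A - MvPolynomial.rename some B,
    fun h0 => ?_, fun x hx => ?_⟩
  · obtain ⟨x, hx⟩ := hs
    have key : ∀ w : ℂ, w ^ q * MvPolynomial.aeval (coord x) A =
        MvPolynomial.aeval (coord x) B := by
      intro w
      have := congrArg (MvPolynomial.aeval (fun o : Option σ => o.elim w (coord x))) h0
      rw [map_sub, map_mul, map_pow, hev, hev, MvPolynomial.aeval_X, map_zero] at this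
      exact sub_eq_zero.1 this
    have k0 := key 0
    have k1 := key 1
    rw [zero_pow hq.ne', zero_mul] at k0
    rw [one_pow, one_mul, ← k0] at k1
    exact hA x hx k1
  · rw [map_sub, map_mul, map_pow, hev, hev, MvPolynomial.aeval_X]
    exact sub_eq_zero.2 (h x hx)

/-- The open unit cube. -/
def openCube (n : ℕ) : Set (Fin n → ℝ) := univ.pi fun _ => Ioo 0 1

theorem mem_openCube {n : ℕ} {x : Fin n → ℝ} : x ∈ openCube n ↔ ∀ i, x i ∈ Ioo (0 : ℝ) 1 := by
  simp [openCube]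

theorem measurableSet_openCube (n : ℕ) : MeasurableSet (openCube n) :=
  MeasurableSet.univ_pi fun _ => measurableSet_Ioo

theorem nonempty_openCube (n : ℕ) : (openCube n).Nonempty :=
  ⟨fun _ => 1 / 2, mem_openCube.2 fun _ => by norm_num⟩

theorem volume_restrict_openCube (n : ℕ) : (volume : Measure (Fin n → ℝ)).restrict (openCube n) =
    Measure.pi fun _ => volume.restrict (Ioo 0 1) := by
  rw [openCube, volume_pi, Measure.restrict_pi_pi]

theorem isSemialgebraic_openCube (n : ℕ) : IsSemialgebraic (openCube n) := by
  have h : ∀ S : Finset (Fin n), IsSemialgebraic {x : Fin n → ℝ | ∀ i ∈ S, x i ∈ Ioo (0 : ℝ) 1} := by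
    intro S
    induction S using Finset.induction_on with
    | empty =>
      have := IsSemialgebraic.pos (1 : MvPolynomial (Fin n) QbarR)
      convert this using 1
      simp
    | insert i S _ ih =>
      have h1 := IsSemialgebraic.pos (MvPolynomial.X i : MvPolynomial (Fin n) QbarR)
      have h2 := IsSemialgebraic.pos (1 - MvPolynomial.X i : MvPolynomial (Fin n) QbarR)
      convert ((h1.inter _ _ h2).inter _ _ ih) using 1
      ext x
      simp
  convert h Finset.univ using 1
  ext x
  simp [mem_openCube]

/-! ### Products of Euler integrals -/

/-- The integrand of Euler's integral. -/
noncomputable def eulerKernel (ν : ℝ) (z : ℂ) (u : ℝ) : ℂ :=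
  ((u ^ ν * (1 - u) ^ (-ν - 1) : ℝ) : ℂ) * (1 - z * (u : ℂ)) ^ (ν : ℂ)

theorem integral_eulerKernel (ν : ℝ) (z : ℂ) :
    ∫ u in Ioo (0 : ℝ) 1, eulerKernel ν z u = eulerIntegral ν 0 z := by
  simp [eulerKernel, eulerIntegral]

theorem integrableOn_eulerKernel {ν : ℝ} (hν : -1 < ν ∧ ν < 0) {z : ℂ} (hz : z ∈ slitPlaneOne) :
    IntegrableOn (eulerKernel ν z) (Ioo 0 1) := by
  unfold eulerKernel
  simpa using integrableOn_eulerIntegrand hν 0 hz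

theorem continuousOn_eulerKernel (ν : ℝ) {X : Type*} [TopologicalSpace X] {s : Set X} {Z : X → ℂ}
    {U : X → ℝ} (hZ : ContinuousOn Z s) (hU : ContinuousOn U s)
    (hZs : ∀ x ∈ s, Z x ∈ slitPlaneOne) (hUs : ∀ x ∈ s, U x ∈ Ioo (0 : ℝ) 1) :
    ContinuousOn (fun x => eulerKernel ν (Z x) (U x)) s := by
  have h1 : ContinuousOn (fun x => U x ^ ν * (1 - U x) ^ (-ν - 1)) s :=
    (hU.rpow_const fun x hx => Or.inl (hUs x hx).1.ne').mul
      ((continuousOn_const.sub hU).rpow_const fun x hx => Or.inl (sub_pos.2 (hUs x hx).2).ne')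
  exact (Complex.continuous_ofReal.comp_continuousOn h1).mul
    ((continuousOn_const.sub (hZ.mul (Complex.continuous_ofReal.comp_continuousOn hU))).cpow_const
      fun x hx => one_sub_mul_mem_slitPlane (hZs x hx) (Ioo_subset_Icc_self (hUs x hx)))

theorem norm_eulerKernel_le {ν : ℝ} (hν : -1 < ν ∧ ν < 0) {κ r u : ℝ} (hκ : 0 < κ) (hr : 0 < r)
    (hu : u ∈ Ioo (0 : ℝ) 1) {z : ℂ} (hz : κ * (1 - u + r * u) ≤ ‖1 - z * (u : ℂ)‖) :
    ‖eulerKernel ν z u‖ ≤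
      κ ^ ν * r ^ (-legEta ν) * (u ^ (ν - legEta ν) * (1 - u) ^ (legEta ν - 1)) := by
  have h1 : (0 : ℝ) < 1 - u := by linarith [hu.2]
  have h0 := hu.1
  rw [eulerKernel, norm_mul, Complex.norm_real, Real.norm_of_nonneg (by positivity)]
  exact norm_cpow_le_of_le hν hκ hr hu hz

/-- The rational degree `ν` equals `-m / q`. -/
structure IsRatDegree (ν : ℝ) (m q : ℕ) : Prop where
  q_pos : 0 < q
  lt : m < q
  eq : ν * q = -m

theorem exists_isRatDegree {ν : ℝ} (hν : -1 < ν ∧ ν < 0) (h : ∃ r : ℚ, (r : ℝ) = ν) :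
    ∃ m q, IsRatDegree ν m q := by
  obtain ⟨r, rfl⟩ := h
  have hr : r < 0 := by exact_mod_cast hν.2
  have hr1 : -1 < r := by exact_mod_cast hν.1
  have hden : (0 : ℝ) < r.den := by exact_mod_cast r.den_pos
  have hnum : r.num < 0 := Rat.num_neg.2 hr
  have he : (r : ℝ) * r.den = r.num := by exact_mod_cast Rat.mul_den_eq_num r
  have hab : ((r.num.natAbs : ℕ) : ℤ) = -r.num := Int.ofNat_natAbs_of_nonpos hnum.le
  have hab' : ((r.num.natAbs : ℕ) : ℝ) = -(r.num : ℝ) := by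
    have h1 : ((r.num.natAbs : ℕ) : ℝ) = (((r.num.natAbs : ℕ) : ℤ) : ℝ) := (Int.cast_natCast _).symm
    rw [h1, hab, Int.cast_neg]
  refine ⟨r.num.natAbs, r.den, r.den_pos, ?_, ?_⟩
  · have : ((r.num.natAbs : ℕ) : ℝ) < r.den := by
      rw [hab', ← he]; nlinarith [hν.1]
    exact_mod_cast this
  · rw [he, hab', neg_neg]

/-- Rationality makes the integrand algebraic: with νq = -m, the q-th power of the kernel has the
integer exponents -m, m - q, -m. -/
theorem eulerKernel_pow {ν : ℝ} {m q : ℕ} (h : IsRatDegree ν m q) {z : ℂ} {u : ℝ}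
    (hu : u ∈ Ioo (0 : ℝ) 1) (hz : z ∈ slitPlaneOne) :
    eulerKernel ν z u ^ q * ((u : ℂ) ^ m * (1 - (u : ℂ)) ^ (q - m) * (1 - z * (u : ℂ)) ^ m) = 1 := by
  have h1 : (0 : ℝ) < 1 - u := by linarith [hu.2]
  have h0 := hu.1
  have hz0 : (1 - z * (u : ℂ)) ≠ 0 :=
    Complex.slitPlane_ne_zero (one_sub_mul_mem_slitPlane hz (Ioo_subset_Icc_self hu))
  have e1 : (u ^ ν) ^ q * u ^ m = 1 := by
    rw [← Real.rpow_mul_natCast h0.le, h.eq, ← Real.rpow_natCast u m, ← Real.rpow_add h0]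
    simp
  have e2 : ((1 - u) ^ (-ν - 1)) ^ q * (1 - u) ^ (q - m) = 1 := by
    rw [← Real.rpow_mul_natCast h1.le, ← Real.rpow_natCast (1 - u) (q - m), ← Real.rpow_add h1,
      Nat.cast_sub h.lt.le, show (-ν - 1) * (q : ℝ) + ((q : ℝ) - m) = 0 by linarith [h.eq]]
    simp
  have e3 : ((1 - z * (u : ℂ)) ^ (ν : ℂ)) ^ q * (1 - z * (u : ℂ)) ^ m = 1 := by
    have hc : (ν : ℂ) * q = -m := by exact_mod_cast congrArg (fun x : ℝ => (x : ℂ)) h.eq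
    rw [← Complex.cpow_mul_nat, hc, Complex.cpow_neg, Complex.cpow_natCast, inv_mul_cancel₀]
    exact pow_ne_zero _ hz0
  have e4 : ((u ^ ν * (1 - u) ^ (-ν - 1) : ℝ) : ℂ) ^ q * ((u : ℂ) ^ m * (1 - (u : ℂ)) ^ (q - m)) =
      1 := by
    have : (u ^ ν * (1 - u) ^ (-ν - 1)) ^ q * (u ^ m * (1 - u) ^ (q - m)) = 1 := by
      rw [mul_pow]
      calc _ = ((u ^ ν) ^ q * u ^ m) * (((1 - u) ^ (-ν - 1)) ^ q * (1 - u) ^ (q - m)) := by ring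
        _ = 1 := by rw [e1, e2, one_mul]
    exact_mod_cast congrArg (fun x : ℝ => (x : ℂ)) this
  unfold eulerKernel
  rw [mul_pow]
  linear_combination ((1 - z * (u : ℂ)) ^ (ν : ℂ)) ^ q * (1 - z * (u : ℂ)) ^ m * e4 + e3

theorem eulerKernel_den_ne_zero {m q : ℕ} {z : ℂ} {u : ℝ} (hu : u ∈ Ioo (0 : ℝ) 1)
    (hz : z ∈ slitPlaneOne) :
    (u : ℂ) ^ m * (1 - (u : ℂ)) ^ (q - m) * (1 - z * (u : ℂ)) ^ m ≠ 0 := by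
  have h1 : (1 - (u : ℂ)) ≠ 0 := by
    have : (1 - u : ℝ) ≠ 0 := by linarith [hu.2]
    exact_mod_cast this
  have h0 : (u : ℂ) ≠ 0 := by exact_mod_cast hu.1.ne'
  exact mul_ne_zero (mul_ne_zero (pow_ne_zero _ h0) (pow_ne_zero _ h1))
    (pow_ne_zero _ (Complex.slitPlane_ne_zero
      (one_sub_mul_mem_slitPlane hz (Ioo_subset_Icc_self hu))))

theorem aeval_aeval_X {σ : Type} (x : σ → ℂ) (i : σ) (p : Polynomial QbarC) :
    MvPolynomial.aeval x (Polynomial.aeval (MvPolynomial.X i : MvPolynomial σ QbarC) p) =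
      Polynomial.aeval (x i) p := by
  rw [← Polynomial.aeval_algHom_apply, MvPolynomial.aeval_X]

/-- By Fubini a product of n one-dimensional Euler integrals is a single integral over the n-cube,
with algebraic integrand. -/
theorem isPeriodFunctionOn_prod_eulerIntegral {ν : ℝ} (hν : -1 < ν ∧ ν < 0) {m q : ℕ}
    (h : IsRatDegree ν m q) {n : ℕ} (z : Fin n → Polynomial QbarC) {V : Set ℂ} (hV : V.Nonempty)
    (hz : ∀ a ∈ V, ∀ j, Polynomial.aeval a (z j) ∈ slitPlaneOne) :
    IsPeriodFunctionOn V fun a => ∏ j, eulerIntegral ν 0 (Polynomial.aeval a (z j)) := by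
  refine ⟨n, openCube n, fun p => ∏ j, eulerKernel ν (Polynomial.aeval p.2 (z j)) (p.1 j),
    isSemialgebraic_openCube n, ?_, ?_, fun x hx => ?_, fun a ha => ⟨?_, ?_⟩⟩
  · refine continuousOn_finsetProd _ fun j _ => continuousOn_eulerKernel ν ?_ ?_
      (fun p hp => hz _ hp.2 j) (fun p hp => mem_openCube.1 hp.1 j)
    · exact ((z j).continuous_aeval.comp continuous_snd).continuousOn
    · exact ((continuous_apply j).comp continuous_fst).continuousOn
  · refine satisfiesAlgebraicEquationOn_of_pow_mul_eq ((nonempty_openCube n).prod hV) h.q_pos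
      (A := ∏ j, (MvPolynomial.X (some j) ^ m * (1 - MvPolynomial.X (some j)) ^ (q - m) *
        (1 - Polynomial.aeval (MvPolynomial.X none) (z j) * MvPolynomial.X (some j)) ^ m)) (B := 1)
      (fun p hp => ?_) fun p hp => ?_
    · simp only [map_prod, map_mul, map_pow, map_sub, map_one, MvPolynomial.aeval_X, aeval_aeval_X]
      exact Finset.prod_ne_zero_iff.2 fun j _ =>
        eulerKernel_den_ne_zero (mem_openCube.1 hp.1 j) (hz _ hp.2 j)
    · simp only [map_prod, map_mul, map_pow, map_sub, map_one, MvPolynomial.aeval_X, aeval_aeval_X]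
      rw [← Finset.prod_pow, ← Finset.prod_mul_distrib]
      exact Finset.prod_eq_one fun j _ => eulerKernel_pow h (mem_openCube.1 hp.1 j) (hz _ hp.2 j)
  · refine DifferentiableOn.fun_finsetProd fun j _ a ha => ?_
    change DifferentiableWithinAt ℂ (fun a => ((x j ^ ν * (1 - x j) ^ (-ν - 1) : ℝ) : ℂ) *
      (1 - Polynomial.aeval a (z j) * (x j : ℂ)) ^ (ν : ℂ)) V a
    have h1 : DifferentiableAt ℂ (fun a : ℂ => 1 - Polynomial.aeval a (z j) * (x j : ℂ)) a :=
      ((z j).differentiableAt_aeval.mul_const _).const_sub 1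
    exact ((h1.cpow_const (one_sub_mul_mem_slitPlane (hz a ha j)
      (Ioo_subset_Icc_self (mem_openCube.1 hx j)))).const_mul _).differentiableWithinAt
  · rw [IntegrableOn, volume_restrict_openCube]
    exact Integrable.fintype_prod fun j => integrableOn_eulerKernel hν (hz a ha j)
  · rw [volume_restrict_openCube, integral_fintype_prod_eq_prod
      (f := fun j u => eulerKernel ν (Polynomial.aeval a (z j)) u)]
    simp only [integral_eulerKernel]

/-- Unfolding both Euler integrals gives an algebraic integrand on the 3-cube. Absolute convergence
follows from a product majorant: the lower bound κ(1-u+su) costs s^(-η) for each factor, and 2η < 1.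
-/
theorem isKZIntegral_integral_mul_prod {ν : ℝ} (hν : -1 < ν ∧ ν < 0) {m q : ℕ}
    (h : IsRatDegree ν m q) (z : Fin 2 → Polynomial QbarC) (A B : Polynomial QbarC)
    (hB : ∀ s ∈ Ioo (0 : ℝ) 1, Polynomial.aeval (s : ℂ) B ≠ 0)
    (hz : ∀ s ∈ Ioo (0 : ℝ) 1, ∀ j, Polynomial.aeval (s : ℂ) (z j) ∈ slitPlaneOne) {κ K : ℝ}
    (hκ : 0 < κ) (hb : ∀ s ∈ Ioo (0 : ℝ) 1, ∀ u ∈ Ioo (0 : ℝ) 1, ∀ j,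
      κ * (1 - u + s * u) ≤ ‖1 - Polynomial.aeval (s : ℂ) (z j) * (u : ℂ)‖)
    (hK : ∀ s ∈ Ioo (0 : ℝ) 1,
      ‖Polynomial.aeval (s : ℂ) A / Polynomial.aeval (s : ℂ) B‖ ≤ K) :
    IsKZIntegral (∫ s in Ioo (0 : ℝ) 1, Polynomial.aeval (s : ℂ) A / Polynomial.aeval (s : ℂ) B *
      ∏ j, eulerIntegral ν 0 (Polynomial.aeval (s : ℂ) (z j))) := by
  set F : (Fin 3 → ℝ) → ℂ := fun x => Polynomial.aeval (x 0 : ℂ) A / Polynomial.aeval (x 0 : ℂ) B *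
    ∏ j : Fin 2, eulerKernel ν (Polynomial.aeval (x 0 : ℂ) (z j)) (x j.succ) with hF
  have hx0 : Continuous fun x : Fin 3 → ℝ => (x 0 : ℂ) :=
    Complex.continuous_ofReal.comp (continuous_apply 0)
  have hFc : ContinuousOn F (openCube 3) := by
    refine ContinuousOn.mul (ContinuousOn.div ?_ ?_ fun x hx => hB _ (mem_openCube.1 hx 0)) ?_
    · exact (A.continuous_aeval.comp hx0).continuousOn
    · exact (B.continuous_aeval.comp hx0).continuousOn
    · exact continuousOn_finsetProd _ fun j _ => continuousOn_eulerKernel ν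
        ((z j).continuous_aeval.comp hx0).continuousOn (continuous_apply j.succ).continuousOn
        (fun x hx => hz _ (mem_openCube.1 hx 0) j) (fun x hx => mem_openCube.1 hx j.succ)
  set W : ℝ → ℝ := fun u => u ^ (ν - legEta ν) * (1 - u) ^ (legEta ν - 1)
  set W₀ : ℝ → ℝ := fun s => K * (κ ^ ν * κ ^ ν) * (s ^ (-(2 * legEta ν)) * (1 - s) ^ (0 : ℝ))
  have hW₀ : IntegrableOn W₀ (Ioo 0 1) :=
    (integrableOn_rpow_mul_rpow (by linarith [legEta_lt hν]) (by norm_num)).const_mul _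
  set w : Fin 3 → ℝ → ℝ := Fin.cons W₀ fun _ => W
  have hw : Integrable (fun x : Fin 3 → ℝ => ∏ i, w i (x i))
      (Measure.pi fun _ => volume.restrict (Ioo (0 : ℝ) 1)) := by
    refine Integrable.fintype_prod fun i => ?_
    refine Fin.cases ?_ (fun j => ?_) i
    · exact hW₀
    · exact integrableOn_legEta_weight hν
  have hFi : IntegrableOn F (openCube 3) := by
    refine Integrable.mono' (g := fun x : Fin 3 → ℝ => ∏ i, w i (x i))
      (by rw [volume_restrict_openCube]; exact hw)
      (hFc.aestronglyMeasurable (measurableSet_openCube 3))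
      ((ae_restrict_iff' (measurableSet_openCube 3)).2 (Filter.Eventually.of_forall fun x hx => ?_))
    have hs := mem_openCube.1 hx 0
    rw [hF, Fin.prod_univ_succ]
    simp only [w, Fin.cons_zero, Fin.cons_succ, Fin.prod_univ_two, norm_mul]
    have k0 := norm_eulerKernel_le hν hκ hs.1 (mem_openCube.1 hx (Fin.succ 0))
      (hb _ hs _ (mem_openCube.1 hx (Fin.succ 0)) 0)
    have k1 := norm_eulerKernel_le hν hκ hs.1 (mem_openCube.1 hx (Fin.succ 1))
      (hb _ hs _ (mem_openCube.1 hx (Fin.succ 1)) 1)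
    have hp : x 0 ^ (-(2 * legEta ν)) = x 0 ^ (-legEta ν) * x 0 ^ (-legEta ν) := by
      rw [← Real.rpow_add hs.1]; congr 1; ring
    have hK0 : 0 ≤ K := (norm_nonneg _).trans (hK _ hs)
    calc _ ≤ K * ((κ ^ ν * x 0 ^ (-legEta ν) * W (x (Fin.succ 0))) *
          (κ ^ ν * x 0 ^ (-legEta ν) * W (x (Fin.succ 1)))) :=
          mul_le_mul (hK _ hs) (mul_le_mul k0 k1 (norm_nonneg _) ((norm_nonneg _).trans k0))
            (by positivity) hK0
      _ = _ := by simp only [W₀, hp, Real.rpow_zero]; ring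
  refine ⟨3, openCube 3, F, isSemialgebraic_openCube 3, hFc, ?_, hFi, ?_⟩
  · refine satisfiesAlgebraicEquationOn_of_pow_mul_eq (nonempty_openCube 3) h.q_pos
      (A := Polynomial.aeval (MvPolynomial.X 0) B ^ q *
        ∏ j : Fin 2, (MvPolynomial.X j.succ ^ m * (1 - MvPolynomial.X j.succ) ^ (q - m) *
        (1 - Polynomial.aeval (MvPolynomial.X 0) (z j) * MvPolynomial.X j.succ) ^ m))
      (B := Polynomial.aeval (MvPolynomial.X 0) A ^ q) (fun x hx => ?_) fun x hx => ?_
    · simp only [map_prod, map_mul, map_pow, map_sub, map_one, MvPolynomial.aeval_X, aeval_aeval_X]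
      exact mul_ne_zero (pow_ne_zero _ (hB _ (mem_openCube.1 hx 0)))
        (Finset.prod_ne_zero_iff.2 fun j _ =>
          eulerKernel_den_ne_zero (mem_openCube.1 hx j.succ) (hz _ (mem_openCube.1 hx 0) j))
    · simp only [map_prod, map_mul, map_pow, map_sub, map_one, MvPolynomial.aeval_X, aeval_aeval_X]
      have e : (∏ j : Fin 2, eulerKernel ν (Polynomial.aeval (x 0 : ℂ) (z j)) (x j.succ)) ^ q *
          ∏ j : Fin 2, ((x j.succ : ℂ) ^ m * (1 - (x j.succ : ℂ)) ^ (q - m) *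
            (1 - Polynomial.aeval (x 0 : ℂ) (z j) * (x j.succ : ℂ)) ^ m) = 1 := by
        rw [← Finset.prod_pow, ← Finset.prod_mul_distrib]
        exact Finset.prod_eq_one fun j _ => eulerKernel_pow h (mem_openCube.1 hx j.succ)
          (hz _ (mem_openCube.1 hx 0) j)
      have hB0 := hB _ (mem_openCube.1 hx 0)
      rw [hF, mul_pow, div_pow]
      have hBq := pow_ne_zero q hB0
      calc _ = Polynomial.aeval (x 0 : ℂ) A ^ q * ((∏ j : Fin 2, eulerKernel ν
            (Polynomial.aeval (x 0 : ℂ) (z j)) (x j.succ)) ^ q *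
            ∏ j : Fin 2, ((x j.succ : ℂ) ^ m * (1 - (x j.succ : ℂ)) ^ (q - m) *
            (1 - Polynomial.aeval (x 0 : ℂ) (z j) * (x j.succ : ℂ)) ^ m)) := by
            field_simp
        _ = _ := by rw [e, mul_one]
  · rw [IntegrableOn] at hFi
    rw [volume_restrict_openCube] at hFi ⊢
    have hmp := measurePreserving_piFinSuccAbove
      (fun _ : Fin 3 => (volume : Measure ℝ).restrict (Ioo 0 1)) 0
    set Ψ : ℝ × (Fin 2 → ℝ) → ℂ := fun p => Polynomial.aeval (p.1 : ℂ) A /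
      Polynomial.aeval (p.1 : ℂ) B * ∏ j : Fin 2, eulerKernel ν (Polynomial.aeval (p.1 : ℂ) (z j))
        (p.2 j) with hΨ
    have hFΨ : F = fun x => Ψ (MeasurableEquiv.piFinSuccAbove (fun _ => ℝ) 0 x) := rfl
    have hΨi : Integrable Ψ (((volume : Measure ℝ).restrict (Ioo 0 1)).prod
        (Measure.pi fun _ : Fin 2 => (volume : Measure ℝ).restrict (Ioo 0 1))) := by
      rw [hFΨ] at hFi
      exact (hmp.integrable_comp_emb (MeasurableEquiv.measurableEmbedding _)).1 hFi
    rw [hFΨ, hmp.integral_comp', integral_prod _ hΨi]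
    refine integral_congr_ae (Filter.Eventually.of_forall fun s => ?_)
    simp only [hΨ]
    rw [integral_const_mul, integral_fintype_prod_eq_prod
      (f := fun j u => eulerKernel ν (Polynomial.aeval (s : ℂ) (z j)) u)]
    simp only [integral_eulerKernel]

/-! ### Elementary periods -/

/-- An integral of dimension zero: the cube in ℝ⁰ is a point of mass one. -/
theorem isKZIntegral_of_mem {a : ℂ} (ha : a ∈ QbarC) : IsKZIntegral a := by
  refine ⟨0, openCube 0, fun _ => a, isSemialgebraic_openCube 0, continuousOn_const, ?_, ?_, ?_⟩
  · refine satisfiesAlgebraicEquationOn_of_pow_mul_eq (nonempty_openCube 0) one_pos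
      (A := 1) (B := MvPolynomial.C ⟨a, ha⟩) (fun x _ => by simp) fun x _ => ?_
    rw [MvPolynomial.aeval_C]
    simp
  · refine integrableOn_const ?_
    simp [openCube]
  · rw [setIntegral_const, Measure.real, openCube, volume_pi_pi]
    simp

/-- Uses π = ∫₀¹ 4/(1+s²) ds, transported to functions on a one-element index set. -/
theorem isKZIntegral_pi : IsKZIntegral (Real.pi : ℂ) := by
  have hne : ∀ x : ℝ, (1 + (x : ℂ) ^ 2) ≠ 0 := fun x => by
    have : (1 + x ^ 2 : ℝ) ≠ 0 := by positivity
    exact_mod_cast this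
  have hc : Continuous fun s : ℝ => 4 / (1 + (s : ℂ) ^ 2) :=
    continuous_const.div (by fun_prop) hne
  have hmp := volume_preserving_funUnique (Fin 1) ℝ
  have hpre : openCube 1 = MeasurableEquiv.funUnique (Fin 1) ℝ ⁻¹' Ioo 0 1 := by
    ext x
    simp [mem_openCube, MeasurableEquiv.funUnique]
  refine ⟨1, openCube 1, fun x => 4 / (1 + ((x 0 : ℝ) : ℂ) ^ 2), isSemialgebraic_openCube 1,
    (hc.comp (continuous_apply 0)).continuousOn, ?_, ?_, ?_⟩
  · refine satisfiesAlgebraicEquationOn_of_pow_mul_eq (nonempty_openCube 1) one_pos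
      (A := 1 + MvPolynomial.X 0 ^ 2) (B := 4) (fun x _ => ?_) fun x _ => ?_
    · simpa using hne (x 0)
    · have := hne (x 0)
      have h4 : MvPolynomial.aeval (fun i : Fin 1 => ((x i : ℝ) : ℂ))
          (4 : MvPolynomial (Fin 1) QbarC) = 4 := map_ofNat _ 4
      rw [h4]
      simp only [pow_one, map_add, map_one, map_pow, MvPolynomial.aeval_X]
      field_simp
  · rw [hpre]
    refine (hmp.integrableOn_comp_preimage (f := fun s : ℝ => 4 / (1 + (s : ℂ) ^ 2))
      (MeasurableEquiv.measurableEmbedding _)).2 ?_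
    exact (hc.integrableOn_Icc (a := 0) (b := 1)).mono_set Ioo_subset_Icc_self
  · rw [hpre]
    refine Eq.symm ((hmp.setIntegral_preimage_emb (MeasurableEquiv.measurableEmbedding _)
      (fun s : ℝ => 4 / (1 + (s : ℂ) ^ 2)) _).trans ?_)
    rw [← integral_Ioc_eq_integral_Ioo, ← intervalIntegral.integral_of_le zero_le_one]
    have : ∀ s : ℝ, 4 / (1 + (s : ℂ) ^ 2) = ((4 * (1 / (1 + s ^ 2)) : ℝ) : ℂ) := fun s => by
      push_cast; ring
    simp only [this]
    rw [intervalIntegral.integral_ofReal, intervalIntegral.integral_const_mul,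
      integral_one_div_one_add_sq]
    simp
    ring

theorem IsKZIntegral.mem {z : ℂ} (h : IsKZIntegral z) : z ∈ kzPeriodsExt :=
  Subring.subset_closure (Or.inl (Subring.subset_closure h))

theorem mem_kzPeriodsExt_of_isAlgebraic {a : ℂ} (ha : IsAlgebraic ℚ a) : a ∈ kzPeriodsExt :=
  (isKZIntegral_of_mem (mem_algebraicClosure_iff.2 ha)).mem

theorem inv_pi_mem_kzPeriodsExt : ((Real.pi : ℝ) : ℂ)⁻¹ ∈ kzPeriodsExt :=
  Subring.subset_closure (Or.inr rfl)

theorem isAlgebraic_sin_mul_pi {ν : ℝ} (h : ∃ r : ℚ, (r : ℝ) = ν) :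
    IsAlgebraic ℚ ((Real.sin (ν * Real.pi) : ℝ) : ℂ) := by
  obtain ⟨r, rfl⟩ := h
  have h1 : IsAlgebraic ℚ (Real.sin (r * Real.pi)) :=
    (IsFractionRing.isAlgebraic_iff ℤ ℚ ℝ).1 (Real.isAlgebraic_sin_rat_mul_pi r)
  exact h1.algebraMap (A := ℂ)

theorem isAlgebraic_I : IsAlgebraic ℚ Complex.I :=
  ⟨Polynomial.X ^ 2 + 1, fun h => by
    have := congrArg (Polynomial.eval 0) h
    simp at this, by simp⟩

theorem legC_mem_kzPeriodsExt {ν : ℝ} (h : ∃ r : ℚ, (r : ℝ) = ν) :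
    (legC ν : ℂ) ∈ kzPeriodsExt := by
  rw [legC, div_eq_mul_inv, Complex.ofReal_mul, Complex.ofReal_inv]
  exact mul_mem (mem_kzPeriodsExt_of_isAlgebraic (isAlgebraic_sin_mul_pi h))
    inv_pi_mem_kzPeriodsExt

theorem entropyScale_mem_kzPeriodsExt {ν : ℝ} (h : ∃ r : ℚ, (r : ℝ) = ν) :
    ((Real.pi ^ 2 / (2 * Real.sin (ν * Real.pi) ^ 2) : ℝ) : ℂ) ∈ kzPeriodsExt := by
  have h1 : ((Real.pi ^ 2 / (2 * Real.sin (ν * Real.pi) ^ 2) : ℝ) : ℂ) =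
      (Real.pi : ℂ) ^ 2 * (2 * ((Real.sin (ν * Real.pi) : ℝ) : ℂ) ^ 2)⁻¹ := by
    push_cast; ring
  rw [h1]
  refine mul_mem (pow_mem isKZIntegral_pi.mem 2) (mem_kzPeriodsExt_of_isAlgebraic ?_)
  have h2 : (2 : ℂ) = algebraMap ℚ ℂ 2 := (map_ofNat _ 2).symm
  rw [h2]
  exact IsAlgebraic.inv ((isAlgebraic_algebraMap (2 : ℚ)).mul ((isAlgebraic_sin_mul_pi h).pow 2))

theorem two_pi_I_mul_int_mem_kzPeriodsExt (n : ℤ) :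
    2 * (Real.pi : ℂ) * Complex.I * n ∈ kzPeriodsExt :=
  mul_mem (mul_mem (mul_mem (ofNat_mem _ 2) isKZIntegral_pi.mem)
    (mem_kzPeriodsExt_of_isAlgebraic isAlgebraic_I)) (intCast_mem _ n)

/-! ### Compact families in the slit plane -/

/-- The segment from 1 to a point of the slit plane avoids 0. Compactness gives a uniform distance
for a + b = 1, and homogeneity gives the rest. -/
theorem exists_mul_add_le_norm_add_mul {K : Set ℂ} (hK : IsCompact K)
    (hs : K ⊆ Complex.slitPlane) :
    ∃ κ : ℝ, 0 < κ ∧ ∀ a b : ℝ, 0 ≤ a → 0 ≤ b → ∀ z ∈ K, κ * (a + b) ≤ ‖(a : ℂ) + b * z‖ := by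
  have hf : ContinuousOn (fun p : ℝ × ℂ => ‖(1 - (p.1 : ℂ)) + p.1 * p.2‖) (Icc 0 1 ×ˢ K) := by
    fun_prop
  have hpos : ∀ p ∈ Icc (0 : ℝ) 1 ×ˢ K, 0 < ‖(1 - (p.1 : ℂ)) + p.1 * p.2‖ := by
    rintro ⟨u, z⟩ ⟨hu, hz⟩
    refine norm_pos_iff.2 (Complex.slitPlane_ne_zero ?_)
    have := one_sub_mul_mem_slitPlane (one_sub_mem_slitPlaneOne_iff.2 (hs hz)) hu
    convert this using 1
    ring
  obtain ⟨κ, hκ, hb⟩ : ∃ κ : ℝ, 0 < κ ∧ ∀ p ∈ Icc (0 : ℝ) 1 ×ˢ K,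
      κ ≤ ‖(1 - (p.1 : ℂ)) + p.1 * p.2‖ := by
    rcases (Icc (0 : ℝ) 1 ×ˢ K).eq_empty_or_nonempty with he | hne
    · exact ⟨1, one_pos, by simp [he]⟩
    · obtain ⟨p, hp, hmin⟩ := (isCompact_Icc.prod hK).exists_isMinOn hne hf
      exact ⟨_, hpos p hp, fun q hq => hmin hq⟩
  refine ⟨κ, hκ, fun a b ha hb' z hz => ?_⟩
  rcases (add_nonneg ha hb').eq_or_lt with h0 | h0
  · rw [← h0, mul_zero]; exact norm_nonneg _
  · have hu : b / (a + b) ∈ Icc (0 : ℝ) 1 :=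
      ⟨by positivity, (div_le_one h0).2 (by linarith)⟩
    have key := hb (b / (a + b), z) ⟨hu, hz⟩
    have e : (a : ℂ) + b * z =
        ((a + b : ℝ) : ℂ) * ((1 - ((b / (a + b) : ℝ) : ℂ)) + ((b / (a + b) : ℝ) : ℂ) * z) := by
      have : ((a : ℂ) + b) ≠ 0 := by exact_mod_cast h0.ne'
      push_cast
      field_simp
      ring
    rw [e, norm_mul, Complex.norm_real, Real.norm_of_nonneg h0.le, mul_comm κ]
    exact mul_le_mul_of_nonneg_left key h0.le

/-! ### Legendre functions and arc integrals at algebraic arguments -/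

/-- As F(0) = 1, the Euler integral at 0 equals -1/c, so F(t) is c² times a product of two Euler
integrals. This fits the threefold integral with trivial dependence on s. -/
theorem legF_mem_kzPeriodsExt {ν : ℝ} (hν : -1 < ν ∧ ν < 0) (h : ∃ r : ℚ, (r : ℝ) = ν) {t : ℂ}
    (ht : t ∈ slitPlaneOne) (hta : IsAlgebraic ℚ t) : legF ν t ∈ kzPeriodsExt := by
  obtain ⟨m, q, hq⟩ := exists_isRatDegree hν h
  obtain ⟨κ, hκ, hb⟩ := exists_mul_add_le_norm_add_mul (K := {1 - t, 1})
    ((Set.finite_singleton (1 : ℂ)).insert (1 - t)).isCompact (by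
      rintro z (rfl | rfl)
      · rw [← one_sub_mem_slitPlaneOne_iff]; simpa using ht
      · exact Complex.one_mem_slitPlane)
  set τ : QbarC := ⟨t, mem_algebraicClosure_iff.2 hta⟩
  have e0 (s : ℝ) : Polynomial.aeval (s : ℂ) (Polynomial.C τ) = t := by
    rw [Polynomial.aeval_C]; rfl
  have key := isKZIntegral_integral_mul_prod hν hq ![Polynomial.C τ, 0] 1 1
    (fun s _ => by simp) (fun s _ j => ?_) hκ (fun s hs u hu j => ?_) (K := 1)
    (fun s _ => by simp)
  · have e : legF ν t = (legC ν : ℂ) ^ 2 *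
        (eulerIntegral ν 0 t * eulerIntegral ν 0 0) := by
      have h1 := legF_zero hν
      rw [legF_eq ν zero_mem_slitPlaneOne] at h1
      rw [legF_eq ν ht]
      linear_combination (-(legC ν : ℂ) * eulerIntegral ν 0 t) * (-h1)
    rw [e]
    refine mul_mem (pow_mem (legC_mem_kzPeriodsExt h) 2) ?_
    convert key.mem using 1
    simp [Fin.prod_univ_two, e0]
  · fin_cases j
    · simpa [e0] using ht
    · simpa using zero_mem_slitPlaneOne
  · have hu1 : 0 ≤ 1 - u := by linarith [hu.2]
    have hle : κ * (1 - u + s * u) ≤ κ * (1 - u + u) := by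
      have : s * u ≤ u := mul_le_of_le_one_left hu.1.le hs.2.le
      gcongr
    refine hle.trans ?_
    fin_cases j
    · refine (hb (1 - u) u hu1 hu.1.le (1 - t) (by simp)).trans_eq (congrArg _ ?_)
      simp [e0]; ring
    · refine (hb (1 - u) u hu1 hu.1.le 1 (by simp)).trans_eq (congrArg _ ?_)
      simp

/-- The arcs are polynomials in s with algebraic coefficients, so parametrisation leaves a rational
prefactor times two Euler integrals. What has to be checked is the uniform lower bound, which
degenerates only as s → 0. -/
theorem arcIntegral_mem_kzPeriodsExt {ν : ℝ} (hν : -1 < ν ∧ ν < 0) (h : ∃ r : ℚ, (r : ℝ) = ν)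
    {c α β : ℂ} (hc : c = 0 ∨ c = 1 ∨ c = Complex.I) (hg : IsGoodArc c β)
    (hne : ∀ s ∈ Icc (0 : ℝ) 1, arc c β s ≠ α) (hα : IsAlgebraic ℚ α) (hβ : IsAlgebraic ℚ β) :
    arcIntegral (kerFF ν) c α β ∈ kzPeriodsExt ∧ arcIntegral (kerFG ν) c α β ∈ kzPeriodsExt := by
  obtain ⟨m, q, hq⟩ := exists_isRatDegree hν h
  have hca : IsAlgebraic ℚ c := by
    rcases hc with rfl | rfl | rfl
    exacts [isAlgebraic_zero, isAlgebraic_one, isAlgebraic_I]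
  set γ₀ : QbarC := ⟨c, mem_algebraicClosure_iff.2 hca⟩
  set a₀ : QbarC := ⟨α, mem_algebraicClosure_iff.2 hα⟩
  set b₀ : QbarC := ⟨β, mem_algebraicClosure_iff.2 hβ⟩
  set Γ : Polynomial QbarC := .X * .C b₀ + .X * (1 - .X) * .C γ₀
  set A : Polynomial QbarC := .C b₀ + (1 - 2 * .X) * .C γ₀
  set B : Polynomial QbarC := Γ - .C a₀
  have eC (s : ℝ) (x : QbarC) : Polynomial.aeval (s : ℂ) (Polynomial.C x) = (x : ℂ) := by
    rw [Polynomial.aeval_C]; rfl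
  have e2 (s : ℝ) : Polynomial.aeval (s : ℂ) (2 : Polynomial QbarC) = 2 := map_ofNat _ 2
  have eΓ (s : ℝ) : Polynomial.aeval (s : ℂ) Γ = arc c β s := by
    simp only [Γ, map_add, map_mul, map_sub, map_one, Polynomial.aeval_X, eC, arc, γ₀, b₀]
  have eA (s : ℝ) : Polynomial.aeval (s : ℂ) A = β + (1 - 2 * s) * c := by
    simp only [A, map_add, map_mul, map_sub, map_one, Polynomial.aeval_X, eC, e2, γ₀, b₀]
  have eB (s : ℝ) : Polynomial.aeval (s : ℂ) B = arc c β s - α := by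
    simp only [B, map_sub, eC, eΓ, a₀]
  have hB (s : ℝ) (hs : s ∈ Icc (0 : ℝ) 1) : Polynomial.aeval (s : ℂ) B ≠ 0 := by
    rw [eB]; exact sub_ne_zero.2 (hne s hs)
  obtain ⟨K, hK⟩ := isCompact_Icc.exists_bound_of_continuousOn
    (f := fun s : ℝ => Polynomial.aeval (s : ℂ) A / Polynomial.aeval (s : ℂ) B) (s := Icc 0 1)
    (((A.continuous_aeval.comp Complex.continuous_ofReal).continuousOn).div
      ((B.continuous_aeval.comp Complex.continuous_ofReal).continuousOn) hB)
  have hslit (s : ℝ) (hs : s ∈ Icc (0 : ℝ) 1) : 1 - arc c β s ∈ Complex.slitPlane := by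
    rcases hs.1.eq_or_lt with rfl | h0
    · simp
    · exact doubleSlit_subset_slitPlane (one_sub_mem_doubleSlit (hg.arc_mem ⟨h0, hs.2⟩))
  obtain ⟨κ₁, hκ₁, hb₁⟩ := exists_mul_add_le_norm_add_mul
    (isCompact_Icc.image (f := fun s : ℝ => 1 - arc c β s)
      (continuous_const.sub (continuous_arc c β)) (s := Icc (0 : ℝ) 1))
    (by rintro _ ⟨s, hs, rfl⟩; exact hslit s hs)
  obtain ⟨κ₂, hκ₂, hb₂⟩ := exists_mul_add_le_norm_add_mul
    (isCompact_Icc.image (f := fun s : ℝ => β + (1 - (s : ℂ)) * c) (by fun_prop)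
      (s := Icc (0 : ℝ) 1))
    (by rintro _ ⟨s, hs, rfl⟩; exact hg.slope_mem hs)
  have low₁ (s : ℝ) (hs : s ∈ Ioo (0 : ℝ) 1) (u : ℝ) (hu : u ∈ Ioo (0 : ℝ) 1) :
      min κ₁ κ₂ * (1 - u + s * u) ≤ ‖1 - arc c β s * (u : ℂ)‖ := by
    have hu1 : 0 ≤ 1 - u := by linarith [hu.2]
    have : s * u ≤ u := mul_le_of_le_one_left hu.1.le hs.2.le
    have hsu : 0 ≤ s * u := mul_nonneg hs.1.le hu.1.le
    calc min κ₁ κ₂ * (1 - u + s * u) ≤ κ₁ * (1 - u + u) :=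
          mul_le_mul (min_le_left _ _) (by linarith) (by linarith) hκ₁.le
      _ ≤ _ := hb₁ (1 - u) u hu1 hu.1.le _ ⟨s, Ioo_subset_Icc_self hs, rfl⟩
      _ = _ := by congr 1; push_cast; ring
  -- Here 1 - (1 - arc)u = (1-u) + su·(β + (1-s)c), and the last factor runs through a compact part
  -- of the slit plane; this is the origin of the term su in the bound.
  have low₂ (s : ℝ) (hs : s ∈ Ioo (0 : ℝ) 1) (u : ℝ) (hu : u ∈ Ioo (0 : ℝ) 1) :
      min κ₁ κ₂ * (1 - u + s * u) ≤ ‖1 - (1 - arc c β s) * (u : ℂ)‖ := by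
    have hu1 : 0 ≤ 1 - u := by linarith [hu.2]
    have hsu : 0 ≤ s * u := mul_nonneg hs.1.le hu.1.le
    calc min κ₁ κ₂ * (1 - u + s * u) ≤ κ₂ * (1 - u + s * u) :=
          mul_le_mul_of_nonneg_right (min_le_right _ _) (by linarith)
      _ ≤ _ := hb₂ (1 - u) (s * u) hu1 hsu _ ⟨s, Ioo_subset_Icc_self hs, rfl⟩
      _ = _ := by congr 1; rw [arc_eq_mul]; push_cast; ring
  have main (z : Fin 2 → Polynomial QbarC) (hz : ∀ j, z j = Γ ∨ z j = 1 - Γ) :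
      IsKZIntegral (∫ s in Ioo (0 : ℝ) 1, Polynomial.aeval (s : ℂ) A / Polynomial.aeval (s : ℂ) B *
        ∏ j, eulerIntegral ν 0 (Polynomial.aeval (s : ℂ) (z j))) := by
    refine isKZIntegral_integral_mul_prod hν hq z A B (fun s hs => hB s (Ioo_subset_Icc_self hs))
      (fun s hs j => ?_) (lt_min hκ₁ hκ₂) (fun s hs u hu j => ?_)
      (fun s hs => hK s (Ioo_subset_Icc_self hs))
    · have hm := hg.arc_mem (Ioo_subset_Ioc_self hs)
      rcases hz j with e | e
      · rw [e, eΓ]; exact doubleSlit_subset_slitPlaneOne hm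
      · rw [e, map_sub, map_one, eΓ]
        exact doubleSlit_subset_slitPlaneOne (one_sub_mem_doubleSlit hm)
    · rcases hz j with e | e
      · rw [e, eΓ]; exact low₁ s hs u hu
      · rw [e, map_sub, map_one, eΓ]; exact low₂ s hs u hu
  have fin (k : ℂ → ℂ) (z : Fin 2 → Polynomial QbarC) (hz : ∀ j, z j = Γ ∨ z j = 1 - Γ)
      (hk : ∀ s ∈ Ioo (0 : ℝ) 1, k (arc c β s) = (legC ν : ℂ) ^ 2 *
        ∏ j, eulerIntegral ν 0 (Polynomial.aeval (s : ℂ) (z j))) :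
      arcIntegral k c α β ∈ kzPeriodsExt := by
    have e : arcIntegral k c α β = (legC ν : ℂ) ^ 2 * ∫ s in Ioo (0 : ℝ) 1,
        Polynomial.aeval (s : ℂ) A / Polynomial.aeval (s : ℂ) B *
        ∏ j, eulerIntegral ν 0 (Polynomial.aeval (s : ℂ) (z j)) := by
      rw [arcIntegral, ← integral_const_mul]
      refine setIntegral_congr_fun measurableSet_Ioo fun s hs => ?_
      simp only [hk s hs, eA, eB]
      ring
    rw [e]
    exact mul_mem (pow_mem (legC_mem_kzPeriodsExt h) 2) (main z hz).mem
  constructor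
  · refine fin _ ![Γ, Γ] (fun j => by fin_cases j <;> simp) fun s hs => ?_
    have hm := hg.arc_mem (Ioo_subset_Ioc_self hs)
    rw [kerFF, legF_eq ν (doubleSlit_subset_slitPlaneOne hm)]
    simp [Fin.prod_univ_two, eΓ]; ring
  · refine fin _ ![Γ, 1 - Γ] (fun j => by fin_cases j <;> simp) fun s hs => ?_
    have hm := hg.arc_mem (Ioo_subset_Ioc_self hs)
    rw [kerFG, legG, legF_eq ν (doubleSlit_subset_slitPlaneOne hm),
      legF_eq ν (doubleSlit_subset_slitPlaneOne (one_sub_mem_doubleSlit hm))]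
    simp [Fin.prod_univ_two, eΓ]; ring

/-- Arbitrary paths need not be algebraic, but their values differ from the arc value only by 2πi n
κ h(α), which is again in the ring. -/
theorem IsKernelValue.mem_kzPeriodsExt {ν : ℝ} (hν : -1 < ν ∧ ν < 0) (h : ∃ r : ℚ, (r : ℝ) = ν)
    {κ α β w : ℂ} (hα : α ∈ doubleSlit) (hβ : β ∈ doubleSlit) (hαβ : α ≠ β)
    (hαa : IsAlgebraic ℚ α) (hβa : IsAlgebraic ℚ β) (hκ : κ ∈ kzPeriodsExt) :
    (IsKernelValue slitPlaneOne (kerFF ν) κ α β w → w ∈ kzPeriodsExt) ∧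
      (IsKernelValue doubleSlit (kerFG ν) κ α β w → w ∈ kzPeriodsExt) := by
  obtain ⟨c, hc, hg, hne⟩ := exists_isGoodArc hα hβ hαβ
  obtain ⟨k₁, k₂⟩ := arcIntegral_mem_kzPeriodsExt hν h hc hg hne hαa hβa
  have hf := legF_mem_kzPeriodsExt hν h (doubleSlit_subset_slitPlaneOne hα) hαa
  have hg' : legG ν α ∈ kzPeriodsExt :=
    legF_mem_kzPeriodsExt hν h (doubleSlit_subset_slitPlaneOne (one_sub_mem_doubleSlit hα))
      (isAlgebraic_one.sub hαa)
  have fin {x y : ℂ} (hx : x ∈ kzPeriodsExt) (hy : y ∈ kzPeriodsExt) (n : ℤ) :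
      κ * x + 2 * (Real.pi : ℂ) * Complex.I * (n * (κ * y)) ∈ kzPeriodsExt := by
    have := add_mem (mul_mem hκ hx) (mul_mem (two_pi_I_mul_int_mem_kzPeriodsExt n) (mul_mem hκ hy))
    convert this using 1
    ring
  constructor
  · rintro ⟨γ, hγ, hi, rfl⟩
    obtain ⟨n, hn⟩ := (isMildAtZero_kerFF hν).exists_int_pathIntegral_eq
      doubleSlit_subset_slitPlaneOne hg hα hne hγ hi
    rw [hn]
    exact fin k₁ (pow_mem hf 2) n
  · rintro ⟨γ, hγ, hi, rfl⟩
    obtain ⟨n, hn⟩ := (isMildAtZero_kerFG hν).exists_int_pathIntegral_eq subset_rfl hg hα hne hγ hi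
    rw [hn]
    exact fin k₂ (mul_mem hf hg') n

theorem entropySum_term_isValue_mem_kzPeriodsExt {ν : ℝ} (hν : -1 < ν ∧ ν < 0)
    (h : ∃ r : ℚ, (r : ℝ) = ν) {C : ℂ} (hC : C ∈ kzPeriodsExt) {α β w : ℂ} (hα : α ∈ doubleSlit)
    (hβ : β ∈ doubleSlit) (hαβ : α ≠ β) (hαa : IsAlgebraic ℚ α) (hβa : IsAlgebraic ℚ β)
    (m : Fin 4) (hw : (((entropySum ν).scale C).term m).IsValue α β w) : w ∈ kzPeriodsExt := by
  obtain ⟨i0, i1, i2, i3⟩ := IsKernelValue.scale_iff ν C hα hβ w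
  have hα' := one_sub_mem_doubleSlit hα
  have hβ' := one_sub_mem_doubleSlit hβ
  have hαβ' : 1 - α ≠ 1 - β := fun e => hαβ (sub_right_injective e)
  have hαa' : IsAlgebraic ℚ (1 - α) := isAlgebraic_one.sub hαa
  have hβa' : IsAlgebraic ℚ (1 - β) := isAlgebraic_one.sub hβa
  have hf := legF_mem_kzPeriodsExt hν h (doubleSlit_subset_slitPlaneOne hβ) hβa
  have hg : legG ν β ∈ kzPeriodsExt :=
    legF_mem_kzPeriodsExt hν h (doubleSlit_subset_slitPlaneOne hβ') hβa'
  have hk : C * -kerFG ν β ∈ kzPeriodsExt := mul_mem hC (neg_mem (mul_mem hf hg))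
  fin_cases m
  · exact (IsKernelValue.mem_kzPeriodsExt hν h hα hβ hαβ hαa hβa
      (mul_mem hC (pow_mem hg 2))).1 (i0.1 hw)
  · exact (IsKernelValue.mem_kzPeriodsExt hν h hα hβ hαβ hαa hβa hk).2 (i1.1 hw)
  · exact (IsKernelValue.mem_kzPeriodsExt hν h hα' hβ' hαβ' hαa' hβa' hk).2 (i2.1 hw)
  · exact (IsKernelValue.mem_kzPeriodsExt hν h hα' hβ' hαβ' hαa' hβa'
      (mul_mem hC (pow_mem hf 2))).1 (i3.1 hw)

/-! ### The Gauss--Manin operator -/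

/-- The coefficients of the symmetric square of Legendre's operator with
`ν (ν + 1) = lam`. -/
noncomputable def legendreSymSquareCoeff (lam : QbarC) : Fin 4 → Polynomial QbarC :=
  ![.C (2 * lam) * (1 - 2 * .X), 1 + .C (4 * lam - 6) * (.X * (1 - .X)),
    3 * (.X * (1 - .X)) * (1 - 2 * .X), (.X * (1 - .X)) ^ 2]

/-- The symmetric square of Legendre's operator with `ν (ν + 1) = lam`. -/
noncomputable def legendreSymSquare (lam : QbarC) : Polynomial (Polynomial QbarC) :=
  .C (legendreSymSquareCoeff lam 3) * .X ^ 3 + .C (legendreSymSquareCoeff lam 2) * .X ^ 2 +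
    .C (legendreSymSquareCoeff lam 1) * .X + .C (legendreSymSquareCoeff lam 0)

theorem natDegree_legendreSymSquare (lam : QbarC) : (legendreSymSquare lam).natDegree = 3 := by
  refine Polynomial.natDegree_cubic ?_
  change ((.X * (1 - .X)) ^ 2 : Polynomial QbarC) ≠ 0
  intro h
  have := congrArg (Polynomial.eval 2) h
  norm_num at this

theorem applyDiffOp_legendreSymSquare {ν : ℝ} {lam : QbarC} (hl : (lam : ℂ) = ν * (ν + 1))
    (y : ℂ → ℂ) (a : ℂ) : applyDiffOp (legendreSymSquare lam) y a =
      symSq ν a (y a) (iteratedDeriv 1 y a) (iteratedDeriv 2 y a) (iteratedDeriv 3 y a) := by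
  have eC (x : QbarC) : Polynomial.aeval a (Polynomial.C x) = (x : ℂ) := by
    rw [Polynomial.aeval_C]; rfl
  have e2 : Polynomial.aeval a (2 : Polynomial QbarC) = 2 := map_ofNat _ 2
  have e3 : Polynomial.aeval a (3 : Polynomial QbarC) = 3 := map_ofNat _ 3
  have c2 : ((2 : QbarC) : ℂ) = 2 := rfl
  have c4 : ((4 : QbarC) : ℂ) = 4 := rfl
  have c6 : ((6 : QbarC) : ℂ) = 6 := rfl
  unfold applyDiffOp
  rw [Polynomial.sum_over_range' _ (by simp) 4 (by rw [natDegree_legendreSymSquare]; norm_num)]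
  simp only [Finset.sum_range_succ, Finset.sum_range_zero, zero_add, iteratedDeriv_zero,
    legendreSymSquare, Polynomial.coeff_add, Polynomial.coeff_C_mul, Polynomial.coeff_X_pow,
    Polynomial.coeff_X, Polynomial.coeff_C]
  norm_num
  simp only [legendreSymSquareCoeff, Matrix.cons_val, map_add, map_mul, map_sub, map_one, map_pow,
    Polynomial.aeval_X, eC, e2, e3, c2, c4, c6, hl, symSq]
  ring

/-- Three products of Legendre functions, up to a constant factor. -/
noncomputable def legendreProduct (ν : ℝ) : Fin 3 → ℂ → ℂ :=
  ![fun a => eulerIntegral ν 0 a * eulerIntegral ν 0 a,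
    fun a => eulerIntegral ν 0 a * eulerIntegral ν 0 (1 - a),
    fun a => eulerIntegral ν 0 (1 - a) * eulerIntegral ν 0 (1 - a)]

theorem legendreProduct_combination {ν : ℝ} (hν : -1 < ν ∧ ν < 0) (g : Fin 3 → ℂ) {a : ℂ}
    (ha : a ∈ doubleSlit) : ∑ j, g j * legendreProduct ν j a =
      g 0 / (legC ν : ℂ) ^ 2 * legF ν a ^ 2 + g 1 / (legC ν : ℂ) ^ 2 * kerFG ν a +
        g 2 / (legC ν : ℂ) ^ 2 * legG ν a ^ 2 := by
  have hc := legC_ne_zero hν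
  rw [kerFG, legG, legF_eq ν (doubleSlit_subset_slitPlaneOne ha),
    legF_eq ν (doubleSlit_subset_slitPlaneOne (one_sub_mem_doubleSlit ha)), Fin.sum_univ_three]
  simp only [legendreProduct, Matrix.cons_val]
  field_simp

/-- Euler integrals replace F and G because the normalising factor c contains 1/π; dropping it
exhibits the solutions directly as integrals of algebraic functions. -/
theorem isPeriodFunctionOn_legendreProduct {ν : ℝ} (hν : -1 < ν ∧ ν < 0)
    (h : ∃ r : ℚ, (r : ℝ) = ν) (j : Fin 3) : IsPeriodFunctionOn doubleSlit (legendreProduct ν j) := by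
  obtain ⟨m, q, hq⟩ := exists_isRatDegree hν h
  have main (z : Fin 2 → Polynomial QbarC) (hz : ∀ j, z j = .X ∨ z j = 1 - .X) :
      IsPeriodFunctionOn doubleSlit
        fun a => ∏ j, eulerIntegral ν 0 (Polynomial.aeval a (z j)) := by
    refine isPeriodFunctionOn_prod_eulerIntegral hν hq z ⟨_, half_mem_doubleSlit⟩ fun a ha j => ?_
    rcases hz j with e | e
    · rw [e, Polynomial.aeval_X]; exact doubleSlit_subset_slitPlaneOne ha
    · rw [e, map_sub, map_one, Polynomial.aeval_X]
      exact doubleSlit_subset_slitPlaneOne (one_sub_mem_doubleSlit ha)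
  fin_cases j
  · simpa [Fin.prod_univ_two] using! main ![.X, .X] fun j => by fin_cases j <;> simp
  · simpa [Fin.prod_univ_two] using! main ![.X, 1 - .X] fun j => by fin_cases j <;> simp
  · simpa [Fin.prod_univ_two] using! main ![1 - .X, 1 - .X] fun j => by fin_cases j <;> simp

theorem legendreProduct_solution {ν : ℝ} (hν : -1 < ν ∧ ν < 0) (j : Fin 3) :
    DifferentiableOn ℂ (legendreProduct ν j) doubleSlit ∧ ∀ a ∈ doubleSlit,
      symSq ν a (legendreProduct ν j a) (iteratedDeriv 1 (legendreProduct ν j) a)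
        (iteratedDeriv 2 (legendreProduct ν j) a) (iteratedDeriv 3 (legendreProduct ν j) a) = 0 := by
  set g : Fin 3 → ℂ := Pi.single j 1
  have he : EqOn (legendreProduct ν j) (fun a => g 0 / (legC ν : ℂ) ^ 2 * legF ν a ^ 2 +
      g 1 / (legC ν : ℂ) ^ 2 * kerFG ν a + g 2 / (legC ν : ℂ) ^ 2 * legG ν a ^ 2) doubleSlit := by
    intro a ha
    simp only [← legendreProduct_combination hν g ha, g]
    simp [Pi.single_apply]
  obtain ⟨w₁, w₂, w₃, hw, hw0⟩ := exists_hasJet_combination hν (g 0 / (legC ν : ℂ) ^ 2)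
    (g 1 / (legC ν : ℂ) ^ 2) (g 2 / (legC ν : ℂ) ^ 2)
  have hj := hw.congr isOpen_doubleSlit he
  refine ⟨fun a ha => (hj.h₀ a ha).differentiableAt.differentiableWithinAt, fun a ha => ?_⟩
  obtain ⟨i1, i2, i3⟩ := hj.iteratedDeriv_eq isOpen_doubleSlit ha
  rw [i1, i2, i3, he ha]
  exact hw0 a ha

/-- On the positive real axis near 0 the powers of log ε force z = 0 and y = 0; then F(ε) → 1 forces
x = 0. -/
theorem eq_zero_of_combination_eq_zero {ν : ℝ} (hν : -1 < ν ∧ ν < 0) {x y z : ℂ}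
    (h : ∀ a ∈ doubleSlit, x * legF ν a ^ 2 + y * kerFG ν a + z * legG ν a ^ 2 = 0) :
    x = 0 ∧ y = 0 ∧ z = 0 := by
  have hc := legC_ne_zero hν
  obtain ⟨d, hd⟩ := exists_hasLogAsymptotics hν
  have hmem : ∀ᶠ ε : ℝ in nhdsWithin 0 (Ioi 0), ((ε : ℂ) * 1) ∈ doubleSlit := by
    filter_upwards [Ioo_mem_nhdsGT (show (0 : ℝ) < 1 by norm_num)] with ε hε
    right
    simpa using hε
  obtain ⟨h1, h2⟩ := hd.coeff_eq (a := 1) (x := x) (y := y) (z := z) (A := 0) (B := 0)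
    Complex.one_mem_slitPlane ((IsBoundedNearZero.const 0).congr (by
      filter_upwards [hmem] with ε hε
      rw [h _ hε]
      ring))
  have hz : z = 0 := by simpa [hc] using h1
  rw [hz] at h2
  have hy : y = 0 := by simpa [hc] using h2
  refine ⟨?_, hy, hz⟩
  have h3 := ((((tendsto_legF_zero hν le_rfl).1.comp (tendsto_ofReal_mul_zero 1)).pow 2).const_mul
    x).congr' (f₂ := fun _ : ℝ => (0 : ℂ)) (by
      filter_upwards [hmem] with ε hε
      simpa [hy, hz] using h _ hε)
  simpa using tendsto_nhds_unique h3 tendsto_const_nhds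

theorem isGaussManinOperator_legendreSymSquare {ν : ℝ} (hν : -1 < ν ∧ ν < 0)
    (h : ∃ r : ℚ, (r : ℝ) = ν) {lam : QbarC} (hl : (lam : ℂ) = ν * (ν + 1)) :
    IsGaussManinOperator (legendreSymSquare lam) := by
  have hdeg := natDegree_legendreSymSquare lam
  refine ⟨by rw [hdeg]; norm_num, doubleSlit, fun j => legendreProduct ν (Fin.cast hdeg j),
    isOpen_doubleSlit, ⟨⟨_, half_mem_doubleSlit⟩, isPreconnected_doubleSlit⟩, fun j => ?_, ?_⟩
  · obtain ⟨h1, h2⟩ := legendreProduct_solution hν (Fin.cast hdeg j)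
    refine ⟨h1, isPeriodFunctionOn_legendreProduct hν h _, fun a ha => ?_⟩
    rw [applyDiffOp_legendreSymSquare hl]
    exact h2 a ha
  · have hli : LinearIndependent ℂ fun (j : Fin 3) (a : doubleSlit) => legendreProduct ν j a := by
      rw [Fintype.linearIndependent_iff]
      intro g hg
      have hc := legC_ne_zero hν
      obtain ⟨h0, h1, h2⟩ := eq_zero_of_combination_eq_zero hν
        (x := g 0 / (legC ν : ℂ) ^ 2) (y := g 1 / (legC ν : ℂ) ^ 2) (z := g 2 / (legC ν : ℂ) ^ 2)
        fun a ha => by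
          rw [← legendreProduct_combination hν g ha]
          simpa using congrFun hg ⟨a, ha⟩
      intro j
      fin_cases j
      · simpa [hc] using h0
      · simpa [hc] using h1
      · simpa [hc] using h2
    exact hli.comp (Fin.cast hdeg) (Fin.cast_injective hdeg)

theorem exists_legendreEigenvalue {ν : ℝ} (h : ∃ r : ℚ, (r : ℝ) = ν) :
    ∃ lam : QbarC, (lam : ℂ) = ν * (ν + 1) := by
  obtain ⟨r, rfl⟩ := h
  exact ⟨algebraMap ℚ QbarC (r * (r + 1)), by simp⟩

/-! ### The interaction entropy -/

/-- The parameter domain of the interaction entropy. -/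
def entropyDomain : Set (ℂ × ℂ) := {p | p.1 ∈ doubleSlit ∧ p.2 ∈ doubleSlit ∧ p.1 ≠ p.2}

theorem isOpen_entropyDomain : IsOpen entropyDomain :=
  (isOpen_doubleSlit.preimage continuous_fst).inter
    ((isOpen_doubleSlit.preimage continuous_snd).inter
      (isOpen_ne_fun continuous_fst continuous_snd))

theorem half_sub_mem_entropyDomain : ((1 / 2, 1 / 4) : ℂ × ℂ) ∈ entropyDomain :=
  ⟨Or.inr (by norm_num), Or.inr (by norm_num), by norm_num⟩

theorem satisfiesAlgebraicEquationOn_aeval {X σ : Type} {coord : X → σ → ℂ} {s : Set X}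
    (hs : s.Nonempty) (p : MvPolynomial σ QbarC) :
    SatisfiesAlgebraicEquationOn coord (fun x => MvPolynomial.aeval (coord x) p) s :=
  satisfiesAlgebraicEquationOn_of_pow_mul_eq hs one_pos (A := 1) (B := p) (by simp) (by simp)

/-- The regions of `(t, α, β)` in which the integrands are considered. -/
def entropyRegion (U : Set ℂ) (a : ℂ → ℂ) : Set (ℂ × ℂ × ℂ) :=
  {p | p.1 ∈ U ∧ p.2.1 ∈ doubleSlit ∧ p.2.2 ∈ doubleSlit ∧ p.1 ≠ a p.2.1}

theorem isOpen_entropyRegion {U : Set ℂ} (hU : IsOpen U) {a : ℂ → ℂ} (ha : Continuous a) :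
    IsOpen (entropyRegion U a) :=
  (hU.preimage continuous_fst).inter ((isOpen_doubleSlit.preimage (by fun_prop)).inter
    ((isOpen_doubleSlit.preimage (by fun_prop)).inter
      (isOpen_ne_fun continuous_fst (by fun_prop))))

theorem nonempty_entropyRegion {U : Set ℂ} (hU : doubleSlit ⊆ U) {a : ℂ → ℂ}
    (ha : a (1 / 2) = 1 / 2) : (entropyRegion U a).Nonempty :=
  ⟨(1 / 4, 1 / 2, 1 / 2), hU (Or.inr (by norm_num)), half_mem_doubleSlit, half_mem_doubleSlit, by
    simp only [ha]; norm_num⟩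

theorem differentiableOn_entropyRegion {U : Set ℂ} {a u v : ℂ → ℂ} (ha : Differentiable ℂ a)
    (hu : DifferentiableOn ℂ u doubleSlit) (hv : DifferentiableOn ℂ v U) (C : ℂ) :
    DifferentiableOn ℂ (fun p : ℂ × ℂ × ℂ => C * (u p.2.2 * (v p.1 / (p.1 - a p.2.1))))
      (entropyRegion U a) := by
  have h1 : DifferentiableOn ℂ (fun p : ℂ × ℂ × ℂ => u p.2.2) (entropyRegion U a) :=
    hu.comp (f := fun p : ℂ × ℂ × ℂ => p.2.2) (by fun_prop) fun p hp => hp.2.2.1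
  have h2 : DifferentiableOn ℂ (fun p : ℂ × ℂ × ℂ => v p.1) (entropyRegion U a) :=
    hv.comp (f := fun p : ℂ × ℂ × ℂ => p.1) (by fun_prop) fun p hp => hp.1
  have h3 : DifferentiableOn ℂ (fun p : ℂ × ℂ × ℂ => p.1 - a p.2.1) (entropyRegion U a) := by
    fun_prop
  simp only [div_eq_mul_inv]
  exact (h1.mul (h2.mul (h3.inv fun p hp => sub_ne_zero.2 hp.2.2.2))).const_mul C

theorem entropySum_analyticity {ν : ℝ} (hν : -1 < ν ∧ ν < 0) (C : ℂ) (m : Fin 4) :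
    IsOpen (((entropySum ν).scale C).term m).dom ∧ (((entropySum ν).scale C).term m).dom.Nonempty ∧
      DifferentiableOn ℂ
        (fun p : ℂ × ℂ × ℂ => (((entropySum ν).scale C).term m).integrand p.1 p.2.1 p.2.2)
        (((entropySum ν).scale C).term m).dom := by
  have hF₁ : DifferentiableOn ℂ (fun t => legendreP ν (1 - 2 * t)) slitPlaneOne :=
    differentiableOn_legF hν
  have hF := hF₁.mono doubleSlit_subset_slitPlaneOne
  have hG : DifferentiableOn ℂ (fun t => legendreP ν (2 * t - 1)) doubleSlit := by
    simp only [legendreP_sub_one]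
    exact fun t ht => (differentiableAt_legG hν ht).differentiableWithinAt
  have h1 : Differentiable ℂ fun a : ℂ => 1 - a := by fun_prop
  fin_cases m
  · exact ⟨isOpen_entropyRegion isOpen_slitPlaneOne continuous_id,
      nonempty_entropyRegion doubleSlit_subset_slitPlaneOne (a := id) rfl,
      differentiableOn_entropyRegion differentiable_id (hG.pow 2) (hF₁.pow 2) C⟩
  · exact ⟨isOpen_entropyRegion isOpen_doubleSlit continuous_id,
      nonempty_entropyRegion subset_rfl (a := id) rfl,
      differentiableOn_entropyRegion differentiable_id (hF.mul hG).neg (hF.mul hG) C⟩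
  · refine ⟨isOpen_entropyRegion isOpen_doubleSlit h1.continuous,
      nonempty_entropyRegion subset_rfl (by norm_num),
      (differentiableOn_entropyRegion h1 (hG.mul hF).neg (hF.mul hG) C).congr fun p _ => ?_⟩
    simp only [← sub_add]
    rfl
  · refine ⟨isOpen_entropyRegion isOpen_slitPlaneOne h1.continuous,
      nonempty_entropyRegion doubleSlit_subset_slitPlaneOne (by norm_num),
      (differentiableOn_entropyRegion h1 (hF.pow 2) (hF₁.pow 2) C).congr fun p _ => ?_⟩
    simp only [← sub_add]
    rfl

theorem entropySum_limits (ν : ℝ) (C : ℂ) (m : Fin 4) :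
    ∃ p q : MvPolynomial (Fin 2) QbarC, ∀ a b : ℂ,
      (((entropySum ν).scale C).term m).lower a b = MvPolynomial.aeval ![a, b] p ∧
      (((entropySum ν).scale C).term m).upper a b = MvPolynomial.aeval ![a, b] q := by
  fin_cases m
  · exact ⟨0, .X 1, fun a b => ⟨(map_zero _).symm, by rw [MvPolynomial.aeval_X]; rfl⟩⟩
  · exact ⟨0, .X 1, fun a b => ⟨(map_zero _).symm, by rw [MvPolynomial.aeval_X]; rfl⟩⟩
  · exact ⟨0, 1 - .X 1, fun a b => ⟨(map_zero _).symm, by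
      rw [map_sub, map_one, MvPolynomial.aeval_X]; rfl⟩⟩
  · exact ⟨0, 1 - .X 1, fun a b => ⟨(map_zero _).symm, by
      rw [map_sub, map_one, MvPolynomial.aeval_X]; rfl⟩⟩

theorem differentiable_aeval_pair (p : MvPolynomial (Fin 2) QbarC) :
    Differentiable ℂ fun x : ℂ × ℂ => MvPolynomial.aeval ![x.1, x.2] p := by
  induction p using MvPolynomial.induction_on with
  | C a => simp only [MvPolynomial.aeval_C]; fun_prop
  | add p q hp hq => simp only [map_add]; exact hp.add hq
  | mul_X p i hp =>
    simp only [map_mul, MvPolynomial.aeval_X]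
    refine hp.mul ?_
    fin_cases i
    · exact differentiable_fst
    · exact differentiable_snd

/-- The prefactor in the definition of the rescaled entropy is exactly 1/(2c²). -/
theorem entropyScale_mul {ν : ℝ} (hν : -1 < ν ∧ ν < 0) (z : ℂ) :
    ((Real.pi ^ 2 / (2 * Real.sin (ν * Real.pi) ^ 2) : ℝ) : ℂ) * (2 * (legC ν : ℂ) ^ 2 / z) =
      1 / z := by
  have hc := (legC_neg hν).ne
  have hπ := Real.pi_ne_zero
  have hs : Real.sin (ν * Real.pi) ≠ 0 := fun h => hc (by rw [legC, h, zero_div])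
  have h1 : Real.pi ^ 2 / (2 * Real.sin (ν * Real.pi) ^ 2) * (2 * legC ν ^ 2) = 1 := by
    rw [legC]
    generalize Real.sin (ν * Real.pi) = r at hs
    field_simp
  have h2 : ((Real.pi ^ 2 / (2 * Real.sin (ν * Real.pi) ^ 2) : ℝ) : ℂ) * (2 * (legC ν : ℂ) ^ 2) =
      1 := by exact_mod_cast congrArg (fun x : ℝ => (x : ℂ)) h1
  rw [mul_div_assoc', h2]

theorem isInteractionEntropy_entropySum {ν : ℝ} (hν : -1 < ν ∧ ν < 0)
    (h : ∃ r : ℚ, (r : ℝ) = ν) :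
    IsInteractionEntropy
      ((entropySum ν).scale ((Real.pi ^ 2 / (2 * Real.sin (ν * Real.pi) ^ 2) : ℝ) : ℂ))
      entropyDomain where
  isOpen_param := isOpen_entropyDomain
  nonempty_param := ⟨_, half_sub_mem_entropyDomain⟩
  analyticity := entropySum_analyticity hν _
  algebraic_lower m := by
    obtain ⟨p, q, hpq⟩ := entropySum_limits ν
      ((Real.pi ^ 2 / (2 * Real.sin (ν * Real.pi) ^ 2) : ℝ) : ℂ) m
    simp only [(hpq _ _).1]
    exact ⟨(differentiable_aeval_pair p).differentiableOn,
      satisfiesAlgebraicEquationOn_aeval ⟨_, half_sub_mem_entropyDomain⟩ p⟩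
  algebraic_upper m := by
    obtain ⟨p, q, hpq⟩ := entropySum_limits ν
      ((Real.pi ^ 2 / (2 * Real.sin (ν * Real.pi) ^ 2) : ℝ) : ℂ) m
    simp only [(hpq _ _).2]
    exact ⟨(differentiable_aeval_pair q).differentiableOn,
      satisfiesAlgebraicEquationOn_aeval ⟨_, half_sub_mem_entropyDomain⟩ q⟩
  periodness m _ _ hαβ hα hβ _ hw :=
    entropySum_term_isValue_mem_kzPeriodsExt hν h (entropyScale_mem_kzPeriodsExt h) hαβ.1 hαβ.2.1
      hαβ.2.2 hα hβ m hw
  symmetry := by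
    obtain ⟨lam, hl⟩ := exists_legendreEigenvalue h
    refine ⟨legendreSymSquare lam, isGaussManinOperator_legendreSymSquare hν h hl,
      fun α β hαβ => ?_⟩
    obtain ⟨l₁, l₂⟩ := isBranchOn_left hν
      ((Real.pi ^ 2 / (2 * Real.sin (ν * Real.pi) ^ 2) : ℝ) : ℂ) hαβ.1 hαβ.2.1 hαβ.2.2
    obtain ⟨r₁, r₂⟩ := isBranchOn_right hν
      ((Real.pi ^ 2 / (2 * Real.sin (ν * Real.pi) ^ 2) : ℝ) : ℂ) hαβ.1 hαβ.2.1 hαβ.2.2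
    refine ⟨⟨l₁, fun N s hN hs => ?_⟩, r₁, fun N s hN hs => ?_⟩
    · rw [applyDiffOp_legendreSymSquare hl, l₂ N s hN hs, entropyScale_mul hν]
    · rw [applyDiffOp_legendreSymSquare hl, r₂ N s hN hs, entropyScale_mul hν]
theorem mainTheorem4 (ν : ℝ) (hν : -1 < ν ∧ ν < 0) :
    -- the integrals exist, and `S_ν(α‖β)` is well defined modulo `2πi Λ_ν(α, β)`
    (∀ α ∈ doubleSlit, ∀ β ∈ doubleSlit, α ≠ β →
      (∃ s, (entropySum ν).IsValue α β s) ∧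
      ∀ s s', (entropySum ν).IsValue α β s → (entropySum ν).IsValue α β s' →
        EntropyCongr ν α β s s') ∧
    -- reciprocity
    (∀ α ∈ doubleSlit, ∀ β ∈ doubleSlit, α ≠ β →
      ∀ s s', (entropySum ν).IsValue α β s → (entropySum ν).IsValue β α s' →
        EntropyCongr ν α β (s - s') (reciprocityTerm ν α β)) ∧
    -- for rational `ν`, the rescaled `S_ν(α‖β)` is an interaction entropy
    ((∃ q : ℚ, (q : ℝ) = ν) →
      IsInteractionEntropy
        ((entropySum ν).scale
          ((Real.pi ^ 2 / (2 * Real.sin (ν * Real.pi) ^ 2) : ℝ) : ℂ))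
        {p : ℂ × ℂ | p.1 ∈ doubleSlit ∧ p.2 ∈ doubleSlit ∧ p.1 ≠ p.2}) :=
  ⟨fun _ hα _ hβ hαβ => entropySum_isValue_congr hν hα hβ hαβ,
    fun _ hα _ hβ hαβ => isReciprocal hν hα hβ hαβ,
    fun h => isInteractionEntropy_entropySum hν h⟩
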